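/- Let $n\ge 1$ and $\mathcal D=\{u\in(0,\infty)^n:\ \sum_{i=1}^n u_i<1\}$. Let $A\in\mathcal C^0(\overline{\mathcal D},\mathbb R^{n\times n})$ have an entropy density: a strictly convex function $h\in\mathcal C^0(\overline{\mathcal D})\cap\mathcal C^2(\mathcal D)$, bounded from below, such that $Dh:\mathcal D\to\mathbb R^n$ is bijective, $z^TD^2h(u)A(u)z\ge 0$ for all $u\in\mathcal D$, $z\in\mathbb R^n$, and, for some $\alpha>0$ and $m_i\in(0,1]$, $z^TD^2h(u)A(u)z\ge\alpha\sum_i u_i^{2m_i-2}z_i^2$ for all $u\in\mathcal D$, $z\in\mathbb R^n$. Let $(\bar u,\bar e)$ be a target state: for constant fluxes $\bar\phi_0,\dots,\bar\phi_n\ge 0$ with $\bar v=\sum_{i=0}^n\bar\phi_i>0$ and an initial thickness $\bar e_0>0$, $\bar u=(\bar\phi_i/\bar v)_{1\le i\le n}$ and $\bar e(t)=\bar e_0+\bar v t$. Assume that $\bar u\in\mathcal D$ and that the mobility matrix $M(\bar u)=A(\bar u)(D^2h(\bar u))^{-1}$ is symmetric. Consider the linearized system $$\partial_t\delta u-A(\bar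 u)\partial_{xx}^2\delta u=0 \text{ for } t>0,\ 0<x<\bar e(t),\qquad A(\bar u)\partial_x\delta u(t,0)=0,$$ $$A(\bar u)\partial_x\delta u(t,\bar e(t))+\bar v\,\delta u(t,\bar e(t))=H_{nl}(t)\delta u(t)+K_l(t)\delta u(t,\bar e(t)),\qquad \delta u(0)=\delta u^0,$$ $$\delta e(t)=\delta e_0+\int_0^t\Theta(s,\delta e(s))\,ds .$$ Then, for every $T>0$, the target state is stabilizable in time $T$ in $L^2$, that is: (a) There are continuous linear maps $H_{nl}(t):L^2(0,\bar e(t))^n\to\mathbb R^n$ and matrices $K_l(t)\in\mathbb R^{n\times n}$, $t\ge 0$, such that, on each of the time intervals $[a,b)=[0,T)$ and $[a,b)=[T,\infty)$, $K_l\in L^\infty_{\rm loc}((a,b))$ and, for all $S\in(a,b)$, $z\mapsto H_{nl}(\cdot)z(\cdot)$ is bounded from $L^2((a,S);L^2(0,\bar e(t))^n)$ to $L^2(a,S)^n$, and with the following properties. For every $\delta u^0\in L^2(0,\bar e_0)^n$ there is a unique $L^2$-weak solution $\delta u$ on $[0,T)$; it extends continuously to $[0,\infty)$ by the unique $L^2$-weak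 solution on $[T,\infty)$ that starts from its limit at time $T$. For every $\varepsilon>0$ there is $\nu>0$ such that $\|\delta u^0\|_{L^2}\le\nu$ implies $\|\delta u(t)\|_{L^2(0,\bar e(t))}\le\varepsilon$ for all $t\ge 0$. Moreover $\|\delta u(t)\|_{L^2(0,\bar e(t))}\to 0$ as $t\to T^-$, for every $\delta u^0$. (b) There is $\Theta$, in $L^1_{\rm loc}((0,T);\mathcal C^0(\mathbb R))$ and in $L^1_{\rm loc}((T,\infty);\mathcal C^0(\mathbb R))$, such that for every $\delta e_0\in\mathbb R$ the equation for $\delta e$ has a unique solution on $[0,\infty)$; for every $\varepsilon>0$ there is $\nu>0$ such that $|\delta e_0|\le\nu$ implies $|\delta e(t)|\le\varepsilon$ for all $t\ge0$; and $\delta e(t)\to0$ as $t\to T^-$, for every $\delta e_0$. Here an $L^2$-weak solution on $[a,b)$ with initial value $u_a$ is a function $u$, continuous on $[a,b)$ with values in $L^2(0,\bar e(t))^n$ (after rescaling of $(0,\bar e(t))$ to $(0,1)$), with $\partial_tu\in L^2((a,b);(H^1(0,\bar e(t))^n)')$, such that for every $S\in(a,b)$ $$\int_a^S\!\!\int_0^{\bar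 e(t)}u\cdot[\partial_tv+A(\bar u)^T\partial_{xx}^2v]\,dx\,dt+\int_0^{\bar e(a)}u_a\cdot v(a,x)\,dx+\int_a^S (H_{nl}(t)u(t))\cdot v(t,\bar e(t))\,dt=0$$ for all $v\in L^2((a,S);H^2)\cap\mathcal C^0([a,S];L^2)$ with $\partial_tv\in L^2((a,S);L^2)$, $v(S,\cdot)=0$ and, for almost all $t\in(a,S)$, $A(\bar u)^T\partial_xv(t,0)=0$ and $K_l(t)^Tv(t,\bar e(t))-A(\bar u)^T\partial_xv(t,\bar e(t))=0$. -/

import Mathlib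

open MeasureTheory Set Filter Topology
open scoped ContDiff Matrix NNReal

namespace CrossDiffusion

/-! ### Volume fractions, entropy structure, mobility -/

/-- `ℝⁿ` with its Euclidean norm. -/
abbrev Vec (n : ℕ) : Type := EuclideanSpace ℝ (Fin n)

/-- Real `n × n` matrices. -/
abbrev Mat (n : ℕ) : Type := Matrix (Fin n) (Fin n) ℝ

/-- The open set `𝒟` of vectors `(u₁, …, uₙ)` with positive entries of sum less than one. -/
def admissible (n : ℕ) : Set (Vec n) := {u | (∀ i, 0 < u i) ∧ ∑ i, u i < 1}

/-- The Hessian matrix `D²h(u)`. -/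
noncomputable def hessian {n : ℕ} (h : Vec n → ℝ) (u : Vec n) : Mat n :=
  Matrix.of fun i j =>
    fderiv ℝ (fun w => fderiv ℝ h w) u (EuclideanSpace.single i 1) (EuclideanSpace.single j 1)

/-- The mobility matrix `M(u) = A(u) (D²h(u))⁻¹`. -/
noncomputable def mobility {n : ℕ} (A : Vec n → Mat n) (h : Vec n → ℝ) (u : Vec n) : Mat n :=
  A u * (hessian h u)⁻¹

/-- The function `h` is an entropy density for the diffusion matrix `A`: it is continuous, strictly
convex and bounded from below on `closure 𝒟`, of class `C²` on `𝒟`, its gradient is a bijection from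
`𝒟` onto `ℝⁿ`, and the symmetric part of `D²h(u) A(u)` is positive semi-definite on `𝒟`; moreover
there are `α > 0` and exponents `mᵢ ∈ (0, 1]` with
`zᵀ D²h(u) A(u) z ≥ α ∑ᵢ uᵢ ^ (2 mᵢ - 2) zᵢ²` for all `z` and all `u ∈ 𝒟`. -/
structure IsEntropyDensity {n : ℕ} (A : Vec n → Mat n) (h : Vec n → ℝ) : Prop where
  continuousOn : ContinuousOn h (closure (admissible n))
  bddBelow : BddBelow (h '' closure (admissible n))
  strictConvexOn : StrictConvexOn ℝ (closure (admissible n)) h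
  contDiffOn : ContDiffOn ℝ 2 h (admissible n)
  gradient_bijOn : BijOn (gradient h) (admissible n) univ
  posSemidef : ∀ u ∈ admissible n, ∀ z : Fin n → ℝ, 0 ≤ z ⬝ᵥ ((hessian h u * A u) *ᵥ z)
  coercive : ∃ α : ℝ, 0 < α ∧ ∃ m : Fin n → ℝ, (∀ i, 0 < m i ∧ m i ≤ 1) ∧
    ∀ u ∈ admissible n, ∀ z : Fin n → ℝ,
      α * ∑ i, (u i) ^ (2 * m i - 2) * (z i) ^ 2 ≤ z ⬝ᵥ ((hessian h u * A u) *ᵥ z)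

/-! ### Target states -/

/-- A target state, given by constant fluxes `φ̄₀, …, φ̄ₙ` of positive sum and by an initial
thickness `ē₀ > 0`. -/
structure TargetState (n : ℕ) where
  flux : Fin (n + 1) → ℝ
  flux_nonneg : ∀ i, 0 ≤ flux i
  flux_sum_pos : 0 < ∑ i, flux i
  initialThickness : ℝ
  initialThickness_pos : 0 < initialThickness

namespace TargetState

variable {n : ℕ} (Z : TargetState n)

/-- The growth speed `v̄ = ∑ᵢ φ̄ᵢ`. -/
noncomputable def speed : ℝ := ∑ i, Z.flux i

/-- The constant volume fractions `ūᵢ = φ̄ᵢ / v̄`, `1 ≤ i ≤ n`. -/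
noncomputable def fraction : Vec n := WithLp.toLp 2 fun i => Z.flux i.succ / Z.speed

/-- The thickness `ē(t) = ē₀ + v̄ t`. -/
noncomputable def thickness (t : ℝ) : ℝ := Z.initialThickness + Z.speed * t

/-! ### Function spaces on the moving domain -/

/-- Lebesgue measure on `(0, ē(t))`. -/
noncomputable def slice (t : ℝ) : Measure ℝ := volume.restrict (Ioo 0 (Z.thickness t))

/-- The Hilbert space `L²(0, ē(t))ⁿ`. -/
abbrev L2 (t : ℝ) : Type := Lp (Vec n) 2 (Z.slice t)

/-- The space-time domain of all `(t, x)` with `a < t < b` and `0 < x < ē(t)`. -/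
def region (a : ℝ) (b : EReal) : Set (ℝ × ℝ) :=
  {p | a < p.1 ∧ (p.1 : EReal) < b ∧ 0 < p.2 ∧ p.2 < Z.thickness p.1}

/-- Lebesgue measure on the space-time domain. -/
noncomputable def regionMeasure (a : ℝ) (b : EReal) : Measure (ℝ × ℝ) :=
  volume.restrict (Z.region a b)

end TargetState

open Classical in
/-- The class in `L²(μ)` of a square-integrable function (zero for any other function). -/
noncomputable def toL2 {n : ℕ} (μ : Measure ℝ) (f : ℝ → Vec n) : Lp (Vec n) 2 μ :=
  if hf : MemLp f 2 μ then hf.toLp f else 0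

/-- The product of a matrix and a vector of `ℝⁿ`. -/
noncomputable def mulVec {n : ℕ} (M : Mat n) (z : Vec n) : Vec n := WithLp.toLp 2 (M *ᵥ z.ofLp)

/-- Partial derivative with respect to time of a function of `(t, x)`. -/
noncomputable def partialT {n : ℕ} (φ : ℝ × ℝ → Vec n) (p : ℝ × ℝ) : Vec n :=
  fderiv ℝ φ p (1, 0)

/-- Partial derivative with respect to space of a function of `(t, x)`. -/
noncomputable def partialX {n : ℕ} (φ : ℝ × ℝ → Vec n) (p : ℝ × ℝ) : Vec n :=
  fderiv ℝ φ p (0, 1)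

/-- Smooth functions with compact support in the set `U`. -/
structure IsBump {n : ℕ} (U : Set (ℝ × ℝ)) (φ : ℝ × ℝ → Vec n) : Prop where
  smooth : ContDiff ℝ ∞ φ
  compactSupport : HasCompactSupport φ
  support_subset : tsupport φ ⊆ U

namespace TargetState

variable {n : ℕ} (Z : TargetState n)

/-- The function `t ↦ f(t, ē(t) ·)` is continuous from `J` to `L²(0, 1)ⁿ`. -/
def ContinuousL2On (f : ℝ → ℝ → Vec n) (J : Set ℝ) : Prop :=
  (∀ t ∈ J, MemLp (f t) 2 (Z.slice t)) ∧
    ContinuousOn (fun t => toL2 (volume.restrict (Ioo (0 : ℝ) 1)) fun y => f t (y * Z.thickness t)) J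

/-- The distributional time derivative of `u` on the moving domain belongs to
`L²((a, b); (H¹(0, ē(t))ⁿ)')`. An element of the dual of `H¹` is written, as the Riesz theorem
allows, in the form `φ ↦ ∫ (F₀ · φ + F₁ · ∂ₓφ) dx` with `F₀, F₁` in `L²`. -/
def TimeDerivInDual (a : ℝ) (b : EReal) (u : ∀ t, Z.L2 t) : Prop :=
  ∃ F₀ F₁ : ℝ × ℝ → Vec n,
    MemLp F₀ 2 (Z.regionMeasure a b) ∧ MemLp F₁ 2 (Z.regionMeasure a b) ∧
    ∀ φ : ℝ × ℝ → Vec n, IsBump (Z.region a b) φ →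
      ∫ t in {t : ℝ | a < t ∧ (t : EReal) < b}, ∫ x, inner ℝ (u t x) (partialT φ (t, x)) ∂Z.slice t
        = -∫ p, (inner ℝ (F₀ p) (φ p) + inner ℝ (F₁ p) (partialX φ p)) ∂Z.regionMeasure a b

/-! ### Feedback operators -/

/-- A feedback `Ψ(t, z) = H_nl(t) z + H_l(t) z`: for each time `t`, a continuous linear map `H_nl(t)`
from `L²(0, ē(t))ⁿ` to `ℝⁿ`, and a matrix `K_l(t)` that determines the local part
`H_l(t) z = K_l(t) z(ē(t))` for `z ∈ H¹(0, ē(t))ⁿ`. -/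
structure Feedback where
  nonlocal : ∀ t : ℝ, Z.L2 t →L[ℝ] Vec n
  gain : ℝ → Mat n

/-- Regularity of a feedback on the time interval `[a, b)`. For all `S ∈ (a, b)`, the map
`z ↦ H_nl(·) z(·)` is bounded from `L²((a, S); L²(0, ē(t))ⁿ)` to `L²(a, S)ⁿ`; and `K_l` belongs to
`L^∞_loc(a, b)`. -/
structure Feedback.IsRegular {Z : TargetState n} (H : Z.Feedback) (a : ℝ) (b : EReal) : Prop where
  nonlocal_bound : ∀ S : ℝ, a < S → (S : EReal) < b → ∃ C : ℝ≥0, ∀ z : ℝ × ℝ → Vec n,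
    MemLp z 2 (Z.regionMeasure a S) →
      MemLp (fun t => H.nonlocal t (toL2 (Z.slice t) fun x => z (t, x))) 2
        (volume.restrict (Ioo a S)) ∧
      eLpNorm (fun t => H.nonlocal t (toL2 (Z.slice t) fun x => z (t, x))) 2
        (volume.restrict (Ioo a S)) ≤ C * eLpNorm z 2 (Z.regionMeasure a S)
  gain_bound : ∀ c d : ℝ, a < c → (d : EReal) < b → ∀ i j,
    MemLp (fun t => H.gain t i j) ⊤ (volume.restrict (Icc c d))

/-! ### Weak solutions of the linearized system -/

/-- `v` is a test function on the time interval `[a, S]`, with weak derivatives `vt = ∂ₜv`,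
`vx = ∂ₓv`, `vxx = ∂ₓₓv`. For almost every `t`, `v t` and `vx t` are the absolutely continuous
representatives on `[0, ē(t)]`, so that their boundary values are the traces. -/
structure IsTestFunction (A : Mat n) (K : ℝ → Mat n) (a S : ℝ)
    (v vt vx vxx : ℝ → ℝ → Vec n) : Prop where
  memLp : MemLp (Function.uncurry v) 2 (Z.regionMeasure a S)
  memLp_t : MemLp (Function.uncurry vt) 2 (Z.regionMeasure a S)
  memLp_x : MemLp (Function.uncurry vx) 2 (Z.regionMeasure a S)
  memLp_xx : MemLp (Function.uncurry vxx) 2 (Z.regionMeasure a S)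
  deriv_x : ∀ᵐ t ∂volume.restrict (Ioo a S), ∀ x ∈ Icc 0 (Z.thickness t),
    v t x = v t 0 + ∫ y in (0 : ℝ)..x, vx t y
  deriv_xx : ∀ᵐ t ∂volume.restrict (Ioo a S), ∀ x ∈ Icc 0 (Z.thickness t),
    vx t x = vx t 0 + ∫ y in (0 : ℝ)..x, vxx t y
  deriv_t : ∀ φ : ℝ × ℝ → Vec n, IsBump (Z.region a S) φ →
    ∫ p, inner ℝ (v p.1 p.2) (partialT φ p) ∂Z.regionMeasure a S
      = -∫ p, inner ℝ (vt p.1 p.2) (φ p) ∂Z.regionMeasure a S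
  continuousL2On : Z.ContinuousL2On v (Icc a S)
  final : ∀ᵐ x ∂Z.slice S, v S x = 0
  boundary_left : ∀ᵐ t ∂volume.restrict (Ioo a S), mulVec Aᵀ (vx t 0) = 0
  boundary_right : ∀ᵐ t ∂volume.restrict (Ioo a S),
    mulVec (K t)ᵀ (v t (Z.thickness t)) - mulVec Aᵀ (vx t (Z.thickness t)) = 0

/-- `u` is an `L²`-weak solution on the time interval `[a, b)` of
`∂ₜu - A ∂ₓₓu = 0` in `(0, ē(t))`, `A ∂ₓu(t, 0) = 0`,
`A ∂ₓu(t, ē(t)) + v̄ u(t, ē(t)) = H_nl(t) u(t) + K_l(t) u(t, ē(t))`, `u(a) = ua`. -/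
structure IsWeakSolution (A : Mat n) (H : Z.Feedback) (a : ℝ) (b : EReal) (ua : Z.L2 a)
    (u : ∀ t, Z.L2 t) : Prop where
  continuousL2On : Z.ContinuousL2On (fun t => u t) {t : ℝ | a ≤ t ∧ (t : EReal) < b}
  timeDeriv : Z.TimeDerivInDual a b u
  weak : ∀ S : ℝ, a < S → (S : EReal) < b → ∀ v vt vx vxx : ℝ → ℝ → Vec n,
    Z.IsTestFunction A H.gain a S v vt vx vxx →
      (∫ t in Ioo a S, ∫ x, inner ℝ (u t x) (vt t x + mulVec Aᵀ (vxx t x)) ∂Z.slice t)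
        + (∫ x, inner ℝ (ua x) (v a x) ∂Z.slice a)
        + (∫ t in Ioo a S, inner ℝ (H.nonlocal t (u t)) (v t (Z.thickness t))) = 0

/-! ### Finite time stabilization -/

/-- Closed-loop evolution of the volume fractions for all `t ≥ 0` when the gains of the feedback may
be singular at time `T`: the function is continuous in `L²` on `[0, ∞)`, a weak solution on `[0, T)`
that starts from `u₀`, and a weak solution on `[T, ∞)` that starts from its value at time `T`. -/
structure IsClosedLoop (A : Mat n) (H : Z.Feedback) (T : ℝ) (u₀ : Z.L2 0)
    (u : ∀ t, Z.L2 t) : Prop where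
  continuousL2On : Z.ContinuousL2On (fun t => u t) (Ici 0)
  before : Z.IsWeakSolution A H 0 T u₀ u
  after : Z.IsWeakSolution A H T ⊤ (u T) u

/-- Stabilization of the volume fractions in finite time `T` for the linearized system with
diffusion matrix `A`: well-posedness, stability, and convergence to zero at time `T`. -/
def FractionsStabilizable (A : Mat n) (T : ℝ) : Prop :=
  ∃ H : Z.Feedback, H.IsRegular 0 T ∧ H.IsRegular T ⊤ ∧
    (∀ u₀ : Z.L2 0, ∃ u : ∀ t, Z.L2 t, Z.IsClosedLoop A H T u₀ u ∧
      (∀ w, Z.IsWeakSolution A H 0 T u₀ w → ∀ t, 0 ≤ t → t < T → w t = u t) ∧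
      (∀ w, Z.IsWeakSolution A H T ⊤ (u T) w → ∀ t, T ≤ t → w t = u t) ∧
      Tendsto (fun t => ‖u t‖) (𝓝[<] T) (𝓝 0)) ∧
    (∀ ε : ℝ, 0 < ε → ∃ ν : ℝ, 0 < ν ∧ ∀ (u₀ : Z.L2 0) (u : ∀ t, Z.L2 t),
      Z.IsClosedLoop A H T u₀ u → ‖u₀‖ ≤ ν → ∀ t, 0 ≤ t → ‖u t‖ ≤ ε)

end TargetState

/-- The feedback law `Θ` belongs to `L¹_loc(J; C⁰(ℝ))`. -/
structure IsL1LocContinuous (Θ : ℝ → ℝ → ℝ) (J : Set ℝ) : Prop where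
  continuous : ∀ᵐ t ∂volume.restrict J, Continuous (Θ t)
  measurable : ∀ w, AEMeasurable (fun t => Θ t w) (volume.restrict J)
  bound : ∀ c d : ℝ, Icc c d ⊆ J → ∀ R : ℝ, ∃ g : ℝ → ℝ, IntegrableOn g (Icc c d) ∧
    ∀ᵐ t ∂volume.restrict (Icc c d), ∀ w, |w| ≤ R → |Θ t w| ≤ g t

/-- `y` solves `y(t) = y₀ + ∫₀ᵗ Θ(s, y(s)) ds` for `0 ≤ t < b`. -/
def IsThicknessSolution (Θ : ℝ → ℝ → ℝ) (b : EReal) (y₀ : ℝ) (y : ℝ → ℝ) : Prop :=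
  ∀ t : ℝ, 0 ≤ t → (t : EReal) < b →
    IntervalIntegrable (fun s => Θ s (y s)) volume 0 t ∧
      y t = (∫ s in (0 : ℝ)..t, Θ s (y s)) + y₀

/-- Stabilization of the thickness in finite time `T`: well-posedness for all `t ≥ 0`, stability, and
convergence to zero at time `T`. -/
def ThicknessStabilizable (T : ℝ) : Prop :=
  ∃ Θ : ℝ → ℝ → ℝ, IsL1LocContinuous Θ (Ioo 0 T) ∧ IsL1LocContinuous Θ (Ioi T) ∧
    (∀ y₀ : ℝ, ∃ y : ℝ → ℝ, IsThicknessSolution Θ ⊤ y₀ y ∧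
      (∀ (b : EReal) (w : ℝ → ℝ), IsThicknessSolution Θ b y₀ w →
        ∀ t : ℝ, 0 ≤ t → (t : EReal) < b → w t = y t) ∧
      Tendsto y (𝓝[<] T) (𝓝 0)) ∧
    (∀ ε : ℝ, 0 < ε → ∃ ν : ℝ, 0 < ν ∧ ∀ (y₀ : ℝ) (y : ℝ → ℝ),
      IsThicknessSolution Θ ⊤ y₀ y → |y₀| ≤ ν → ∀ t, 0 ≤ t → |y t| ≤ ε)

/-- The target state `(ū, ē)` is stabilizable in finite time `T` in `L²` for the system with
diffusion matrix application `A`, linearized around that state. -/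
def TargetState.StabilizableInFiniteTime {n : ℕ} (Z : TargetState n) (A : Vec n → Mat n) (T : ℝ) :
    Prop :=
  Z.FractionsStabilizable (A Z.fraction) T ∧ ThicknessStabilizable T

end CrossDiffusion

namespace CrossDiffusion

/-! ### Diagonalization of the diffusion matrix -/

/-! The two equations are uncoupled and are treated separately. For the thickness, the law `-y / (T
- t)` makes `y / (T - t)` constant, so every solution is a straight line that reaches zero at time
`T`.

For the fractions, let `G` be the Hessian of the entropy at the target. Coercivity makes `G`
invertible, hence positive definite, and symmetry of the mobility makes `G A = G M G` symmetric
positive definite. Thus `A` is similar to a positive definite symmetric matrix, and the system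
splits into scalar heat equations with diffusivities `σ i > 0`
(`IsEntropyDensity.exists_eigenbasis`). The local gain is `v̄ / 2`. Since `ē` is affine in time,
writing a component as `ē^(-1/2) exp (-v̄ x² / (4 σ ē)) z(s, x / ē)` with `ds = dt / ē²` gives
exactly `∂ₛ z = σ ∂_yy z` on `(0, 1)`, and the Robin boundary operator becomes a multiple of `∂_y
z(1)` (`hasDerivAt_mode_t`, `boundaryFlux_eq`). The nonlocal feedback therefore prescribes the
Neumann datum at `y = 1`.

The feedback moves the `N` lowest frequencies `k π` of the cosine basis to `(N + k + 1/2) π` and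
leaves the others alone. It must return `-w sin w` on each mode `cos (w y)`; as `sin` vanishes at
the frequencies that stay, this is a finite combination of functions biorthogonal to the new modes
(`inner_feedbackKernel`). These functions come from an explicit inverse of a Cauchy matrix, so the
Riesz basis costs only `exp (O(N log N))` (`abs_cauchyInv_le`), while the closed loop decays at
least like `exp (-σ N² π² s)` (`norm_evol_le`).

To reach zero at time `T`, the feedback uses `N = (m + 1)^4` modes between the times `T m / (m + 1)`
and `T (m + 1) / (m + 2)`. The decay exponent on this interval is of order at least `m^6`, the cost
exponent at most of order `m^5`, so the product of the factors tends to zero and is even summable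
(`tendsto_stepFactor`, `summable_totalFactor`). After `T` the feedback and the solution vanish.

The closed loop is shown to be a weak solution by Green's identity with explicit modes
(`IsScalarTest.green`), then by a limit of finite modal sums (`IsTestFunction.green_evol`) and by
joining the time intervals (`IsTestFunction.green_state`). Its time derivative lies in the dual
space by a parabolic energy bound, summed over all intervals, and a Hahn-Banach and Riesz argument
(`timeDerivInDual_closedLoop`). Uniqueness comes from testing with backward heat solutions: the
cosine coefficients satisfy Volterra equations in which the feedback involves finitely many
coefficients only, and Gronwall's lemma applies (`unique_before`). -/

lemma isOpen_admissible (n : ℕ) : IsOpen (admissible n) := by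
  have h : admissible n = (⋂ i, {u : Vec n | 0 < u i}) ∩ {u : Vec n | ∑ i, u i < 1} := by
    ext u; simp [admissible]
  rw [h]
  refine (isOpen_iInter_of_finite fun i => ?_).inter ?_
  · exact isOpen_lt continuous_const (by fun_prop)
  · exact isOpen_lt (by fun_prop) continuous_const

lemma convex_admissible (n : ℕ) : Convex ℝ (admissible n) := by
  rintro u ⟨hu, hu'⟩ w ⟨hw, hw'⟩ a b ha hb hab
  refine ⟨fun i => ?_, ?_⟩
  · simp only [PiLp.add_apply, PiLp.smul_apply, smul_eq_mul]
    rcases ha.eq_or_lt with rfl | ha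
    · obtain rfl : b = 1 := by linarith
      simpa using hw i
    · have := mul_pos ha (hu i)
      have := mul_nonneg hb (hw i).le
      linarith
  · simp only [PiLp.add_apply, PiLp.smul_apply, smul_eq_mul, Finset.sum_add_distrib,
      ← Finset.mul_sum]
    rcases ha.eq_or_lt with rfl | ha
    · obtain rfl : b = 1 := by linarith
      simpa using hw'
    · have := mul_lt_mul_of_pos_left hu' ha
      have := mul_le_mul_of_nonneg_left hw'.le hb
      linarith

lemma dotProduct_hessian_mulVec {n : ℕ} (h : Vec n → ℝ) (u : Vec n) (z w : Fin n → ℝ) :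
    z ⬝ᵥ (hessian h u *ᵥ w) =
      fderiv ℝ (fun x => fderiv ℝ h x) u (WithLp.toLp 2 z) (WithLp.toLp 2 w) := by
  have hz : ∀ z : Fin n → ℝ, (WithLp.toLp 2 z : Vec n) = ∑ i, z i • EuclideanSpace.single i 1 := by
    intro z
    ext j
    simp [Pi.single_apply]
  rw [hz z, hz w]
  simp only [dotProduct, Matrix.mulVec, hessian, Matrix.of_apply, map_sum, map_smul,
    sum_apply, smul_apply, smul_eq_mul, Finset.mul_sum]
  rw [Finset.sum_comm]
  refine Finset.sum_congr rfl fun i _ => Finset.sum_congr rfl fun j _ => by ring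

lemma hessian_isSymm {n : ℕ} {h : Vec n → ℝ} {u : Vec n} (hu : ContDiffAt ℝ 2 h u) :
    (hessian h u).IsSymm := by
  ext i j
  exact hu.isSymmSndFDerivAt (by simp) _ _

/-- Along the line through `u` in the direction `z` a convex function has a monotone derivative, and
the derivative of a monotone function is nonnegative. -/
lemma fderiv_fderiv_nonneg_of_convexOn {n : ℕ} {h : Vec n → ℝ} {s : Set (Vec n)} (hs : IsOpen s)
    (hc : ConvexOn ℝ s h) (hd : ContDiffOn ℝ 2 h s) {u : Vec n} (hu : u ∈ s) (z : Vec n) :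
    0 ≤ fderiv ℝ (fun x => fderiv ℝ h x) u z z := by
  set g : ℝ →ᵃ[ℝ] Vec n := AffineMap.lineMap u (u + z) with hg
  have hgv : ∀ t, g t = u + t • z := fun t => by
    simp [hg, AffineMap.lineMap_apply, add_comm]
  have hgc : Continuous g := by
    have : (g : ℝ → Vec n) = fun t => u + t • z := funext hgv
    rw [this]; fun_prop
  have hgd : ∀ t, HasDerivAt g z t := fun t => by
    have : (g : ℝ → Vec n) = fun t => u + t • z := funext hgv
    rw [this]
    simpa using ((hasDerivAt_id t).smul_const z).const_add u
  have hI : IsOpen (g ⁻¹' s) := hs.preimage hgc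
  have h0 : (0 : ℝ) ∈ g ⁻¹' s := by simpa [hgv] using hu
  have hdiff : ∀ t ∈ g ⁻¹' s, HasDerivAt (h ∘ g) (fderiv ℝ h (g t) z) t := fun t ht =>
    (((hd.contDiffAt (hs.mem_nhds ht)).differentiableAt two_ne_zero).hasFDerivAt).comp_hasDerivAt t
      (hgd t)
  have hmono : MonotoneOn (deriv (h ∘ g)) (g ⁻¹' s) :=
    (hc.comp_affineMap g).monotoneOn_deriv fun t ht => (hdiff t ht).differentiableAt
  have hd2 : HasDerivAt (fun t => fderiv ℝ h (g t) z)
      (fderiv ℝ (fun x => fderiv ℝ h x) u z z) 0 := by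
    have h1 : ContDiffAt ℝ 1 (fun x => fderiv ℝ h x) u :=
      (hd.contDiffAt (hs.mem_nhds hu)).fderiv_right (by norm_num)
    have h2 : HasFDerivAt (fun x => fderiv ℝ h x) (fderiv ℝ (fun x => fderiv ℝ h x) u) (g 0) := by
      rw [show g 0 = u by simp [hgv]]
      exact (h1.differentiableAt one_ne_zero).hasFDerivAt
    have h3 := h2.comp_hasDerivAt (0 : ℝ) (hgd 0)
    simpa using h3.clm_apply (hasDerivAt_const (0 : ℝ) z)
  have hmono' : MonotoneOn (fun t => fderiv ℝ h (g t) z) (g ⁻¹' s) :=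
    hmono.congr fun t ht => (hdiff t ht).deriv
  have := hmono'.derivWithin_nonneg (x := 0)
  rwa [derivWithin_of_isOpen hI h0, hd2.deriv] at this

lemma mulVec_eq_iff {n : ℕ} (M : Mat n) (z w : Vec n) : mulVec M z = w ↔ M *ᵥ z.ofLp = w.ofLp := by
  constructor
  · rintro rfl; rfl
  · intro h
    ext i
    simpa [mulVec] using congrFun h i

/-- A matrix `A` such that, for some positive definite `G`, the matrix `G * A` is positive definite,
has a basis of eigenvectors with positive eigenvalues, and the transposed matrix has the dual
basis as a basis of eigenvectors. -/
lemma exists_eigenbasis {n : ℕ} {A G : Mat n} (hG : G.PosDef) (hGA : (G * A).PosDef) :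
    ∃ (σ : Fin n → ℝ) (p q : Fin n → Vec n), (∀ i, 0 < σ i) ∧
      (∀ i, mulVec A (p i) = σ i • p i) ∧ (∀ i, mulVec Aᵀ (q i) = σ i • q i) ∧
      (∀ i j, inner ℝ (q i) (p j) = if i = j then (1 : ℝ) else 0) ∧
      ∀ z : Vec n, z = ∑ i, inner ℝ (q i) z • p i := by
  obtain ⟨C, hCs, hCG⟩ : ∃ C : Mat n, Cᵀ = C ∧ C * C = G := by
    open scoped MatrixOrder in
    refine ⟨CFC.sqrt G, ?_, ?_⟩
    · have := (Matrix.nonneg_iff_posSemidef.1 (CFC.sqrt_nonneg G)).isHermitian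
      simpa [Matrix.IsHermitian] using this
    · exact CFC.sqrt_mul_sqrt_self G hG.posSemidef.nonneg
  have hCu : IsUnit C := by
    have h := hG.isUnit
    rw [← hCG] at h
    exact isUnit_of_mul_isUnit_left h
  have hCd : IsUnit C.det := (Matrix.isUnit_iff_isUnit_det C).1 hCu
  have hCi : C * C⁻¹ = 1 := Matrix.mul_nonsing_inv C hCd
  have hCi' : C⁻¹ * C = 1 := Matrix.nonsing_inv_mul C hCd
  have hCis : C⁻¹ᵀ = C⁻¹ := by rw [Matrix.transpose_nonsing_inv, hCs]
  -- With `C = G^(1/2)`, this conjugate of `A` equals `C⁻¹ (G A) C⁻¹` and is symmetric positive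
  -- definite. Its orthonormal eigenbasis `e` yields `p = C⁻¹ e` for `A` and the biorthogonal family
  -- `q = C e` for `Aᵀ`.
  set D : Mat n := C * A * C⁻¹ with hDdef
  have hD : D = (C⁻¹)ᴴ * (G * A) * C⁻¹ := by
    rw [Matrix.conjTranspose_eq_transpose_of_trivial, hCis, ← hCG, hDdef, Matrix.mul_assoc C C A,
      ← Matrix.mul_assoc C⁻¹ C, hCi', Matrix.one_mul]
  have hDpos : D.PosDef := by
    rw [hD]
    refine hGA.conjTranspose_mul_mul_same ?_
    intro x y hxy
    have := congrArg (fun z => C *ᵥ z) hxy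
    simpa [Matrix.mulVec_mulVec, hCi] using this
  have hDh := hDpos.isHermitian
  have hDs : Dᵀ = D := by simpa [Matrix.IsHermitian] using hDh
  set e := hDh.eigenvectorBasis with he
  have heig : ∀ i, D *ᵥ (e i).ofLp = hDh.eigenvalues i • (e i).ofLp := fun i =>
    hDh.mulVec_eigenvectorBasis i
  refine ⟨hDh.eigenvalues, fun i => mulVec C⁻¹ (e i), fun i => mulVec C (e i),
    hDpos.eigenvalues_pos, fun i => ?_, fun i => ?_, ?_⟩
  · rw [mulVec_eq_iff]
    have h1 : A * C⁻¹ = C⁻¹ * D := by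
      rw [hDdef, ← Matrix.mul_assoc, ← Matrix.mul_assoc, hCi', Matrix.one_mul]
    simp only [mulVec, Matrix.mulVec_mulVec, h1]
    rw [← Matrix.mulVec_mulVec, heig, Matrix.mulVec_smul]
    rfl
  · rw [mulVec_eq_iff]
    have h1 : Aᵀ * C = C * D := by
      rw [← hDs, hDdef, Matrix.transpose_mul, Matrix.transpose_mul, hCis, hCs,
        ← Matrix.mul_assoc, hCi, Matrix.one_mul]
    simp only [mulVec, Matrix.mulVec_mulVec, h1]
    rw [← Matrix.mulVec_mulVec, heig, Matrix.mulVec_smul]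
    rfl
  have hin : ∀ z w : Vec n, inner ℝ (mulVec C z) (mulVec C⁻¹ w) = inner ℝ z w := by
    intro z w
    simp only [mulVec, EuclideanSpace.inner_eq_star_dotProduct, star_trivial]
    rw [Matrix.dotProduct_mulVec, Matrix.vecMul_mulVec, hCis, hCi', Matrix.vecMul_one]
  refine ⟨fun i j => ?_, fun z => ?_⟩
  · rw [hin, orthonormal_iff_ite.1 e.orthonormal i j]
  · have hz : mulVec C⁻¹ (mulVec C z) = z := by
      rw [mulVec_eq_iff]
      simp [mulVec, Matrix.mulVec_mulVec, hCi']
    have hz' : ∀ w : Vec n, inner ℝ (mulVec C w) z = inner ℝ w (mulVec C z) := by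
      intro w
      conv_lhs => rw [← hz]
      exact hin _ _
    simp only [hz']
    have h2 := e.sum_repr' (mulVec C z)
    conv_lhs => rw [← hz, ← h2]
    ext j
    simp [mulVec, Matrix.mulVec_sum, Matrix.mulVec_smul]

/-- Convexity alone makes the Hessian `G` only positive semi-definite. The coercivity inequality
makes `G A` injective, hence `G` invertible, hence positive definite. Symmetry of `M = A G⁻¹` gives
`(G A)ᵀ = (G M G)ᵀ = G A`, and the abstract lemma applies. -/
lemma IsEntropyDensity.exists_eigenbasis {n : ℕ} {A : Vec n → Mat n} {h : Vec n → ℝ}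
    (hh : IsEntropyDensity A h) {u : Vec n} (hu : u ∈ admissible n) (hM : (mobility A h u).IsSymm) :
    ∃ (σ : Fin n → ℝ) (p q : Fin n → Vec n), (∀ i, 0 < σ i) ∧
      (∀ i, mulVec (A u) (p i) = σ i • p i) ∧ (∀ i, mulVec (A u)ᵀ (q i) = σ i • q i) ∧
      (∀ i j, inner ℝ (q i) (p j) = if i = j then (1 : ℝ) else 0) ∧
      ∀ z : Vec n, z = ∑ i, inner ℝ (q i) z • p i := by
  set G := hessian h u with hGdef
  have hGsymm : Gᵀ = G :=
    hessian_isSymm (hh.contDiffOn.contDiffAt ((isOpen_admissible n).mem_nhds hu))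
  have hpos : ∀ z : Fin n → ℝ, z ≠ 0 → 0 < z ⬝ᵥ ((G * A u) *ᵥ z) := by
    obtain ⟨α, hα, m, -, hcoer⟩ := hh.coercive
    intro z hz
    refine lt_of_lt_of_le (mul_pos hα ?_) (hcoer u hu z)
    obtain ⟨i, hi⟩ := Function.ne_iff.1 hz
    have hterm : ∀ j, 0 < (u j) ^ (2 * m j - 2) := fun j => Real.rpow_pos_of_pos (hu.1 j) _
    refine Finset.sum_pos' (fun j _ => mul_nonneg (hterm j).le (sq_nonneg _))
      ⟨i, Finset.mem_univ _, mul_pos (hterm i) (by positivity [show z i ≠ 0 from hi])⟩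
  have hGA_inj : Function.Injective (G * A u).mulVec := by
    intro x y hxy
    by_contra hne
    have := hpos (x - y) (sub_ne_zero.2 hne)
    rw [Matrix.mulVec_sub, sub_eq_zero.2 hxy] at this
    simp at this
  have hGAu : IsUnit (G * A u) := Matrix.mulVec_injective_iff_isUnit.1 hGA_inj
  have hGu : IsUnit G := isUnit_of_mul_isUnit_left hGAu
  have hGd : IsUnit G.det := (Matrix.isUnit_iff_isUnit_det G).1 hGu
  have hGpsd : G.PosSemidef := by
    refine Matrix.PosSemidef.of_dotProduct_mulVec_nonneg (by simpa [Matrix.IsHermitian]) fun z => ?_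
    rw [star_trivial, hGdef, dotProduct_hessian_mulVec]
    exact fderiv_fderiv_nonneg_of_convexOn (isOpen_admissible n)
      (hh.strictConvexOn.convexOn.subset subset_closure (convex_admissible n)) hh.contDiffOn hu _
  have hG : G.PosDef := hGpsd.posDef_iff_isUnit.2 hGu
  have hGAsymm : (G * A u)ᵀ = G * A u := by
    have hMs : (A u * G⁻¹)ᵀ = A u * G⁻¹ := hM
    have hA : A u = A u * G⁻¹ * G := by
      rw [Matrix.mul_assoc, Matrix.nonsing_inv_mul G hGd, Matrix.mul_one]
    rw [hA, Matrix.transpose_mul, Matrix.transpose_mul, hMs, hGsymm, Matrix.mul_assoc]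
  refine CrossDiffusion.exists_eigenbasis hG (Matrix.PosDef.of_dotProduct_mulVec_pos
    (by simpa [Matrix.IsHermitian] using hGAsymm) fun {z} hz => ?_)
  simpa using hpos z hz

end CrossDiffusion

namespace CrossDiffusion

/-! ### Stabilization of the thickness -/

/-- The feedback law `Θ(t, y) = - y / (T - t)` before the time `T`, and zero afterwards. -/
noncomputable def thicknessFeedback (T : ℝ) (t y : ℝ) : ℝ := if t < T then -y / (T - t) else 0

lemma thicknessFeedback_of_lt {T t : ℝ} (ht : t < T) (y : ℝ) :
    thicknessFeedback T t y = -y / (T - t) := if_pos ht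

lemma thicknessFeedback_of_le {T t : ℝ} (ht : T ≤ t) (y : ℝ) : thicknessFeedback T t y = 0 :=
  if_neg ht.not_gt

/-- The closed-loop thickness `y₀ (1 - t / T)` before the time `T`, and zero afterwards. -/
noncomputable def thicknessSolution (T y₀ t : ℝ) : ℝ := if t < T then y₀ * (1 - t / T) else 0

lemma isL1LocContinuous_thicknessFeedback_before (T : ℝ) :
    IsL1LocContinuous (thicknessFeedback T) (Ioo 0 T) where
  continuous := by
    refine ae_of_all _ fun t => ?_
    by_cases ht : t < T
    · simp only [funext (thicknessFeedback_of_lt ht)]; fun_prop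
    · simp only [funext (thicknessFeedback_of_le (not_lt.1 ht))]; fun_prop
  measurable w := by
    refine Measurable.aemeasurable ?_
    exact Measurable.ite measurableSet_Iio (by fun_prop) measurable_const
  bound c d hcd R := by
    rcases lt_or_ge d c with h | h
    · exact ⟨0, by simp [Icc_eq_empty h.not_ge], by simp [Icc_eq_empty h.not_ge]⟩
    have hd : d < T := (hcd (right_mem_Icc.2 h)).2
    refine ⟨fun _ => R / (T - d), integrableOn_const (by simp), ?_⟩
    filter_upwards [ae_restrict_mem measurableSet_Icc] with t ht w hw
    have h1 : t < T := ht.2.trans_lt hd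
    rw [thicknessFeedback_of_lt h1, abs_div, abs_neg, abs_of_pos (sub_pos.2 h1)]
    have := abs_nonneg w
    exact div_le_div₀ (this.trans hw) hw (sub_pos.2 hd) (by linarith [ht.2])

lemma isL1LocContinuous_thicknessFeedback_after (T : ℝ) :
    IsL1LocContinuous (thicknessFeedback T) (Ioi T) where
  continuous := by
    filter_upwards [ae_restrict_mem measurableSet_Ioi] with t ht
    simp only [funext (thicknessFeedback_of_le (le_of_lt ht))]; fun_prop
  measurable w := by
    refine Measurable.aemeasurable ?_
    exact Measurable.ite measurableSet_Iio (by fun_prop) measurable_const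
  bound c d hcd R := by
    refine ⟨0, integrableOn_zero, ?_⟩
    filter_upwards [ae_restrict_mem measurableSet_Icc] with t ht w hw
    rw [thicknessFeedback_of_le (le_of_lt (hcd ht))]; simp

/-- The singularity of the gain at `T` is compensated by the linear vanishing of the solution, so
the integrand of the integral equation is bounded up to `T`. -/
lemma thicknessFeedback_solution {T : ℝ} (hT : 0 < T) (y₀ s : ℝ) :
    thicknessFeedback T s (thicknessSolution T y₀ s) = if s < T then -y₀ / T else 0 := by
  unfold thicknessFeedback thicknessSolution
  split_ifs with h
  · have : T - s ≠ 0 := (sub_pos.2 h).ne'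
    field_simp
  · rfl

lemma isThicknessSolution_thicknessSolution {T : ℝ} (hT : 0 < T) (y₀ : ℝ) :
    IsThicknessSolution (thicknessFeedback T) ⊤ y₀ (thicknessSolution T y₀) := by
  intro t ht _
  simp only [thicknessFeedback_solution hT]
  have hint : ∀ a b, IntervalIntegrable (fun s => if s < T then -y₀ / T else 0) volume a b := by
    intro a b
    have h : (fun s => if s < T then -y₀ / T else 0) = (Iio T).indicator fun _ => -y₀ / T := by
      ext s; simp [indicator]
    rw [h, intervalIntegrable_iff]
    exact (integrableOn_const (by simp)).indicator measurableSet_Iio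
  refine ⟨hint _ _, ?_⟩
  have hlow : ∀ t, 0 ≤ t → t ≤ T → ∫ s in (0 : ℝ)..t, (if s < T then -y₀ / T else 0)
      = -y₀ / T * t := by
    intro t ht htT
    have : ∫ s in (0 : ℝ)..t, (if s < T then -y₀ / T else 0) = ∫ _ in (0 : ℝ)..t, -y₀ / T := by
      refine intervalIntegral.integral_congr_ae ?_
      filter_upwards [compl_mem_ae_iff.2 (measure_singleton T)] with s hs hs'
      rw [uIoc_of_le ht] at hs'
      exact if_pos (lt_of_le_of_ne (hs'.2.trans htT) hs)
    rw [this, intervalIntegral.integral_const, smul_eq_mul, sub_zero, mul_comm]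
  rcases lt_or_ge t T with h | h
  · rw [hlow t ht h.le, thicknessSolution, if_pos h]; field_simp; ring
  · have hz : ∫ s in T..t, (if s < T then -y₀ / T else 0) = 0 := by
      refine intervalIntegral.integral_zero_ae (ae_of_all _ fun s hs => ?_)
      rw [uIoc_of_le h] at hs
      exact if_neg hs.1.le.not_gt
    rw [← intervalIntegral.integral_add_adjacent_intervals (hint 0 T) (hint T t),
      hlow T hT.le le_rfl, hz, thicknessSolution, if_neg h.not_gt]
    field_simp; ring

lemma IsThicknessSolution.continuousOn {Θ : ℝ → ℝ → ℝ} {b : EReal} {y₀ : ℝ} {w : ℝ → ℝ}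
    (hw : IsThicknessSolution Θ b y₀ w) {S : ℝ} (hS : 0 ≤ S) (hSb : (S : EReal) < b) :
    ContinuousOn w (Icc 0 S) := by
  have h1 : ContinuousOn (fun t => (∫ s in (0 : ℝ)..t, Θ s (w s)) + y₀) (Icc 0 S) := by
    refine ContinuousOn.add ?_ continuousOn_const
    have := intervalIntegral.continuousOn_primitive_interval (a := 0) (b := S)
      (f := fun s => Θ s (w s)) (μ := volume) ?_
    · rwa [uIcc_of_le hS] at this
    · rw [uIcc_of_le hS, integrableOn_Icc_iff_integrableOn_Ioc,
        ← intervalIntegrable_iff_integrableOn_Ioc_of_le hS]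
      exact (hw S hS hSb).1
  refine h1.congr fun t ht => ?_
  exact (hw t ht.1 (lt_of_le_of_lt (by exact_mod_cast ht.2) hSb)).2

/-- Before `T` the integrand is continuous, so the solution is differentiable and the quotient `w /
(T - s)` has derivative zero; the mean value theorem makes it constant. -/
lemma IsThicknessSolution.eq_before {T : ℝ} (hT : 0 < T) {b : EReal} {y₀ : ℝ} {w : ℝ → ℝ}
    (hw : IsThicknessSolution (thicknessFeedback T) b y₀ w) {t : ℝ} (ht : 0 ≤ t) (htT : t < T)
    (htb : (t : EReal) < b) : w t = y₀ * (1 - t / T) := by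
  have hc := hw.continuousOn ht htb
  have hg : ContinuousOn (fun s => -w s / (T - s)) (Icc 0 t) :=
    hc.neg.div (by fun_prop) fun s hs => (sub_pos.2 (hs.2.trans_lt htT)).ne'
  have hderiv : ∀ s ∈ Ioo 0 t, HasDerivAt w (-w s / (T - s)) s := by
    intro s hs
    have h1 : HasDerivAt (fun r => ∫ x in (0 : ℝ)..r, -w x / (T - x)) (-w s / (T - s)) s := by
      refine intervalIntegral.integral_hasDerivAt_right ?_ ?_ ?_
      · exact (hg.mono (by rw [uIcc_of_le hs.1.le]; exact Icc_subset_Icc_right hs.2.le)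
          ).intervalIntegrable
      · exact (hg.mono Ioo_subset_Icc_self).stronglyMeasurableAtFilter isOpen_Ioo s hs
      · exact hg.continuousAt (Icc_mem_nhds hs.1 hs.2)
    refine (h1.add_const y₀).congr_of_eventuallyEq ?_
    filter_upwards [Ioo_mem_nhds hs.1 hs.2] with r hr
    rw [(hw r hr.1.le (lt_of_le_of_lt (by exact_mod_cast hr.2.le) htb)).2]
    congr 1
    refine intervalIntegral.integral_congr fun x hx => ?_
    rw [uIcc_of_le hr.1.le] at hx
    exact thicknessFeedback_of_lt (hx.2.trans_lt (hr.2.trans htT)) _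
  have h0 : w 0 = y₀ := by
    have := (hw 0 le_rfl (lt_of_le_of_lt (by exact_mod_cast ht) htb)).2
    simpa using this
  rcases ht.eq_or_lt with rfl | ht0
  · simp [h0]
  have hq : ∀ s ∈ Ioo 0 t, HasDerivAt (fun s => w s / (T - s)) 0 s := by
    intro s hs
    have h2 : T - s ≠ 0 := (sub_pos.2 (hs.2.trans htT)).ne'
    refine ((hderiv s hs).div ((hasDerivAt_id s).const_sub T) h2).congr_deriv ?_
    simp only [id]
    field_simp
    ring
  obtain ⟨c, hc', hcs⟩ := exists_hasDerivAt_eq_slope (fun s => w s / (T - s)) (fun _ => 0) ht0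
    (hc.div (by fun_prop) fun s hs => (sub_pos.2 (hs.2.trans_lt htT)).ne') hq
  have h2 : T - t ≠ 0 := (sub_pos.2 htT).ne'
  rw [eq_comm, div_eq_zero_iff, sub_zero, sub_zero, h0] at hcs
  have h3 := hcs.resolve_right ht0.ne'
  field_simp at h3 ⊢
  linarith

/-- Continuity of an integral carries the explicit formula from `[0, T)` to `w T = 0`; afterwards
nothing is added because the feedback is zero. -/
lemma IsThicknessSolution.eq_thicknessSolution {T : ℝ} (hT : 0 < T) {b : EReal} {y₀ : ℝ}
    {w : ℝ → ℝ} (hw : IsThicknessSolution (thicknessFeedback T) b y₀ w) {t : ℝ} (ht : 0 ≤ t)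
    (htb : (t : EReal) < b) : w t = thicknessSolution T y₀ t := by
  unfold thicknessSolution
  split_ifs with htT
  · exact hw.eq_before hT ht htT htb
  rw [not_lt] at htT
  have hTb : (T : EReal) < b := lt_of_le_of_lt (by exact_mod_cast htT) htb
  have hwT : w T = 0 := by
    have h1 : Tendsto w (𝓝[<] T) (𝓝 (w T)) := by
      have h := hw.continuousOn hT.le hTb T (right_mem_Icc.2 hT.le)
      refine h.mono_left ?_
      rw [← nhdsWithin_Ioo_eq_nhdsLT hT]
      exact nhdsWithin_mono _ Ioo_subset_Icc_self
    have h2 : Tendsto w (𝓝[<] T) (𝓝 (y₀ * (1 - T / T))) := by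
      have h3 : Tendsto (fun t => y₀ * (1 - t / T)) (𝓝[<] T) (𝓝 (y₀ * (1 - T / T))) :=
        (Continuous.tendsto (by fun_prop) T).mono_left nhdsWithin_le_nhds
      refine h3.congr' ?_
      rw [← nhdsWithin_Ioo_eq_nhdsLT hT]
      filter_upwards [self_mem_nhdsWithin] with s hs
      exact (hw.eq_before hT hs.1.le hs.2 (lt_trans (by exact_mod_cast hs.2) hTb)).symm
    rw [tendsto_nhds_unique h1 h2, div_self hT.ne']; simp
  obtain ⟨hi, he⟩ := hw t ht htb
  obtain ⟨hiT, heT⟩ := hw T hT.le hTb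
  have hz : ∫ s in T..t, thicknessFeedback T s (w s) = 0 := by
    refine intervalIntegral.integral_zero_ae (ae_of_all _ fun s hs => ?_)
    rw [uIoc_of_le htT] at hs
    exact thicknessFeedback_of_le hs.1.le _
  rw [he, ← intervalIntegral.integral_add_adjacent_intervals hiT (hiT.symm.trans hi), hz, add_zero,
    ← heT, hwT]

lemma thicknessStabilizable {T : ℝ} (hT : 0 < T) : ThicknessStabilizable T := by
  refine ⟨thicknessFeedback T, isL1LocContinuous_thicknessFeedback_before T,
    isL1LocContinuous_thicknessFeedback_after T, fun y₀ => ⟨thicknessSolution T y₀,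
      isThicknessSolution_thicknessSolution hT y₀,
      fun b w hw t ht htb => hw.eq_thicknessSolution hT ht htb, ?_⟩,
    fun ε hε => ⟨ε, hε, fun y₀ y hy hy₀ t ht => ?_⟩⟩
  · have h3 : Tendsto (fun t => y₀ * (1 - t / T)) (𝓝[<] T) (𝓝 (y₀ * (1 - T / T))) :=
      (Continuous.tendsto (by fun_prop) T).mono_left nhdsWithin_le_nhds
    rw [div_self hT.ne', sub_self, mul_zero] at h3
    refine h3.congr' ?_
    filter_upwards [self_mem_nhdsWithin] with s hs
    exact (if_pos hs).symm
  · rw [hy.eq_thicknessSolution hT ht (EReal.coe_lt_top t), thicknessSolution]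
    split_ifs with htT
    · rw [abs_mul]
      have h1 : t / T ≤ 1 := (div_le_one hT).2 htT.le
      have h2 : 0 ≤ t / T := div_nonneg ht hT.le
      have h4 : |1 - t / T| ≤ 1 := abs_le.2 ⟨by linarith, by linarith⟩
      exact (mul_le_of_le_one_right (abs_nonneg _) h4).trans hy₀
    · simpa using hε.le

end CrossDiffusion

namespace CrossDiffusion

/-! ### Cosines in `L²(0, 1)` -/

/-- Lebesgue measure on `(0, 1)`. -/
noncomputable abbrev unitMeasure : Measure ℝ := volume.restrict (Ioo (0 : ℝ) 1)

/-- The Hilbert space `L²(0, 1)`. -/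
abbrev UnitL2 : Type := Lp ℝ 2 unitMeasure

lemma memLp_unit_of_continuous {E : Type*} [NormedAddCommGroup E] {f : ℝ → E} (hf : Continuous f)
    (p : ENNReal) : MemLp f p unitMeasure := by
  obtain ⟨C, hC⟩ := (isCompact_Icc (a := (0 : ℝ)) (b := 1)).exists_bound_of_continuousOn
    hf.continuousOn
  exact MemLp.of_bound hf.aestronglyMeasurable.restrict C
    ((ae_restrict_mem measurableSet_Ioo).mono fun x hx => hC x (Ioo_subset_Icc_self hx))

/-- The class of `y ↦ cos (w y)` in `L²(0, 1)`. -/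
noncomputable def cosMode (w : ℝ) : UnitL2 :=
  (memLp_unit_of_continuous (f := fun y => Real.cos (w * y)) (by fun_prop) 2).toLp _

lemma coeFn_cosMode (w : ℝ) : cosMode w =ᵐ[unitMeasure] fun y => Real.cos (w * y) :=
  MemLp.coeFn_toLp _

lemma inner_cosMode (w : ℝ) (f : UnitL2) :
    inner ℝ (cosMode w) f = ∫ y in Ioo (0 : ℝ) 1, Real.cos (w * y) * f y := by
  rw [L2.inner_def]
  refine integral_congr_ae ?_
  filter_upwards [coeFn_cosMode w] with y hy
  simp [hy, mul_comm]

lemma inner_cosMode_cosMode (a b : ℝ) :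
    inner ℝ (cosMode a) (cosMode b) = ∫ y in (0 : ℝ)..1, Real.cos (a * y) * Real.cos (b * y) := by
  rw [inner_cosMode, intervalIntegral.integral_of_le zero_le_one, integral_Ioc_eq_integral_Ioo]
  refine integral_congr_ae ?_
  filter_upwards [coeFn_cosMode b] with y hy
  rw [hy]

lemma norm_cosMode_le (w : ℝ) : ‖cosMode w‖ ≤ 1 := by
  have h : ‖cosMode w‖ ^ 2 ≤ 1 := by
    rw [← real_inner_self_eq_norm_sq, inner_cosMode_cosMode]
    have := intervalIntegral.integral_mono_on (a := (0 : ℝ)) (b := 1) (μ := volume) zero_le_one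
      (f := fun y => Real.cos (w * y) * Real.cos (w * y)) (g := fun _ => 1)
      (Continuous.intervalIntegrable (by fun_prop) _ _)
      (Continuous.intervalIntegrable (by fun_prop) _ _)
      (fun y _ => by nlinarith [Real.cos_sq_add_sin_sq (w * y), sq_nonneg (Real.sin (w * y))])
    simpa using this
  nlinarith [norm_nonneg (cosMode w)]

lemma inner_cosMode_cosMode_of_sq_ne {a b : ℝ} (hab : a ^ 2 ≠ b ^ 2) :
    inner ℝ (cosMode a) (cosMode b) =
      (a * Real.sin a * Real.cos b - b * Real.cos a * Real.sin b) / (a ^ 2 - b ^ 2) := by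
  have hne : a ^ 2 - b ^ 2 ≠ 0 := sub_ne_zero.2 hab
  rw [inner_cosMode_cosMode]
  have hd : ∀ y ∈ uIcc (0 : ℝ) 1, HasDerivAt (fun y =>
      (a * Real.sin (a * y) * Real.cos (b * y) - b * Real.cos (a * y) * Real.sin (b * y)) /
        (a ^ 2 - b ^ 2)) (Real.cos (a * y) * Real.cos (b * y)) y := by
    intro y _
    have ha : HasDerivAt (fun y => a * y) a y := by simpa using (hasDerivAt_id y).const_mul a
    have hb : HasDerivAt (fun y => b * y) b y := by simpa using (hasDerivAt_id y).const_mul b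
    refine ((((ha.sin.const_mul a).mul hb.cos).sub ((ha.cos.const_mul b).mul hb.sin)).div_const
      (a ^ 2 - b ^ 2)).congr_deriv ?_
    field_simp
    ring
  rw [intervalIntegral.integral_eq_sub_of_hasDerivAt hd
    (Continuous.intervalIntegrable (by fun_prop) _ _)]
  simp

lemma inner_cosMode_nat {w : ℝ} (k : ℕ) (h : w ^ 2 ≠ (k * Real.pi) ^ 2) :
    inner ℝ (cosMode (k * Real.pi)) (cosMode w) =
      (-1) ^ k * (w * Real.sin w) / (w ^ 2 - (k * Real.pi) ^ 2) := by
  rw [real_inner_comm, inner_cosMode_cosMode_of_sq_ne h, Real.cos_nat_mul_pi, Real.sin_nat_mul_pi]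
  ring

lemma inner_cosMode_nat_nat_of_ne {j k : ℕ} (h : j ≠ k) :
    inner ℝ (cosMode (j * Real.pi)) (cosMode (k * Real.pi)) = (0 : ℝ) := by
  rw [inner_cosMode_nat j, Real.sin_nat_mul_pi]
  · simp
  · intro h2
    rw [sq_eq_sq₀ (by positivity) (by positivity)] at h2
    exact h (by exact_mod_cast (mul_right_cancel₀ Real.pi_ne_zero h2).symm)

lemma inner_cosMode_nat_self (k : ℕ) :
    inner ℝ (cosMode (k * Real.pi)) (cosMode (k * Real.pi)) = if k = 0 then (1 : ℝ) else 1 / 2 := by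
  rw [inner_cosMode_cosMode]
  split_ifs with hk
  · simp [hk]
  have hkπ : (k : ℝ) * Real.pi ≠ 0 := mul_ne_zero (by exact_mod_cast hk) Real.pi_ne_zero
  have hd : ∀ y ∈ uIcc (0 : ℝ) 1, HasDerivAt (fun y =>
      y / 2 + Real.sin (k * Real.pi * y) * Real.cos (k * Real.pi * y) / (2 * (k * Real.pi)))
        (Real.cos (k * Real.pi * y) * Real.cos (k * Real.pi * y)) y := by
    intro y _
    have ha : HasDerivAt (fun y => k * Real.pi * y) (k * Real.pi) y := by
      simpa using (hasDerivAt_id y).const_mul (k * Real.pi)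
    refine (((hasDerivAt_id y).div_const 2).add ((ha.sin.mul ha.cos).div_const
      (2 * (k * Real.pi)))).congr_deriv ?_
    have := Real.sin_sq_add_cos_sq (k * Real.pi * y)
    field_simp
    linear_combination -this
  rw [intervalIntegral.integral_eq_sub_of_hasDerivAt hd
    (Continuous.intervalIntegrable (by fun_prop) _ _)]
  simp [Real.sin_nat_mul_pi]

/-- Completeness of the cosines by the Weierstrass theorem: polynomials in `cos (π y)` are
combinations of the cosines, and they approximate every continuous function on `[0, 1]` uniformly
because `cos (π ·)` is injective there. -/
lemma eq_zero_of_forall_inner_cosMode {f : UnitL2}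
    (hf : ∀ k : ℕ, inner ℝ (cosMode (k * Real.pi)) f = (0 : ℝ)) : f = 0 := by
  have hfi : Integrable f unitMeasure := (Lp.memLp f).integrable (by norm_num)
  have hbdd : ∀ g : ℝ → ℝ, ContinuousOn g (Icc 0 1) → Integrable (fun y => g y * f y) unitMeasure := by
    intro g hg
    obtain ⟨C, hC⟩ := (isCompact_Icc (a := (0 : ℝ)) (b := 1)).exists_bound_of_continuousOn hg
    refine hfi.bdd_mul (c := C) ((hg.mono Ioo_subset_Icc_self).aestronglyMeasurable measurableSet_Ioo)
      ((ae_restrict_mem measurableSet_Ioo).mono fun x hx => hC x (Ioo_subset_Icc_self hx))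
  -- The product-to-sum formula lowers the power and shifts the frequency by one in both directions,
  -- hence the integer `k`.
  have hpow : ∀ (m : ℕ) (k : ℤ),
      ∫ y in Ioo (0 : ℝ) 1, Real.cos (Real.pi * y) ^ m * Real.cos (k * Real.pi * y) * f y = 0 := by
    intro m
    induction m with
    | zero =>
      intro k
      have := hf k.natAbs
      rw [inner_cosMode] at this
      refine Eq.trans ?_ this
      apply integral_congr_ae
      filter_upwards with y
      simp only [pow_zero, one_mul]
      rcases Int.natAbs_eq k with h | h
      · conv_lhs => rw [h]
        simp
      · conv_lhs => rw [h]
        simp [neg_mul]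
    | succ m ih =>
      intro k
      have h1 := ih (k + 1)
      have h2 := ih (k - 1)
      have h3 : ∀ y, Real.cos (Real.pi * y) ^ (m + 1) * Real.cos (k * Real.pi * y) * f y =
          (1 / 2) * (Real.cos (Real.pi * y) ^ m * Real.cos ((k + 1 : ℤ) * Real.pi * y) * f y +
            Real.cos (Real.pi * y) ^ m * Real.cos ((k - 1 : ℤ) * Real.pi * y) * f y) := by
        intro y
        have e1 : ((k + 1 : ℤ) : ℝ) * Real.pi * y = k * Real.pi * y + Real.pi * y := by
          push_cast; ring
        have e2 : ((k - 1 : ℤ) : ℝ) * Real.pi * y = k * Real.pi * y - Real.pi * y := by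
          push_cast; ring
        rw [e1, e2, Real.cos_add, Real.cos_sub]
        ring
      simp_rw [h3]
      rw [integral_const_mul, integral_add (hbdd _ (by fun_prop)) (hbdd _ (by fun_prop)), h1, h2]
      simp
  have hpoly : ∀ P : Polynomial ℝ,
      ∫ y in Ioo (0 : ℝ) 1, P.eval (Real.cos (Real.pi * y)) * f y = 0 := by
    intro P
    induction P using Polynomial.induction_on' with
    | add P Q hP hQ =>
      simp only [Polynomial.eval_add, add_mul]
      rw [integral_add (hbdd _ (by fun_prop)) (hbdd _ (by fun_prop)), hP, hQ, add_zero]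
    | monomial m c =>
      simp only [Polynomial.eval_monomial, mul_assoc]
      rw [integral_const_mul]
      have := hpow m 0
      simp only [Int.cast_zero, zero_mul, Real.cos_zero, mul_one] at this
      rw [this, mul_zero]
  have hcont : ∀ g : ℝ → ℝ, Continuous g → ∫ y in Ioo (0 : ℝ) 1, g y * f y = 0 := by
    intro g hg
    set c := ∫ y in Ioo (0 : ℝ) 1, ‖f y‖ with hc
    have hc0 : 0 ≤ c := integral_nonneg fun _ => norm_nonneg _
    by_contra hne
    have hpos := norm_pos_iff.2 hne
    set ε := ‖∫ y in Ioo (0 : ℝ) 1, g y * f y‖ / (c + 1) with hε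
    have hε0 : 0 < ε := div_pos hpos (by linarith)
    -- The function to be approximated is `g` read in the variable `x = cos (π y)`.
    obtain ⟨P, hP⟩ := exists_polynomial_near_of_continuousOn (-1) 1
      (fun x => g (Real.arccos x / Real.pi))
      (hg.comp (Real.continuous_arccos.div_const _)).continuousOn ε hε0
    have hP' : ∀ y ∈ Icc (0 : ℝ) 1, |P.eval (Real.cos (Real.pi * y)) - g y| < ε := by
      intro y hy
      have h := hP (Real.cos (Real.pi * y)) ⟨Real.neg_one_le_cos _, Real.cos_le_one _⟩
      rwa [Real.arccos_cos (mul_nonneg Real.pi_pos.le hy.1)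
        (mul_le_of_le_one_right Real.pi_pos.le hy.2), mul_div_cancel_left₀ _ Real.pi_ne_zero] at h
    have h1 : ∫ y in Ioo (0 : ℝ) 1, g y * f y =
        -∫ y in Ioo (0 : ℝ) 1, (P.eval (Real.cos (Real.pi * y)) - g y) * f y := by
      simp only [sub_mul]
      rw [integral_sub (hbdd _ (by fun_prop)) (hbdd _ hg.continuousOn), hpoly]
      ring
    have h2 : ‖∫ y in Ioo (0 : ℝ) 1, g y * f y‖ ≤ ε * c := by
      rw [h1, norm_neg, hc, ← integral_const_mul]
      refine norm_integral_le_of_norm_le (hfi.norm.const_mul _) ?_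
      filter_upwards [ae_restrict_mem measurableSet_Ioo] with y hy
      rw [norm_mul]
      exact mul_le_mul_of_nonneg_right (hP' y (Ioo_subset_Icc_self hy)).le (norm_nonneg _)
    have h3 : ε * (c + 1) = ‖∫ y in Ioo (0 : ℝ) 1, g y * f y‖ :=
      div_mul_cancel₀ _ (by linarith)
    linarith
  have hae : ∀ᵐ y, y ∈ Ioo (0 : ℝ) 1 → f y = 0 := by
    refine isOpen_Ioo.ae_eq_zero_of_integral_contDiff_smul_eq_zero
      (LocallyIntegrableOn.mono_set (IntegrableOn.locallyIntegrableOn hfi) subset_rfl) ?_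
    intro g hg _ hgs
    rw [← hcont g hg.continuous, ← setIntegral_eq_integral_of_forall_compl_eq_zero (s := Ioo 0 1)]
    · rfl
    · intro y hy
      rw [image_eq_zero_of_notMem_tsupport (fun h => hy (hgs h)), zero_smul]
  rw [Lp.eq_zero_iff_ae_eq_zero, Filter.EventuallyEq, ae_restrict_iff' measurableSet_Ioo]
  exact hae

/-- The normalized cosines. -/
noncomputable def cosBasisVec (k : ℕ) : UnitL2 :=
  (if k = 0 then 1 else √2 : ℝ) • cosMode (k * Real.pi)

lemma orthonormal_cosBasisVec : Orthonormal ℝ cosBasisVec := by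
  rw [orthonormal_iff_ite]
  intro j k
  simp only [cosBasisVec, inner_smul_left, inner_smul_right, conj_trivial]
  rcases eq_or_ne j k with rfl | hjk
  · rw [inner_cosMode_nat_self]
    rw [if_pos rfl]
    split_ifs with h
    · norm_num
    · rw [← mul_assoc, Real.mul_self_sqrt (by norm_num)]; norm_num
  · rw [inner_cosMode_nat_nat_of_ne hjk, if_neg hjk]; simp

/-- The Hilbert basis of `L²(0, 1)` that consists of the normalized cosines. -/
noncomputable def cosBasis : HilbertBasis ℕ ℝ UnitL2 :=
  HilbertBasis.mkOfOrthogonalEqBot orthonormal_cosBasisVec <| by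
    rw [Submodule.eq_bot_iff]
    intro f hf
    refine eq_zero_of_forall_inner_cosMode fun k => ?_
    have h := (Submodule.mem_orthogonal _ _).1 hf (cosBasisVec k)
      (Submodule.subset_span (mem_range_self k))
    rw [cosBasisVec, inner_smul_left, mul_eq_zero] at h
    refine h.resolve_left ?_
    split_ifs <;> simp

lemma cosBasis_apply (k : ℕ) : cosBasis k = cosBasisVec k := by
  simp [cosBasis]

end CrossDiffusion

namespace CrossDiffusion

/-! ### A Riesz basis of cosines with modified low frequencies -/

/-- Barycentric form of Lagrange interpolation: a polynomial of degree less than the number of nodes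
equals its interpolant. For the right polynomial this inverts a Cauchy matrix. -/
lemma sum_nodalWeight_mul_eval {ι : Type*} [DecidableEq ι] {s : Finset ι} {v : ι → ℝ}
    (hv : InjOn v s) {P : Polynomial ℝ} (hP : P.degree < s.card) {x : ℝ} (hx : ∀ i ∈ s, x ≠ v i) :
    ∑ i ∈ s, Lagrange.nodalWeight s v i * (x - v i)⁻¹ * P.eval (v i) =
      P.eval x / (Lagrange.nodal s v).eval x := by
  have hne : (Lagrange.nodal s v).eval x ≠ 0 := Lagrange.eval_nodal_not_at_node hx
  rw [eq_div_iff hne, mul_comm]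
  conv_rhs => rw [Lagrange.eq_interpolate hv hP]
  exact (Lagrange.eval_interpolate_not_at_node _ hx).symm

/-- The frequencies `k π` for `k ≥ N`, together with the `N` frequencies
`(N + k + 1 / 2) π`, `k < N`. -/
noncomputable def freq (N k : ℕ) : ℝ :=
  if k < N then (N + k + 1 / 2) * Real.pi else k * Real.pi

lemma freq_of_lt {N k : ℕ} (h : k < N) : freq N k = (N + k + 1 / 2) * Real.pi := if_pos h

lemma freq_of_le {N k : ℕ} (h : N ≤ k) : freq N k = k * Real.pi := if_neg h.not_gt

lemma le_freq (N k : ℕ) : N * Real.pi ≤ freq N k := by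
  unfold freq
  have := Real.pi_pos
  split_ifs with h
  · have : (0 : ℝ) ≤ k := by positivity
    gcongr; linarith
  · have : (N : ℝ) ≤ k := by exact_mod_cast not_lt.1 h
    gcongr

lemma freq_pos_of_lt {N k : ℕ} (h : k < N) : 0 < freq N k := by
  rw [freq_of_lt h]; have := Real.pi_pos; positivity

/-- This is the reason for the half-integers: the factor `w sin w`, by which the Cauchy inverse
divides, stays away from zero. -/
lemma sin_freq_sq {N k : ℕ} (h : k < N) : Real.sin (freq N k) ^ 2 = 1 := by
  have h1 : freq N k = Real.pi / 2 + (N + k : ℕ) * Real.pi := by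
    rw [freq_of_lt h]; push_cast; ring
  rw [h1, Real.sin_add_nat_mul_pi, Real.sin_pi_div_two, mul_one, ← pow_mul, mul_comm, pow_mul]
  simp

lemma sin_freq_of_le {N k : ℕ} (h : N ≤ k) : Real.sin (freq N k) = 0 := by
  rw [freq_of_le h, Real.sin_nat_mul_pi]

lemma one_le_abs_sq_sub_sq {a b : ℕ} (h : a ≠ b) : (1 : ℝ) ≤ |(a : ℝ) ^ 2 - (b : ℝ) ^ 2| := by
  have h2 : (a : ℤ) ^ 2 - (b : ℤ) ^ 2 ≠ 0 := by
    rw [sub_ne_zero]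
    intro h3
    exact h (by exact_mod_cast (sq_eq_sq₀ (by positivity) (by positivity)).1 h3)
  exact_mod_cast Int.one_le_abs h2

section Cauchy

variable (N : ℕ)

/-- Squares of the low modified frequencies. -/
noncomputable def nodeX (j : Fin N) : ℝ := freq N j ^ 2

/-- Squares of the low frequencies. -/
noncomputable def nodeY (k : Fin N) : ℝ := ((k : ℕ) * Real.pi) ^ 2

variable {N}

lemma one_le_pi_sq : (1 : ℝ) ≤ Real.pi ^ 2 := by nlinarith [Real.pi_gt_three]

lemma nodeX_eq (j : Fin N) : nodeX N j = (N + j + 1 / 2) ^ 2 * Real.pi ^ 2 := by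
  rw [nodeX, freq_of_lt j.2]; ring

lemma nodeY_eq (k : Fin N) : nodeY N k = (k : ℝ) ^ 2 * Real.pi ^ 2 := by
  rw [nodeY]; ring

/-- Divided by `π²`, the difference factors as `(i - j) (2 N + i + j + 1)`, a product of two nonzero
integers. -/
lemma nodeX_sub_nodeX_abs {i j : Fin N} (h : i ≠ j) : Real.pi ^ 2 ≤ |nodeX N i - nodeX N j| := by
  have h1 := one_le_abs_sq_sub_sq (a := 2 * N + 2 * i + 1) (b := 2 * N + 2 * j + 1)
    (fun h2 => h (Fin.ext (by omega)))
  have h3 : (1 : ℝ) ≤ |((N : ℝ) + i + 1 / 2) ^ 2 - (N + j + 1 / 2) ^ 2| := by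
    have e : ((N : ℝ) + i + 1 / 2) ^ 2 - (N + j + 1 / 2) ^ 2 =
      ((i : ℤ) - j : ℤ) * ((2 * N + i + j + 1 : ℕ) : ℝ) := by push_cast; ring
    rw [e, abs_mul]
    have h4 : (1 : ℝ) ≤ |(((i : ℤ) - j : ℤ) : ℝ)| := by
      have : ((i : ℕ) : ℤ) - (j : ℕ) ≠ 0 := by
        intro h5; exact h (Fin.ext (by omega))
      exact_mod_cast Int.one_le_abs this
    have h5 : (1 : ℝ) ≤ |((2 * N + i + j + 1 : ℕ) : ℝ)| := by
      rw [abs_of_nonneg (by positivity)]; push_cast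
      have : (0 : ℝ) ≤ 2 * N + i + j := by positivity
      linarith
    nlinarith
  rw [nodeX_eq, nodeX_eq, ← sub_mul, abs_mul, abs_of_nonneg (sq_nonneg Real.pi)]
  nlinarith [sq_nonneg Real.pi]

lemma nodeY_sub_nodeY_abs {i j : Fin N} (h : i ≠ j) : Real.pi ^ 2 ≤ |nodeY N i - nodeY N j| := by
  have h1 := one_le_abs_sq_sub_sq (a := i) (b := j) (fun h2 => h (Fin.ext h2))
  rw [nodeY_eq, nodeY_eq, ← sub_mul, abs_mul, abs_of_nonneg (sq_nonneg Real.pi)]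
  nlinarith [sq_nonneg Real.pi]

lemma nodeX_sub_nodeY_pos (i k : Fin N) : 0 < nodeX N i - nodeY N k := by
  rw [nodeX_eq, nodeY_eq, ← sub_mul]
  have h1 : ((k : ℕ) : ℝ) ≤ N := by exact_mod_cast k.2.le
  have h2 : (0 : ℝ) ≤ (i : ℕ) := by positivity
  have h3 : (0 : ℝ) ≤ (k : ℕ) := by positivity
  have := Real.pi_pos
  refine mul_pos ?_ (by positivity)
  nlinarith

lemma nodeX_sub_nodeY_abs_le (i k : Fin N) :
    |nodeX N i - nodeY N k| ≤ (2 * N) ^ 2 * Real.pi ^ 2 := by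
  rw [abs_of_pos (nodeX_sub_nodeY_pos i k), nodeX_eq, nodeY_eq, ← sub_mul]
  have h1 : ((i : ℕ) : ℝ) + 1 ≤ N := by exact_mod_cast i.2
  have h2 : (0 : ℝ) ≤ (i : ℕ) := by positivity
  gcongr
  nlinarith [sq_nonneg ((k : ℕ) : ℝ)]

lemma nodeY_injOn : InjOn (nodeY N) (Finset.univ : Finset (Fin N)) := by
  intro i _ j _ hij
  by_contra h
  have := nodeY_sub_nodeY_abs h
  rw [hij, sub_self, abs_zero] at this
  linarith [one_le_pi_sq]

/-- The inverse of the matrix of the inner products of `cos (k π y)` and `cos (freq N j y)`. -/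
noncomputable def cauchyInv (j k : Fin N) : ℝ :=
  (-1) ^ (k : ℕ) / (freq N j * Real.sin (freq N j)) *
    ((Lagrange.nodal Finset.univ (nodeY N)).eval (nodeX N j) /
      (Lagrange.nodal (Finset.univ.erase j) (nodeX N)).eval (nodeX N j)) *
    (Lagrange.nodalWeight Finset.univ (nodeY N) k *
      (Lagrange.nodal (Finset.univ.erase j) (nodeX N)).eval (nodeY N k))

lemma freq_mul_sin_ne_zero (j : Fin N) : freq N j * Real.sin (freq N j) ≠ 0 := by
  refine mul_ne_zero (freq_pos_of_lt j.2).ne' fun h => ?_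
  have := sin_freq_sq j.2
  rw [h] at this
  norm_num at this

lemma inner_cosMode_freq_of_lt (j k : Fin N) :
    inner ℝ (cosMode ((k : ℕ) * Real.pi)) (cosMode (freq N j)) =
      (-1) ^ (k : ℕ) * (freq N j * Real.sin (freq N j)) * (nodeX N j - nodeY N k)⁻¹ := by
  rw [inner_cosMode_nat, div_eq_mul_inv, nodeX, nodeY]
  exact sub_ne_zero.1 (nodeX_sub_nodeY_pos j k).ne'

lemma eval_nodal_erase_ne_zero (j : Fin N) :
    (Lagrange.nodal (Finset.univ.erase j) (nodeX N)).eval (nodeX N j) ≠ 0 := by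
  refine Lagrange.eval_nodal_not_at_node fun i hi h => ?_
  have := nodeX_sub_nodeX_abs (Finset.ne_of_mem_erase hi)
  rw [h, sub_self, abs_zero] at this
  linarith [one_le_pi_sq]

/-- Up to row and column factors the inner products form the Cauchy matrix `1 / (x_i - y_k)`. The
barycentric formula for the polynomial `∏_{l ≠ j} (X - x_l)`, of degree `N - 1`, produces a value
that vanishes at all `x_i` except `x_j`; the other factors of `cauchyInv` only normalize. -/
lemma sum_cauchyInv_mul (i j : Fin N) :
    ∑ k : Fin N, cauchyInv j k * inner ℝ (cosMode ((k : ℕ) * Real.pi)) (cosMode (freq N i)) =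
      if j = i then 1 else 0 := by
  have hW : (Lagrange.nodal Finset.univ (nodeY N)).eval (nodeX N i) ≠ 0 :=
    Lagrange.eval_nodal_not_at_node fun k _ => sub_ne_zero.1 (nodeX_sub_nodeY_pos i k).ne'
  have key := sum_nodalWeight_mul_eval (nodeY_injOn (N := N))
    (P := Lagrange.nodal (Finset.univ.erase j) (nodeX N)) (x := nodeX N i) (by
      rw [Lagrange.degree_nodal]
      exact_mod_cast Finset.card_erase_lt_of_mem (Finset.mem_univ j))
    (fun k _ => sub_ne_zero.1 (nodeX_sub_nodeY_pos i k).ne')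
  have hterm : ∀ k : Fin N,
      cauchyInv j k * inner ℝ (cosMode ((k : ℕ) * Real.pi)) (cosMode (freq N i)) =
      (freq N i * Real.sin (freq N i)) / (freq N j * Real.sin (freq N j)) *
    ((Lagrange.nodal Finset.univ (nodeY N)).eval (nodeX N j) /
      (Lagrange.nodal (Finset.univ.erase j) (nodeX N)).eval (nodeX N j)) *
    (Lagrange.nodalWeight Finset.univ (nodeY N) k * (nodeX N i - nodeY N k)⁻¹ *
      (Lagrange.nodal (Finset.univ.erase j) (nodeX N)).eval (nodeY N k)) := by
    intro k
    rw [inner_cosMode_freq_of_lt, cauchyInv]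
    have h1 : ((-1 : ℝ) ^ (k : ℕ)) * (-1) ^ (k : ℕ) = 1 := by
      rw [← mul_pow]; simp
    linear_combination (freq N i * Real.sin (freq N i)) / (freq N j * Real.sin (freq N j)) *
    ((Lagrange.nodal Finset.univ (nodeY N)).eval (nodeX N j) /
      (Lagrange.nodal (Finset.univ.erase j) (nodeX N)).eval (nodeX N j)) *
    (Lagrange.nodalWeight Finset.univ (nodeY N) k * (nodeX N i - nodeY N k)⁻¹ *
      (Lagrange.nodal (Finset.univ.erase j) (nodeX N)).eval (nodeY N k)) * h1
  simp_rw [hterm]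
  rw [← Finset.mul_sum, key]
  split_ifs with h
  · subst h
    have h1 := freq_mul_sin_ne_zero j
    have h2 := eval_nodal_erase_ne_zero j
    rw [div_self h1]
    field_simp
  · rw [Lagrange.eval_nodal_at_node (Finset.mem_erase.2 ⟨Ne.symm h, Finset.mem_univ i⟩)]
    simp

lemma sum_mul_cauchyInv (k l : Fin N) :
    ∑ j : Fin N, inner ℝ (cosMode ((k : ℕ) * Real.pi)) (cosMode (freq N j)) * cauchyInv j l =
      if k = l then 1 else 0 := by
  have h1 : (Matrix.of fun j k : Fin N => cauchyInv j k) * (Matrix.of fun k i : Fin N =>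
      inner ℝ (cosMode ((k : ℕ) * Real.pi)) (cosMode (freq N i))) = 1 := by
    ext j i
    rw [Matrix.mul_apply, Matrix.one_apply]
    exact sum_cauchyInv_mul i j
  have h3 := mul_eq_one_comm.1 h1
  have h2 := congrFun (congrFun h3 k) l
  rw [Matrix.mul_apply, Matrix.one_apply] at h2
  exact h2

/-- The products in the denominators have gaps of at least `π²`, those in the numerators factors of
at most `(2 N)² π²`. What matters is the growth `exp (O(N log N))`, which is negligible against a
decay with exponent of order `N²`. -/
lemma abs_cauchyInv_le (hN : 1 ≤ N) (j k : Fin N) :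
    |cauchyInv j k| ≤ 10 * (2 * N : ℝ) ^ (4 * N) := by
  have hpi := Real.pi_pos
  have hcard : (Finset.univ.erase j).card = N - 1 := by simp
  have hcard' : (Finset.univ.erase k).card = N - 1 := by simp
  have e1 : |(-1) ^ (k : ℕ) / (freq N j * Real.sin (freq N j))| ≤ 1 := by
    rw [abs_div, abs_pow, abs_neg, abs_one, one_pow, abs_mul]
    have h1 : |Real.sin (freq N j)| = 1 := by
      have := sin_freq_sq j.2
      rw [← sq_abs] at this
      exact (pow_eq_one_iff_of_nonneg (abs_nonneg _) two_ne_zero).1 this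
    have h2 : 1 ≤ freq N j := by
      have h3 := le_freq N j
      have h4 : (1 : ℝ) ≤ N := by exact_mod_cast hN
      nlinarith [Real.pi_gt_three]
    rw [h1, mul_one, abs_of_pos (by linarith)]
    exact (div_le_one (by linarith)).2 h2
  have e2 : |(Lagrange.nodal Finset.univ (nodeY N)).eval (nodeX N j)| ≤
      ((2 * N) ^ 2 * Real.pi ^ 2) ^ N := by
    rw [Lagrange.eval_nodal, Finset.abs_prod]
    calc _ ≤ ∏ _i : Fin N, ((2 * N : ℝ) ^ 2 * Real.pi ^ 2) :=
          Finset.prod_le_prod (fun _ _ => abs_nonneg _) fun i _ => nodeX_sub_nodeY_abs_le j i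
      _ = _ := by simp
  have e3 : (Real.pi ^ 2) ^ (N - 1) ≤
      |(Lagrange.nodal (Finset.univ.erase j) (nodeX N)).eval (nodeX N j)| := by
    rw [Lagrange.eval_nodal, Finset.abs_prod, ← hcard, ← Finset.prod_const]
    exact Finset.prod_le_prod (fun _ _ => by positivity) fun i hi =>
      nodeX_sub_nodeX_abs (Finset.ne_of_mem_erase hi).symm
  have e4 : |Lagrange.nodalWeight Finset.univ (nodeY N) k| ≤ ((Real.pi ^ 2) ^ (N - 1))⁻¹ := by
    rw [Lagrange.nodalWeight, Finset.abs_prod, ← hcard', ← inv_pow, ← Finset.prod_const]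
    refine Finset.prod_le_prod (fun _ _ => abs_nonneg _) fun i hi => ?_
    rw [abs_inv]
    exact inv_anti₀ (by positivity) (nodeY_sub_nodeY_abs (Finset.ne_of_mem_erase hi).symm)
  have e5 : |(Lagrange.nodal (Finset.univ.erase j) (nodeX N)).eval (nodeY N k)| ≤
      ((2 * N) ^ 2 * Real.pi ^ 2) ^ (N - 1) := by
    rw [Lagrange.eval_nodal, Finset.abs_prod, ← hcard, ← Finset.prod_const]
    refine Finset.prod_le_prod (fun _ _ => abs_nonneg _) fun i hi => ?_
    rw [abs_sub_comm]
    exact nodeX_sub_nodeY_abs_le i k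
  have hP : 0 < (Real.pi ^ 2) ^ (N - 1) := by positivity
  have hA : (1 : ℝ) ≤ 2 * N := by
    have : (1 : ℝ) ≤ N := by exact_mod_cast hN
    linarith
  rw [cauchyInv, abs_mul, abs_mul, abs_div (Polynomial.eval _ _), abs_mul (Lagrange.nodalWeight _ _ _)]
  calc _ ≤ 1 * (((2 * N) ^ 2 * Real.pi ^ 2) ^ N / (Real.pi ^ 2) ^ (N - 1)) *
        (((Real.pi ^ 2) ^ (N - 1))⁻¹ * ((2 * N) ^ 2 * Real.pi ^ 2) ^ (N - 1)) := by gcongr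
    -- There are `2 N - 1` factors `π²` above and `2 (N - 1)` below, so one remains; it is at most
    -- `10`.
    _ = Real.pi ^ 2 * (2 * N) ^ (2 * N + 2 * (N - 1)) := by
      have h1 : ((2 * N : ℝ) ^ 2 * Real.pi ^ 2) ^ N =
          (2 * N) ^ (2 * N) * ((Real.pi ^ 2) ^ (N - 1) * Real.pi ^ 2) := by
        rw [← pow_succ, Nat.sub_add_cancel hN, mul_pow, ← pow_mul]
      have h2 : ((2 * N : ℝ) ^ 2 * Real.pi ^ 2) ^ (N - 1) =
          (2 * N) ^ (2 * (N - 1)) * (Real.pi ^ 2) ^ (N - 1) := by rw [mul_pow, ← pow_mul]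
      rw [h1, h2, pow_add]
      generalize (Real.pi ^ 2) ^ (N - 1) = P at hP
      field_simp
    _ ≤ 10 * (2 * N : ℝ) ^ (4 * N) := by
      gcongr
      · nlinarith [Real.pi_lt_d2]
      · omega

end Cauchy

/-- The functions of the dual basis that correspond to the low modified frequencies. -/
noncomputable def dualMode {N : ℕ} (j : Fin N) : UnitL2 :=
  ∑ k : Fin N, cauchyInv j k • cosMode ((k : ℕ) * Real.pi)

lemma norm_dualMode_le {N : ℕ} (hN : 1 ≤ N) (j : Fin N) :
    ‖dualMode j‖ ≤ N * (10 * (2 * N : ℝ) ^ (4 * N)) := by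
  refine (norm_sum_le _ _).trans ?_
  calc _ ≤ ∑ _k : Fin N, (10 * (2 * N : ℝ) ^ (4 * N)) := by
        refine Finset.sum_le_sum fun k _ => ?_
        rw [norm_smul, Real.norm_eq_abs]
        exact (mul_le_of_le_one_right (abs_nonneg _) (norm_cosMode_le _)).trans
          (abs_cauchyInv_le hN j k)
    _ = _ := by simp

lemma inner_dualMode {N : ℕ} (j : Fin N) (z : UnitL2) : inner ℝ (dualMode j) z =
    ∑ k : Fin N, cauchyInv j k * inner ℝ (cosMode ((k : ℕ) * Real.pi)) z := by
  simp [dualMode, sum_inner, inner_smul_left]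

lemma inner_dualMode_cosMode {N : ℕ} (j i : Fin N) :
    inner ℝ (dualMode j) (cosMode (freq N i)) = if j = i then (1 : ℝ) else 0 := by
  rw [inner_dualMode, sum_cauchyInv_mul]

/-- The dual functions are combinations of `cos (k π y)` with `k < N`, which are orthogonal to the
unchanged cosines. -/
lemma inner_dualMode_cosMode_of_le {N : ℕ} (j : Fin N) {k : ℕ} (hk : N ≤ k) :
    inner ℝ (dualMode j) (cosMode (freq N k)) = (0 : ℝ) := by
  rw [inner_dualMode, freq_of_le hk]
  refine Finset.sum_eq_zero fun i _ => ?_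
  rw [inner_cosMode_nat_nat_of_ne (by omega), mul_zero]

/-- The kernel of the feedback: for all modes of frequency `freq N k`, it yields the flux
`- w sin w` at the end point. -/
noncomputable def feedbackKernel (N : ℕ) : UnitL2 :=
  -∑ j : Fin N, (freq N j * Real.sin (freq N j)) • dualMode j

/-- Biorthogonality settles the moved frequencies; at the others `sin` vanishes, so no flux is
requested. This is why a bounded functional suffices to prescribe the fluxes of all modes at once.
-/
lemma inner_feedbackKernel (N k : ℕ) :
    inner ℝ (feedbackKernel N) (cosMode (freq N k)) = -(freq N k * Real.sin (freq N k)) := by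
  rw [feedbackKernel, inner_neg_left, sum_inner, neg_inj]
  simp only [inner_smul_left, conj_trivial]
  rcases lt_or_ge k N with hk | hk
  · simpa using Finset.sum_eq_single (s := Finset.univ) (⟨k, hk⟩ : Fin N)
      (f := fun j : Fin N => freq N j * Real.sin (freq N j) *
        inner ℝ (dualMode j) (cosMode (freq N (⟨k, hk⟩ : Fin N))))
      (fun j _ hj => by rw [inner_dualMode_cosMode, if_neg hj, mul_zero]) (by simp) |>.trans
        (by rw [inner_dualMode_cosMode, if_pos rfl, mul_one])
  · rw [sin_freq_of_le hk, mul_zero]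
    exact Finset.sum_eq_zero fun j _ => by rw [inner_dualMode_cosMode_of_le j hk, mul_zero]

/-- The component of `z` on the low modified modes. -/
noncomputable def lowPart (N : ℕ) (z : UnitL2) : UnitL2 :=
  ∑ j : Fin N, inner ℝ (dualMode j) z • cosMode (freq N j)

/-- Since `cauchyInv` is also a right inverse, subtracting the moved modes removes every low cosine
coefficient. The rest is an orthogonal expansion in the unchanged cosines, so the new family spans.
-/
lemma inner_cosMode_sub_lowPart {N k : ℕ} (hk : k < N) (z : UnitL2) :
    inner ℝ (cosMode (k * Real.pi)) (z - lowPart N z) = (0 : ℝ) := by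
  rw [inner_sub_right, lowPart, inner_sum, sub_eq_zero]
  simp only [inner_smul_right, inner_dualMode, Finset.sum_mul]
  rw [Finset.sum_comm]
  have h : ∀ l : Fin N, ∑ j : Fin N, cauchyInv j l * inner ℝ (cosMode ((l : ℕ) * Real.pi)) z *
      inner ℝ (cosMode (k * Real.pi)) (cosMode (freq N j)) =
      (if (⟨k, hk⟩ : Fin N) = l then 1 else 0) * inner ℝ (cosMode ((l : ℕ) * Real.pi)) z := by
    intro l
    rw [← sum_mul_cauchyInv, Finset.sum_mul]
    exact Finset.sum_congr rfl fun j _ => by simp only; ring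
  simp_rw [h]
  simp

end CrossDiffusion

namespace CrossDiffusion

/-! ### Closed-loop evolution of the Riesz basis -/

lemma hasSum_sq_cosBasis (z : UnitL2) :
    HasSum (fun k => inner ℝ (cosBasis k) z ^ 2) (‖z‖ ^ 2) := by
  have h := cosBasis.hasSum_inner_mul_inner z z
  rw [real_inner_self_eq_norm_sq] at h
  refine h.congr_fun fun k => ?_
  rw [real_inner_comm z, sq]

lemma memℓp_mul_repr {m : ℕ → ℝ} (hm : ∀ k, |m k| ≤ 1) (z : UnitL2) :
    Memℓp (fun k => m k * inner ℝ (cosBasis k) z) 2 := by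
  refine memℓp_gen ?_
  have h := (hasSum_sq_cosBasis z).summable
  refine Summable.of_nonneg_of_le (fun k => by positivity) (fun k => ?_) h
  simp only [ENNReal.toReal_ofNat, Real.rpow_ofNat, norm_mul, Real.norm_eq_abs, mul_pow, sq_abs]
  exact mul_le_of_le_one_left (sq_nonneg _) ((sq_le_one_iff_abs_le_one _).2 (hm k))

/-- The vector with coefficients `m k * ⟪e k, z⟫` in the cosine basis. -/
noncomputable def diag (m : ℕ → ℝ) (hm : ∀ k, |m k| ≤ 1) (z : UnitL2) : UnitL2 :=
  cosBasis.repr.symm ⟨fun k => m k * inner ℝ (cosBasis k) z, memℓp_mul_repr hm z⟩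

lemma inner_cosBasis_diag {m : ℕ → ℝ} (hm : ∀ k, |m k| ≤ 1) (z : UnitL2) (k : ℕ) :
    inner ℝ (cosBasis k) (diag m hm z) = m k * inner ℝ (cosBasis k) z := by
  rw [← cosBasis.repr_apply_apply, diag, LinearIsometryEquiv.apply_symm_apply]

lemma ext_cosBasis {f g : UnitL2} (h : ∀ k, inner ℝ (cosBasis k) f = (inner ℝ (cosBasis k) g : ℝ)) :
    f = g := by
  apply cosBasis.repr.injective
  ext k
  rw [cosBasis.repr_apply_apply, cosBasis.repr_apply_apply, h]

/-- Comparison of coefficients through Parseval's identity. -/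
lemma norm_le_of_forall_abs_inner_le {f g : UnitL2} {B : ℝ} (hB : 0 ≤ B)
    (h : ∀ k, |inner ℝ (cosBasis k) f| ≤ B * |(inner ℝ (cosBasis k) g : ℝ)|) : ‖f‖ ≤ B * ‖g‖ := by
  refine abs_le_of_sq_le_sq' ?_ (by positivity) |>.2
  rw [mul_pow]
  refine hasSum_le (fun k => ?_) (hasSum_sq_cosBasis f) ((hasSum_sq_cosBasis g).mul_left (B ^ 2))
  rw [← mul_pow, ← sq_abs, ← sq_abs (B * _), abs_mul B, abs_of_nonneg hB]
  gcongr
  exact h k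

/-- The coefficients of `z` in the Riesz basis of the functions `cos (freq N k y)`. -/
noncomputable def coef (N k : ℕ) (z : UnitL2) : ℝ :=
  if h : k < N then inner ℝ (dualMode ⟨k, h⟩) z
  else √2 * inner ℝ (cosBasis k) (z - lowPart N z)

lemma coef_of_lt {N k : ℕ} (h : k < N) (z : UnitL2) :
    coef N k z = inner ℝ (dualMode ⟨k, h⟩) z := dif_pos h

lemma coef_of_le {N k : ℕ} (h : N ≤ k) (z : UnitL2) :
    coef N k z = √2 * inner ℝ (cosBasis k) (z - lowPart N z) := dif_neg h.not_gt

lemma cosBasis_of_pos {k : ℕ} (h : k ≠ 0) : cosBasis k = √2 • cosMode (k * Real.pi) := by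
  rw [cosBasis_apply, cosBasisVec, if_neg h]

lemma inner_cosBasis_sub_lowPart {N k : ℕ} (hk : k < N) (z : UnitL2) :
    inner ℝ (cosBasis k) (z - lowPart N z) = (0 : ℝ) := by
  rw [cosBasis_apply, cosBasisVec, inner_smul_left, inner_cosMode_sub_lowPart hk, mul_zero]

/-- The factor `√2` of `coef` is the normalization of the cosine; `N ≥ 1` excludes the constant
mode, which is normalized by `1`. -/
lemma coef_smul_cosMode {N k : ℕ} (hN : 1 ≤ N) (h : N ≤ k) (z : UnitL2) (θ : ℝ) :
    (coef N k z * θ) • cosMode (freq N k) =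
      (θ * inner ℝ (cosBasis k) (z - lowPart N z)) • cosBasis k := by
  rw [coef_of_le h, freq_of_le h, cosBasis_of_pos (by omega), smul_smul]
  congr 1; ring

/-- The bound for the coefficients of the low modified modes. -/
noncomputable def lowConst (N : ℕ) : ℝ := N * (N * (10 * (2 * N : ℝ) ^ (4 * N)))

lemma lowConst_nonneg (N : ℕ) : 0 ≤ lowConst N := by unfold lowConst; positivity

lemma sum_abs_coef_le {N : ℕ} (hN : 1 ≤ N) (z : UnitL2) :
    ∑ k ∈ Finset.range N, |coef N k z| ≤ lowConst N * ‖z‖ := by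
  calc _ ≤ ∑ _k ∈ Finset.range N, N * (10 * (2 * N : ℝ) ^ (4 * N)) * ‖z‖ := by
        refine Finset.sum_le_sum fun k hk => ?_
        rw [coef_of_lt (Finset.mem_range.1 hk)]
        exact (abs_real_inner_le_norm _ _).trans
          (mul_le_mul_of_nonneg_right (norm_dualMode_le hN _) (norm_nonneg _))
    _ = _ := by simp [lowConst]; ring

lemma lowPart_eq (N : ℕ) (z : UnitL2) :
    lowPart N z = ∑ k ∈ Finset.range N, coef N k z • cosMode (freq N k) := by
  rw [lowPart, ← Fin.sum_univ_eq_sum_range (fun k => coef N k z • cosMode (freq N k))]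
  exact Finset.sum_congr rfl fun k _ => by rw [coef_of_lt k.2]

lemma norm_sum_coef_le {N : ℕ} (hN : 1 ≤ N) (z : UnitL2) {θ : ℕ → ℝ} {B : ℝ}
    (hθ : ∀ k < N, |θ k| ≤ B) :
    ‖∑ k ∈ Finset.range N, (coef N k z * θ k) • cosMode (freq N k)‖ ≤ B * (lowConst N * ‖z‖) := by
  have hB : 0 ≤ B := (abs_nonneg _).trans (hθ 0 hN)
  refine (norm_sum_le _ _).trans (le_trans ?_
    (mul_le_mul_of_nonneg_left (sum_abs_coef_le hN z) hB))
  rw [Finset.mul_sum]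
  refine Finset.sum_le_sum fun k hk => ?_
  rw [norm_smul, norm_mul, Real.norm_eq_abs, Real.norm_eq_abs, mul_comm B]
  refine (mul_le_of_le_one_right (by positivity) (norm_cosMode_le _)).trans ?_
  exact mul_le_mul_of_nonneg_left (hθ k (Finset.mem_range.1 hk)) (abs_nonneg _)

lemma norm_sub_lowPart_le {N : ℕ} (hN : 1 ≤ N) (z : UnitL2) :
    ‖z - lowPart N z‖ ≤ (1 + lowConst N) * ‖z‖ := by
  have h := norm_sum_coef_le hN z (θ := fun _ => 1) (B := 1) (by simp)
  simp only [mul_one, one_mul, ← lowPart_eq] at h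
  calc _ ≤ ‖z‖ + ‖lowPart N z‖ := norm_sub_le _ _
    _ ≤ _ := by linarith

/-- The factor of decay of the mode of frequency `w` after the time `r`. -/
noncomputable def decay (σ w r : ℝ) : ℝ := Real.exp (-(σ * w ^ 2 * r))

lemma decay_zero (σ w : ℝ) : decay σ w 0 = 1 := by simp [decay]

lemma decay_pos (σ w r : ℝ) : 0 < decay σ w r := Real.exp_pos _

lemma decay_le_one {σ r : ℝ} (hσ : 0 ≤ σ) (hr : 0 ≤ r) (w : ℝ) : decay σ w r ≤ 1 := by
  rw [decay, Real.exp_le_one_iff, neg_nonpos]; positivity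

lemma abs_decay_le_one {σ : ℝ} (hσ : 0 < σ) (r w : ℝ) : |decay σ w (max r 0)| ≤ 1 := by
  rw [abs_of_pos (decay_pos _ _ _)]
  exact decay_le_one hσ.le (le_max_right _ _) w

lemma decay_anti {σ r w w' : ℝ} (hσ : 0 ≤ σ) (hr : 0 ≤ r) (hw : 0 ≤ w) (h : w ≤ w') :
    decay σ w' r ≤ decay σ w r := by
  unfold decay; gcongr

/-- The closed-loop evolution of the scalar equation on `(0, 1)`. -/
noncomputable def evol {σ : ℝ} (hσ : 0 < σ) (N : ℕ) (r : ℝ) (z : UnitL2) : UnitL2 :=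
  ∑ k ∈ Finset.range N, (coef N k z * decay σ (freq N k) r) • cosMode (freq N k) +
    -- The `max` only keeps the multipliers below one for every real `r`, as `diag` requires; the
    -- estimates use `r ≥ 0`.
    diag (fun k => decay σ (k * Real.pi) (max r 0)) (fun _ => abs_decay_le_one hσ r _)
      (z - lowPart N z)

/-- Finite sums of modes that approximate the closed-loop evolution. -/
noncomputable def modalSum (σ : ℝ) (N M : ℕ) (r : ℝ) (z : UnitL2) : UnitL2 :=
  ∑ k ∈ Finset.range M, (coef N k z * decay σ (freq N k) r) • cosMode (freq N k)

/-- Every `z` is the sum of its low part and the rest. This lets evolutions with different `N` be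
joined continuously. -/
lemma evol_zero {σ : ℝ} (hσ : 0 < σ) (N : ℕ) (z : UnitL2) : evol hσ N 0 z = z := by
  have h : diag (fun k => decay σ (k * Real.pi) (max 0 0)) (fun k => abs_decay_le_one hσ 0 _)
      (z - lowPart N z) = z - lowPart N z :=
    ext_cosBasis fun k => by rw [inner_cosBasis_diag]; simp [decay_zero]
  rw [evol, h]
  simp [decay_zero, ← lowPart_eq]

/-- The bound of the closed-loop evolution. -/
noncomputable def evolConst (N : ℕ) : ℝ := 1 + 2 * lowConst N

lemma one_le_evolConst (N : ℕ) : 1 ≤ evolConst N := by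
  have := lowConst_nonneg N
  unfold evolConst; linarith

/-- All frequencies present are at least `N π`. The constant `evolConst N` is the price of the moved
modes, which are not orthogonal to the others. -/
lemma norm_evol_le {σ : ℝ} (hσ : 0 < σ) {N : ℕ} (hN : 1 ≤ N) {r : ℝ} (hr : 0 ≤ r) (z : UnitL2) :
    ‖evol hσ N r z‖ ≤ evolConst N * decay σ (N * Real.pi) r * ‖z‖ := by
  have hpi := Real.pi_pos
  have h1 := norm_sum_coef_le hN z (θ := fun k => decay σ (freq N k) r)
    (B := decay σ (N * Real.pi) r) (fun k _ => by
      rw [abs_of_pos (decay_pos _ _ _)]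
      exact decay_anti hσ.le hr (by positivity) (le_freq N k))
  have h2 : ‖diag (fun k => decay σ (k * Real.pi) (max r 0)) (fun k => abs_decay_le_one hσ r _)
      (z - lowPart N z)‖ ≤ decay σ (N * Real.pi) r * ‖z - lowPart N z‖ := by
    refine norm_le_of_forall_abs_inner_le (decay_pos _ _ _).le fun k => ?_
    rw [inner_cosBasis_diag, abs_mul, max_eq_left hr, abs_of_pos (decay_pos _ _ _)]
    rcases lt_or_ge k N with hk | hk
    · rw [inner_cosBasis_sub_lowPart hk]; simp
    · have : (N : ℝ) ≤ k := by exact_mod_cast hk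
      exact mul_le_mul_of_nonneg_right (decay_anti hσ.le hr (by positivity) (by gcongr))
        (abs_nonneg _)
  have h3 := norm_sub_lowPart_le hN z
  calc _ ≤ _ := norm_add_le _ _
    _ ≤ decay σ (N * Real.pi) r * (lowConst N * ‖z‖) +
        decay σ (N * Real.pi) r * ((1 + lowConst N) * ‖z‖) :=
      add_le_add h1 (h2.trans (mul_le_mul_of_nonneg_left h3 (decay_pos _ _ _).le))
    _ = _ := by unfold evolConst; ring

/-- The low modes are summed exactly, and decay factors are at most one, so the error is dominated
by the Parseval tail of the initial remainder, uniformly in `r ≥ 0`. Continuity in time and all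
passages to the limit rest on this uniformity. -/
lemma exists_modalSum_error {σ : ℝ} (hσ : 0 < σ) {N : ℕ} (hN : 1 ≤ N) (z : UnitL2) :
    ∃ δ : ℕ → ℝ, Tendsto δ atTop (𝓝 0) ∧
      ∀ L r, 0 ≤ r → ‖evol hσ N r z - modalSum σ N (N + L) r z‖ ≤ δ L := by
  set z' := z - lowPart N z with hz'
  refine ⟨fun L => ‖z' - ∑ k ∈ Finset.range (N + L), inner ℝ (cosBasis k) z' • cosBasis k‖, ?_,
    fun L r hr => ?_⟩
  · have h := (cosBasis.hasSum_repr z').tendsto_sum_nat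
    simp only [cosBasis.repr_apply_apply] at h
    have h2 := (h.comp (tendsto_add_atTop_nat N)).const_sub z'
    rw [sub_self] at h2
    have h3 := h2.norm
    rw [norm_zero] at h3
    refine h3.congr fun L => ?_
    simp [Function.comp, add_comm]
  · have hsum : ∀ f : ℕ → UnitL2, ∑ k ∈ Finset.range (N + L), f k =
        ∑ k ∈ Finset.range N, f k + ∑ l ∈ Finset.range L, f (N + l) :=
      fun f => Finset.sum_range_add f N L
    have e1 : evol hσ N r z - modalSum σ N (N + L) r z =
        diag (fun k => decay σ (k * Real.pi) (max r 0)) (fun k => abs_decay_le_one hσ r _) z' -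
          ∑ k ∈ Finset.range (N + L),
            (decay σ (k * Real.pi) r * inner ℝ (cosBasis k) z') • cosBasis k := by
      rw [evol, modalSum, hsum, hsum, add_sub_add_left_eq_sub]
      congr 1
      rw [Finset.sum_eq_zero (s := Finset.range N), zero_add]
      · exact Finset.sum_congr rfl fun l _ => by
          rw [coef_smul_cosMode hN (by omega), freq_of_le (by omega)]
      · intro k hk
        rw [inner_cosBasis_sub_lowPart (Finset.mem_range.1 hk), mul_zero, zero_smul]
    rw [e1]
    beta_reduce
    rw [← one_mul ‖z' - ∑ k ∈ Finset.range (N + L), inner ℝ (cosBasis k) z' • cosBasis k‖]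
    have hin : ∀ (c : ℕ → ℝ) (k : ℕ),
        inner ℝ (cosBasis k) (∑ l ∈ Finset.range (N + L), c l • cosBasis l) =
          if k ∈ Finset.range (N + L) then c k else 0 := by
      intro c k
      simp only [inner_sum, inner_smul_right, orthonormal_iff_ite.1 cosBasis.orthonormal]
      simp
    refine norm_le_of_forall_abs_inner_le zero_le_one fun k => ?_
    rw [inner_sub_right, inner_sub_right, inner_cosBasis_diag, hin, hin, one_mul, max_eq_left hr]
    split_ifs
    · simp
    · rw [sub_zero, sub_zero, abs_mul]
      refine mul_le_of_le_one_left (abs_nonneg _) ?_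
      rw [abs_of_pos (decay_pos _ _ _)]
      exact decay_le_one hσ.le hr _

/-- The weight `2 N` on the low modes matches the bound for sums of sines in
`integral_sq_sum_sin_freq_le`; half of that bound is estimated here. -/
lemma sum_coef_sq_le {N : ℕ} (hN : 1 ≤ N) (L : ℕ) (z : UnitL2) :
    2 * N * ∑ k ∈ Finset.range N, coef N k z ^ 2 + ∑ l ∈ Finset.range L, coef N (N + l) z ^ 2 ≤
      4 * N * evolConst N ^ 2 * ‖z‖ ^ 2 := by
  have h1 : ∑ l ∈ Finset.range L, coef N (N + l) z ^ 2 ≤ 2 * ‖z - lowPart N z‖ ^ 2 := by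
    have h2 := (hasSum_sq_cosBasis (z - lowPart N z))
    have h3 := sum_le_hasSum ((Finset.range L).map (addLeftEmbedding N))
      (fun k _ => sq_nonneg _) h2
    rw [Finset.sum_map] at h3
    calc _ = 2 * ∑ l ∈ Finset.range L, inner ℝ (cosBasis (N + l)) (z - lowPart N z) ^ 2 := by
          rw [Finset.mul_sum]
          refine Finset.sum_congr rfl fun l _ => ?_
          rw [coef_of_le (by omega), mul_pow, Real.sq_sqrt (by norm_num)]
      _ ≤ _ := by gcongr; exact h3
  have h4 : ∑ k ∈ Finset.range N, coef N k z ^ 2 ≤ (lowConst N * ‖z‖) ^ 2 := by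
    refine le_trans ?_ (pow_le_pow_left₀ (Finset.sum_nonneg fun _ _ => abs_nonneg _)
      (sum_abs_coef_le hN z) 2)
    simp_rw [← sq_abs (coef N _ z)]
    exact Finset.sum_sq_le_sq_sum_of_nonneg fun _ _ => abs_nonneg _
  have h5 : ‖z - lowPart N z‖ ^ 2 ≤ ((1 + lowConst N) * ‖z‖) ^ 2 := by
    gcongr; exact norm_sub_lowPart_le hN z
  have hN' : (1 : ℝ) ≤ N := by exact_mod_cast hN
  have hlow := lowConst_nonneg N
  calc _ ≤ 2 * N * (lowConst N * ‖z‖) ^ 2 + 2 * N * ((1 + lowConst N) * ‖z‖) ^ 2 := by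
        have : 2 * ‖z - lowPart N z‖ ^ 2 ≤ 2 * N * ((1 + lowConst N) * ‖z‖) ^ 2 := by
          nlinarith [sq_nonneg ((1 + lowConst N) * ‖z‖)]
        gcongr
        exact h1.trans this
    _ = 2 * N * (lowConst N ^ 2 + (1 + lowConst N) ^ 2) * ‖z‖ ^ 2 := by ring
    _ ≤ 2 * N * (2 * evolConst N ^ 2) * ‖z‖ ^ 2 := by
        gcongr
        unfold evolConst; nlinarith
    _ = _ := by ring

lemma integral_sin_sin_of_ne {j k : ℕ} (h : j ≠ k) :
    ∫ y in (0 : ℝ)..1, Real.sin (j * Real.pi * y) * Real.sin (k * Real.pi * y) = 0 := by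
  set a := (j : ℝ) * Real.pi
  set b := (k : ℝ) * Real.pi
  have hne : a ^ 2 - b ^ 2 ≠ 0 := by
    intro h2
    rw [sub_eq_zero, sq_eq_sq₀ (by positivity) (by positivity)] at h2
    exact h (by exact_mod_cast (mul_right_cancel₀ Real.pi_ne_zero h2))
  have hd : ∀ y ∈ uIcc (0 : ℝ) 1, HasDerivAt (fun y =>
      (b * (Real.sin (a * y) * Real.cos (b * y)) - a * (Real.cos (a * y) * Real.sin (b * y))) /
        (a ^ 2 - b ^ 2)) (Real.sin (a * y) * Real.sin (b * y)) y := by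
    intro y _
    have ha : HasDerivAt (fun y => a * y) a y := by simpa using (hasDerivAt_id y).const_mul a
    have hb : HasDerivAt (fun y => b * y) b y := by simpa using (hasDerivAt_id y).const_mul b
    refine ((((ha.sin.mul hb.cos).const_mul b).sub ((ha.cos.mul hb.sin).const_mul a)).div_const
      (a ^ 2 - b ^ 2)).congr_deriv ?_
    field_simp
    ring
  rw [intervalIntegral.integral_eq_sub_of_hasDerivAt hd
    (Continuous.intervalIntegrable (by fun_prop) _ _)]
  simp [a, b, Real.sin_nat_mul_pi]

lemma integral_sin_sq_le_one (w : ℝ) : ∫ y in (0 : ℝ)..1, Real.sin (w * y) ^ 2 ≤ 1 := by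
  have := intervalIntegral.integral_mono_on (a := (0 : ℝ)) (b := 1) (μ := volume) zero_le_one
    (f := fun y => Real.sin (w * y) ^ 2) (g := fun _ => 1)
    (Continuous.intervalIntegrable (by fun_prop) _ _)
    (Continuous.intervalIntegrable (by fun_prop) _ _)
    (fun y _ => Real.sin_sq_le_one _)
  simpa using this

/-- Plain Cauchy-Schwarz, for the moved frequencies, where no orthogonality to the whole family is
at hand; the loss is the number of terms. -/
lemma integral_sq_sum_sin_le {ι : Type*} (s : Finset ι) (c w : ι → ℝ) :
    ∫ y in (0 : ℝ)..1, (∑ k ∈ s, c k * Real.sin (w k * y)) ^ 2 ≤ s.card * ∑ k ∈ s, c k ^ 2 := by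
  have hb : ∀ y ∈ Icc (0 : ℝ) 1, (∑ k ∈ s, c k * Real.sin (w k * y)) ^ 2 ≤
      s.card * ∑ k ∈ s, c k ^ 2 := by
    intro y _
    refine (sq_sum_le_card_mul_sum_sq).trans ?_
    refine mul_le_mul_of_nonneg_left (Finset.sum_le_sum fun k _ => ?_) (by positivity)
    rw [mul_pow]
    exact mul_le_of_le_one_right (sq_nonneg _) (Real.sin_sq_le_one _)
  have := intervalIntegral.integral_mono_on (a := (0 : ℝ)) (b := 1) (μ := volume) zero_le_one
    (f := fun y => (∑ k ∈ s, c k * Real.sin (w k * y)) ^ 2) (g := fun _ => s.card * ∑ k ∈ s, c k ^ 2)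
    (Continuous.intervalIntegrable (by fun_prop) _ _)
    (Continuous.intervalIntegrable (by fun_prop) _ _) hb
  simpa using this

lemma integral_sq_sum_sin_nat_le (s : Finset ℕ) (c : ℕ → ℝ) :
    ∫ y in (0 : ℝ)..1, (∑ k ∈ s, c k * Real.sin (k * Real.pi * y)) ^ 2 ≤ ∑ k ∈ s, c k ^ 2 := by
  have h : ∀ y : ℝ, (∑ k ∈ s, c k * Real.sin (k * Real.pi * y)) ^ 2 =
      ∑ j ∈ s, ∑ k ∈ s, c j * c k * (Real.sin (j * Real.pi * y) * Real.sin (k * Real.pi * y)) := by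
    intro y
    rw [sq, Finset.sum_mul_sum]
    exact Finset.sum_congr rfl fun j _ => Finset.sum_congr rfl fun k _ => by ring
  simp_rw [h]
  rw [intervalIntegral.integral_finsetSum
    (fun j _ => Continuous.intervalIntegrable (by fun_prop) _ _)]
  refine Finset.sum_le_sum fun j hj => ?_
  rw [intervalIntegral.integral_finsetSum
    (fun j _ => Continuous.intervalIntegrable (by fun_prop) _ _),
    Finset.sum_eq_single j]
  · rw [intervalIntegral.integral_const_mul, ← sq]
    simp_rw [← sq]
    exact mul_le_of_le_one_right (sq_nonneg _) (integral_sin_sq_le_one _)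
  · intro k _ hk
    rw [intervalIntegral.integral_const_mul, integral_sin_sin_of_ne hk.symm, mul_zero]
  · exact fun h => absurd hj h

/-- Cauchy-Schwarz on the moved modes, orthogonality of the sines on the others. The sines arise as
derivatives of the cosine modes. -/
lemma integral_sq_sum_sin_freq_le (N L : ℕ) (c : ℕ → ℝ) :
    ∫ y in (0 : ℝ)..1, (∑ k ∈ Finset.range (N + L), c k * Real.sin (freq N k * y)) ^ 2 ≤
      2 * N * ∑ k ∈ Finset.range N, c k ^ 2 + 2 * ∑ l ∈ Finset.range L, c (N + l) ^ 2 := by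
  have h1 := integral_sq_sum_sin_le (Finset.range N) c (freq N)
  have h2 := integral_sq_sum_sin_nat_le ((Finset.range L).map (addLeftEmbedding N)) c
  simp only [Finset.sum_map, addLeftEmbedding_apply, Finset.card_range] at h1 h2
  have h3 : ∀ y : ℝ, ∑ k ∈ Finset.range (N + L), c k * Real.sin (freq N k * y) =
      ∑ k ∈ Finset.range N, c k * Real.sin (freq N k * y) +
        ∑ l ∈ Finset.range L, c (N + l) * Real.sin ((N + l : ℕ) * Real.pi * y) := by
    intro y
    rw [Finset.sum_range_add]
    congr 1
    exact Finset.sum_congr rfl fun l _ => by rw [freq_of_le (Nat.le_add_right _ _)]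
  have h4 := intervalIntegral.integral_mono_on (a := (0 : ℝ)) (b := 1) (μ := volume) zero_le_one
    (f := fun y => (∑ k ∈ Finset.range (N + L), c k * Real.sin (freq N k * y)) ^ 2)
    (g := fun y => 2 * (∑ k ∈ Finset.range N, c k * Real.sin (freq N k * y)) ^ 2 +
      2 * (∑ l ∈ Finset.range L, c (N + l) * Real.sin ((N + l : ℕ) * Real.pi * y)) ^ 2)
    (Continuous.intervalIntegrable (by fun_prop) _ _)
    (Continuous.intervalIntegrable (by fun_prop) _ _)
    (fun y _ => by rw [h3]; exact add_sq_le.trans (by rw [mul_add]))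
  refine h4.trans ?_
  rw [intervalIntegral.integral_add (Continuous.intervalIntegrable (by fun_prop) _ _)
    (Continuous.intervalIntegrable (by fun_prop) _ _), intervalIntegral.integral_const_mul,
    intervalIntegral.integral_const_mul]
  linarith

end CrossDiffusion

namespace CrossDiffusion

/-! ### Multiplication operators on `L²(0, 1)` -/

/-- The Hilbert space `L²(0, 1)ⁿ`. -/
abbrev UnitVecL2 (n : ℕ) : Type := Lp (Vec n) 2 unitMeasure

lemma exists_unit_bound (g : C(ℝ, ℝ)) : ∃ B : ℝ, 0 ≤ B ∧ ∀ᵐ y ∂unitMeasure, |g y| ≤ B := by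
  obtain ⟨B, hB⟩ := (isCompact_Icc (a := (0 : ℝ)) (b := 1)).exists_bound_of_continuousOn
    g.continuous.continuousOn
  refine ⟨max B 0, le_max_right _ _, ?_⟩
  filter_upwards [ae_restrict_mem measurableSet_Ioo] with y hy
  exact (hB y (Ioo_subset_Icc_self hy)).trans (le_max_left _ _)

section Multiplication

variable {n : ℕ}

lemma memLp_mulLift (g : C(ℝ, ℝ)) (p : Vec n) (f : UnitL2) :
    MemLp (fun y => (g y * f y) • p) 2 unitMeasure := by
  obtain ⟨B, hB, hg⟩ := exists_unit_bound g
  refine MemLp.of_le_mul (c := B * ‖p‖) (Lp.memLp f) ?_ ?_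
  · exact (g.continuous.aestronglyMeasurable.mul (Lp.aestronglyMeasurable f)).smul_const p
  · filter_upwards [hg] with y hy
    rw [norm_smul, norm_mul, Real.norm_eq_abs (g y)]
    calc |g y| * ‖f y‖ * ‖p‖ ≤ B * ‖f y‖ * ‖p‖ := by gcongr
      _ = _ := by ring

lemma memLp_proj (g : C(ℝ, ℝ)) (q : Vec n) (F : UnitVecL2 n) :
    MemLp (fun y => g y * inner ℝ q (F y)) 2 unitMeasure := by
  obtain ⟨B, hB, hg⟩ := exists_unit_bound g
  refine MemLp.of_le_mul (c := B * ‖q‖) (Lp.memLp F) ?_ ?_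
  · exact g.continuous.aestronglyMeasurable.mul
      ((Lp.aestronglyMeasurable F).const_inner)
  · filter_upwards [hg] with y hy
    rw [norm_mul, Real.norm_eq_abs (g y), mul_assoc]
    gcongr
    exact norm_inner_le_norm _ _

/-- The operator `f ↦ g f p` from `L²(0, 1)` to `L²(0, 1)ⁿ`. -/
noncomputable def mulLift (g : C(ℝ, ℝ)) (p : Vec n) : UnitL2 →L[ℝ] UnitVecL2 n :=
  LinearMap.mkContinuousOfExistsBound
    { toFun := fun f => (memLp_mulLift g p f).toLp _
      map_add' := fun f₁ f₂ => by
        rw [← MemLp.toLp_add, MemLp.toLp_eq_toLp_iff]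
        filter_upwards [Lp.coeFn_add f₁ f₂] with y hy
        simp only [hy, Pi.add_apply]
        module
      map_smul' := fun c f => by
        rw [RingHom.id_apply, ← MemLp.toLp_const_smul, MemLp.toLp_eq_toLp_iff]
        filter_upwards [Lp.coeFn_smul c f] with y hy
        simp only [hy, Pi.smul_apply, smul_eq_mul]
        module }
    (by
      obtain ⟨B, hB, hg⟩ := exists_unit_bound g
      refine ⟨B * ‖p‖, fun f => Lp.norm_le_mul_norm_of_ae_le_mul ?_⟩
      filter_upwards [hg, (memLp_mulLift g p f).coeFn_toLp] with y hy hf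
      simp only [LinearMap.coe_mk, AddHom.coe_mk]
      rw [hf, norm_smul, norm_mul, Real.norm_eq_abs (g y)]
      calc |g y| * ‖f y‖ * ‖p‖ ≤ B * ‖f y‖ * ‖p‖ := by gcongr
        _ = _ := by ring)

lemma coeFn_mulLift (g : C(ℝ, ℝ)) (p : Vec n) (f : UnitL2) :
    mulLift g p f =ᵐ[unitMeasure] fun y => (g y * f y) • p :=
  (memLp_mulLift g p f).coeFn_toLp

/-- The operator `F ↦ g ⟪q, F⟫` from `L²(0, 1)ⁿ` to `L²(0, 1)`. -/
noncomputable def proj (g : C(ℝ, ℝ)) (q : Vec n) : UnitVecL2 n →L[ℝ] UnitL2 :=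
  LinearMap.mkContinuousOfExistsBound
    { toFun := fun F => (memLp_proj g q F).toLp _
      map_add' := fun f₁ f₂ => by
        rw [← MemLp.toLp_add, MemLp.toLp_eq_toLp_iff]
        filter_upwards [Lp.coeFn_add f₁ f₂] with y hy
        simp only [hy, Pi.add_apply, inner_add_right]
        ring
      map_smul' := fun c f => by
        rw [RingHom.id_apply, ← MemLp.toLp_const_smul, MemLp.toLp_eq_toLp_iff]
        filter_upwards [Lp.coeFn_smul c f] with y hy
        simp only [hy, Pi.smul_apply, smul_eq_mul, inner_smul_right]
        ring }
    (by
      obtain ⟨B, hB, hg⟩ := exists_unit_bound g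
      refine ⟨B * ‖q‖, fun F => Lp.norm_le_mul_norm_of_ae_le_mul ?_⟩
      filter_upwards [hg, (memLp_proj g q F).coeFn_toLp] with y hy hf
      simp only [LinearMap.coe_mk, AddHom.coe_mk]
      rw [hf, norm_mul, Real.norm_eq_abs (g y), mul_assoc]
      gcongr
      exact norm_inner_le_norm _ _)

lemma coeFn_proj (g : C(ℝ, ℝ)) (q : Vec n) (F : UnitVecL2 n) :
    proj g q F =ᵐ[unitMeasure] fun y => g y * inner ℝ q (F y) :=
  (memLp_proj g q F).coeFn_toLp

lemma norm_mulLift_le {g : C(ℝ, ℝ)} {B : ℝ} (hB : 0 ≤ B) (hg : ∀ y ∈ Ioo (0 : ℝ) 1, |g y| ≤ B)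
    (p : Vec n) : ‖mulLift g p‖ ≤ B * ‖p‖ := by
  refine ContinuousLinearMap.opNorm_le_bound _ (by positivity) fun f => ?_
  refine Lp.norm_le_mul_norm_of_ae_le_mul ?_
  filter_upwards [ae_restrict_mem measurableSet_Ioo, coeFn_mulLift g p f] with y hy hf
  rw [hf, norm_smul, norm_mul, Real.norm_eq_abs (g y)]
  calc |g y| * ‖f y‖ * ‖p‖ ≤ B * ‖f y‖ * ‖p‖ := by gcongr; exact hg y hy
    _ = _ := by ring

lemma norm_proj_le {g : C(ℝ, ℝ)} {B : ℝ} (hB : 0 ≤ B) (hg : ∀ y ∈ Ioo (0 : ℝ) 1, |g y| ≤ B)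
    (q : Vec n) : ‖proj g q‖ ≤ B * ‖q‖ := by
  refine ContinuousLinearMap.opNorm_le_bound _ (by positivity) fun F => ?_
  refine Lp.norm_le_mul_norm_of_ae_le_mul ?_
  filter_upwards [ae_restrict_mem measurableSet_Ioo, coeFn_proj g q F] with y hy hf
  rw [hf, norm_mul, Real.norm_eq_abs (g y), mul_assoc]
  gcongr
  · exact hg y hy
  · exact norm_inner_le_norm _ _

lemma mulLift_sub (g g' : C(ℝ, ℝ)) (p : Vec n) : mulLift g p - mulLift g' p = mulLift (g - g') p := by
  ext1 f
  refine Lp.ext ?_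
  rw [sub_apply]
  filter_upwards [Lp.coeFn_sub (mulLift g p f) (mulLift g' p f), coeFn_mulLift g p f,
    coeFn_mulLift g' p f, coeFn_mulLift (g - g') p f] with y h1 h2 h3 h4
  rw [h1, Pi.sub_apply, h2, h3, h4, ContinuousMap.sub_apply]
  module

lemma coeFn_finset_sum {ι : Type*} {E : Type*} [NormedAddCommGroup E] {μ : Measure ℝ}
    (s : Finset ι) (F : ι → Lp E 2 μ) :
    (∑ i ∈ s, F i : Lp E 2 μ) =ᵐ[μ] fun y => ∑ i ∈ s, F i y := by
  classical
  induction s using Finset.induction_on with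
  | empty =>
    simp only [Finset.sum_empty]
    exact Lp.coeFn_zero _ _ _
  | insert a s ha ih =>
    rw [Finset.sum_insert ha]
    filter_upwards [Lp.coeFn_add (F a) (∑ i ∈ s, F i), ih] with y h1 h2
    rw [h1, Pi.add_apply, h2, Finset.sum_insert ha]

lemma inner_proj (g : C(ℝ, ℝ)) (q : Vec n) (f : UnitL2) (F : UnitVecL2 n) :
    inner ℝ f (proj g q F) = inner ℝ (mulLift g q f) F := by
  rw [L2.inner_def, L2.inner_def]
  refine integral_congr_ae ?_
  filter_upwards [coeFn_proj g q F, coeFn_mulLift g q f] with y h1 h2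
  rw [h1, h2, inner_smul_left]
  simp only [conj_trivial, RCLike.inner_apply]
  ring

variable {g g' : Fin n → C(ℝ, ℝ)} {p q : Fin n → Vec n}

lemma proj_sum_mulLift (hg : ∀ i y, g' i y * g i y = 1)
    (hpq : ∀ i j, inner ℝ (q i) (p j) = if i = j then (1 : ℝ) else 0) (z : Fin n → UnitL2)
    (i : Fin n) : proj (g' i) (q i) (∑ j, mulLift (g j) (p j) (z j)) = z i := by
  refine Lp.ext ?_
  filter_upwards [coeFn_proj (g' i) (q i) (∑ j, mulLift (g j) (p j) (z j)),
    coeFn_finset_sum Finset.univ fun j => mulLift (g j) (p j) (z j),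
    ae_all_iff.2 fun j => coeFn_mulLift (g j) (p j) (z j)] with y h1 h2 h3
  rw [h1, h2]
  simp only [h3, inner_sum, inner_smul_right, hpq]
  simp [← mul_assoc, hg]

lemma sum_mulLift_proj (hg : ∀ i y, g' i y * g i y = 1)
    (hpq : ∀ z : Vec n, z = ∑ i, inner ℝ (q i) z • p i) (F : UnitVecL2 n) :
    ∑ j, mulLift (g j) (p j) (proj (g' j) (q j) F) = F := by
  refine Lp.ext ?_
  filter_upwards [ae_all_iff.2 fun j => coeFn_proj (g' j) (q j) F,
    coeFn_finset_sum Finset.univ fun j => mulLift (g j) (p j) (proj (g' j) (q j) F),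
    ae_all_iff.2 fun j => coeFn_mulLift (g j) (p j) (proj (g' j) (q j) F)] with y h1 h2 h3
  rw [h2]
  conv_rhs => rw [hpq (F y)]
  refine Finset.sum_congr rfl fun j _ => ?_
  rw [h3, h1, ← mul_assoc, mul_comm (g j y), hg, one_mul]

end Multiplication

/-! ### The moving domain -/

namespace TargetState

variable {n : ℕ} (Z : TargetState n)

lemma speed_pos : 0 < Z.speed := Z.flux_sum_pos

lemma thickness_pos {t : ℝ} (ht : 0 ≤ t) : 0 < Z.thickness t := by
  have := mul_nonneg Z.speed_pos.le ht
  have := Z.initialThickness_pos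
  unfold thickness; linarith

lemma thickness_mono {s t : ℝ} (h : s ≤ t) : Z.thickness s ≤ Z.thickness t := by
  have := mul_le_mul_of_nonneg_left h Z.speed_pos.le
  unfold thickness; linarith

lemma hasDerivAt_thickness (t : ℝ) : HasDerivAt Z.thickness Z.speed t := by
  unfold thickness
  simpa using ((hasDerivAt_id t).const_mul Z.speed).const_add Z.initialThickness

@[fun_prop]
lemma continuous_thickness : Continuous Z.thickness := by unfold thickness; fun_prop

lemma map_mul_unitMeasure {t : ℝ} (ht : 0 < Z.thickness t) :
    Measure.map (fun y => y * Z.thickness t) unitMeasure =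
      ENNReal.ofReal (Z.thickness t)⁻¹ • Z.slice t := by
  have h := Measure.restrict_map (μ := volume) (f := fun y : ℝ => y * Z.thickness t)
    (by fun_prop) (s := Ioo 0 (Z.thickness t)) measurableSet_Ioo
  have hp : (fun y : ℝ => y * Z.thickness t) ⁻¹' Ioo 0 (Z.thickness t) = Ioo 0 1 := by
    ext y
    simp only [mem_preimage, mem_Ioo, mul_pos_iff_of_pos_right ht]
    rw [mul_lt_iff_lt_one_left ht]
  rw [hp, Real.map_volume_mul_right ht.ne', Measure.restrict_smul,
    abs_of_pos (inv_pos.2 ht)] at h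
  exact h.symm

lemma map_div_slice {t : ℝ} (ht : 0 < Z.thickness t) :
    Measure.map (fun x => x / Z.thickness t) (Z.slice t) =
      ENNReal.ofReal (Z.thickness t) • unitMeasure := by
  have h := Measure.restrict_map (μ := volume) (f := fun y : ℝ => y * (Z.thickness t)⁻¹)
    (by fun_prop) (s := Ioo 0 1) measurableSet_Ioo
  have hp : (fun y : ℝ => y * (Z.thickness t)⁻¹) ⁻¹' Ioo 0 1 = Ioo 0 (Z.thickness t) := by
    ext y
    simp only [mem_preimage, mem_Ioo, mul_pos_iff_of_pos_right (inv_pos.2 ht)]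
    rw [← div_eq_mul_inv, div_lt_one ht]
  rw [hp, Real.map_volume_mul_right (inv_ne_zero ht.ne'), Measure.restrict_smul, inv_inv,
    abs_of_pos ht] at h
  simp only [div_eq_mul_inv]
  exact h.symm

lemma integral_slice {E : Type*} [NormedAddCommGroup E] [NormedSpace ℝ E] {t : ℝ}
    (ht : 0 < Z.thickness t) (f : ℝ → E) :
    ∫ x, f x ∂Z.slice t = Z.thickness t • ∫ y in Ioo (0 : ℝ) 1, f (y * Z.thickness t) := by
  have h := (measurableEmbedding_mulRight₀ ht.ne').integral_map (μ := unitMeasure) f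
  rw [Z.map_mul_unitMeasure ht, integral_smul_measure,
    ENNReal.toReal_ofReal (inv_nonneg.2 ht.le)] at h
  rw [← h, smul_smul, mul_inv_cancel₀ ht.ne', one_smul]

variable {Z} in
lemma memLp_comp_mul {E : Type*} [NormedAddCommGroup E] {t : ℝ} (ht : 0 < Z.thickness t)
    {f : ℝ → E} (hf : MemLp f 2 (Z.slice t)) :
    MemLp (fun y => f (y * Z.thickness t)) 2 unitMeasure := by
  refine MemLp.comp_of_map (f := fun y : ℝ => y * Z.thickness t) (g := f) ?_ (by fun_prop)
  rw [Z.map_mul_unitMeasure ht]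
  exact hf.smul_measure ENNReal.ofReal_ne_top

variable {Z} in
lemma memLp_comp_div {E : Type*} [NormedAddCommGroup E] {t : ℝ} (ht : 0 < Z.thickness t)
    {f : ℝ → E} (hf : MemLp f 2 unitMeasure) :
    MemLp (fun x => f (x / Z.thickness t)) 2 (Z.slice t) := by
  refine MemLp.comp_of_map (f := fun x : ℝ => x / Z.thickness t) (g := f) ?_ (by fun_prop)
  rw [Z.map_div_slice ht]
  exact hf.smul_measure ENNReal.ofReal_ne_top

lemma quasiMeasurePreserving_mul {t : ℝ} (ht : 0 < Z.thickness t) :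
    Measure.QuasiMeasurePreserving (fun y => y * Z.thickness t) unitMeasure (Z.slice t) := by
  refine ⟨by fun_prop, ?_⟩
  rw [Z.map_mul_unitMeasure ht]
  exact Measure.smul_absolutelyContinuous

lemma quasiMeasurePreserving_div {t : ℝ} (ht : 0 < Z.thickness t) :
    Measure.QuasiMeasurePreserving (fun x => x / Z.thickness t) (Z.slice t) unitMeasure := by
  refine ⟨by fun_prop, ?_⟩
  rw [Z.map_div_slice ht]
  exact Measure.smul_absolutelyContinuous

end TargetState

lemma toL2_eq {n : ℕ} {μ : Measure ℝ} {f : ℝ → Vec n} (hf : MemLp f 2 μ) :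
    toL2 μ f = hf.toLp f := dif_pos hf

lemma coeFn_toL2 {n : ℕ} {μ : Measure ℝ} {f : ℝ → Vec n} (hf : MemLp f 2 μ) :
    toL2 μ f =ᵐ[μ] f := by
  rw [toL2_eq hf]; exact hf.coeFn_toLp

namespace TargetState

variable {n : ℕ} (Z : TargetState n)

/-- Rescaling of functions on `(0, 1)` to functions on `(0, ē(t))`. -/
noncomputable def dilate (t : ℝ) (F : UnitVecL2 n) : Z.L2 t :=
  toL2 (Z.slice t) fun x => F (x / Z.thickness t)

/-- Rescaling of functions on `(0, ē(t))` to functions on `(0, 1)`. -/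
noncomputable def contract (t : ℝ) (u : Z.L2 t) : UnitVecL2 n :=
  toL2 unitMeasure fun y => u (y * Z.thickness t)

lemma coeFn_dilate {t : ℝ} (ht : 0 < Z.thickness t) (F : UnitVecL2 n) :
    Z.dilate t F =ᵐ[Z.slice t] fun x => F (x / Z.thickness t) :=
  coeFn_toL2 (memLp_comp_div ht (Lp.memLp F))

lemma coeFn_contract {t : ℝ} (ht : 0 < Z.thickness t) (u : Z.L2 t) :
    Z.contract t u =ᵐ[unitMeasure] fun y => u (y * Z.thickness t) :=
  coeFn_toL2 (memLp_comp_mul ht (Lp.memLp u))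

lemma contract_dilate {t : ℝ} (ht : 0 < Z.thickness t) (F : UnitVecL2 n) :
    Z.contract t (Z.dilate t F) = F := by
  refine Lp.ext ?_
  filter_upwards [Z.coeFn_contract ht (Z.dilate t F),
    (Z.quasiMeasurePreserving_mul ht).ae (Z.coeFn_dilate ht F)] with y h1 h2
  rw [h1, h2, mul_div_cancel_right₀ _ ht.ne']

lemma dilate_contract {t : ℝ} (ht : 0 < Z.thickness t) (u : Z.L2 t) :
    Z.dilate t (Z.contract t u) = u := by
  refine Lp.ext ?_
  filter_upwards [Z.coeFn_dilate ht (Z.contract t u),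
    (Z.quasiMeasurePreserving_div ht).ae (Z.coeFn_contract ht u)] with y h1 h2
  rw [h1, h2, div_mul_cancel₀ _ ht.ne']

lemma inner_eq_contract {t : ℝ} (ht : 0 < Z.thickness t) (u v : Z.L2 t) :
    inner ℝ u v = Z.thickness t * inner ℝ (Z.contract t u) (Z.contract t v) := by
  rw [L2.inner_def, L2.inner_def, Z.integral_slice ht, smul_eq_mul]
  congr 1
  refine integral_congr_ae ?_
  filter_upwards [Z.coeFn_contract ht u, Z.coeFn_contract ht v] with y h1 h2
  rw [h1, h2]

lemma norm_eq_contract {t : ℝ} (ht : 0 < Z.thickness t) (u : Z.L2 t) :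
    ‖u‖ = √(Z.thickness t) * ‖Z.contract t u‖ := by
  rw [← sq_eq_sq₀ (norm_nonneg _) (by positivity), mul_pow, Real.sq_sqrt ht.le,
    ← real_inner_self_eq_norm_sq, ← real_inner_self_eq_norm_sq, Z.inner_eq_contract ht]

lemma contract_add {t : ℝ} (ht : 0 < Z.thickness t) (u v : Z.L2 t) :
    Z.contract t (u + v) = Z.contract t u + Z.contract t v := by
  refine Lp.ext ?_
  filter_upwards [Z.coeFn_contract ht (u + v), Z.coeFn_contract ht u, Z.coeFn_contract ht v,
    (Z.quasiMeasurePreserving_mul ht).ae (Lp.coeFn_add u v),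
    Lp.coeFn_add (Z.contract t u) (Z.contract t v)] with y h1 h2 h3 h4 h5
  rw [h1, h4, h5, Pi.add_apply, Pi.add_apply, h2, h3]

lemma contract_smul {t : ℝ} (ht : 0 < Z.thickness t) (c : ℝ) (u : Z.L2 t) :
    Z.contract t (c • u) = c • Z.contract t u := by
  refine Lp.ext ?_
  filter_upwards [Z.coeFn_contract ht (c • u), Z.coeFn_contract ht u,
    (Z.quasiMeasurePreserving_mul ht).ae (Lp.coeFn_smul c u),
    Lp.coeFn_smul c (Z.contract t u)] with y h1 h2 h4 h5
  rw [h1, h4, h5, Pi.smul_apply, Pi.smul_apply, h2]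

/-- Rescaling to `(0, 1)` as a continuous linear map. -/
noncomputable def contractL {t : ℝ} (ht : 0 < Z.thickness t) : Z.L2 t →L[ℝ] UnitVecL2 n :=
  LinearMap.mkContinuous
    { toFun := Z.contract t
      map_add' := Z.contract_add ht
      map_smul' := Z.contract_smul ht } (√(Z.thickness t))⁻¹ fun u => by
    rw [Z.norm_eq_contract ht, ← mul_assoc, inv_mul_cancel₀ (Real.sqrt_pos.2 ht).ne', one_mul]
    rfl

lemma contract_toL2 {t : ℝ} (ht : 0 < Z.thickness t) {f : ℝ → Vec n} (hf : MemLp f 2 (Z.slice t)) :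
    Z.contract t (toL2 (Z.slice t) f) = toL2 unitMeasure fun y => f (y * Z.thickness t) := by
  refine Lp.ext ?_
  filter_upwards [Z.coeFn_contract ht (toL2 (Z.slice t) f), coeFn_toL2 (memLp_comp_mul ht hf),
    (Z.quasiMeasurePreserving_mul ht).ae (coeFn_toL2 hf)] with y h1 h2 h3
  rw [h1, h2, h3]

lemma contract_injective {t : ℝ} (ht : 0 < Z.thickness t) : Function.Injective (Z.contract t) :=
  fun u v h => by rw [← Z.dilate_contract ht u, h, Z.dilate_contract ht]

lemma contract_zero {t : ℝ} (ht : 0 < Z.thickness t) : Z.contract t 0 = 0 :=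
  (Z.contractL ht).map_zero

end TargetState

end CrossDiffusion

namespace CrossDiffusion

/-! ### Integration by parts for primitives -/

lemma absolutelyContinuousOnInterval_primitive {c a L : ℝ} {f' : ℝ → ℝ}
    (hf' : IntervalIntegrable f' volume a L) :
    AbsolutelyContinuousOnInterval (fun x => c + ∫ y in a..x, f' y) a L ∧
      ∀ᵐ x, x ∈ uIcc a L → deriv (fun x => c + ∫ y in a..x, f' y) x = f' x := by
  constructor
  · have h1 := hf'.absolutelyContinuousOnInterval_intervalIntegral (c := a) (by simp)
    have h2 : AbsolutelyContinuousOnInterval (fun _ : ℝ => c) a L :=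
      (LipschitzOnWith.absolutelyContinuousOnInterval (K := 0) (LipschitzWith.const c).lipschitzOnWith)
    exact h2.fun_add h1
  · filter_upwards [hf'.ae_hasDerivAt_integral] with x hx hxL
    exact ((hx hxL a (by simp)).const_add c).deriv

/-- Integration by parts against a function that is merely the primitive of an integrable one, the
regularity that test functions have on almost every slice. -/
lemma integral_mul_primitive {a L : ℝ} (hL : a ≤ L) {ψ ψ' f f' : ℝ → ℝ}
    (hψ : ∀ x ∈ Icc a L, HasDerivAt ψ (ψ' x) x) (hψ' : ContinuousOn ψ' (Icc a L))
    (hf' : IntervalIntegrable f' volume a L)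
    (hf : ∀ x ∈ Icc a L, f x = f a + ∫ y in a..x, f' y) :
    ∫ x in a..L, (ψ' x * f x + ψ x * f' x) = ψ L * f L - ψ a * f a := by
  have hψi : IntervalIntegrable ψ' volume a L :=
    ContinuousOn.intervalIntegrable (by rwa [uIcc_of_le hL])
  have hψe : ∀ x ∈ Icc a L, ψ x = ψ a + ∫ y in a..x, ψ' y := by
    intro x hx
    rw [intervalIntegral.integral_eq_sub_of_hasDerivAt (f := ψ)]
    · ring
    · intro y hy
      rw [uIcc_of_le hx.1] at hy
      exact hψ y ⟨hy.1, hy.2.trans hx.2⟩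
    · refine ContinuousOn.intervalIntegrable (hψ'.mono ?_)
      rw [uIcc_of_le hx.1]
      exact Icc_subset_Icc_right hx.2
  obtain ⟨h1, h1'⟩ := absolutelyContinuousOnInterval_primitive (c := ψ a) hψi
  obtain ⟨h2, h2'⟩ := absolutelyContinuousOnInterval_primitive (c := f a) hf'
  have key := h1.integral_deriv_mul_eq_sub h2
  rw [← hψe L (right_mem_Icc.2 hL), ← hf L (right_mem_Icc.2 hL)] at key
  simp only [intervalIntegral.integral_same, add_zero] at key
  rw [← key]
  refine intervalIntegral.integral_congr_ae ?_
  filter_upwards [h1', h2'] with x hx1 hx2 hx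
  have hx' := uIoc_subset_uIcc hx
  have hx'' : x ∈ Icc a L := by rwa [uIcc_of_le hL] at hx'
  rw [hx1 hx', hx2 hx', ← hψe x hx'', ← hf x hx'']

/-- The lemma of du Bois-Reymond: a test function of mean zero is the derivative of a test function,
so `k` integrates every test function like a constant. -/
lemma eqOn_const_of_weak_deriv_eq_zero {a S : ℝ} (haS : a < S) {k : ℝ → ℝ}
    (hk : ContinuousOn k (Icc a S))
    (h : ∀ η : ℝ → ℝ, ContDiff ℝ ∞ η → HasCompactSupport η → tsupport η ⊆ Ioo a S →
      ∫ t in Ioo a S, deriv η t * k t = 0) {c : ℝ} (hc : c ∈ Icc a S) : k c = k a := by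
  let B : ContDiffBump ((a + S) / 2) := ⟨(S - a) / 8, (S - a) / 4, by linarith, by linarith⟩
  set ρ : ℝ → ℝ := B.normed volume with hρ
  have hρs : ContDiff ℝ ∞ ρ := B.contDiff_normed
  have hρc : HasCompactSupport ρ := B.hasCompactSupport_normed
  have hρt : tsupport ρ ⊆ Ioo a S := by
    rw [hρ, B.tsupport_normed_eq]
    intro x hx
    rw [Metric.mem_closedBall, Real.dist_eq] at hx
    have := abs_le.1 hx
    simp only [B] at this
    constructor <;> linarith
  have hρ1 : ∫ t, ρ t = 1 := B.integral_normed
  have hint : ∀ ψ : ℝ → ℝ, Continuous ψ → IntegrableOn (fun t => ψ t * k t) (Ioo a S) :=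
    fun ψ hψ => ((hψ.continuousOn.mul hk).integrableOn_Icc).mono_set Ioo_subset_Icc_self
  have hoo : ∀ ψ : ℝ → ℝ, tsupport ψ ⊆ Ioo a S → ∫ t in Ioo a S, ψ t = ∫ t, ψ t := fun ψ hψ =>
    setIntegral_eq_integral_of_forall_compl_eq_zero fun x hx =>
      image_eq_zero_of_notMem_tsupport fun h => hx (hψ h)
  set C := ∫ t in Ioo a S, ρ t * k t with hC
  have hz : ∀ ψ : ℝ → ℝ, ContDiff ℝ ∞ ψ → HasCompactSupport ψ → tsupport ψ ⊆ Ioo a S →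
      ∫ t in Ioo a S, ψ t * k t = (∫ t, ψ t) * C := by
    intro ψ hψ hψc hψt
    set I := ∫ t, ψ t with hI
    -- Subtracting a multiple of a bump of integral one makes the mean zero, so that the primitive
    -- has compact support in `(a, S)`.
    set χ : ℝ → ℝ := fun t => ψ t - I * ρ t with hχ
    have hχs : ContDiff ℝ ∞ χ := hψ.sub (contDiff_const.mul hρs)
    have hψi := hψ.continuous.integrable_of_hasCompactSupport hψc (μ := volume)
    have hρi := hρs.continuous.integrable_of_hasCompactSupport hρc (μ := volume)
    have hχi : Integrable χ := hψi.sub (hρi.const_mul I)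
    have hχ0 : ∫ t, χ t = 0 := by
      rw [hχ, integral_sub hψi (hρi.const_mul I), integral_const_mul, hρ1]; ring
    set K := tsupport ψ ∪ tsupport ρ with hK
    have hKc : IsCompact K := IsCompact.union hψc hρc
    have hKt : K ⊆ Ioo a S := union_subset hψt hρt
    have hKn : K.Nonempty := by
      refine Nonempty.inr ?_
      rw [hρ, B.tsupport_normed_eq]
      exact ⟨_, Metric.mem_closedBall_self B.rOut_pos.le⟩
    have hα := hKt (hKc.sInf_mem hKn)
    have hβ := hKt (hKc.sSup_mem hKn)
    have hKI : ∀ t, t ∉ Icc (sInf K) (sSup K) → χ t = 0 := by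
      intro t ht
      have h1 : t ∉ K := fun h => ht ⟨csInf_le hKc.bddBelow h, le_csSup hKc.bddAbove h⟩
      simp only [hχ, image_eq_zero_of_notMem_tsupport (fun h => h1 (Or.inl h)),
        image_eq_zero_of_notMem_tsupport (fun h => h1 (Or.inr h))]
      simp
    set η : ℝ → ℝ := fun t => ∫ s in a..t, χ s with hη
    have hηd : ∀ t, HasDerivAt η (χ t) t := fun t =>
      hχs.continuous.integral_hasStrictDerivAt a t |>.hasDerivAt
    have hηd' : deriv η = χ := funext fun t => (hηd t).deriv
    have hηs : ContDiff ℝ ∞ η := by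
      rw [contDiff_infty_iff_deriv, hηd']
      exact ⟨fun t => (hηd t).differentiableAt, hχs⟩
    have hη0 : ∀ t, t ∉ Icc (sInf K) (sSup K) → η t = 0 := by
      intro t ht
      rcases lt_or_ge t (sInf K) with h1 | h1
      · refine (intervalIntegral.integral_congr (g := fun _ => 0) fun s hs => ?_).trans (by simp)
        refine hKI s fun h => ?_
        have := hs.2
        have h3 : max a t < sInf K := max_lt hα.1 h1
        exact absurd (h.1.trans this) (not_le.2 h3)
      · have h2 : sSup K < t := by
          by_contra h; exact ht ⟨h1, not_lt.1 h⟩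
        simp only [hη]
        rw [intervalIntegral.integral_of_le (by linarith [hα.1]), ← hχ0]
        refine setIntegral_eq_integral_of_forall_compl_eq_zero fun s hs => hKI s fun h => ?_
        exact hs ⟨hα.1.trans_le h.1, h.2.trans h2.le⟩
    have hηt : tsupport η ⊆ Icc (sInf K) (sSup K) :=
      closure_minimal (fun t ht => by_contra fun h => ht (hη0 t h)) isClosed_Icc
    have key := h η hηs (HasCompactSupport.of_support_subset_isCompact isCompact_Icc
      ((subset_tsupport _).trans hηt)) (hηt.trans fun t ht => ⟨hα.1.trans_le ht.1, ht.2.trans_lt hβ.2⟩)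
    rw [hηd'] at key
    have h1 : ∫ t in Ioo a S, χ t * k t = (∫ t in Ioo a S, ψ t * k t) - I * C := by
      rw [hC, ← integral_const_mul, ← integral_sub (hint ψ hψ.continuous)
        ((hint ρ hρs.continuous).const_mul I)]
      refine integral_congr_ae (ae_of_all _ fun t => ?_)
      simp only [hχ]; ring
    rw [key] at h1
    linarith
  have hae : ∀ᵐ t, t ∈ Ioo a S → k t - C = 0 := by
    refine isOpen_Ioo.ae_eq_zero_of_integral_contDiff_smul_eq_zero
      (((hk.sub continuousOn_const).mono Ioo_subset_Icc_self).locallyIntegrableOn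
        measurableSet_Ioo) fun ψ hψ hψc hψt => ?_
    have h1 : (fun t => ψ t • (k t - C)) = fun t => (Ioo a S).indicator (fun t => ψ t * k t - C * ψ t) t := by
      funext t
      by_cases ht : t ∈ Ioo a S
      · simp only [indicator_of_mem ht, smul_eq_mul]; ring
      · simp [indicator_of_notMem ht, image_eq_zero_of_notMem_tsupport fun h => ht (hψt h)]
    rw [h1, integral_indicator measurableSet_Ioo, integral_sub (hint ψ hψ.continuous)
      ((hψ.continuous.integrable_of_hasCompactSupport hψc).integrableOn.const_mul C),
      integral_const_mul, hoo ψ hψt, hz ψ hψ hψc hψt]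
    ring
  have hEq : EqOn k (fun _ => C) (Icc a S) := by
    refine Measure.eqOn_Icc_of_ae_eq volume haS.ne ?_ hk continuousOn_const
    rw [Filter.EventuallyEq, ← restrict_Ioo_eq_restrict_Icc, ae_restrict_iff' measurableSet_Ioo]
    filter_upwards [hae] with t ht h
    linarith [ht h]
  rw [hEq hc, hEq (left_mem_Icc.2 haS.le)]

/-- A continuous function with an integrable weak derivative is a primitive of it. -/
lemma sub_eq_integral_of_weak_deriv {a S : ℝ} {g G : ℝ → ℝ} (hg : ContinuousOn g (Icc a S))
    (hG : IntegrableOn G (Ioo a S))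
    (h : ∀ η : ℝ → ℝ, ContDiff ℝ ∞ η → HasCompactSupport η → tsupport η ⊆ Ioo a S →
      ∫ t in Ioo a S, (deriv η t * g t + η t * G t) = 0)
    {c d : ℝ} (hc : a ≤ c) (hcd : c ≤ d) (hd : d ≤ S) : g d - g c = ∫ t in c..d, G t := by
  rcases hcd.eq_or_lt with rfl | hcd'
  · simp
  have haS : a < S := by linarith
  have hGi : IntervalIntegrable G volume a S := by
    rwa [intervalIntegrable_iff_integrableOn_Ioo_of_le haS.le]
  -- This difference has weak derivative zero, hence is constant on the closed interval.
  set k : ℝ → ℝ := fun t => g t - ∫ s in a..t, G s with hk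
  have hkc : ContinuousOn k (Icc a S) := by
    refine hg.sub ?_
    have := intervalIntegral.continuousOn_primitive_interval (a := a) (b := S) (f := G)
      (μ := volume) (by
        rw [uIcc_of_le haS.le, integrableOn_Icc_iff_integrableOn_Ioo]; exact hG)
    rwa [uIcc_of_le haS.le] at this
  have hkint : ∀ ψ : ℝ → ℝ, Continuous ψ → IntegrableOn (fun t => ψ t * k t) (Ioo a S) := by
    intro ψ hψ
    exact ((hψ.continuousOn.mul hkc).integrableOn_Icc).mono_set Ioo_subset_Icc_self
  have hweak : ∀ η : ℝ → ℝ, ContDiff ℝ ∞ η → HasCompactSupport η → tsupport η ⊆ Ioo a S →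
      ∫ t in Ioo a S, deriv η t * k t = 0 := by
    intro η hη hηc hηs
    have hηd : Continuous (deriv η) := hη.continuous_deriv (by simp)
    have hza : η a = 0 := image_eq_zero_of_notMem_tsupport fun h => (lt_irrefl a (hηs h).1)
    have hzS : η S = 0 := image_eq_zero_of_notMem_tsupport fun h => (lt_irrefl S (hηs h).2)
    have h1 := integral_mul_primitive haS.le (ψ := η) (ψ' := deriv η)
      (f := fun t => ∫ s in a..t, G s) (f' := G)
      (fun x _ => ((hη.differentiable (by simp)) x).hasDerivAt) hηd.continuousOn hGi
      (fun x _ => by simp)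
    rw [hza, hzS, zero_mul, zero_mul, sub_zero, intervalIntegral.integral_of_le haS.le,
      integral_Ioc_eq_integral_Ioo] at h1
    have h2 := h η hη hηc hηs
    have i1 : IntegrableOn (fun t => η t * G t) (Ioo a S) :=
      hG.bdd_mul hη.continuous.aestronglyMeasurable.restrict
        (ae_of_all _ (hηc.exists_bound_of_continuous hη.continuous).choose_spec)
    have i2 : IntegrableOn (fun t => deriv η t * ∫ s in a..t, G s) (Ioo a S) := by
      refine IntegrableOn.congr_fun (((hηd.continuousOn.mul hg).integrableOn_Icc.mono_set
        Ioo_subset_Icc_self).sub (hkint _ hηd)) (fun t _ => ?_) measurableSet_Ioo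
      simp only [hk, Pi.sub_apply, Pi.mul_apply]; ring
    have i3 : IntegrableOn (fun t => deriv η t * g t) (Ioo a S) :=
      ((hηd.continuousOn.mul hg).integrableOn_Icc.mono_set Ioo_subset_Icc_self)
    have i4 : ∫ t in Ioo a S, deriv η t * k t = (∫ t in Ioo a S, (deriv η t * g t + η t * G t)) -
        ∫ t in Ioo a S, (deriv η t * (∫ s in a..t, G s) + η t * G t) := by
      rw [integral_add i3 i1, integral_add i2 i1, add_sub_add_right_eq_sub, ← integral_sub i3 i2]
      refine integral_congr_ae (ae_of_all _ fun t => ?_)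
      simp only [hk]
      ring
    rw [i4, h1, h2, sub_zero]
  have h1 := eqOn_const_of_weak_deriv_eq_zero haS hkc hweak ⟨hc, hcd.trans hd⟩
  have h2 := eqOn_const_of_weak_deriv_eq_zero haS hkc hweak ⟨hc.trans hcd, hd⟩
  simp only [hk] at h1 h2
  have h3 := intervalIntegral.integral_interval_sub_left (μ := volume) (f := G) (a := a) (b := d)
    (c := c)
    (hGi.mono_set (by rw [uIcc_of_le haS.le, uIcc_of_le (hc.trans hcd)]; exact Icc_subset_Icc_right hd))
    (hGi.mono_set (by rw [uIcc_of_le haS.le, uIcc_of_le hc]; exact Icc_subset_Icc_right (hcd.trans hd)))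
  linarith

/-! ### Integration on the space-time domain -/

namespace TargetState

variable {n : ℕ} (Z : TargetState n)

/-- The set of all times `t` with `a < t < b`. -/
def times (a : ℝ) (b : EReal) : Set ℝ := {t | a < t ∧ (t : EReal) < b}

lemma times_coe (a S : ℝ) : times a (S : EReal) = Ioo a S := by
  ext t; simp [times]

lemma measurableSet_times (a : ℝ) (b : EReal) : MeasurableSet (times a b) :=
  measurableSet_Ioi.inter (measurable_coe_real_ereal measurableSet_Iio)

lemma measurableSet_region (a : ℝ) (b : EReal) : MeasurableSet (Z.region a b) := by
  have h : Z.region a b = Prod.fst ⁻¹' times a b ∩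
      {p : ℝ × ℝ | 0 < p.2} ∩ {p : ℝ × ℝ | p.2 < Z.thickness p.1} := by
    ext p; simp [region, times, and_assoc]
  rw [h]
  refine (((measurableSet_times a b).preimage measurable_fst).inter ?_).inter ?_
  · exact measurableSet_lt measurable_const measurable_snd
  · exact measurableSet_lt measurable_snd (Z.continuous_thickness.measurable.comp measurable_fst)

lemma indicator_region_apply {E : Type*} [Zero E] {a : ℝ} {b : EReal} (F : ℝ × ℝ → E) (t x : ℝ) :
    (Z.region a b).indicator F (t, x) =
      (times a b).indicator (fun t => (Ioo 0 (Z.thickness t)).indicator (fun x => F (t, x)) x) t := by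
  simp only [indicator, region, times, mem_ofPred_eq, mem_Ioo]
  grind

lemma integral_indicator_region {E : Type*} [NormedAddCommGroup E] [NormedSpace ℝ E] {a : ℝ}
    {b : EReal} (F : ℝ × ℝ → E) (t : ℝ) :
    ∫ x, (Z.region a b).indicator F (t, x) =
      (times a b).indicator (fun t => ∫ x, F (t, x) ∂Z.slice t) t := by
  simp only [Z.indicator_region_apply]
  by_cases ht : t ∈ times a b
  · simp only [indicator_of_mem ht]
    rw [integral_indicator measurableSet_Ioo, slice]
  · simp only [indicator_of_notMem ht]; simp

variable {Z}

lemma integrable_integral_slice {E : Type*} [NormedAddCommGroup E] [NormedSpace ℝ E] {a : ℝ}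
    {b : EReal} {F : ℝ × ℝ → E} (hF : Integrable F (Z.regionMeasure a b)) :
    IntegrableOn (fun t => ∫ x, F (t, x) ∂Z.slice t) (times a b) := by
  have h1 := (integrable_indicator_iff (Z.measurableSet_region a b)).2 hF
  rw [Measure.volume_eq_prod] at h1
  have h2 := h1.integral_prod_left
  simp only [Z.integral_indicator_region] at h2
  exact (integrable_indicator_iff (measurableSet_times a b)).1 h2

lemma integral_region {E : Type*} [NormedAddCommGroup E] [NormedSpace ℝ E] {a : ℝ}
    {b : EReal} {F : ℝ × ℝ → E} (hF : Integrable F (Z.regionMeasure a b)) :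
    ∫ p, F p ∂Z.regionMeasure a b = ∫ t in times a b, ∫ x, F (t, x) ∂Z.slice t := by
  have h1 := (integrable_indicator_iff (Z.measurableSet_region a b)).2 hF
  rw [regionMeasure, ← integral_indicator (Z.measurableSet_region a b)]
  rw [Measure.volume_eq_prod] at h1 ⊢
  rw [integral_prod _ h1, ← integral_indicator (measurableSet_times a b)]
  simp only [Z.integral_indicator_region]

lemma ae_integrable_slice {E : Type*} [NormedAddCommGroup E] {a : ℝ}
    {b : EReal} {F : ℝ × ℝ → E} (hF : Integrable F (Z.regionMeasure a b)) :
    ∀ᵐ t ∂volume.restrict (times a b), Integrable (fun x => F (t, x)) (Z.slice t) := by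
  have h1 := (integrable_indicator_iff (Z.measurableSet_region a b)).2 hF
  rw [Measure.volume_eq_prod] at h1
  rw [ae_restrict_iff' (measurableSet_times a b)]
  filter_upwards [h1.prod_right_ae] with t ht htm
  simp only [Z.indicator_region_apply, indicator_of_mem htm] at ht
  exact (integrable_indicator_iff measurableSet_Ioo).1 ht

lemma ae_aestronglyMeasurable_slice {E : Type*} [NormedAddCommGroup E] {a : ℝ}
    {b : EReal} {F : ℝ × ℝ → E} (hF : AEStronglyMeasurable F (Z.regionMeasure a b)) :
    ∀ᵐ t ∂volume.restrict (times a b), AEStronglyMeasurable (fun x => F (t, x)) (Z.slice t) := by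
  have h1 := (aestronglyMeasurable_indicator_iff (Z.measurableSet_region a b)).2 hF
  rw [Measure.volume_eq_prod] at h1
  rw [ae_restrict_iff' (measurableSet_times a b)]
  filter_upwards [h1.prodMk_left] with t ht htm
  simp only [Z.indicator_region_apply, indicator_of_mem htm] at ht
  exact (aestronglyMeasurable_indicator_iff measurableSet_Ioo).1 ht

lemma ae_memLp_slice {E : Type*} [NormedAddCommGroup E] {a : ℝ}
    {b : EReal} {F : ℝ × ℝ → E} (hF : MemLp F 2 (Z.regionMeasure a b)) :
    ∀ᵐ t ∂volume.restrict (times a b), MemLp (fun x => F (t, x)) 2 (Z.slice t) := by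
  filter_upwards [ae_aestronglyMeasurable_slice hF.1,
    ae_integrable_slice (hF.integrable_norm_rpow (by simp) (by simp))] with t h1 h2
  refine (integrable_norm_rpow_iff h1 (by simp) (by simp)).1 ?_
  simpa using h2

lemma isFiniteMeasure_regionMeasure (a S : ℝ) : IsFiniteMeasure (Z.regionMeasure a S) := by
  refine ⟨?_⟩
  rw [regionMeasure, Measure.restrict_apply_univ]
  refine lt_of_le_of_lt (measure_mono (t := Icc a S ×ˢ Icc 0 (Z.thickness S)) ?_)
    (isCompact_Icc.prod isCompact_Icc).measure_lt_top
  rintro ⟨t, x⟩ ⟨h1, h2, h3, h4⟩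
  have h5 : t ≤ S := by exact_mod_cast h2.le
  exact ⟨⟨h1.le, h5⟩, h3.le, h4.le.trans (Z.thickness_mono h5)⟩

instance (t : ℝ) : IsFiniteMeasure (Z.slice t) := by unfold slice; infer_instance

/-- The closure of the space-time domain. -/
def closedRegion (Z : TargetState n) (a S : ℝ) : Set (ℝ × ℝ) :=
  {p | p.1 ∈ Icc a S ∧ p.2 ∈ Icc 0 (Z.thickness p.1)}

lemma isCompact_closedRegion (a S : ℝ) : IsCompact (Z.closedRegion a S) := by
  refine (isCompact_Icc.prod isCompact_Icc : IsCompact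
    (Icc a S ×ˢ Icc 0 (Z.thickness S))).of_isClosed_subset ?_ ?_
  · have h : Z.closedRegion a S = {p : ℝ × ℝ | a ≤ p.1} ∩ {p : ℝ × ℝ | p.1 ≤ S} ∩
        {p : ℝ × ℝ | 0 ≤ p.2} ∩ {p : ℝ × ℝ | p.2 ≤ Z.thickness p.1} := by
      ext p; simp [closedRegion, and_assoc]
    rw [h]
    refine (((?_ : IsClosed _).inter ?_).inter ?_).inter ?_
    · exact isClosed_le continuous_const continuous_fst
    · exact isClosed_le continuous_fst continuous_const
    · exact isClosed_le continuous_const continuous_snd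
    · exact isClosed_le continuous_snd (Z.continuous_thickness.comp continuous_fst)
  · rintro ⟨t, x⟩ ⟨h1, h2⟩
    exact ⟨h1, h2.1, h2.2.trans (Z.thickness_mono h1.2)⟩

lemma region_subset_closedRegion (a S : ℝ) : Z.region a S ⊆ Z.closedRegion a S := by
  rintro ⟨t, x⟩ ⟨h1, h2, h3, h4⟩
  exact ⟨⟨h1.le, by exact_mod_cast h2.le⟩, h3.le, h4.le⟩

lemma exists_bound_regionMeasure {E : Type*} [NormedAddCommGroup E] {a S : ℝ} {F : ℝ × ℝ → E}
    (hF : ContinuousOn F (Z.closedRegion a S)) :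
    AEStronglyMeasurable F (Z.regionMeasure a S) ∧
      ∃ C, ∀ᵐ p ∂Z.regionMeasure a S, ‖F p‖ ≤ C := by
  obtain ⟨C, hC⟩ := (isCompact_closedRegion a S).exists_bound_of_continuousOn hF
  refine ⟨(hF.aestronglyMeasurable_of_isCompact (isCompact_closedRegion a S)
    (isCompact_closedRegion a S).measurableSet).mono_measure
      (Measure.restrict_mono (region_subset_closedRegion a S) le_rfl), C, ?_⟩
  filter_upwards [ae_restrict_mem (Z.measurableSet_region a S)] with p hp
  exact hC p (region_subset_closedRegion a S hp)

lemma memLp_of_continuousOn {E : Type*} [NormedAddCommGroup E] {a S : ℝ} {F : ℝ × ℝ → E}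
    (hF : ContinuousOn F (Z.closedRegion a S)) : MemLp F 2 (Z.regionMeasure a S) := by
  obtain ⟨h1, C, hC⟩ := exists_bound_regionMeasure hF
  have := isFiniteMeasure_regionMeasure (Z := Z) a S
  exact MemLp.of_bound h1 C hC

lemma integrable_continuousOn_mul {a S : ℝ} {F f : ℝ × ℝ → ℝ}
    (hF : ContinuousOn F (Z.closedRegion a S)) (hf : MemLp f 2 (Z.regionMeasure a S)) :
    Integrable (fun p => F p * f p) (Z.regionMeasure a S) := by
  obtain ⟨h1, C, hC⟩ := exists_bound_regionMeasure hF
  have := isFiniteMeasure_regionMeasure (Z := Z) a S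
  exact (hf.integrable (by norm_num)).bdd_mul h1 hC

end TargetState

end CrossDiffusion

namespace CrossDiffusion

namespace TargetState

variable {n : ℕ} (Z : TargetState n)

/-! ### Explicit solutions of the heat equation on the moving domain -/

/-- The time `∫₀ᵗ ē(s)⁻² ds` in which the equation becomes a heat equation on `(0, 1)`. -/
noncomputable def scaledTime (t : ℝ) : ℝ := t / (Z.initialThickness * Z.thickness t)

lemma hasDerivAt_scaledTime {t : ℝ} (ht : 0 < Z.thickness t) :
    HasDerivAt Z.scaledTime (1 / Z.thickness t ^ 2) t := by
  have h0 := Z.initialThickness_pos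
  refine ((hasDerivAt_id t).div ((Z.hasDerivAt_thickness t).const_mul Z.initialThickness)
    (by positivity)).congr_deriv ?_
  simp only [id]
  rw [div_eq_div_iff (by positivity) (by positivity)]
  have : Z.thickness t = Z.initialThickness + Z.speed * t := rfl
  generalize Z.thickness t = E at *
  subst this
  ring

/-- The factor `ē^(-1/2) exp (- v̄ x² / (4 σ ē))`. -/
noncomputable def amp (σ t x : ℝ) : ℝ :=
  (√(Z.thickness t))⁻¹ * Real.exp (-(Z.speed * x ^ 2 / (4 * σ * Z.thickness t)))

/-- The solution of `∂ₜφ = σ ∂ₓₓφ` that corresponds to `exp (- σ w² s) cos (w y)`. -/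
noncomputable def mode (σ w t x : ℝ) : ℝ :=
  Z.amp σ t x * Real.cos (w * (x / Z.thickness t)) * decay σ w (Z.scaledTime t)

/-- Space derivative of `mode`. -/
noncomputable def modeX (σ w t x : ℝ) : ℝ :=
  Z.amp σ t x * (-(Z.speed * x / (2 * σ * Z.thickness t)) * Real.cos (w * (x / Z.thickness t)) -
    w / Z.thickness t * Real.sin (w * (x / Z.thickness t))) * decay σ w (Z.scaledTime t)

/-- Second space derivative of `mode`. -/
noncomputable def modeXX (σ w t x : ℝ) : ℝ :=
  Z.amp σ t x * ((Z.speed ^ 2 * x ^ 2 / (4 * σ ^ 2 * Z.thickness t ^ 2) -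
      Z.speed / (2 * σ * Z.thickness t) - w ^ 2 / Z.thickness t ^ 2) *
      Real.cos (w * (x / Z.thickness t)) +
    Z.speed * x * w / (σ * Z.thickness t ^ 2) * Real.sin (w * (x / Z.thickness t))) *
    decay σ w (Z.scaledTime t)

lemma hasDerivAt_amp_x (σ t x : ℝ) : HasDerivAt (Z.amp σ t)
    (Z.amp σ t x * -(Z.speed * x / (2 * σ * Z.thickness t))) x := by
  have h1 : HasDerivAt (fun x => -(Z.speed * x ^ 2 / (4 * σ * Z.thickness t)))
      (-(Z.speed * (2 * x) / (4 * σ * Z.thickness t))) x := by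
    simpa using ((((hasDerivAt_id x).fun_pow 2).const_mul Z.speed).div_const
      (4 * σ * Z.thickness t)).fun_neg
  have h2 : Z.speed * (2 * x) / (4 * σ * Z.thickness t) = Z.speed * x / (2 * σ * Z.thickness t) := by
    rw [show 4 * σ * Z.thickness t = 2 * (2 * σ * Z.thickness t) by ring,
      show Z.speed * (2 * x) = 2 * (Z.speed * x) by ring, mul_div_mul_left _ _ two_ne_zero]
  rw [h2] at h1
  unfold amp
  refine (h1.exp.const_mul _).congr_deriv ?_
  ring

lemma hasDerivAt_mode_x (σ w t x : ℝ) : HasDerivAt (Z.mode σ w t) (Z.modeX σ w t x) x := by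
  unfold mode modeX
  have h1 : HasDerivAt (fun x => w * (x / Z.thickness t)) (w / Z.thickness t) x := by
    simpa [div_eq_mul_inv] using ((hasDerivAt_id x).div_const (Z.thickness t)).const_mul w
  refine (((Z.hasDerivAt_amp_x σ t x).mul h1.cos).mul_const _).congr_deriv ?_
  ring

lemma hasDerivAt_modeX_x {σ t : ℝ} (hσ : σ ≠ 0) (ht : 0 < Z.thickness t) (w x : ℝ) :
    HasDerivAt (Z.modeX σ w t) (Z.modeXX σ w t x) x := by
  unfold modeX modeXX
  have h1 : HasDerivAt (fun x => w * (x / Z.thickness t)) (w / Z.thickness t) x := by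
    simpa [div_eq_mul_inv] using ((hasDerivAt_id x).div_const (Z.thickness t)).const_mul w
  have h2 : HasDerivAt (fun x => -(Z.speed * x / (2 * σ * Z.thickness t)))
      (-(Z.speed / (2 * σ * Z.thickness t))) x := by
    simpa using (((hasDerivAt_id x).const_mul Z.speed).div_const (2 * σ * Z.thickness t)).fun_neg
  refine (((Z.hasDerivAt_amp_x σ t x).mul ((h2.mul h1.cos).sub
    (h1.sin.const_mul (w / Z.thickness t)))).mul_const _).congr_deriv ?_
  have := ht.ne'
  simp only [Pi.mul_apply, Pi.sub_apply]
  field_simp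
  ring

/-- The Gaussian factor removes the transport term created by rescaling the domain, and `ē^(-1/2)`
removes the zero order term. No potential is left because `ē` is affine. The sign of `σ` is free, so
the backward heat equation is covered too. -/
lemma hasDerivAt_mode_t {σ t : ℝ} (hσ : σ ≠ 0) (ht : 0 < Z.thickness t) (w x : ℝ) :
    HasDerivAt (fun t => Z.mode σ w t x) (σ * Z.modeXX σ w t x) t := by
  unfold mode modeXX amp decay
  have hE := Z.hasDerivAt_thickness t
  have hne := ht.ne'
  have hsq : 0 < √(Z.thickness t) := Real.sqrt_pos.2 ht
  have h1 := (hE.sqrt hne).inv hsq.ne'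
  have h2 := ((hasDerivAt_const t (Z.speed * x ^ 2)).div (hE.const_mul (4 * σ))
    (by positivity)).neg.exp
  have h3 := (((hasDerivAt_const t x).div hE hne).const_mul w).cos
  have h4 := (((Z.hasDerivAt_scaledTime ht).const_mul (σ * w ^ 2)).neg).exp
  refine (((h1.mul h2).mul h3).mul h4).congr_deriv ?_
  have hR : √(Z.thickness t) ^ 2 = Z.thickness t := Real.sq_sqrt ht.le
  simp only [Pi.mul_apply, Pi.div_apply, Pi.inv_apply, Pi.neg_apply]
  generalize Real.cos (w * (x / Z.thickness t)) = c
  generalize Real.sin (w * (x / Z.thickness t)) = s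
  generalize Real.exp (-(Z.speed * x ^ 2 / (4 * σ * Z.thickness t))) = e
  generalize Real.exp (-(σ * w ^ 2 * Z.scaledTime t)) = e'
  generalize √(Z.thickness t) = R at *
  rw [← hR]
  field_simp
  ring

lemma modeX_zero (σ w t : ℝ) : Z.modeX σ w t 0 = 0 := by simp [modeX]

/-- The flux of `mode` through the moving boundary. -/
noncomputable def boundaryFlux (σ w t : ℝ) : ℝ :=
  σ / Z.thickness t * Z.amp σ t (Z.thickness t) * -(w * Real.sin w) * decay σ w (Z.scaledTime t)

/-- At `x = ē` the logarithmic derivative of the Gaussian factor is `-v̄ / (2 σ)`, which cancels the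
Robin term exactly and leaves the Neumann datum `-w sin w`. This explains the local gain `v̄ / 2`.
-/
lemma boundaryFlux_eq {σ t : ℝ} (hσ : σ ≠ 0) (ht : 0 < Z.thickness t) (w : ℝ) :
    σ * Z.modeX σ w t (Z.thickness t) + Z.speed / 2 * Z.mode σ w t (Z.thickness t) =
      Z.boundaryFlux σ w t := by
  have := ht.ne'
  unfold modeX mode boundaryFlux
  rw [div_self this, mul_one]
  field_simp
  ring

lemma continuousAt_thickness (t : ℝ) : ContinuousAt Z.thickness t :=
  Z.continuous_thickness.continuousAt

lemma contDiff_thickness {k : ℕ∞ω} : ContDiff ℝ k Z.thickness := by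
  unfold thickness; fun_prop

lemma contDiffAt_scaledTime {t : ℝ} (ht : 0 < Z.thickness t) {k : ℕ∞ω} :
    ContDiffAt ℝ k Z.scaledTime t := by
  unfold scaledTime
  have := Z.initialThickness_pos
  exact contDiffAt_id.div (contDiffAt_const.mul Z.contDiff_thickness.contDiffAt) (by positivity)

lemma contDiffAt_mode {σ : ℝ} (hσ : σ ≠ 0) (w : ℝ) {p : ℝ × ℝ} (hp : 0 < Z.thickness p.1)
    {k : ℕ∞ω} : ContDiffAt ℝ k (fun p : ℝ × ℝ => Z.mode σ w p.1 p.2) p := by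
  have h1 : ContDiffAt ℝ k (fun p : ℝ × ℝ => Z.thickness p.1) p :=
    (Z.contDiff_thickness.comp contDiff_fst).contDiffAt
  have h2 : ContDiffAt ℝ k (fun p : ℝ × ℝ => Z.scaledTime p.1) p :=
    (Z.contDiffAt_scaledTime hp).comp p contDiffAt_fst
  have hs := Real.sqrt_pos.2 hp
  unfold mode amp decay
  refine ContDiffAt.mul (ContDiffAt.mul (ContDiffAt.mul ?_ ?_) ?_) ?_
  · exact (h1.sqrt hp.ne').inv hs.ne'
  · refine ContDiffAt.exp (ContDiffAt.neg (ContDiffAt.div (by fun_prop) (by fun_prop) ?_))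
    have := hp.ne'
    positivity
  · exact ContDiffAt.cos (contDiffAt_const.mul (contDiffAt_snd.div h1 hp.ne'))
  · exact ContDiffAt.exp (ContDiffAt.neg (contDiffAt_const.mul h2))

lemma continuousAt_amp {σ : ℝ} (hσ : σ ≠ 0) {p : ℝ × ℝ} (hp : 0 < Z.thickness p.1) :
    ContinuousAt (fun p : ℝ × ℝ => Z.amp σ p.1 p.2) p := by
  have hs := (Real.sqrt_pos.2 hp).ne'
  have := hp.ne'
  unfold amp
  exact ContinuousAt.mul (ContinuousAt.inv₀ (by fun_prop) hs) (ContinuousAt.rexp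
    (ContinuousAt.neg (ContinuousAt.div (by fun_prop) (by fun_prop) (by positivity))))

lemma continuousAt_decay {σ w : ℝ} {p : ℝ × ℝ} (hp : 0 < Z.thickness p.1) :
    ContinuousAt (fun p : ℝ × ℝ => decay σ w (Z.scaledTime p.1)) p := by
  have h2 : ContinuousAt (fun p : ℝ × ℝ => Z.scaledTime p.1) p :=
    ContinuousAt.comp (f := Prod.fst) (g := Z.scaledTime)
      (Z.hasDerivAt_scaledTime hp).continuousAt continuousAt_fst
  unfold decay
  fun_prop

lemma continuousAt_mode {σ : ℝ} (hσ : σ ≠ 0) (w : ℝ) {p : ℝ × ℝ} (hp : 0 < Z.thickness p.1) :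
    ContinuousAt (fun p : ℝ × ℝ => Z.mode σ w p.1 p.2) p :=
  (Z.contDiffAt_mode hσ w hp (k := 0)).continuousAt

lemma continuousAt_modeX {σ : ℝ} (hσ : σ ≠ 0) (w : ℝ) {p : ℝ × ℝ} (hp : 0 < Z.thickness p.1) :
    ContinuousAt (fun p : ℝ × ℝ => Z.modeX σ w p.1 p.2) p := by
  have h1 := Z.continuousAt_amp hσ hp
  have h2 := Z.continuousAt_decay (σ := σ) (w := w) hp
  have h3 : ContinuousAt (fun p : ℝ × ℝ => w * (p.2 / Z.thickness p.1)) p :=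
    continuousAt_const.mul (ContinuousAt.div (by fun_prop) (by fun_prop) hp.ne')
  have h3c : ContinuousAt (fun p : ℝ × ℝ => Real.cos (w * (p.2 / Z.thickness p.1))) p :=
    Real.continuous_cos.continuousAt.comp h3
  have h3s : ContinuousAt (fun p : ℝ × ℝ => Real.sin (w * (p.2 / Z.thickness p.1))) p :=
    Real.continuous_sin.continuousAt.comp h3
  have := hp.ne'
  unfold modeX
  refine ContinuousAt.mul (ContinuousAt.mul h1 (ContinuousAt.sub (ContinuousAt.mul
    (ContinuousAt.neg (ContinuousAt.div (by fun_prop) (by fun_prop) (by positivity)))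
    h3c) (ContinuousAt.mul (ContinuousAt.div (by fun_prop) (by fun_prop) this)
      h3s))) h2

lemma continuousAt_modeXX {σ : ℝ} (hσ : σ ≠ 0) (w : ℝ) {p : ℝ × ℝ} (hp : 0 < Z.thickness p.1) :
    ContinuousAt (fun p : ℝ × ℝ => Z.modeXX σ w p.1 p.2) p := by
  have h1 := Z.continuousAt_amp hσ hp
  have h2 := Z.continuousAt_decay (σ := σ) (w := w) hp
  have h3 : ContinuousAt (fun p : ℝ × ℝ => w * (p.2 / Z.thickness p.1)) p :=
    continuousAt_const.mul (ContinuousAt.div (by fun_prop) (by fun_prop) hp.ne')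
  have h3c : ContinuousAt (fun p : ℝ × ℝ => Real.cos (w * (p.2 / Z.thickness p.1))) p :=
    Real.continuous_cos.continuousAt.comp h3
  have h3s : ContinuousAt (fun p : ℝ × ℝ => Real.sin (w * (p.2 / Z.thickness p.1))) p :=
    Real.continuous_sin.continuousAt.comp h3
  have := hp.ne'
  unfold modeXX
  refine ContinuousAt.mul (ContinuousAt.mul h1 (ContinuousAt.add (ContinuousAt.mul
    (ContinuousAt.sub (ContinuousAt.sub (ContinuousAt.div (by fun_prop) (by fun_prop)
      (by positivity)) (ContinuousAt.div (by fun_prop) (by fun_prop) (by positivity)))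
      (ContinuousAt.div (by fun_prop) (by fun_prop) (by positivity)))
    h3c) (ContinuousAt.mul (ContinuousAt.div (by fun_prop) (by fun_prop)
      (by positivity)) h3s))) h2

/-! ### The gauge on the unit interval -/

/-- The multiplier `ē^(-1/2) exp (- v̄ ē y² / (4 σ))`. -/
noncomputable def gauge (σ t : ℝ) : C(ℝ, ℝ) where
  toFun y := (√(Z.thickness t))⁻¹ * Real.exp (-(Z.speed * Z.thickness t * y ^ 2 / (4 * σ)))
  continuous_toFun := by fun_prop

/-- The inverse of `gauge`. -/
noncomputable def gaugeInv (σ t : ℝ) : C(ℝ, ℝ) where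
  toFun y := √(Z.thickness t) * Real.exp (Z.speed * Z.thickness t * y ^ 2 / (4 * σ))
  continuous_toFun := by fun_prop

lemma gaugeInv_mul_gauge {t : ℝ} (ht : 0 < Z.thickness t) (σ y : ℝ) :
    Z.gaugeInv σ t y * Z.gauge σ t y = 1 := by
  have hs := (Real.sqrt_pos.2 ht).ne'
  simp only [gauge, gaugeInv, ContinuousMap.coe_mk, Real.exp_neg]
  field_simp

lemma amp_mul {t : ℝ} (ht : 0 < Z.thickness t) (σ y : ℝ) :
    Z.amp σ t (y * Z.thickness t) = Z.gauge σ t y := by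
  simp only [amp, gauge, ContinuousMap.coe_mk]
  congr 3
  rw [mul_comm (4 * σ), mul_pow, ← mul_assoc, sq (Z.thickness t), ← mul_assoc, mul_comm _ (Z.thickness t),
    mul_div_mul_left _ _ ht.ne']
  ring

lemma mode_mul {t : ℝ} (ht : 0 < Z.thickness t) (σ w y : ℝ) :
    Z.mode σ w t (y * Z.thickness t) =
      Z.gauge σ t y * (decay σ w (Z.scaledTime t) * Real.cos (w * y)) := by
  rw [mode, Z.amp_mul ht, mul_div_cancel_right₀ _ ht.ne']
  ring

/-- Changing the sign of `σ` inverts the Gaussian. Hence pairing with backward modes computes the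
cosine coefficients of the unknown in the gauged variable. -/
lemma gaugeInv_eq {t : ℝ} (ht : 0 < Z.thickness t) (σ y : ℝ) :
    Z.gaugeInv σ t y = Z.thickness t * Z.gauge (-σ) t y := by
  have hR := Real.mul_self_sqrt ht.le
  have hs := (Real.sqrt_pos.2 ht).ne'
  simp only [gauge, gaugeInv, ContinuousMap.coe_mk, mul_neg, div_neg, neg_neg]
  rw [← mul_assoc]
  congr 1
  field_simp
  rw [sq, hR]

lemma gauge_abs_le {σ : ℝ} (hσ : 0 < σ) {t : ℝ} (ht : 0 < Z.thickness t) (y : ℝ) :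
    |Z.gauge σ t y| ≤ (√(Z.thickness t))⁻¹ := by
  have := Z.speed_pos
  simp only [gauge, ContinuousMap.coe_mk]
  rw [abs_of_nonneg (by positivity)]
  refine mul_le_of_le_one_right (by positivity) ?_
  rw [Real.exp_le_one_iff, neg_nonpos]
  positivity

lemma gaugeInv_abs_le {σ : ℝ} (hσ : 0 < σ) {t T : ℝ} (ht : 0 < Z.thickness t) (htT : t ≤ T) {y : ℝ}
    (hy : y ∈ Ioo (0 : ℝ) 1) :
    |Z.gaugeInv σ t y| ≤ √(Z.thickness T) * Real.exp (Z.speed * Z.thickness T / (4 * σ)) := by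
  have := Z.speed_pos
  have h := Z.thickness_mono htT
  simp only [gaugeInv, ContinuousMap.coe_mk]
  rw [abs_of_nonneg (by positivity)]
  gcongr ?_ * Real.exp (?_ / _)
  · exact Real.sqrt_le_sqrt h
  · have h1 : y ^ 2 ≤ 1 := by nlinarith [hy.1, hy.2]
    calc _ ≤ Z.speed * Z.thickness t * 1 := by gcongr
      _ ≤ _ := by rw [mul_one]; gcongr

end TargetState

end CrossDiffusion

namespace CrossDiffusion

/-! ### Pairing with the explicit solutions -/

section Multiplication

variable {n : ℕ}

lemma proj_sub (g g' : C(ℝ, ℝ)) (q : Vec n) : proj g q - proj g' q = proj (g - g') q := by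
  ext1 F
  refine Lp.ext ?_
  rw [sub_apply]
  filter_upwards [Lp.coeFn_sub (proj g q F) (proj g' q F), coeFn_proj g q F,
    coeFn_proj g' q F, coeFn_proj (g - g') q F] with y h1 h2 h3 h4
  rw [h1, Pi.sub_apply, h2, h3, h4, ContinuousMap.sub_apply]
  ring

/-- Compactness of `[0, 1]` makes the multipliers converge uniformly in space, hence the operators
in norm. -/
lemma continuousOn_mulLift {γ : ℝ → C(ℝ, ℝ)} {s : Set ℝ}
    (hγ : ContinuousOn (fun p : ℝ × ℝ => γ p.1 p.2) (s ×ˢ Icc 0 1)) (p : Vec n) :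
    ContinuousOn (fun t => mulLift (γ t) p) s := by
  intro t ht
  rw [Metric.continuousWithinAt_iff']
  intro ε hε
  have hε' : 0 < ε / (‖p‖ + 1) := by positivity
  obtain ⟨v, hv, hvt⟩ := isCompact_Icc.mem_uniformity_of_prod (f := fun t y => γ t y) hγ ht
    (Metric.dist_mem_uniformity hε')
  filter_upwards [hv] with r hr
  rw [dist_eq_norm, mulLift_sub]
  refine (norm_mulLift_le hε'.le (fun y hy => ?_) p).trans_lt ?_
  · exact (hvt r hr y (Ioo_subset_Icc_self hy)).le
  · rw [div_mul_eq_mul_div, div_lt_iff₀ (by positivity)]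
    nlinarith

lemma continuousOn_proj {γ : ℝ → C(ℝ, ℝ)} {s : Set ℝ}
    (hγ : ContinuousOn (fun p : ℝ × ℝ => γ p.1 p.2) (s ×ˢ Icc 0 1)) (q : Vec n) :
    ContinuousOn (fun t => proj (γ t) q) s := by
  intro t ht
  rw [Metric.continuousWithinAt_iff']
  intro ε hε
  have hε' : 0 < ε / (‖q‖ + 1) := by positivity
  obtain ⟨v, hv, hvt⟩ := isCompact_Icc.mem_uniformity_of_prod (f := fun t y => γ t y) hγ ht
    (Metric.dist_mem_uniformity hε')
  filter_upwards [hv] with r hr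
  rw [dist_eq_norm, proj_sub]
  refine (norm_proj_le hε'.le (fun y hy => ?_) q).trans_lt ?_
  · exact (hvt r hr y (Ioo_subset_Icc_self hy)).le
  · rw [div_mul_eq_mul_div, div_lt_iff₀ (by positivity)]
    nlinarith

end Multiplication

namespace TargetState

variable {n : ℕ} (Z : TargetState n)

lemma continuousOn_gauge (σ : ℝ) :
    ContinuousOn (fun p : ℝ × ℝ => Z.gauge σ p.1 p.2) (Ici 0 ×ˢ Icc 0 1) := by
  intro p hp
  have h := Real.sqrt_pos.2 (Z.thickness_pos hp.1)
  refine ContinuousAt.continuousWithinAt ?_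
  simp only [gauge, ContinuousMap.coe_mk]
  exact ContinuousAt.mul (ContinuousAt.inv₀ (by fun_prop) h.ne') (by fun_prop)

lemma continuousOn_gaugeInv (σ : ℝ) :
    ContinuousOn (fun p : ℝ × ℝ => Z.gaugeInv σ p.1 p.2) (Ici 0 ×ˢ Icc 0 1) := by
  simp only [gaugeInv, ContinuousMap.coe_mk]
  fun_prop

lemma continuousAt_decay_scaledTime (σ w : ℝ) {t : ℝ} (ht : 0 ≤ t) :
    ContinuousAt (fun t => decay σ w (Z.scaledTime t)) t := by
  have := (Z.hasDerivAt_scaledTime (Z.thickness_pos ht)).continuousAt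
  unfold decay
  fun_prop

lemma integral_mode_mul {t : ℝ} (ht : 0 < Z.thickness t) (σ w : ℝ) (q : Vec n) {f : ℝ → Vec n}
    (hf : MemLp f 2 (Z.slice t)) :
    ∫ x, Z.mode σ w t x * inner ℝ q (f x) ∂Z.slice t =
      Z.thickness t * decay σ w (Z.scaledTime t) * inner ℝ (cosMode w)
        (proj (Z.gauge σ t) q (toL2 unitMeasure fun y => f (y * Z.thickness t))) := by
  rw [Z.integral_slice ht, smul_eq_mul, mul_assoc, L2.inner_def, ← integral_const_mul (decay σ w (Z.scaledTime t))]
  congr 1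
  refine integral_congr_ae ?_
  filter_upwards [coeFn_proj (Z.gauge σ t) q (toL2 unitMeasure fun y => f (y * Z.thickness t)),
    coeFn_toL2 (memLp_comp_mul ht hf), coeFn_cosMode w] with y h1 h2 h3
  rw [Z.mode_mul ht, h1, h2, h3]
  simp only [RCLike.inner_apply, conj_trivial]
  ring

variable {Z}

lemma ContinuousL2On.continuousOn_integral_mode {v : ℝ → ℝ → Vec n} {J : Set ℝ}
    (hv : Z.ContinuousL2On v J) (hJ : J ⊆ Ici 0) (σ w : ℝ) (q : Vec n) :
    ContinuousOn (fun t => ∫ x, Z.mode σ w t x * inner ℝ q (v t x) ∂Z.slice t) J := by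
  have h1 : ContinuousOn (fun t => Z.thickness t * decay σ w (Z.scaledTime t) *
      inner ℝ (cosMode w) (proj (Z.gauge σ t) q
        (toL2 unitMeasure fun y => v t (y * Z.thickness t)))) J := by
    refine ContinuousOn.mul (ContinuousOn.mul (by fun_prop) fun t ht =>
      (Z.continuousAt_decay_scaledTime σ w (hJ ht)).continuousWithinAt) ?_
    refine ContinuousOn.inner continuousOn_const ?_
    exact (((continuousOn_proj (Z.continuousOn_gauge σ) q).mono hJ).clm_apply hv.2)
  refine h1.congr fun t ht => ?_
  exact Z.integral_mode_mul (Z.thickness_pos (hJ ht)) σ w q (hv.1 t ht)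

/-! ### Green's identity for test functions -/

/-- A scalar component of a test function in the direction of an eigenvector. -/
structure IsScalarTest (Z : TargetState n) (σ a S : ℝ) (f ft fx fxx : ℝ → ℝ → ℝ) : Prop where
  memLp : MemLp (Function.uncurry f) 2 (Z.regionMeasure a S)
  memLp_t : MemLp (Function.uncurry ft) 2 (Z.regionMeasure a S)
  memLp_x : MemLp (Function.uncurry fx) 2 (Z.regionMeasure a S)
  memLp_xx : MemLp (Function.uncurry fxx) 2 (Z.regionMeasure a S)
  deriv_x : ∀ᵐ t ∂volume.restrict (Ioo a S), ∀ x ∈ Icc 0 (Z.thickness t),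
    f t x = f t 0 + ∫ y in (0 : ℝ)..x, fx t y
  deriv_xx : ∀ᵐ t ∂volume.restrict (Ioo a S), ∀ x ∈ Icc 0 (Z.thickness t),
    fx t x = fx t 0 + ∫ y in (0 : ℝ)..x, fxx t y
  deriv_t : ∀ φ : ℝ × ℝ → ℝ, ContDiff ℝ ∞ φ → HasCompactSupport φ → tsupport φ ⊆ Z.region a S →
    ∫ p, f p.1 p.2 * fderiv ℝ φ p (1, 0) ∂Z.regionMeasure a S
      = -∫ p, ft p.1 p.2 * φ p ∂Z.regionMeasure a S
  boundary_left : ∀ᵐ t ∂volume.restrict (Ioo a S), fx t 0 = 0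
  boundary_right : ∀ᵐ t ∂volume.restrict (Ioo a S),
    σ * fx t (Z.thickness t) = Z.speed / 2 * f t (Z.thickness t)

lemma inner_mulVec_transpose {A : Mat n} {σ : ℝ} {p : Vec n} (hp : mulVec A p = σ • p) (z : Vec n) :
    inner ℝ p (mulVec Aᵀ z) = σ * inner ℝ p z := by
  have h : inner ℝ p (mulVec Aᵀ z) = inner ℝ (mulVec A p) z := by
    simp only [mulVec, EuclideanSpace.inner_eq_star_dotProduct, star_trivial,
      Matrix.mulVec_transpose]
    rw [← Matrix.dotProduct_mulVec, dotProduct_comm]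
  rw [h, hp, inner_smul_left, conj_trivial]

/-- Taking the inner product with an eigenvector `p` of `A` replaces `Aᵀ` by the number `σ` in the
equation and in both boundary conditions; the gain `v̄ / 2` turns the right one into a scalar Robin
condition. -/
lemma IsTestFunction.isScalarTest {A : Mat n} {σ a S : ℝ} (hσ : σ ≠ 0) {p : Vec n}
    (hp : mulVec A p = σ • p) {v vt vx vxx : ℝ → ℝ → Vec n} {K : ℝ → Mat n}
    (hK : ∀ t, K t = (Z.speed / 2) • (1 : Mat n))
    (hv : Z.IsTestFunction A K a S v vt vx vxx) :
    Z.IsScalarTest σ a S (fun t x => inner ℝ p (v t x)) (fun t x => inner ℝ p (vt t x))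
      (fun t x => inner ℝ p (vx t x)) (fun t x => inner ℝ p (vxx t x)) := by
  have hprim : ∀ {v vx : ℝ → ℝ → Vec n}, MemLp (Function.uncurry vx) 2 (Z.regionMeasure a S) →
      (∀ᵐ t ∂volume.restrict (Ioo a S), ∀ x ∈ Icc 0 (Z.thickness t),
        v t x = v t 0 + ∫ y in (0 : ℝ)..x, vx t y) →
      ∀ᵐ t ∂volume.restrict (Ioo a S), ∀ x ∈ Icc 0 (Z.thickness t),
        inner ℝ p (v t x) = inner ℝ p (v t 0) + ∫ y in (0 : ℝ)..x, inner ℝ p (vx t y) := by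
    intro v vx h1 h2
    have h3 := ae_memLp_slice h1
    rw [times_coe] at h3
    filter_upwards [h2, h3] with t ht ht3 x hx
    rw [ht x hx, inner_add_right]
    congr 1
    have hi : IntervalIntegrable (vx t) volume 0 x := by
      rw [intervalIntegrable_iff_integrableOn_Ioo_of_le hx.1]
      exact (ht3.integrable (by norm_num)).mono_measure
        (Measure.restrict_mono (Ioo_subset_Ioo_right hx.2) le_rfl)
    exact ((innerSL ℝ p).intervalIntegral_comp_comm hi).symm
  refine ⟨hv.memLp.const_inner p, hv.memLp_t.const_inner p, hv.memLp_x.const_inner p,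
    hv.memLp_xx.const_inner p, hprim hv.memLp_x hv.deriv_x, hprim hv.memLp_xx hv.deriv_xx,
    fun φ hφ hφc hφs => ?_, ?_, ?_⟩
  · have h := hv.deriv_t (fun x => φ x • p) ⟨hφ.smul contDiff_const, hφc.smul_right,
      (closure_mono (Function.support_smul_subset_left φ fun _ => p)).trans hφs⟩
    have h1 : ∀ x, partialT (fun x => φ x • p) x = fderiv ℝ φ x (1, 0) • p := fun x => by
      rw [partialT, fderiv_smul_const (hφ.differentiable (by simp) x)]
      simp
    simp only [h1, inner_smul_right] at h
    simp only [real_inner_comm _ p]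
    simpa only [mul_comm] using h
  · filter_upwards [hv.boundary_left] with t ht
    have h := inner_mulVec_transpose hp (vx t 0)
    rw [ht, inner_zero_right] at h
    simpa [hσ] using h.symm
  · filter_upwards [hv.boundary_right] with t ht
    have h := inner_mulVec_transpose hp (vx t (Z.thickness t))
    rw [← h, ← sub_eq_zero.1 ht, hK]
    simp only [mulVec, Matrix.transpose_smul, Matrix.transpose_one, Matrix.smul_mulVec,
      Matrix.one_mulVec, WithLp.toLp_smul, WithLp.toLp_ofLp, inner_smul_right]

end TargetState

end CrossDiffusion

/-! ### Cut-off heat modes and integration by parts on a slice -/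

namespace CrossDiffusion

lemma integrable_fun_add {α : Type*} [MeasurableSpace α] {μ : Measure α} {f g : α → ℝ}
    (hf : Integrable f μ) (hg : Integrable g μ) : Integrable (fun x => f x + g x) μ := hf.add hg

lemma integrable_fun_sub {α : Type*} [MeasurableSpace α] {μ : Measure α} {f g : α → ℝ}
    (hf : Integrable f μ) (hg : Integrable g μ) : Integrable (fun x => f x - g x) μ := hf.sub hg

namespace TargetState

variable {n : ℕ} (Z : TargetState n)

/-- A cut-off solution of the heat equation. -/
noncomputable def cutoffMode (σ w : ℝ) (η χ : ℝ → ℝ) (p : ℝ × ℝ) : ℝ :=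
  η p.1 * (χ (p.2 / Z.thickness p.1) * Z.mode σ w p.1 p.2)

/-- The mode is smooth only where the thickness is positive; outside the support of `η` the product
is locally zero. -/
lemma contDiff_cutoffMode {σ : ℝ} (hσ : σ ≠ 0) (w : ℝ) {a S : ℝ} (ha : 0 ≤ a) {η χ : ℝ → ℝ}
    (hη : ContDiff ℝ ∞ η) (hηs : tsupport η ⊆ Ioo a S) (hχ : ContDiff ℝ ∞ χ) :
    ContDiff ℝ ∞ (Z.cutoffMode σ w η χ) := by
  rw [contDiff_iff_contDiffAt]
  intro p
  by_cases hp : p.1 ∈ tsupport η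
  · have hE := Z.thickness_pos (ha.trans (hηs hp).1.le)
    unfold cutoffMode
    refine ContDiffAt.mul (hη.contDiffAt.comp p contDiffAt_fst) (ContDiffAt.mul ?_
      (Z.contDiffAt_mode hσ w hE))
    exact ContDiffAt.comp (g := χ) (f := fun p : ℝ × ℝ => p.2 / Z.thickness p.1) p
      hχ.contDiffAt (contDiffAt_snd.div
      (Z.contDiff_thickness.contDiffAt.comp p contDiffAt_fst) hE.ne')
  · have h : Z.cutoffMode σ w η χ =ᶠ[𝓝 p] fun _ => 0 := by
      have h1 : ∀ᶠ r in 𝓝 p, r.1 ∈ (tsupport η)ᶜ :=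
        continuousAt_fst.eventually_mem ((isClosed_tsupport η).isOpen_compl.mem_nhds hp)
      filter_upwards [h1] with r hr
      rw [cutoffMode, image_eq_zero_of_notMem_tsupport hr, zero_mul]
    exact contDiffAt_const.congr_of_eventuallyEq h

lemma tsupport_cutoffMode_subset (σ w : ℝ) {a S : ℝ} (ha : 0 ≤ a) {η χ : ℝ → ℝ}
    (hηc : HasCompactSupport η) (hηs : tsupport η ⊆ Ioo a S) (hχc : HasCompactSupport χ)
    (hχs : tsupport χ ⊆ Ioo 0 1) :
    HasCompactSupport (Z.cutoffMode σ w η χ) ∧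
      tsupport (Z.cutoffMode σ w η χ) ⊆ Z.region a S := by
  set K := (fun r : ℝ × ℝ => (r.1, r.2 * Z.thickness r.1)) '' (tsupport η ×ˢ tsupport χ) with hK
  have hKc : IsCompact K := by
    refine (IsCompact.prod hηc hχc).image ?_
    fun_prop
  have hKs : K ⊆ Z.region a S := by
    rintro _ ⟨⟨t, y⟩, ⟨h1, h2⟩, rfl⟩
    have h3 := hηs h1
    have h4 := hχs h2
    have hE := Z.thickness_pos (ha.trans h3.1.le)
    refine ⟨h3.1, EReal.coe_lt_coe_iff.2 h3.2, mul_pos h4.1 hE, ?_⟩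
    exact mul_lt_of_lt_one_left hE h4.2
  have hsub : Function.support (Z.cutoffMode σ w η χ) ⊆ K := by
    intro p hp
    have h1 : p.1 ∈ tsupport η := by
      by_contra h
      exact hp (by rw [cutoffMode, image_eq_zero_of_notMem_tsupport h, zero_mul])
    have h2 : p.2 / Z.thickness p.1 ∈ tsupport χ := by
      by_contra h
      exact hp (by rw [cutoffMode, image_eq_zero_of_notMem_tsupport h, zero_mul, mul_zero])
    have hE := Z.thickness_pos (ha.trans (hηs h1).1.le)
    exact ⟨(p.1, p.2 / Z.thickness p.1), ⟨h1, h2⟩, by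
      simp only [div_mul_cancel₀ _ hE.ne']⟩
  exact ⟨HasCompactSupport.of_support_subset_isCompact hKc hsub,
    (closure_minimal hsub hKc.isClosed).trans hKs⟩

lemma fderiv_cutoffMode {σ : ℝ} (hσ : σ ≠ 0) (w : ℝ) {a S : ℝ} (ha : 0 ≤ a) {η χ : ℝ → ℝ}
    (hη : ContDiff ℝ ∞ η) (hηs : tsupport η ⊆ Ioo a S) (hχ : ContDiff ℝ ∞ χ) {p : ℝ × ℝ}
    (hp : 0 < Z.thickness p.1) :
    fderiv ℝ (Z.cutoffMode σ w η χ) p (1, 0) =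
      deriv η p.1 * (χ (p.2 / Z.thickness p.1) * Z.mode σ w p.1 p.2) +
      η p.1 * (deriv χ (p.2 / Z.thickness p.1) * -(p.2 * Z.speed / Z.thickness p.1 ^ 2) *
          Z.mode σ w p.1 p.2 +
        χ (p.2 / Z.thickness p.1) * (σ * Z.modeXX σ w p.1 p.2)) := by
  have h1 := ((Z.contDiff_cutoffMode hσ w ha hη hηs hχ).differentiable (by simp) p).hasFDerivAt
  have h2 : HasDerivAt (fun t : ℝ => (t, p.2)) ((1 : ℝ), (0 : ℝ)) p.1 :=
    (hasDerivAt_id p.1).prodMk (hasDerivAt_const p.1 p.2)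
  have h3 := HasFDerivAt.comp_hasDerivAt (f := fun t : ℝ => (t, p.2)) p.1 h1 h2
  have h4 : HasDerivAt (fun t => p.2 / Z.thickness t) (-(p.2 * Z.speed / Z.thickness p.1 ^ 2)) p.1 := by
    refine ((hasDerivAt_const p.1 p.2).div (Z.hasDerivAt_thickness p.1) hp.ne').congr_deriv ?_
    ring
  have h5 := HasDerivAt.comp (h₂ := χ) (h := fun t => p.2 / Z.thickness t) p.1
    ((hχ.differentiable (by simp)) _).hasDerivAt h4
  have h6 := (((hη.differentiable (by simp)) p.1).hasDerivAt).mul (h5.mul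
    (Z.hasDerivAt_mode_t hσ hp w p.2))
  rw [h3.unique (h6.congr_of_eventuallyEq (Eventually.of_forall fun t => by rfl))]
  simp only [Pi.mul_apply, Function.comp_apply]

variable {Z}

section Slice

variable {σ a S : ℝ} {f ft fx fxx : ℝ → ℝ → ℝ}

lemma integral_slice_eq_intervalIntegral {t : ℝ} (ht : 0 < Z.thickness t) (F : ℝ → ℝ) :
    ∫ x, F x ∂Z.slice t = ∫ x in (0 : ℝ)..Z.thickness t, F x := by
  rw [slice, intervalIntegral.integral_of_le ht.le, integral_Ioc_eq_integral_Ioo]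

lemma MemLp.intervalIntegrable_slice {t : ℝ} (ht : 0 < Z.thickness t) {F : ℝ → ℝ}
    (hF : MemLp F 2 (Z.slice t)) : IntervalIntegrable F volume 0 (Z.thickness t) := by
  rw [intervalIntegrable_iff_integrableOn_Ioo_of_le ht.le]
  exact hF.integrable (by norm_num)

lemma integrable_slice_continuous_mul {t : ℝ} {F f : ℝ → ℝ} (hF : Continuous F)
    (hf : MemLp f 2 (Z.slice t)) : Integrable (fun x => F x * f x) (Z.slice t) := by
  obtain ⟨C, hC⟩ := isCompact_Icc.exists_bound_of_continuousOn
    (hF.continuousOn (s := Icc 0 (Z.thickness t)))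
  refine (hf.integrable (by norm_num)).bdd_mul hF.aestronglyMeasurable (c := C) ?_
  filter_upwards [ae_restrict_mem measurableSet_Ioo] with x hx
  exact hC x (Ioo_subset_Icc_self hx)

lemma continuous_mode_x (σ w t : ℝ) : Continuous (Z.mode σ w t) :=
  continuous_iff_continuousAt.2 fun x => (Z.hasDerivAt_mode_x σ w t x).continuousAt

lemma continuous_modeX_x {t : ℝ} (hσ : σ ≠ 0) (ht : 0 < Z.thickness t) (w : ℝ) :
    Continuous (Z.modeX σ w t) :=
  continuous_iff_continuousAt.2 fun x => (Z.hasDerivAt_modeX_x hσ ht w x).continuousAt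

lemma continuous_modeXX_x {t : ℝ} (hσ : σ ≠ 0) (ht : 0 < Z.thickness t) (w : ℝ) :
    Continuous (Z.modeXX σ w t) :=
  continuous_iff_continuousAt.2 fun x => by
    have h := Z.continuousAt_modeXX hσ w (p := (t, x)) ht
    exact ContinuousAt.comp (f := fun x => (t, x)) (g := fun p : ℝ × ℝ => Z.modeXX σ w p.1 p.2)
      h (by fun_prop)

/-- Data of a test function on a generic slice. -/
structure IsSliceTest (Z : TargetState n) (σ t : ℝ) (f ft fx fxx : ℝ → ℝ) : Prop where
  memLp : MemLp f 2 (Z.slice t)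
  memLp_t : MemLp ft 2 (Z.slice t)
  memLp_x : MemLp fx 2 (Z.slice t)
  memLp_xx : MemLp fxx 2 (Z.slice t)
  deriv_x : ∀ x ∈ Icc 0 (Z.thickness t), f x = f 0 + ∫ y in (0 : ℝ)..x, fx y
  deriv_xx : ∀ x ∈ Icc 0 (Z.thickness t), fx x = fx 0 + ∫ y in (0 : ℝ)..x, fxx y
  left : fx 0 = 0
  right : σ * fx (Z.thickness t) = Z.speed / 2 * f (Z.thickness t)

lemma IsScalarTest.ae_isSliceTest (hf : Z.IsScalarTest σ a S f ft fx fxx) :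
    ∀ᵐ t ∂volume.restrict (Ioo a S), Z.IsSliceTest σ t (f t) (ft t) (fx t) (fxx t) := by
  have h1 := ae_memLp_slice hf.memLp
  have h2 := ae_memLp_slice hf.memLp_t
  have h3 := ae_memLp_slice hf.memLp_x
  have h4 := ae_memLp_slice hf.memLp_xx
  rw [times_coe] at h1 h2 h3 h4
  filter_upwards [h1, h2, h3, h4, hf.deriv_x, hf.deriv_xx, hf.boundary_left, hf.boundary_right]
    with t g1 g2 g3 g4 g5 g6 g7 g8
  exact ⟨g1, g2, g3, g4, g5, g6, g7, g8⟩

variable {t : ℝ} {f ft fx fxx : ℝ → ℝ}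

/-- Integration by parts against the weight `x` writes the trace as an interior integral, which
makes its integrability in time a matter of Fubini. -/
lemma IsSliceTest.thickness_mul_trace (hf : Z.IsSliceTest σ t f ft fx fxx)
    (ht : 0 < Z.thickness t) :
    Z.thickness t * f (Z.thickness t) = ∫ x, (f x + x * fx x) ∂Z.slice t := by
  have h := integral_mul_primitive ht.le (ψ := id) (ψ' := fun _ => 1) (f := f) (f' := fx)
    (fun x _ => hasDerivAt_id x) continuousOn_const (MemLp.intervalIntegrable_slice ht hf.memLp_x)
    hf.deriv_x
  rw [integral_slice_eq_intervalIntegral ht]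
  simp only [id, one_mul, zero_mul, sub_zero] at h
  exact h.symm

/-- The cut-off lives on the moving domain, so its time derivative involves `χ'`. An integration by
parts in space moves this derivative to the other factors; afterwards only the bounded function `χ`
occurs and can tend to one. -/
lemma IsSliceTest.integral_cutoff (hσ : σ ≠ 0) (hf : Z.IsSliceTest σ t f ft fx fxx)
    (ht : 0 < Z.thickness t) (w : ℝ) {χ χ' : ℝ → ℝ} (hχ1 : Continuous χ) (hχ2 : Continuous χ')
    (hχ : ∀ x, HasDerivAt χ (χ' x * (1 / Z.thickness t)) x) (h0 : χ 0 = 0)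
    (h1 : χ (Z.thickness t) = 0) (r r' : ℝ) :
    ∫ x, (f x * (r' * (χ x * Z.mode σ w t x) +
      r * (χ' x * -(x * Z.speed / Z.thickness t ^ 2) * Z.mode σ w t x +
        χ x * (σ * Z.modeXX σ w t x))) +
        ft x * (r * (χ x * Z.mode σ w t x))) ∂Z.slice t =
      ∫ x, χ x * (r' * (Z.mode σ w t x * f x) + r * (
        (σ * Z.modeXX σ w t x + Z.speed / Z.thickness t *
          (Z.mode σ w t x + x * Z.modeX σ w t x)) * f x +
        Z.mode σ w t x * ft x + x * Z.speed / Z.thickness t * Z.mode σ w t x * fx x))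
          ∂Z.slice t := by
  set E := Z.thickness t with hE
  have m0 := continuous_mode_x (Z := Z) σ w t
  have m1 := continuous_modeX_x hσ ht w
  have m2 := continuous_modeXX_x hσ ht w
  have hm : ∀ x, HasDerivAt (fun x => χ x * (x * Z.speed / E * Z.mode σ w t x))
      (χ' x * (1 / E) * (x * Z.speed / E * Z.mode σ w t x) +
        χ x * (Z.speed / E * Z.mode σ w t x + x * Z.speed / E * Z.modeX σ w t x)) x := by
    intro x
    have g2 : HasDerivAt (fun x => x * Z.speed / E) (Z.speed / E) x := by
      simpa using ((hasDerivAt_id x).mul_const Z.speed).div_const E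
    exact (hχ x).mul (g2.mul (Z.hasDerivAt_mode_x σ w t x))
  -- The weight is `x v̄ / ē`, the velocity with which the points of the domain move; `χ` vanishes
  -- at both ends, so there is no boundary term.
  have key := integral_mul_primitive ht.le
    (ψ := fun x => χ x * (x * Z.speed / E * Z.mode σ w t x)) (f := f) (f' := fx)
    (fun x _ => hm x) (by fun_prop) (MemLp.intervalIntegrable_slice ht hf.memLp_x) hf.deriv_x
  rw [h1, h0, zero_mul, zero_mul, zero_mul, zero_mul, sub_zero,
    ← integral_slice_eq_intervalIntegral ht] at key
  rw [← sub_eq_zero, ← integral_sub]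
  · rw [← neg_eq_zero, ← mul_eq_zero_of_right r key, ← integral_const_mul, ← integral_neg]
    refine integral_congr_ae (ae_of_all _ fun x => ?_)
    simp only
    field_simp
    ring
  · have i1 := integrable_slice_continuous_mul (t := t)
      (F := fun x => r' * (χ x * Z.mode σ w t x) +
      r * (χ' x * -(x * Z.speed / E ^ 2) * Z.mode σ w t x +
        χ x * (σ * Z.modeXX σ w t x))) (by fun_prop) hf.memLp
    have i2 := integrable_slice_continuous_mul (t := t)
      (F := fun x => r * (χ x * Z.mode σ w t x)) (by fun_prop) hf.memLp_t
    refine (i1.add i2).congr (ae_of_all _ fun x => ?_)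
    simp only [Pi.add_apply]; ring
  · have i1 := integrable_slice_continuous_mul (t := t)
      (F := fun x => χ x * (r' * Z.mode σ w t x + r * (σ * Z.modeXX σ w t x +
        Z.speed / E * (Z.mode σ w t x + x * Z.modeX σ w t x)))) (by fun_prop) hf.memLp
    have i2 := integrable_slice_continuous_mul (t := t)
      (F := fun x => χ x * (r * Z.mode σ w t x)) (by fun_prop) hf.memLp_t
    have i3 := integrable_slice_continuous_mul (t := t)
      (F := fun x => χ x * (r * (x * Z.speed / E * Z.mode σ w t x)))
      (by fun_prop) hf.memLp_x
    refine ((i1.add i2).add i3).congr (ae_of_all _ fun x => ?_)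
    simp only [Pi.add_apply]; ring

/-- Without cut-off the velocity term contributes `v̄ φ f` at the moving end, for the mode `φ`. With
Green's formula for `σ ∂ₓₓ` and the adjoint Robin condition of `f`, half of it is cancelled and
exactly the boundary flux of `φ` times `f` remains. -/
lemma IsSliceTest.integral_boundary (hσ : σ ≠ 0) (hf : Z.IsSliceTest σ t f ft fx fxx)
    (ht : 0 < Z.thickness t) (w r r' : ℝ) :
    ∫ x, (r' * (Z.mode σ w t x * f x) + r * (
        (σ * Z.modeXX σ w t x + Z.speed / Z.thickness t *
          (Z.mode σ w t x + x * Z.modeX σ w t x)) * f x +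
        Z.mode σ w t x * ft x + x * Z.speed / Z.thickness t * Z.mode σ w t x * fx x)) ∂Z.slice t =
      r' * (∫ x, Z.mode σ w t x * f x ∂Z.slice t) +
      r * ((∫ x, Z.mode σ w t x * (ft x + σ * fxx x) ∂Z.slice t) +
        Z.boundaryFlux σ w t * f (Z.thickness t)) := by
  set E := Z.thickness t with hE
  have m0 := continuous_mode_x (Z := Z) σ w t
  have m1 := continuous_modeX_x hσ ht w
  have m2 := continuous_modeXX_x hσ ht w
  have k1 := integral_mul_primitive ht.le
    (ψ := fun x => x * Z.speed / E * Z.mode σ w t x) (f := f) (f' := fx)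
    (fun x _ => (((hasDerivAt_id x).mul_const Z.speed).div_const E).mul
      (Z.hasDerivAt_mode_x σ w t x)) (by simp only [id]; fun_prop)
      (MemLp.intervalIntegrable_slice ht hf.memLp_x) hf.deriv_x
  have k2 := integral_mul_primitive ht.le
    (ψ := Z.modeX σ w t) (f := f) (f' := fx)
    (fun x _ => Z.hasDerivAt_modeX_x hσ ht w x) (by fun_prop)
      (MemLp.intervalIntegrable_slice ht hf.memLp_x) hf.deriv_x
  have k3 := integral_mul_primitive ht.le
    (ψ := Z.mode σ w t) (f := fx) (f' := fxx)
    (fun x _ => Z.hasDerivAt_mode_x σ w t x) (by fun_prop)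
      (MemLp.intervalIntegrable_slice ht hf.memLp_xx) hf.deriv_xx
  rw [← integral_slice_eq_intervalIntegral ht] at k1 k2 k3
  simp only [zero_mul, zero_div, sub_zero, modeX_zero, hf.left, mul_zero, id, one_mul] at k1 k2 k3
  rw [mul_div_cancel_left₀ _ ht.ne'] at k1
  have hb := Z.boundaryFlux_eq hσ ht w
  have hr := hf.right
  rw [← hE] at hb hr
  have e : Z.boundaryFlux σ w t * f E = (Z.speed * Z.mode σ w t E * f E) +
      (σ * (Z.modeX σ w t E * f E) - σ * (Z.mode σ w t E * fx E)) := by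
    rw [← hb, show σ * (Z.mode σ w t E * fx E) = Z.mode σ w t E * (σ * fx E) by ring, hr]
    ring
  have j1 := integrable_slice_continuous_mul m0 hf.memLp
  have j2 := integrable_slice_continuous_mul m0 hf.memLp_t
  have j3 := integrable_slice_continuous_mul m0 hf.memLp_xx
  have j4 := integrable_slice_continuous_mul m2 hf.memLp
  have j5 := integrable_slice_continuous_mul m1 hf.memLp_x
  have j6 := integrable_slice_continuous_mul m0 hf.memLp_x
  have j7 := integrable_slice_continuous_mul (t := t) (F := fun x => x * Z.modeX σ w t x)
    (by fun_prop) hf.memLp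
  have j8 := integrable_slice_continuous_mul (t := t) (F := fun x => x * Z.mode σ w t x)
    (by fun_prop) hf.memLp_x
  have j9 := integrable_slice_continuous_mul m1 hf.memLp_x
  have l1 : Integrable (fun x => Z.mode σ w t x * (ft x + σ * fxx x)) (Z.slice t) := by
    refine (j2.add (j3.const_mul σ)).congr (ae_of_all _ fun x => ?_)
    simp only [Pi.add_apply]; ring
  have l2 : Integrable (fun x => (Z.speed / E * Z.mode σ w t x +
      x * Z.speed / E * Z.modeX σ w t x) * f x + x * Z.speed / E * Z.mode σ w t x * fx x)
      (Z.slice t) := by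
    refine ((j1.const_mul (Z.speed / E)).add ((j7.const_mul (Z.speed / E)).add
      (j8.const_mul (Z.speed / E)))).congr (ae_of_all _ fun x => ?_)
    simp only [Pi.add_apply]; ring
  have l3 : Integrable (fun x => Z.modeXX σ w t x * f x + Z.modeX σ w t x * fx x) (Z.slice t) :=
    j4.add j9
  have l4 : Integrable (fun x => Z.modeX σ w t x * fx x + Z.mode σ w t x * fxx x) (Z.slice t) :=
    j5.add j3
  have l5 := integrable_fun_sub (l3.const_mul σ) (l4.const_mul σ)
  have l6 := integrable_fun_add l2 l5
  have l6' := integrable_fun_add l1 l6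
  rw [e, ← k1, ← k2, ← k3, ← integral_const_mul, ← integral_const_mul, ← integral_const_mul,
    ← integral_sub (l3.const_mul σ) (l4.const_mul σ), ← integral_add l2 l5,
    ← integral_add l1 l6, ← integral_const_mul,
    ← integral_add (j1.const_mul r') (l6'.const_mul r)]
  refine integral_congr_ae (ae_of_all _ fun x => ?_)
  simp only
  ring

end Slice

end TargetState

end CrossDiffusion

/-! ### Green's identity on the space-time domain -/

namespace CrossDiffusion

/-- Cut-off functions in `(0, 1)` that converge to one. -/
lemma exists_cutoff_sequence : ∃ χ : ℕ → ℝ → ℝ, (∀ j, ContDiff ℝ ∞ (χ j)) ∧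
    (∀ j, HasCompactSupport (χ j)) ∧ (∀ j, tsupport (χ j) ⊆ Ioo 0 1) ∧ (∀ j y, |χ j y| ≤ 1) ∧
    ∀ y ∈ Ioo (0 : ℝ) 1, Tendsto (fun j => χ j y) atTop (𝓝 1) := by
  have hr : ∀ j : ℕ, (1 : ℝ) / (j + 4) < 1 / (j + 3) ∧ (0 : ℝ) < 1 / (j + 4) ∧
      (1 : ℝ) / (j + 3) < 1 / 2 := by
    intro j
    have : (0 : ℝ) ≤ j := j.cast_nonneg
    exact ⟨one_div_lt_one_div_of_lt (by positivity) (by linarith), by positivity,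
      one_div_lt_one_div_of_lt (by positivity) (by linarith)⟩
  let B : ∀ j : ℕ, ContDiffBump ((1 : ℝ) / 2) := fun j =>
    ⟨1 / 2 - 1 / (j + 3), 1 / 2 - 1 / (j + 4), by linarith [(hr j).2.2], by linarith [(hr j).1]⟩
  refine ⟨fun j => B j, fun j => (B j).contDiff, fun j => (B j).hasCompactSupport, fun j y hy => ?_,
    fun j y => ?_, fun y hy => ?_⟩
  · rw [(B j).tsupport_eq, Metric.mem_closedBall, Real.dist_eq] at hy
    have h1 := abs_le.1 hy
    have h2 := (hr j).2.1
    simp only [B] at h1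
    constructor <;> linarith
  · rw [abs_of_nonneg (B j).nonneg]
    exact (B j).le_one
  · have h1 : Tendsto (fun j : ℕ => (1 : ℝ) / 2 - 1 / (j + 3)) atTop (𝓝 (1 / 2 - 0)) := by
      refine tendsto_const_nhds.sub ?_
      have := (tendsto_add_atTop_iff_nat 2).2 (tendsto_one_div_add_atTop_nhds_zero_nat (𝕜 := ℝ))
      refine this.congr fun j => ?_
      push_cast; ring_nf
    have h2 : |y - 1 / 2| < 1 / 2 - 0 := by
      rw [abs_lt]; constructor <;> linarith [hy.1, hy.2]
    refine tendsto_const_nhds.congr' ?_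
    filter_upwards [h1.eventually_const_lt h2] with j hj
    refine ((B j).one_of_mem_closedBall ?_).symm
    rw [Metric.mem_closedBall, Real.dist_eq]
    exact hj.le

namespace TargetState

variable {n : ℕ} {Z : TargetState n} {σ a S : ℝ} {f ft fx fxx : ℝ → ℝ → ℝ}

lemma continuousOn_closedRegion {E : Type*} [TopologicalSpace E] (ha : 0 ≤ a) {F : ℝ × ℝ → E}
    (hF : ∀ p : ℝ × ℝ, 0 < Z.thickness p.1 → ContinuousAt F p) :
    ContinuousOn F (Z.closedRegion a S) := fun p hp =>
  (hF p (Z.thickness_pos (ha.trans hp.1.1))).continuousWithinAt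

lemma integrable_mul_of_continuousAt (ha : 0 ≤ a) {F f : ℝ × ℝ → ℝ}
    (hF : ∀ p : ℝ × ℝ, 0 < Z.thickness p.1 → ContinuousAt F p)
    (hf : MemLp f 2 (Z.regionMeasure a S)) :
    Integrable (fun p => F p * f p) (Z.regionMeasure a S) :=
  integrable_continuousOn_mul (continuousOn_closedRegion ha hF) hf

/-- The density in Green's identity. -/
noncomputable def greenDensity (Z : TargetState n) (σ w : ℝ) (η : ℝ → ℝ) (f ft fx : ℝ → ℝ → ℝ)
    (p : ℝ × ℝ) : ℝ :=
  deriv η p.1 * (Z.mode σ w p.1 p.2 * f p.1 p.2) + η p.1 * (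
    (σ * Z.modeXX σ w p.1 p.2 + Z.speed / Z.thickness p.1 *
      (Z.mode σ w p.1 p.2 + p.2 * Z.modeX σ w p.1 p.2)) * f p.1 p.2 +
    Z.mode σ w p.1 p.2 * ft p.1 p.2 +
    p.2 * Z.speed / Z.thickness p.1 * Z.mode σ w p.1 p.2 * fx p.1 p.2)

lemma IsScalarTest.integrable_greenDensity (hσ : σ ≠ 0) (ha : 0 ≤ a)
    (hf : Z.IsScalarTest σ a S f ft fx fxx) (w : ℝ) {η : ℝ → ℝ} (hη : ContDiff ℝ ∞ η) :
    Integrable (Z.greenDensity σ w η f ft fx) (Z.regionMeasure a S) := by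
  have hη0 : ∀ p : ℝ × ℝ, ContinuousAt (fun p : ℝ × ℝ => η p.1) p := fun p =>
    (hη.continuous.comp continuous_fst).continuousAt
  have hη1 : ∀ p : ℝ × ℝ, ContinuousAt (fun p : ℝ × ℝ => deriv η p.1) p := fun p =>
    ((hη.continuous_deriv (by simp)).comp continuous_fst).continuousAt
  have m0 : ∀ p : ℝ × ℝ, 0 < Z.thickness p.1 → ContinuousAt (fun p : ℝ × ℝ => Z.mode σ w p.1 p.2) p :=
    fun p hp => Z.continuousAt_mode hσ w hp
  have m1 : ∀ p : ℝ × ℝ, 0 < Z.thickness p.1 → ContinuousAt (fun p : ℝ × ℝ => Z.modeX σ w p.1 p.2) p :=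
    fun p hp => Z.continuousAt_modeX hσ w hp
  have m2 : ∀ p : ℝ × ℝ, 0 < Z.thickness p.1 →
      ContinuousAt (fun p : ℝ × ℝ => Z.modeXX σ w p.1 p.2) p :=
    fun p hp => Z.continuousAt_modeXX hσ w hp
  have me : ∀ p : ℝ × ℝ, 0 < Z.thickness p.1 →
      ContinuousAt (fun p : ℝ × ℝ => Z.speed / Z.thickness p.1) p := fun p hp =>
    ContinuousAt.div (by fun_prop) (by fun_prop) hp.ne'
  have mv : ∀ p : ℝ × ℝ, 0 < Z.thickness p.1 →
      ContinuousAt (fun p : ℝ × ℝ => p.2 * Z.speed / Z.thickness p.1) p := fun p hp =>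
    ContinuousAt.div (by fun_prop) (by fun_prop) hp.ne'
  have i1 := integrable_mul_of_continuousAt ha (F := fun p => deriv η p.1 * Z.mode σ w p.1 p.2 +
    η p.1 * (σ * Z.modeXX σ w p.1 p.2 + Z.speed / Z.thickness p.1 *
      (Z.mode σ w p.1 p.2 + p.2 * Z.modeX σ w p.1 p.2)))
    (fun p hp => ((hη1 p).mul (m0 p hp)).add ((hη0 p).mul (((m2 p hp).const_mul σ).add
      ((me p hp).mul ((m0 p hp).add (continuousAt_snd.mul (m1 p hp))))))) hf.memLp
  have i2 := integrable_mul_of_continuousAt ha (F := fun p => η p.1 * Z.mode σ w p.1 p.2)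
    (fun p hp => (hη0 p).mul (m0 p hp)) hf.memLp_t
  have i3 := integrable_mul_of_continuousAt ha
    (F := fun p => η p.1 * (p.2 * Z.speed / Z.thickness p.1 * Z.mode σ w p.1 p.2))
    (fun p hp => (hη0 p).mul ((mv p hp).mul (m0 p hp))) hf.memLp_x
  refine ((i1.add i2).add i3).congr (ae_of_all _ fun p => ?_)
  simp only [greenDensity, Pi.add_apply, Function.uncurry]
  ring

/-- The cut-off mode is an admissible function in the definition of the weak time derivative; the
slice identity then rewrites the outcome without `χ'`. -/
lemma IsScalarTest.integral_cutoff_greenDensity (hσ : σ ≠ 0) (ha : 0 ≤ a)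
    (hf : Z.IsScalarTest σ a S f ft fx fxx) (w : ℝ) {η χ : ℝ → ℝ} (hη : ContDiff ℝ ∞ η)
    (hηc : HasCompactSupport η) (hηs : tsupport η ⊆ Ioo a S) (hχ : ContDiff ℝ ∞ χ)
    (hχc : HasCompactSupport χ) (hχs : tsupport χ ⊆ Ioo 0 1) :
    Integrable (fun p : ℝ × ℝ => χ (p.2 / Z.thickness p.1) * Z.greenDensity σ w η f ft fx p)
      (Z.regionMeasure a S) ∧
    ∫ p : ℝ × ℝ, χ (p.2 / Z.thickness p.1) * Z.greenDensity σ w η f ft fx p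
      ∂Z.regionMeasure a S = 0 := by
  have hφ := Z.contDiff_cutoffMode hσ w ha hη hηs hχ
  obtain ⟨hφc, hφs⟩ := Z.tsupport_cutoffMode_subset σ w ha hηc hηs hχc hχs
  have hi : Integrable (fun p : ℝ × ℝ => χ (p.2 / Z.thickness p.1) *
      Z.greenDensity σ w η f ft fx p) (Z.regionMeasure a S) := by
    obtain ⟨h1, C, hC⟩ := exists_bound_regionMeasure (Z := Z) (a := a) (S := S)
      (F := fun p : ℝ × ℝ => χ (p.2 / Z.thickness p.1))
      (continuousOn_closedRegion ha fun p hp => ContinuousAt.comp (g := χ)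
        (f := fun p : ℝ × ℝ => p.2 / Z.thickness p.1) hχ.continuous.continuousAt
        (ContinuousAt.div (by fun_prop) (by fun_prop) hp.ne'))
    exact (hf.integrable_greenDensity hσ ha w hη).bdd_mul h1 hC
  refine ⟨hi, ?_⟩
  have h0 := hf.deriv_t _ hφ hφc hφs
  have hd : Continuous fun p => fderiv ℝ (Z.cutoffMode σ w η χ) p (1, 0) :=
    (hφ.continuous_fderiv (by simp)).clm_apply continuous_const
  have i1 := integrable_continuousOn_mul (hd.continuousOn (s := Z.closedRegion a S)) hf.memLp
  have i2 := integrable_continuousOn_mul (hφ.continuous.continuousOn (s := Z.closedRegion a S))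
    hf.memLp_t
  have i3 : Integrable (fun p : ℝ × ℝ => f p.1 p.2 * fderiv ℝ (Z.cutoffMode σ w η χ) p (1, 0) +
      ft p.1 p.2 * Z.cutoffMode σ w η χ p) (Z.regionMeasure a S) := by
    refine (i1.add i2).congr (ae_of_all _ fun p => ?_)
    simp only [Pi.add_apply, Function.uncurry]; ring
  have h1 : ∫ p : ℝ × ℝ, (f p.1 p.2 * fderiv ℝ (Z.cutoffMode σ w η χ) p (1, 0) +
      ft p.1 p.2 * Z.cutoffMode σ w η χ p) ∂Z.regionMeasure a S = 0 := by
    rw [integral_add, h0, neg_add_cancel]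
    · exact i1.congr (ae_of_all _ fun p => mul_comm _ _)
    · exact i2.congr (ae_of_all _ fun p => mul_comm _ _)
  rw [integral_region hi, ← h1, integral_region i3, times_coe]
  refine integral_congr_ae ?_
  filter_upwards [hf.ae_isSliceTest, ae_restrict_mem measurableSet_Ioo] with t ht htm
  have hE := Z.thickness_pos (ha.trans htm.1.le)
  have h2 := ht.integral_cutoff hσ hE w (χ := fun x => χ (x / Z.thickness t))
    (χ' := fun x => deriv χ (x / Z.thickness t)) (hχ.continuous.comp (by fun_prop))
    ((hχ.continuous_deriv (by simp)).comp (by fun_prop))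
    (fun x => HasDerivAt.comp (h₂ := χ) (h := fun x => x / Z.thickness t) x
        ((hχ.differentiable (by simp)) _).hasDerivAt ((hasDerivAt_id x).div_const _))
    (by rw [zero_div]; exact image_eq_zero_of_notMem_tsupport fun h => lt_irrefl _ (hχs h).1)
    (by rw [div_self hE.ne']; exact image_eq_zero_of_notMem_tsupport fun h => lt_irrefl _ (hχs h).2)
    (η t) (deriv η t)
  refine (Eq.trans ?_ h2).symm
  refine integral_congr_ae (ae_of_all _ fun x => ?_)
  simp only
  rw [Z.fderiv_cutoffMode hσ w ha hη hηs hχ (p := (t, x)) hE]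
  rfl

/-- The value at the end point of the slices is integrable in time. -/
lemma IsScalarTest.integrableOn_trace (ha : 0 ≤ a) (hf : Z.IsScalarTest σ a S f ft fx fxx) :
    IntegrableOn (fun t => f t (Z.thickness t)) (Ioo a S) := by
  have i1 := integrable_mul_of_continuousAt ha (F := fun p => 1 / Z.thickness p.1)
    (fun p hp => ContinuousAt.div (by fun_prop) (by fun_prop) hp.ne') hf.memLp
  have i2 := integrable_mul_of_continuousAt ha (F := fun p => p.2 / Z.thickness p.1)
    (fun p hp => ContinuousAt.div (by fun_prop) (by fun_prop) hp.ne') hf.memLp_x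
  have h := integrable_integral_slice (i1.add i2)
  rw [times_coe] at h
  refine h.congr ?_
  filter_upwards [hf.ae_isSliceTest, ae_restrict_mem measurableSet_Ioo] with t ht htm
  have hE := Z.thickness_pos (ha.trans htm.1.le)
  rw [eq_comm, ← mul_right_inj' hE.ne', ht.thickness_mul_trace hE, ← integral_const_mul]
  refine integral_congr_ae (ae_of_all _ fun x => ?_)
  simp only [Pi.add_apply, Function.uncurry]
  field_simp

lemma IsScalarTest.integrable_mode_mul (hσ : σ ≠ 0) (ha : 0 ≤ a)
    (hf : Z.IsScalarTest σ a S f ft fx fxx) (w : ℝ) :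
    Integrable (fun p : ℝ × ℝ => Z.mode σ w p.1 p.2 * (ft p.1 p.2 + σ * fxx p.1 p.2))
      (Z.regionMeasure a S) := by
  have m0 : ∀ p : ℝ × ℝ, 0 < Z.thickness p.1 → ContinuousAt (fun p : ℝ × ℝ => Z.mode σ w p.1 p.2) p :=
    fun p hp => Z.continuousAt_mode hσ w hp
  refine ((integrable_mul_of_continuousAt ha m0 hf.memLp_t).add
    ((integrable_mul_of_continuousAt ha m0 hf.memLp_xx).const_mul σ)).congr (ae_of_all _ fun p => ?_)
  simp only [Pi.add_apply, Function.uncurry]; ring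

lemma continuousAt_boundaryFlux (hσ : σ ≠ 0) (w : ℝ) {t : ℝ} (ht : 0 ≤ t) :
    ContinuousAt (Z.boundaryFlux σ w) t := by
  have hE := Z.thickness_pos ht
  have h1 : ContinuousAt (fun t => Z.amp σ t (Z.thickness t)) t := by
    refine ContinuousAt.comp (f := fun t => (t, Z.thickness t))
      (g := fun p : ℝ × ℝ => Z.amp σ p.1 p.2) (Z.continuousAt_amp hσ hE) (by fun_prop)
  have h2 := Z.continuousAt_decay_scaledTime σ w ht
  unfold boundaryFlux
  exact (((ContinuousAt.div (by fun_prop) (by fun_prop) hE.ne').mul h1).mul_const _).mul h2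

lemma integrableOn_continuous_mul {a S : ℝ} {F f : ℝ → ℝ} (hF : ContinuousOn F (Icc a S))
    (hf : IntegrableOn f (Ioo a S)) : IntegrableOn (fun t => F t * f t) (Ioo a S) := by
  obtain ⟨C, hC⟩ := isCompact_Icc.exists_bound_of_continuousOn hF
  refine hf.bdd_mul ((hF.mono Ioo_subset_Icc_self).aestronglyMeasurable measurableSet_Ioo)
    (c := C) ?_
  filter_upwards [ae_restrict_mem measurableSet_Ioo] with t ht
  exact hC t (Ioo_subset_Icc_self ht)

/-- Green's identity for a test function and an explicit solution of the heat equation. -/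
theorem IsScalarTest.green (hσ : σ ≠ 0) (ha : 0 ≤ a)
    (hf : Z.IsScalarTest σ a S f ft fx fxx) (w : ℝ)
    (hg : ContinuousOn (fun t => ∫ x, Z.mode σ w t x * f t x ∂Z.slice t) (Icc a S)) :
    IntegrableOn (fun t => (∫ x, Z.mode σ w t x * (ft t x + σ * fxx t x) ∂Z.slice t) +
        Z.boundaryFlux σ w t * f t (Z.thickness t)) (Ioo a S) ∧
    ∀ c d, a ≤ c → c ≤ d → d ≤ S →
      (∫ x, Z.mode σ w d x * f d x ∂Z.slice d) - (∫ x, Z.mode σ w c x * f c x ∂Z.slice c) =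
        ∫ t in c..d, ((∫ x, Z.mode σ w t x * (ft t x + σ * fxx t x) ∂Z.slice t) +
          Z.boundaryFlux σ w t * f t (Z.thickness t)) := by
  have hG : IntegrableOn (fun t => (∫ x, Z.mode σ w t x * (ft t x + σ * fxx t x) ∂Z.slice t) +
      Z.boundaryFlux σ w t * f t (Z.thickness t)) (Ioo a S) := by
    have h1 := integrable_integral_slice (hf.integrable_mode_mul hσ ha w)
    rw [times_coe] at h1
    exact h1.add (integrableOn_continuous_mul (fun t ht =>
      (continuousAt_boundaryFlux hσ w (ha.trans ht.1)).continuousWithinAt)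
      (hf.integrableOn_trace ha))
  refine ⟨hG, fun c d hc hcd hd => ?_⟩
  refine sub_eq_integral_of_weak_deriv (g := fun t => ∫ x, Z.mode σ w t x * f t x ∂Z.slice t)
    hg hG (fun η hη hηc hηs => ?_) hc hcd hd
  obtain ⟨χ, hχ, hχc, hχs, hχ1, hχl⟩ := exists_cutoff_sequence
  have hi := hf.integrable_greenDensity hσ ha w hη
  -- The spatial cut-offs tend to one and are bounded by one; the integrable density itself
  -- dominates.
  have hlim : Tendsto (fun j => ∫ p : ℝ × ℝ, χ j (p.2 / Z.thickness p.1) *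
      Z.greenDensity σ w η f ft fx p ∂Z.regionMeasure a S) atTop
      (𝓝 (∫ p, Z.greenDensity σ w η f ft fx p ∂Z.regionMeasure a S)) := by
    refine tendsto_integral_of_dominated_convergence _ (fun j =>
      (hf.integral_cutoff_greenDensity hσ ha w hη hηc hηs (hχ j) (hχc j) (hχs j)).1.1) hi.norm
      (fun j => ae_of_all _ fun p => ?_) ?_
    · rw [norm_mul]
      exact mul_le_of_le_one_left (norm_nonneg _) (hχ1 j _)
    · filter_upwards [ae_restrict_mem (Z.measurableSet_region a S)] with p hp
      have hE := Z.thickness_pos (ha.trans hp.1.le)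
      have := (hχl (p.2 / Z.thickness p.1)
        ⟨div_pos hp.2.2.1 hE, (div_lt_one hE).2 hp.2.2.2⟩).mul_const
          (Z.greenDensity σ w η f ft fx p)
      rwa [one_mul] at this
  have hzero : ∫ p, Z.greenDensity σ w η f ft fx p ∂Z.regionMeasure a S = 0 := by
    refine tendsto_nhds_unique hlim (tendsto_const_nhds.congr fun j => ?_)
    exact (hf.integral_cutoff_greenDensity hσ ha w hη hηc hηs (hχ j) (hχc j) (hχs j)).2.symm
  rw [← hzero, integral_region hi, times_coe]
  refine integral_congr_ae ?_
  filter_upwards [hf.ae_isSliceTest, ae_restrict_mem measurableSet_Ioo] with t ht htm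
  exact (ht.integral_boundary hσ (Z.thickness_pos (ha.trans htm.1.le)) w (η t) (deriv η t)).symm

end TargetState

end CrossDiffusion

/-! ### Testing weak solutions with backward heat modes -/

namespace CrossDiffusion

lemma mulVec_smul {n : ℕ} (M : Mat n) (c : ℝ) (z : Vec n) : mulVec M (c • z) = c • mulVec M z := by
  simp [mulVec, Matrix.mulVec_smul]

lemma integral_eq_zero_of_hasDerivAt_fst {F F' : ℝ × ℝ → ℝ}
    (h : ∀ t x, HasDerivAt (fun t => F (t, x)) (F' (t, x)) t) (hF : Continuous F)
    (hF' : Continuous F') (hFc : HasCompactSupport F) (hFc' : HasCompactSupport F') :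
    ∫ p, F' p = 0 := by
  have hi : Integrable F' (volume.prod volume) := hF'.integrable_of_hasCompactSupport hFc'
  rw [Measure.volume_eq_prod, integral_prod_symm _ hi]
  refine integral_eq_zero_of_ae (ae_of_all _ fun x => ?_)
  have hs : ∀ {G : ℝ × ℝ → ℝ}, Continuous G → HasCompactSupport G →
      Integrable fun t => G (t, x) := by
    intro G hG hGc
    refine (hG.comp (by fun_prop : Continuous fun t : ℝ => (t, x))).integrable_of_hasCompactSupport ?_
    refine HasCompactSupport.of_support_subset_isCompact (hGc.image continuous_fst) fun t ht => ?_
    exact ⟨(t, x), subset_tsupport _ ht, rfl⟩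
  exact integral_eq_zero_of_hasDerivAt_of_integrable (fun t => h t x) (hs hF' hFc') (hs hF hFc)

namespace TargetState

variable {n : ℕ} {Z : TargetState n} {σ a S : ℝ}

section Backward

variable (Z) in
/-- Multiples of explicit solutions of the backward heat equation. -/
noncomputable def backward (σ w : ℝ) (q : Vec n) (θ : ℝ → ℝ) (t x : ℝ) : Vec n :=
  (θ t * Z.mode (-σ) w t x) • q

variable (Z) in
/-- Time derivative of `backward`, for `θ' = - ψ`. -/
noncomputable def backwardT (σ w : ℝ) (q : Vec n) (θ ψ : ℝ → ℝ) (t x : ℝ) : Vec n :=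
  (-(ψ t) * Z.mode (-σ) w t x + θ t * (-σ * Z.modeXX (-σ) w t x)) • q

variable {θ ψ : ℝ → ℝ} {q : Vec n}

lemma hasDerivAt_backward (hσ : σ ≠ 0) (hθ : ∀ t, HasDerivAt θ (-ψ t) t) (w : ℝ) {t : ℝ}
    (ht : 0 < Z.thickness t) (x : ℝ) :
    HasDerivAt (fun t => Z.backward σ w q θ t x) (Z.backwardT σ w q θ ψ t x) t :=
  ((hθ t).mul (Z.hasDerivAt_mode_t (neg_ne_zero.2 hσ) ht w x)).smul_const q

lemma continuousAt_backward (hσ : σ ≠ 0) (hθ : Continuous θ) (w : ℝ) {p : ℝ × ℝ}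
    (hp : 0 < Z.thickness p.1) :
    ContinuousAt (fun p : ℝ × ℝ => Z.backward σ w q θ p.1 p.2) p :=
  ((hθ.comp continuous_fst).continuousAt.mul
    (Z.continuousAt_mode (neg_ne_zero.2 hσ) w hp)).smul continuousAt_const

lemma continuousAt_backwardT (hσ : σ ≠ 0) (hθ : Continuous θ) (hψ : Continuous ψ) (w : ℝ)
    {p : ℝ × ℝ} (hp : 0 < Z.thickness p.1) :
    ContinuousAt (fun p : ℝ × ℝ => Z.backwardT σ w q θ ψ p.1 p.2) p :=
  (((hψ.comp continuous_fst).neg.continuousAt.mul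
    (Z.continuousAt_mode (neg_ne_zero.2 hσ) w hp)).add
    ((hθ.comp continuous_fst).continuousAt.mul (continuousAt_const.mul
      (Z.continuousAt_modeXX (neg_ne_zero.2 hσ) w hp)))).smul continuousAt_const

lemma toL2_mode {t : ℝ} (ht : 0 < Z.thickness t) (σ w : ℝ) (q : Vec n) (c : ℝ) :
    (toL2 unitMeasure fun y => (c * Z.mode σ w t (y * Z.thickness t)) • q) =
      (c * decay σ w (Z.scaledTime t)) • mulLift (Z.gauge σ t) q (cosMode w) := by
  have hm : MemLp (fun y => (c * Z.mode σ w t (y * Z.thickness t)) • q) 2 unitMeasure := by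
    have h := (Lp.memLp (mulLift (Z.gauge σ t) q (cosMode w))).const_smul
      (c * decay σ w (Z.scaledTime t))
    refine (memLp_congr_ae ?_).1 h
    filter_upwards [coeFn_mulLift (Z.gauge σ t) q (cosMode w), coeFn_cosMode w] with y h1 h2
    simp only [Pi.smul_apply]
    rw [h1, h2, Z.mode_mul ht]
    module
  refine Lp.ext ?_
  filter_upwards [coeFn_toL2 hm, coeFn_mulLift (Z.gauge σ t) q (cosMode w), coeFn_cosMode w,
    Lp.coeFn_smul (c * decay σ w (Z.scaledTime t)) (mulLift (Z.gauge σ t) q (cosMode w))]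
    with y h0 h1 h2 h3
  rw [h0, h3, Pi.smul_apply, h1, h2, Z.mode_mul ht]
  module

lemma memLp_slice_of_continuous {E : Type*} [NormedAddCommGroup E] {t : ℝ} {F : ℝ → E}
    (hF : Continuous F) : MemLp F 2 (Z.slice t) := by
  obtain ⟨C, hC⟩ := isCompact_Icc.exists_bound_of_continuousOn
    (hF.continuousOn (s := Icc 0 (Z.thickness t)))
  refine MemLp.of_bound hF.aestronglyMeasurable.restrict C ?_
  filter_upwards [ae_restrict_mem measurableSet_Ioo] with x hx
  exact hC x (Ioo_subset_Icc_self hx)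

/-- For `sin w = 0` the flux of the backward mode vanishes, which is the adjoint boundary condition.
The time factor `θ` supplies the final condition, and its derivative is the only term left in `∂ₜ v
+ Aᵀ ∂ₓₓ v`. -/
lemma isTestFunction_backward {A : Mat n} {K : ℝ → Mat n}
    (hK : ∀ t, K t = (Z.speed / 2) • (1 : Mat n)) (hσ : σ ≠ 0) (hq : mulVec Aᵀ q = σ • q)
    (ha : 0 ≤ a) (hψ : Continuous ψ) (hθ : ∀ t, HasDerivAt θ (-ψ t) t) (hθS : θ S = 0) {w : ℝ}
    (hw : Real.sin w = 0) :
    Z.IsTestFunction A K a S (Z.backward σ w q θ) (Z.backwardT σ w q θ ψ)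
      (fun t x => (θ t * Z.modeX (-σ) w t x) • q) (fun t x => (θ t * Z.modeXX (-σ) w t x) • q) := by
  have hσ' := neg_ne_zero.2 hσ
  have hθc : Continuous θ := continuous_iff_continuousAt.2 fun t => (hθ t).continuousAt
  have hθ1 : ∀ p : ℝ × ℝ, ContinuousAt (fun p : ℝ × ℝ => θ p.1) p := fun p =>
    (hθc.comp continuous_fst).continuousAt
  have hpos : ∀ {t}, t ∈ Ioo a S → 0 < Z.thickness t := fun ht => Z.thickness_pos (ha.trans ht.1.le)
  refine ⟨?_, ?_, ?_, ?_, ?_, ?_, ?_, ?_, ?_, ?_, ?_⟩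
  · exact memLp_of_continuousOn (continuousOn_closedRegion ha fun p hp =>
      continuousAt_backward hσ hθc w hp)
  · exact memLp_of_continuousOn (continuousOn_closedRegion ha fun p hp =>
      continuousAt_backwardT hσ hθc hψ w hp)
  · exact memLp_of_continuousOn (continuousOn_closedRegion ha fun p hp =>
      ((hθ1 p).mul (Z.continuousAt_modeX hσ' w hp)).smul continuousAt_const)
  · exact memLp_of_continuousOn (continuousOn_closedRegion ha fun p hp =>
      ((hθ1 p).mul (Z.continuousAt_modeXX hσ' w hp)).smul continuousAt_const)
  · filter_upwards [ae_restrict_mem measurableSet_Ioo] with t ht x hx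
    have hc := continuous_modeX_x hσ' (hpos ht) w
    rw [intervalIntegral.integral_eq_sub_of_hasDerivAt (f := Z.backward σ w q θ t)
      (fun y _ => ((Z.hasDerivAt_mode_x (-σ) w t y).const_mul (θ t)).smul_const q)
      (Continuous.intervalIntegrable (by fun_prop) _ _)]
    abel
  · filter_upwards [ae_restrict_mem measurableSet_Ioo] with t ht x hx
    have hc := continuous_modeXX_x hσ' (hpos ht) w
    rw [intervalIntegral.integral_eq_sub_of_hasDerivAt
      (f := fun x => (θ t * Z.modeX (-σ) w t x) • q)
      (fun y _ => ((Z.hasDerivAt_modeX_x hσ' (hpos ht) w y).const_mul (θ t)).smul_const q)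
      (Continuous.intervalIntegrable (by fun_prop) _ _)]
    abel
  · intro φ hφ
    have hφd := hφ.smooth.differentiable (by simp)
    have hφt : Continuous (partialT φ) :=
      (hφ.smooth.continuous_fderiv (by simp)).clm_apply continuous_const
    have hz : ∀ p, p ∉ tsupport φ → φ p = 0 ∧ partialT φ p = 0 := fun p hp =>
      ⟨image_eq_zero_of_notMem_tsupport hp, by
        rw [partialT, image_eq_zero_of_notMem_tsupport fun h => hp (tsupport_fderiv_subset ℝ h)]
        rfl⟩
    have hposs : ∀ p ∈ tsupport φ, 0 < Z.thickness p.1 := fun p hp =>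
      Z.thickness_pos (ha.trans (hφ.support_subset hp).1.le)
    set F : ℝ × ℝ → ℝ := fun p => inner ℝ (Z.backward σ w q θ p.1 p.2) (φ p) with hF
    set F' : ℝ × ℝ → ℝ := fun p => inner ℝ (Z.backward σ w q θ p.1 p.2) (partialT φ p) +
      inner ℝ (Z.backwardT σ w q θ ψ p.1 p.2) (φ p) with hF'
    have hnear : ∀ p, p ∉ tsupport φ → ∀ᶠ r in 𝓝 p, r ∉ tsupport φ := fun p hp =>
      (isClosed_tsupport φ).isOpen_compl.mem_nhds hp
    have hFz : ∀ p, p ∉ tsupport φ → F p = 0 ∧ F' p = 0 := fun p hp => by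
      simp [hF, hF', (hz p hp).1, (hz p hp).2]
    have cF : Continuous F := continuous_iff_continuousAt.2 fun p => by
      by_cases hp : p ∈ tsupport φ
      · exact (continuousAt_backward hσ hθc w (hposs p hp)).inner hφ.smooth.continuous.continuousAt
      · exact (continuousAt_const (y := (0 : ℝ))).congr
          ((hnear p hp).mono fun r hr => (hFz r hr).1.symm)
    have cF' : Continuous F' := continuous_iff_continuousAt.2 fun p => by
      by_cases hp : p ∈ tsupport φ
      · exact ((continuousAt_backward hσ hθc w (hposs p hp)).inner hφt.continuousAt).add
          ((continuousAt_backwardT hσ hθc hψ w (hposs p hp)).inner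
            hφ.smooth.continuous.continuousAt)
      · exact (continuousAt_const (y := (0 : ℝ))).congr
          ((hnear p hp).mono fun r hr => (hFz r hr).2.symm)
    have sF : HasCompactSupport F := HasCompactSupport.of_support_subset_isCompact
      hφ.compactSupport fun p hp => by_contra fun h => hp (hFz p h).1
    have sF' : HasCompactSupport F' := HasCompactSupport.of_support_subset_isCompact
      hφ.compactSupport fun p hp => by_contra fun h => hp (hFz p h).2
    have hder : ∀ t x, HasDerivAt (fun t => F (t, x)) (F' (t, x)) t := by
      intro t x
      by_cases hp : (t, x) ∈ tsupport φ
      · have h1 := HasFDerivAt.comp_hasDerivAt (f := fun t : ℝ => (t, x)) t (hφd (t, x)).hasFDerivAt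
          ((hasDerivAt_id t).prodMk (hasDerivAt_const t x))
        exact (hasDerivAt_backward hσ hθ w (hposs _ hp) x).inner ℝ h1
      · rw [(hFz _ hp).2]
        refine (hasDerivAt_const t (0 : ℝ)).congr_of_eventuallyEq ?_
        have : ContinuousAt (fun t : ℝ => (t, x)) t := by fun_prop
        filter_upwards [this.eventually (hnear _ hp)] with r hr
        exact (hFz _ hr).1
    have h0 := integral_eq_zero_of_hasDerivAt_fst hder cF cF' sF sF'
    have hreg : ∫ p, F' p ∂Z.regionMeasure a S = 0 := by
      rw [← h0, regionMeasure]
      exact setIntegral_eq_integral_of_forall_compl_eq_zero fun p hp =>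
        (hFz p fun h => hp (hφ.support_subset h)).2
    rw [hF', integral_add] at hreg
    · linarith
    · have := isFiniteMeasure_regionMeasure (Z := Z) a S
      exact (memLp_of_continuousOn (continuousOn_closedRegion ha fun p hp =>
        (continuousAt_backward hσ hθc w hp).inner hφt.continuousAt)).integrable (by norm_num)
    · have := isFiniteMeasure_regionMeasure (Z := Z) a S
      exact (memLp_of_continuousOn (continuousOn_closedRegion ha fun p hp =>
        (continuousAt_backwardT hσ hθc hψ w hp).inner
          hφ.smooth.continuous.continuousAt)).integrable (by norm_num)
  · refine ⟨fun t _ => ?_, ?_⟩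
    · have hc := continuous_mode_x (Z := Z) (-σ) w t
      refine memLp_slice_of_continuous ?_
      unfold backward
      fun_prop
    · have h1 : ContinuousOn (fun t => (θ t * decay (-σ) w (Z.scaledTime t)) •
          mulLift (Z.gauge (-σ) t) q (cosMode w)) (Icc a S) := by
        have hsub : Icc a S ⊆ Ici 0 := fun t ht => ha.trans ht.1
        refine ContinuousOn.smul (hθc.continuousOn.mul fun t ht =>
          (Z.continuousAt_decay_scaledTime (-σ) w (hsub ht)).continuousWithinAt) ?_
        exact ((continuousOn_mulLift (Z.continuousOn_gauge (-σ)) q).mono hsub).clm_apply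
          continuousOn_const
      exact h1.congr fun t ht => toL2_mode (Z.thickness_pos (ha.trans ht.1)) (-σ) w q (θ t)
  · exact ae_of_all _ fun x => by simp [backward, hθS]
  · refine ae_of_all _ fun t => ?_
    rw [modeX_zero, mul_zero, zero_smul]
    simpa using mulVec_smul Aᵀ 0 (0 : Vec n)
  · filter_upwards [ae_restrict_mem measurableSet_Ioo] with t ht
    -- Used with `-σ`: the identity reads `-σ φₓ + v̄ / 2 φ = 0` at the moving end.
    have hb := Z.boundaryFlux_eq hσ' (hpos ht) w
    rw [boundaryFlux, hw, mul_zero, neg_zero, mul_zero, zero_mul] at hb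
    rw [mulVec_smul, hq, hK, backward, mulVec_smul]
    have h1 : mulVec ((Z.speed / 2) • (1 : Mat n))ᵀ q = (Z.speed / 2) • q := by
      simp only [mulVec, Matrix.transpose_smul, Matrix.transpose_one, Matrix.smul_mulVec,
        Matrix.one_mulVec, WithLp.toLp_smul, WithLp.toLp_ofLp]
    rw [h1, smul_smul, smul_smul, ← sub_smul]
    have h2 : θ t * Z.mode (-σ) w t (Z.thickness t) * (Z.speed / 2) -
        θ t * Z.modeX (-σ) w t (Z.thickness t) * σ = 0 := by linear_combination θ t * hb
    rw [h2, zero_smul]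

end Backward

/-- The modes of a weak solution satisfy integral equations. -/
theorem IsWeakSolution.integral_mode_eq {A : Mat n} {H : Z.Feedback}
    (hK : ∀ t, H.gain t = (Z.speed / 2) • (1 : Mat n)) (hσ : σ ≠ 0) {q : Vec n}
    (hq : mulVec Aᵀ q = σ • q) (ha : 0 ≤ a) {b : EReal} {ua : Z.L2 a} {u : ∀ t, Z.L2 t}
    (hu : Z.IsWeakSolution A H a b ua u) (haS : a < S) (hS : (S : EReal) < b)
    (hint : IntegrableOn (fun t => H.nonlocal t (u t)) (Ioo a S)) {w : ℝ} (hw : Real.sin w = 0)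
    {t : ℝ} (ht : t ∈ Icc a S) :
    ∫ x, Z.mode (-σ) w t x * inner ℝ q (u t x) ∂Z.slice t =
      (∫ x, Z.mode (-σ) w a x * inner ℝ q (ua x) ∂Z.slice a) +
      ∫ r in a..t, Z.mode (-σ) w r (Z.thickness r) * inner ℝ q (H.nonlocal r (u r)) := by
  have hσ' := neg_ne_zero.2 hσ
  set α : ℝ → ℝ := fun t => ∫ x, Z.mode (-σ) w t x * inner ℝ q (u t x) ∂Z.slice t with hα
  set α₀ := ∫ x, Z.mode (-σ) w a x * inner ℝ q (ua x) ∂Z.slice a with hα₀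
  set β : ℝ → ℝ := fun r => Z.mode (-σ) w r (Z.thickness r) * inner ℝ q (H.nonlocal r (u r))
    with hβ
  have hαc : ContinuousOn α (Icc a S) := by
    have hsub : Icc a S ⊆ {t : ℝ | a ≤ t ∧ (t : EReal) < b} := fun t ht =>
      ⟨ht.1, (EReal.coe_le_coe_iff.2 ht.2).trans_lt hS⟩
    have h := hu.continuousL2On
    have h' : Z.ContinuousL2On (fun t => u t) (Icc a S) :=
      ⟨fun t ht => h.1 t (hsub ht), h.2.mono hsub⟩
    exact h'.continuousOn_integral_mode (fun t ht => ha.trans ht.1) (-σ) w q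
  have hmc : ContinuousOn (fun r => Z.mode (-σ) w r (Z.thickness r)) (Icc a S) := by
    intro r hr
    refine ContinuousAt.continuousWithinAt ?_
    exact ContinuousAt.comp (f := fun t => (t, Z.thickness t))
      (g := fun p : ℝ × ℝ => Z.mode (-σ) w p.1 p.2)
      (Z.continuousAt_mode hσ' w (Z.thickness_pos (ha.trans hr.1))) (by fun_prop)
  have hβi : IntegrableOn β (Ioo a S) :=
    integrableOn_continuous_mul hmc (hint.const_inner q)
  have hβi' : IntervalIntegrable β volume a S := by
    rwa [intervalIntegrable_iff_integrableOn_Ioo_of_le haS.le]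
  -- The defect of the claimed integral equation. Choosing `θ' = -d` on `[a, S]` and `θ(S) = 0` in
  -- the test function gives `∫ d² = 0`.
  set d : ℝ → ℝ := fun t => α t - α₀ - ∫ r in a..t, β r with hd
  have hdc : ContinuousOn d (Icc a S) := by
    refine (hαc.sub continuousOn_const).sub ?_
    have := intervalIntegral.continuousOn_primitive_interval (a := a) (b := S) (f := β)
      (μ := volume) (by
        rw [uIcc_of_le haS.le, integrableOn_Icc_iff_integrableOn_Ioo]; exact hβi)
    rwa [uIcc_of_le haS.le] at this
  -- Constant continuation outside `[a, S]` makes `ψ` continuous on the whole line, so that its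
  -- primitive is differentiable everywhere.
  set ψ : ℝ → ℝ := IccExtend haS.le ((Icc a S).domRestrict d) with hψ
  have hψc : Continuous ψ := hdc.domRestrict.Icc_extend'
  have hψd : ∀ t ∈ Icc a S, ψ t = d t := fun t ht => by
    rw [hψ, IccExtend_of_mem _ _ ht]; rfl
  set θ : ℝ → ℝ := fun t => ∫ r in t..S, ψ r with hθ
  have hθd : ∀ t, HasDerivAt θ (-ψ t) t := fun t =>
    intervalIntegral.integral_hasDerivAt_left (hψc.intervalIntegrable _ _)
      (hψc.stronglyMeasurableAtFilter _ _) hψc.continuousAt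
  have hθc : Continuous θ := continuous_iff_continuousAt.2 fun t => (hθd t).continuousAt
  have hθS : θ S = 0 := by simp [hθ]
  have hweak := hu.weak S haS hS _ _ _ _
    (isTestFunction_backward hK hσ hq ha hψc hθd hθS hw)
  have e1 : ∫ t in Ioo a S, ∫ x, inner ℝ (u t x) (Z.backwardT σ w q θ ψ t x +
      mulVec Aᵀ ((θ t * Z.modeXX (-σ) w t x) • q)) ∂Z.slice t = -∫ t in Ioo a S, ψ t * α t := by
    rw [← integral_neg]
    refine integral_congr_ae (ae_of_all _ fun t => ?_)
    simp only [hα]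
    rw [← integral_const_mul, ← integral_neg]
    refine integral_congr_ae (ae_of_all _ fun x => ?_)
    simp only
    rw [mulVec_smul, hq, backwardT, smul_smul, ← add_smul, inner_smul_right, real_inner_comm]
    ring
  have e2 : ∫ x, inner ℝ (ua x) (Z.backward σ w q θ a x) ∂Z.slice a = θ a * α₀ := by
    rw [hα₀, ← integral_const_mul]
    refine integral_congr_ae (ae_of_all _ fun x => ?_)
    simp only
    rw [backward, inner_smul_right, real_inner_comm]
    ring
  have e3 : ∫ t in Ioo a S, inner ℝ (H.nonlocal t (u t)) (Z.backward σ w q θ t (Z.thickness t)) =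
      ∫ t in Ioo a S, θ t * β t := by
    refine integral_congr_ae (ae_of_all _ fun t => ?_)
    simp only [hβ]
    rw [backward, inner_smul_right, real_inner_comm]
    ring
  rw [e1, e2, e3] at hweak
  -- Integration by parts turns `∫ θ β` into `∫ ψ` times the primitive of `β`; the boundary terms
  -- vanish.
  have e4 := integral_mul_primitive haS.le (ψ := θ) (ψ' := fun t => -ψ t)
    (f := fun t => ∫ r in a..t, β r) (f' := β) (fun x _ => hθd x) (by fun_prop) hβi'
    (fun x _ => by simp)
  rw [hθS, intervalIntegral.integral_same, zero_mul, mul_zero, sub_zero,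
    intervalIntegral.integral_of_le haS.le, integral_Ioc_eq_integral_Ioo] at e4
  have hBc : ContinuousOn (fun t => ∫ r in a..t, β r) (Icc a S) := by
    refine (((hαc.sub (continuousOn_const (c := α₀))).sub hdc)).congr fun t _ => ?_
    simp only [hd, Pi.sub_apply]; ring
  have hi1 : IntegrableOn (fun t => ψ t * α t) (Ioo a S) :=
    ((hψc.continuousOn.mul hαc).integrableOn_Icc).mono_set Ioo_subset_Icc_self
  have hi2 : IntegrableOn (fun t => θ t * β t) (Ioo a S) :=
    integrableOn_continuous_mul hθc.continuousOn hβi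
  have hi3 : IntegrableOn (fun t => -ψ t * ∫ r in a..t, β r) (Ioo a S) :=
    ((hψc.neg.continuousOn.mul hBc).integrableOn_Icc).mono_set Ioo_subset_Icc_self
  have hi4 : IntegrableOn ψ (Ioo a S) :=
    (hψc.continuousOn.integrableOn_Icc).mono_set Ioo_subset_Icc_self
  rw [integral_add hi3 hi2] at e4
  have e5 : θ a = ∫ t in Ioo a S, ψ t := by
    simp only [hθ]
    rw [intervalIntegral.integral_of_le haS.le, integral_Ioc_eq_integral_Ioo]
  have e6 : ∫ t in Ioo a S, d t ^ 2 = 0 := by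
    have h1 : ∫ t in Ioo a S, d t ^ 2 = ∫ t in Ioo a S, (ψ t * α t - ψ t * α₀ +
        -ψ t * ∫ r in a..t, β r) := by
      refine setIntegral_congr_fun measurableSet_Ioo fun t ht => ?_
      have h2 := hψd t (Ioo_subset_Icc_self ht)
      simp only [h2, hd]; ring
    rw [h1, integral_add (integrable_fun_sub hi1 (hi4.mul_const α₀)) hi3, integral_sub hi1 (hi4.mul_const α₀),
      integral_mul_const, ← e5]
    linarith
  have e7 : EqOn d (fun _ => 0) (Icc a S) := by
    refine Measure.eqOn_Icc_of_ae_eq volume haS.ne ?_ hdc continuousOn_const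
    rw [Filter.EventuallyEq, ← restrict_Ioo_eq_restrict_Icc]
    have h1 := (integral_eq_zero_iff_of_nonneg (fun t => sq_nonneg (d t))
      (((hdc.pow 2).integrableOn_Icc).mono_set Ioo_subset_Icc_self)).1 e6
    filter_upwards [h1] with t h2
    exact pow_eq_zero_iff two_ne_zero |>.1 h2
  have := e7 ht
  simp only [hd] at this
  linarith

end TargetState

end CrossDiffusion

namespace CrossDiffusion

/-! ### The feedback -/

/-- A basis of eigenvectors of a matrix with positive eigenvalues, and the dual basis. -/
structure Eigenbasis {n : ℕ} (M : Mat n) where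
  σ : Fin n → ℝ
  p : Fin n → Vec n
  q : Fin n → Vec n
  σ_pos : ∀ i, 0 < σ i
  mulVec_p : ∀ i, mulVec M (p i) = σ i • p i
  mulVec_q : ∀ i, mulVec Mᵀ (q i) = σ i • q i
  inner_q_p : ∀ i j, inner ℝ (q i) (p j) = if i = j then (1 : ℝ) else 0
  sum_eq : ∀ z : Vec n, z = ∑ i, inner ℝ (q i) z • p i

/-- Coefficients of `feedbackKernel` in the cosine basis. -/
noncomputable def kernelCoef (N k : ℕ) : ℝ :=
  if h : k < N then -∑ j : Fin N, freq N j * Real.sin (freq N j) * cauchyInv j ⟨k, h⟩ else 0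

/-- The kernel lies in the span of the first `N` cosines. Allowing any `M ≥ N` gives one fixed range
of summation for all times up to some `S < T`. -/
lemma inner_feedbackKernel_eq {N M : ℕ} (h : N ≤ M) (f : UnitL2) :
    inner ℝ (feedbackKernel N) f =
      ∑ k ∈ Finset.range M, kernelCoef N k * inner ℝ (cosMode (k * Real.pi)) f := by
  have h1 : ∑ k ∈ Finset.range M, kernelCoef N k * inner ℝ (cosMode (k * Real.pi)) f =
      ∑ k ∈ Finset.range N, kernelCoef N k * inner ℝ (cosMode (k * Real.pi)) f := by
    refine (Finset.sum_subset (Finset.range_mono h) fun k _ hk => ?_).symm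
    rw [kernelCoef, dif_neg (by simpa using hk), zero_mul]
  rw [h1, ← Fin.sum_univ_eq_sum_range
    (fun k => kernelCoef N k * inner ℝ (cosMode (k * Real.pi)) f), feedbackKernel, inner_neg_left,
    sum_inner]
  simp only [inner_smul_left, conj_trivial, inner_dualMode]
  simp only [kernelCoef, Fin.is_lt, dif_pos, Finset.mul_sum, neg_mul, Finset.sum_neg_distrib,
    Finset.sum_mul]
  rw [Finset.sum_comm]
  refine congrArg Neg.neg (Finset.sum_congr rfl fun k _ => Finset.sum_congr rfl fun j _ => ?_)
  simp only [Fin.eta]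
  ring

lemma exists_kernelCoef_bound (M : ℕ) : ∃ C, 0 ≤ C ∧ ∀ N ≤ M, ∀ k < M, |kernelCoef N k| ≤ C := by
  refine ⟨∑ N ∈ Finset.range (M + 1), ∑ k ∈ Finset.range M, |kernelCoef N k|, by positivity,
    fun N hN k hk => ?_⟩
  refine (Finset.single_le_sum (f := fun k => |kernelCoef N k|) (fun _ _ => abs_nonneg _)
    (Finset.mem_range.2 hk)).trans ?_
  exact Finset.single_le_sum (f := fun N => ∑ k ∈ Finset.range M, |kernelCoef N k|)
    (fun _ _ => Finset.sum_nonneg fun _ _ => abs_nonneg _) (Finset.mem_range.2 (by omega))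

lemma eLpNorm_two_le_of_integral_sq_le {α β E F : Type*} [MeasurableSpace α] [MeasurableSpace β]
    [NormedAddCommGroup E] [NormedAddCommGroup F] {μ : Measure α} {ν : Measure β} {f : α → E}
    {g : β → F} (hf : MemLp f 2 μ) (hg : MemLp g 2 ν) (C : ℝ≥0)
    (h : ∫ x, ‖f x‖ ^ 2 ∂μ ≤ C ^ 2 * ∫ x, ‖g x‖ ^ 2 ∂ν) : eLpNorm f 2 μ ≤ C * eLpNorm g 2 ν := by
  rw [hf.eLpNorm_eq_integral_rpow_norm (by simp) (by simp),
    hg.eLpNorm_eq_integral_rpow_norm (by simp) (by simp)]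
  simp only [ENNReal.toReal_ofNat, Real.rpow_ofNat, ← one_div, ← Real.sqrt_eq_rpow]
  rw [← ENNReal.ofReal_coe_nnreal, ← ENNReal.ofReal_mul C.coe_nonneg]
  refine ENNReal.ofReal_le_ofReal ?_
  rw [← Real.sqrt_sq C.coe_nonneg, ← Real.sqrt_mul (sq_nonneg _)]
  exact Real.sqrt_le_sqrt h

namespace TargetState

variable {n : ℕ} (Z : TargetState n) {M : Mat n} (B : Eigenbasis M)

/-- The component of `u` in the `i`-th eigenspace, as a function on the unit interval. -/
noncomputable def profile (i : Fin n) (t : ℝ) (u : Z.L2 t) : UnitL2 :=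
  proj (Z.gaugeInv (B.σ i) t) (B.q i) (Z.contract t u)

/-- The function with given components. -/
noncomputable def assemble (t : ℝ) (z : Fin n → UnitL2) : Z.L2 t :=
  Z.dilate t (∑ i, mulLift (Z.gauge (B.σ i) t) (B.p i) (z i))

variable {Z}

lemma profile_assemble {t : ℝ} (ht : 0 < Z.thickness t) (z : Fin n → UnitL2) (i : Fin n) :
    Z.profile B i t (Z.assemble B t z) = z i := by
  rw [profile, assemble, Z.contract_dilate ht]
  exact proj_sum_mulLift (g := fun i => Z.gauge (B.σ i) t) (g' := fun i => Z.gaugeInv (B.σ i) t)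
    (fun i y => Z.gaugeInv_mul_gauge ht _ _) B.inner_q_p z i

lemma assemble_profile {t : ℝ} (ht : 0 < Z.thickness t) (u : Z.L2 t) :
    Z.assemble B t (fun i => Z.profile B i t u) = u := by
  rw [assemble]
  conv_rhs => rw [← Z.dilate_contract ht u]
  congr 1
  exact sum_mulLift_proj (g := fun i => Z.gauge (B.σ i) t) (g' := fun i => Z.gaugeInv (B.σ i) t)
    (fun i y => Z.gaugeInv_mul_gauge ht _ _) B.sum_eq _

lemma profile_ext {t : ℝ} (ht : 0 < Z.thickness t) {u w : Z.L2 t}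
    (h : ∀ i, Z.profile B i t u = Z.profile B i t w) : u = w := by
  rw [← assemble_profile B ht u, ← assemble_profile B ht w]
  simp only [h]

/-- The gauge of `-σ` is, up to the factor `ē` from the change of variables, the inverse gauge, so
integrals against backward modes are cosine coefficients of the profile. -/
lemma integral_mode_eq_profile {t : ℝ} (ht : 0 < Z.thickness t) (i : Fin n) (w : ℝ) (u : Z.L2 t) :
    ∫ x, Z.mode (-(B.σ i)) w t x * inner ℝ (B.q i) (u x) ∂Z.slice t =
      decay (-(B.σ i)) w (Z.scaledTime t) * inner ℝ (cosMode w) (Z.profile B i t u) := by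
  rw [Z.integral_mode_mul ht _ _ _ (Lp.memLp u)]
  have h : Z.profile B i t u = Z.thickness t • proj (Z.gauge (-(B.σ i)) t) (B.q i)
      (toL2 unitMeasure fun y => u (y * Z.thickness t)) := by
    refine Lp.ext ?_
    filter_upwards [coeFn_proj (Z.gaugeInv (B.σ i) t) (B.q i) (Z.contract t u),
      coeFn_proj (Z.gauge (-(B.σ i)) t) (B.q i) (Z.contract t u),
      Lp.coeFn_smul (Z.thickness t) (proj (Z.gauge (-(B.σ i)) t) (B.q i) (Z.contract t u))]
      with y h1 h2 h3
    rw [profile, h1]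
    refine Eq.trans ?_ h3.symm
    rw [Pi.smul_apply, h2, Z.gaugeInv_eq ht, smul_eq_mul]
    ring
  rw [h, inner_smul_right]
  ring

lemma ContinuousL2On.continuousOn_profile {u : ∀ t, Z.L2 t} {J : Set ℝ} (hJ : J ⊆ Ici 0)
    (hu : Z.ContinuousL2On (fun t => u t) J) (i : Fin n) :
    ContinuousOn (fun t => Z.profile B i t (u t)) J :=
  ((continuousOn_proj (Z.continuousOn_gaugeInv (B.σ i)) (B.q i)).mono hJ).clm_apply hu.2

lemma norm_profile_le {t T : ℝ} (ht : 0 ≤ t) (htT : t ≤ T) (i : Fin n) (u : Z.L2 t) :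
    ‖Z.profile B i t u‖ ≤ √(Z.thickness T) *
      Real.exp (Z.speed * Z.thickness T / (4 * B.σ i)) * ‖B.q i‖ * (√(Z.thickness 0))⁻¹ * ‖u‖ := by
  have hE := Z.thickness_pos ht
  have h0 := Real.sqrt_pos.2 (Z.thickness_pos le_rfl)
  have h1 := norm_proj_le (g := Z.gaugeInv (B.σ i) t) (B := √(Z.thickness T) *
      Real.exp (Z.speed * Z.thickness T / (4 * B.σ i))) (by positivity)
    (fun y hy => Z.gaugeInv_abs_le (B.σ_pos i) hE htT hy) (B.q i)
  refine (ContinuousLinearMap.le_opNorm _ _).trans ?_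
  rw [Z.norm_eq_contract hE u, mul_assoc _ _ (_ * _)]
  refine mul_le_mul h1 ?_ (norm_nonneg _) (by positivity)
  rw [← mul_assoc]
  refine le_mul_of_one_le_left (norm_nonneg _) ?_
  rw [← div_eq_inv_mul, one_le_div h0]
  exact Real.sqrt_le_sqrt (Z.thickness_mono ht)

variable (Z)

/-- The factor in the relation between the kernel and the boundary flux. -/
noncomputable def fluxFactor (σ t : ℝ) : ℝ := σ / Z.thickness t * Z.amp σ t (Z.thickness t)

variable {Z}

lemma continuousAt_fluxFactor {σ : ℝ} (hσ : σ ≠ 0) {t : ℝ} (ht : 0 ≤ t) :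
    ContinuousAt (Z.fluxFactor σ) t := by
  have hE := Z.thickness_pos ht
  refine ContinuousAt.mul (ContinuousAt.div (by fun_prop) (by fun_prop) hE.ne') ?_
  exact ContinuousAt.comp (f := fun t => (t, Z.thickness t))
      (g := fun p : ℝ × ℝ => Z.amp σ p.1 p.2) (Z.continuousAt_amp hσ hE) (by fun_prop)

variable (Z)

open Classical in
/-- The feedback with `N t` modified modes at time `t < T`. -/
noncomputable def modalFeedback (N : ℝ → ℕ) (T : ℝ) : Z.Feedback where
  nonlocal t :=
    if h : 0 ≤ t ∧ t < T then
      ∑ i, ((Z.fluxFactor (B.σ i) t) • ((innerSL ℝ (feedbackKernel (N t))).comp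
        ((proj (Z.gaugeInv (B.σ i) t) (B.q i)).comp (Z.contractL (Z.thickness_pos h.1))))).smulRight
          (B.p i)
    else 0
  gain _ := (Z.speed / 2) • 1

variable {Z B} {N : ℝ → ℕ} {T : ℝ}

lemma modalFeedback_of_le {t : ℝ} (ht : T ≤ t) : (Z.modalFeedback B N T).nonlocal t = 0 :=
  dif_neg fun h => absurd h.2 (not_lt.2 ht)

lemma modalFeedback_apply {t : ℝ} (h0 : 0 ≤ t) (hT : t < T) (u : Z.L2 t) :
    (Z.modalFeedback B N T).nonlocal t u = ∑ i, (Z.fluxFactor (B.σ i) t *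
      inner ℝ (feedbackKernel (N t)) (Z.profile B i t u)) • B.p i := by
  rw [modalFeedback]
  simp only [dif_pos (And.intro h0 hT), _root_.sum_apply]
  rfl

lemma inner_modalFeedback {t : ℝ} (h0 : 0 ≤ t) (hT : t < T) (u : Z.L2 t) (i : Fin n) :
    inner ℝ (B.q i) ((Z.modalFeedback B N T).nonlocal t u) = Z.fluxFactor (B.σ i) t *
      inner ℝ (feedbackKernel (N t)) (Z.profile B i t u) := by
  rw [modalFeedback_apply h0 hT]
  simp [inner_sum, inner_smul_right, B.inner_q_p]

/-- A monotone number of modes is measurable in time, and every function on `ℕ` is measurable. -/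
lemma aestronglyMeasurable_kernelCoef (hN : MonotoneOn N (Ico 0 T)) {S : ℝ} (hS : S < T) (k : ℕ) :
    AEStronglyMeasurable (fun t => kernelCoef (N t) k) (volume.restrict (Ioo 0 S)) := by
  have h1 : AEMeasurable N (volume.restrict (Ioo 0 S)) :=
    aemeasurable_restrict_of_monotoneOn measurableSet_Ioo
      (hN.mono fun t ht => ⟨ht.1.le, ht.2.trans hS⟩)
  exact ((measurable_from_nat (f := fun N => kernelCoef N k)).comp_aemeasurable h1).aestronglyMeasurable

/-- Uniform bound and measurability of the feedback on compact subintervals of `[0, T)`. -/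
lemma modalFeedback_aestronglyMeasurable (hN : MonotoneOn N (Ico 0 T)) {S : ℝ} (hS : S < T)
    {u : ∀ t, Z.L2 t} (hu : ∀ i k, AEStronglyMeasurable
      (fun t => (inner ℝ (cosMode (k * Real.pi)) (Z.profile B i t (u t)) : ℝ))
        (volume.restrict (Ioo 0 S)) ) :
    AEStronglyMeasurable (fun t => (Z.modalFeedback B N T).nonlocal t (u t))
      (volume.restrict (Ioo 0 S)) := by
  have h : AEStronglyMeasurable (fun t => ∑ i, (Z.fluxFactor (B.σ i) t * ∑ k ∈ Finset.range (N S),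
      kernelCoef (N t) k * inner ℝ (cosMode (k * Real.pi)) (Z.profile B i t (u t))) • B.p i)
      (volume.restrict (Ioo 0 S)) := by
    refine Finset.aestronglyMeasurable_fun_sum _ fun i _ => ?_
    refine AEStronglyMeasurable.smul_const (AEStronglyMeasurable.mul ?_ ?_) _
    · exact ContinuousOn.aestronglyMeasurable (fun t ht => (continuousAt_fluxFactor
        (B.σ_pos i).ne' ht.1.le).continuousWithinAt) measurableSet_Ioo
    · exact Finset.aestronglyMeasurable_fun_sum _ fun k _ =>
        (aestronglyMeasurable_kernelCoef hN hS k).mul (hu i k)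
  refine h.congr ?_
  filter_upwards [ae_restrict_mem measurableSet_Ioo] with t ht
  rw [modalFeedback_apply ht.1.le (ht.2.trans hS)]
  refine Finset.sum_congr rfl fun i _ => ?_
  rw [inner_feedbackKernel_eq (hN ⟨ht.1.le, ht.2.trans hS⟩ ⟨(ht.1.trans ht.2).le, hS⟩ ht.2.le)]

lemma exists_fluxFactor_bound (B : Eigenbasis M) (S : ℝ) :
    ∃ C, 0 ≤ C ∧ ∀ t ∈ Icc 0 S, ∀ i, |Z.fluxFactor (B.σ i) t| ≤ C := by
  have h : ∀ i, ∃ C, ∀ t ∈ Icc 0 S, |Z.fluxFactor (B.σ i) t| ≤ C := fun i =>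
    isCompact_Icc.exists_bound_of_continuousOn fun t ht =>
      (continuousAt_fluxFactor (B.σ_pos i).ne' ht.1).continuousWithinAt
  choose C hC using h
  refine ⟨∑ i, |C i|, by positivity, fun t ht i => ((hC i t ht).trans (le_abs_self _)).trans ?_⟩
  exact Finset.single_le_sum (f := fun i => |C i|) (fun _ _ => abs_nonneg _) (Finset.mem_univ i)

/-- Up to `S < T` at most `N S` modes are moved, so only finitely many kernel coefficients occur;
the bound may blow up as `S` tends to `T`. -/
lemma exists_norm_modalFeedback_le (hN : MonotoneOn N (Ico 0 T)) {S : ℝ} (hS : S < T) :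
    ∃ C, 0 ≤ C ∧ ∀ t ∈ Icc 0 S, ∀ u : Z.L2 t, ‖(Z.modalFeedback B N T).nonlocal t u‖ ≤ C * ‖u‖ := by
  obtain ⟨C₁, hC₁, h₁⟩ := exists_fluxFactor_bound (Z := Z) B S
  obtain ⟨C₂, hC₂, h₂⟩ := exists_kernelCoef_bound (N S)
  refine ⟨∑ i, C₁ * (N S * (C₂ * (√(Z.thickness S) *
      Real.exp (Z.speed * Z.thickness S / (4 * B.σ i)) * ‖B.q i‖ * (√(Z.thickness 0))⁻¹))) *
      ‖B.p i‖, by positivity, fun t ht u => ?_⟩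
  have hN' : N t ≤ N S := hN ⟨ht.1, ht.2.trans_lt hS⟩ ⟨ht.1.trans ht.2, hS⟩ ht.2
  rw [modalFeedback_apply ht.1 (ht.2.trans_lt hS), Finset.sum_mul]
  refine (norm_sum_le _ _).trans (Finset.sum_le_sum fun i _ => ?_)
  rw [norm_smul, norm_mul, Real.norm_eq_abs, Real.norm_eq_abs, inner_feedbackKernel_eq hN']
  have h3 : |∑ k ∈ Finset.range (N S), kernelCoef (N t) k *
      inner ℝ (cosMode (k * Real.pi)) (Z.profile B i t u)| ≤ N S * (C₂ * (√(Z.thickness S) *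
      Real.exp (Z.speed * Z.thickness S / (4 * B.σ i)) * ‖B.q i‖ * (√(Z.thickness 0))⁻¹ * ‖u‖)) := by
    refine (Finset.abs_sum_le_sum_abs _ _).trans ?_
    refine (Finset.sum_le_card_nsmul _ _ _ fun k hk => ?_).trans (by rw [Finset.card_range, nsmul_eq_mul])
    rw [abs_mul]
    refine mul_le_mul (h₂ _ hN' k (Finset.mem_range.1 hk)) ?_ (abs_nonneg _) hC₂
    refine (abs_real_inner_le_norm _ _).trans ?_
    refine (mul_le_of_le_one_left (norm_nonneg _) (norm_cosMode_le _)).trans ?_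
    exact norm_profile_le B ht.1 ht.2 i u
  calc _ ≤ C₁ * (N S * (C₂ * (√(Z.thickness S) *
      Real.exp (Z.speed * Z.thickness S / (4 * B.σ i)) * ‖B.q i‖ * (√(Z.thickness 0))⁻¹ * ‖u‖))) *
      ‖B.p i‖ := by gcongr; exact h₁ t ht i
    _ = _ := by ring

lemma modalFeedback_memLp_of_norm_le {S : ℝ} {u : ∀ t, Z.L2 t} {g : ℝ → ℝ} {C : ℝ}
    (hC : ∀ t ∈ Icc 0 S, ∀ u : Z.L2 t, ‖(Z.modalFeedback B N T).nonlocal t u‖ ≤ C * ‖u‖)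
    (hm : AEStronglyMeasurable (fun t => (Z.modalFeedback B N T).nonlocal t (u t))
      (volume.restrict (Ioo 0 S))) (hg : MemLp g 2 (volume.restrict (Ioo 0 S)))
    (hu : ∀ᵐ t ∂volume.restrict (Ioo 0 S), ‖u t‖ ≤ ‖g t‖) (hC0 : 0 ≤ C) :
    MemLp (fun t => (Z.modalFeedback B N T).nonlocal t (u t)) 2 (volume.restrict (Ioo 0 S)) := by
  refine hg.of_le_mul (c := C) hm ?_
  filter_upwards [hu, ae_restrict_mem measurableSet_Ioo] with t h1 h2
  exact (hC t (Ioo_subset_Icc_self h2) _).trans (mul_le_mul_of_nonneg_left h1 hC0)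

lemma integrableOn_modalFeedback (hN : MonotoneOn N (Ico 0 T)) {S : ℝ} (hS : S < T)
    {u : ∀ t, Z.L2 t} (hu : Z.ContinuousL2On (fun t => u t) (Icc 0 S)) :
    IntegrableOn (fun t => (Z.modalFeedback B N T).nonlocal t (u t)) (Ioo 0 S) := by
  obtain ⟨C, hC0, hC⟩ := exists_norm_modalFeedback_le (Z := Z) (B := B) hN hS
  have hm := modalFeedback_aestronglyMeasurable (Z := Z) (B := B) (u := u) hN hS fun i k => by
    refine ContinuousOn.aestronglyMeasurable ?_ measurableSet_Ioo
    exact continuousOn_const.inner ((hu.continuousOn_profile B (fun t ht => ht.1) i).mono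
      Ioo_subset_Icc_self)
  obtain ⟨D, hD⟩ := isCompact_Icc.exists_bound_of_continuousOn hu.2
  refine (MemLp.integrable (q := 2) (by norm_num)) (modalFeedback_memLp_of_norm_le
    (g := fun _ => √(Z.thickness S) * D) hC hm
    (memLp_const _) ?_ hC0)
  filter_upwards [ae_restrict_mem measurableSet_Ioo] with t ht
  rw [Z.norm_eq_contract (Z.thickness_pos ht.1.le)]
  refine le_trans ?_ (le_abs_self _)
  refine mul_le_mul (Real.sqrt_le_sqrt (Z.thickness_mono ht.2.le)) (hD t (Ioo_subset_Icc_self ht))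
    (norm_nonneg _) (Real.sqrt_nonneg _)

lemma isRegular_modalFeedback_before (hN : MonotoneOn N (Ico 0 T)) :
    (Z.modalFeedback B N T).IsRegular 0 T := by
  refine ⟨fun S h0S hST => ?_, fun c d _ _ i j => memLp_top_const _⟩
  have hS : S < T := EReal.coe_lt_coe_iff.1 hST
  obtain ⟨C, hC0, hC⟩ := exists_norm_modalFeedback_le (Z := Z) (B := B) hN hS
  refine ⟨C.toNNReal, fun z hz => ?_⟩
  set u : ∀ t, Z.L2 t := fun t => toL2 (Z.slice t) fun x => z (t, x) with hu
  have hzs := ae_memLp_slice hz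
  rw [times_coe] at hzs
  have hm : AEStronglyMeasurable (fun t => (Z.modalFeedback B N T).nonlocal t (u t))
      (volume.restrict (Ioo 0 S)) := by
    refine modalFeedback_aestronglyMeasurable hN hS fun i k => ?_
    -- For a general square-integrable `z` the profile is not continuous in time. Its cosine
    -- coefficients are measurable because they are slice integrals against continuous backward
    -- modes.
    have h1 := integrable_integral_slice (integrable_mul_of_continuousAt (le_refl (0 : ℝ))
      (fun p hp => Z.continuousAt_mode (neg_ne_zero.2 (B.σ_pos i).ne') (k * Real.pi) hp)
      (hz.const_inner (B.q i)))
    rw [times_coe] at h1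
    have h2 : AEStronglyMeasurable (fun t => (decay (-(B.σ i)) (k * Real.pi) (Z.scaledTime t))⁻¹)
        (volume.restrict (Ioo 0 S)) :=
      ContinuousOn.aestronglyMeasurable (fun t ht => (ContinuousAt.inv₀
        (Z.continuousAt_decay_scaledTime _ _ ht.1.le) (decay_pos _ _ _).ne').continuousWithinAt)
        measurableSet_Ioo
    refine (h2.mul h1.1).congr ?_
    filter_upwards [hzs, ae_restrict_mem measurableSet_Ioo] with t ht htm
    have h3 := integral_mode_eq_profile B (Z.thickness_pos htm.1.le) i (k * Real.pi) (u t)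
    rw [Pi.mul_apply, inv_mul_eq_iff_eq_mul₀ (decay_pos _ _ _).ne', ← h3]
    refine integral_congr_ae ?_
    filter_upwards [coeFn_toL2 ht] with x hx
    rw [hu]
    simp only
    rw [hx]
  have hn : ∀ᵐ t ∂volume.restrict (Ioo 0 S), ‖u t‖ ^ 2 = ∫ x, ‖z (t, x)‖ ^ 2 ∂Z.slice t := by
    filter_upwards [hzs] with t ht
    rw [← real_inner_self_eq_norm_sq, L2.inner_def]
    refine integral_congr_ae ?_
    filter_upwards [coeFn_toL2 ht] with x hx
    simp only [hu, hx, real_inner_self_eq_norm_sq]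
  have hi : Integrable (fun p => ‖z p‖ ^ 2) (Z.regionMeasure 0 S) := by
    simpa using hz.integrable_norm_rpow (by simp) (by simp)
  have hi2 := integrable_integral_slice hi
  have hi3 := integral_region hi
  rw [times_coe] at hi2 hi3
  have hg : MemLp (fun t => √(∫ x, ‖z (t, x)‖ ^ 2 ∂Z.slice t)) 2 (volume.restrict (Ioo 0 S)) := by
    have h1 := hi2.1.aemeasurable.sqrt.aestronglyMeasurable
    rw [memLp_two_iff_integrable_sq h1]
    refine hi2.congr (ae_of_all _ fun t => ?_)
    exact (Real.sq_sqrt (integral_nonneg fun x => by positivity)).symm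
  have hmem := modalFeedback_memLp_of_norm_le hC hm hg (by
    filter_upwards [hn] with t ht
    rw [← ht, Real.sqrt_sq (norm_nonneg _), norm_norm]) hC0
  refine ⟨hmem, eLpNorm_two_le_of_integral_sq_le hmem hz _ ?_⟩
  rw [hi3, Real.coe_toNNReal _ hC0, ← integral_const_mul]
  refine integral_mono_ae ?_ (hi2.const_mul _) ?_
  · simpa using hmem.integrable_norm_rpow (by simp) (by simp)
  · filter_upwards [hn, ae_restrict_mem measurableSet_Ioo] with t h1 h2
    rw [← h1, ← mul_pow]
    exact pow_le_pow_left₀ (norm_nonneg _) (hC t (Ioo_subset_Icc_self h2) (u t)) 2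

lemma isRegular_modalFeedback_after : (Z.modalFeedback B N T).IsRegular T ⊤ := by
  refine ⟨fun S h0S hST => ⟨0, fun z hz => ?_⟩, fun c d _ _ i j => memLp_top_const _⟩
  have h : (fun t => (Z.modalFeedback B N T).nonlocal t (toL2 (Z.slice t) fun x => z (t, x)))
      =ᵐ[volume.restrict (Ioo T S)] 0 := by
    filter_upwards [ae_restrict_mem measurableSet_Ioo] with t ht
    rw [modalFeedback_of_le ht.1.le]; rfl
  refine ⟨(memLp_congr_ae h).2 MemLp.zero, ?_⟩
  rw [eLpNorm_congr_ae h]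
  simp

end TargetState

end CrossDiffusion

namespace CrossDiffusion

/-! ### Uniqueness -/

/-- Gronwall's inequality for the primitive of `D`, with initial value and inhomogeneity zero. -/
lemma eq_zero_of_le_integral {S C : ℝ} {D : ℝ → ℝ} (hD : ContinuousOn D (Icc 0 S))
    (h0 : ∀ t ∈ Icc 0 S, 0 ≤ D t) (h : ∀ t ∈ Icc 0 S, D t ≤ C * ∫ r in (0 : ℝ)..t, D r) :
    ∀ t ∈ Icc 0 S, D t = 0 := by
  intro t ht
  have hS : 0 ≤ S := ht.1.trans ht.2
  set E : ℝ → ℝ := IccExtend hS ((Icc 0 S).domRestrict D) with hE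
  have hEc : Continuous E := hD.domRestrict.Icc_extend'
  have hED : ∀ t ∈ Icc 0 S, E t = D t := fun t ht => by rw [hE, IccExtend_of_mem _ _ ht]; rfl
  have hint : ∀ t ∈ Icc 0 S, ∫ r in (0 : ℝ)..t, D r = ∫ r in (0 : ℝ)..t, E r := fun t ht =>
    intervalIntegral.integral_congr fun r hr => by
      rw [uIcc_of_le ht.1] at hr
      exact (hED r ⟨hr.1, hr.2.trans ht.2⟩).symm
  have hF0 : ∀ t ∈ Icc 0 S, 0 ≤ ∫ r in (0 : ℝ)..t, E r := fun t ht =>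
    intervalIntegral.integral_nonneg ht.1 fun r hr => by
      rw [hED r ⟨hr.1, hr.2.trans ht.2⟩]; exact h0 r ⟨hr.1, hr.2.trans ht.2⟩
  have key := norm_le_gronwallBound_of_norm_deriv_right_le (f := fun t => ∫ r in (0 : ℝ)..t, E r)
    (f' := E) (a := 0) (b := S) (δ := 0) (K := C) (ε := 0)
    (fun t _ => (hEc.integral_hasStrictDerivAt 0 t).hasDerivAt.continuousAt.continuousWithinAt)
    (fun t _ => (hEc.integral_hasStrictDerivAt 0 t).hasDerivAt.hasDerivWithinAt) (by simp)
    (fun t ht => by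
      have ht' := Ico_subset_Icc_self ht
      rw [hED t ht', Real.norm_of_nonneg (h0 t ht'), Real.norm_of_nonneg (hF0 t ht'), add_zero,
        ← hint t ht']
      exact h t ht') t ht
  rw [gronwallBound_ε0_δ0, Real.norm_of_nonneg (hF0 t ht)] at key
  have h2 := h t ht
  rw [hint t ht, le_antisymm key (hF0 t ht), mul_zero] at h2
  exact le_antisymm h2 (h0 t ht)

namespace TargetState

variable {n : ℕ} {Z : TargetState n} {A : Mat n} {B : Eigenbasis A} {N : ℝ → ℕ} {T : ℝ}

lemma eq_of_inner_cosMode_profile (B : Eigenbasis A) {t : ℝ} (ht : 0 < Z.thickness t)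
    {u w : Z.L2 t} (h : ∀ i (k : ℕ),
      ∫ x, Z.mode (-(B.σ i)) (k * Real.pi) t x * inner ℝ (B.q i) (u x) ∂Z.slice t =
      ∫ x, Z.mode (-(B.σ i)) (k * Real.pi) t x * inner ℝ (B.q i) (w x) ∂Z.slice t) : u = w := by
  refine profile_ext B ht fun i => ?_
  rw [← sub_eq_zero]
  refine eq_zero_of_forall_inner_cosMode fun k => ?_
  have h1 := h i k
  rw [integral_mode_eq_profile B ht, integral_mode_eq_profile B ht,
    mul_right_inj' (decay_pos _ _ _).ne'] at h1
  rw [inner_sub_right, h1, sub_self]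

lemma ContinuousL2On.mono {v : ℝ → ℝ → Vec n} {J J' : Set ℝ} (h : Z.ContinuousL2On v J)
    (hJ : J' ⊆ J) : Z.ContinuousL2On v J' := ⟨fun t ht => h.1 t (hJ ht), h.2.mono hJ⟩

lemma Icc_subset_times {a S : ℝ} {b : EReal} (hS : (S : EReal) < b) :
    Icc a S ⊆ {t : ℝ | a ≤ t ∧ (t : EReal) < b} := fun _ ht =>
  ⟨ht.1, (EReal.coe_le_coe_iff.2 ht.2).trans_lt hS⟩

/-- The cosine coefficients of the difference of two solutions satisfy a Volterra system. Up to `S <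
T` its right-hand side involves only the coefficients with index below `N S`: these vanish by
Gronwall, and then so do all others. -/
theorem unique_before (hN : MonotoneOn N (Ico 0 T)) {u₀ : Z.L2 0} {u w : ∀ t, Z.L2 t}
    (hu : Z.IsWeakSolution A (Z.modalFeedback B N T) 0 T u₀ u)
    (hw : Z.IsWeakSolution A (Z.modalFeedback B N T) 0 T u₀ w) {t : ℝ} (ht0 : 0 ≤ t) (htT : t < T) :
    w t = u t := by
  obtain ⟨S, htS, hST⟩ := exists_between htT
  have h0S : 0 < S := ht0.trans_lt htS
  have hSE : (S : EReal) < T := EReal.coe_lt_coe_iff.2 hST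
  have huc := hu.continuousL2On.mono (Icc_subset_times (a := 0) hSE)
  have hwc := hw.continuousL2On.mono (Icc_subset_times (a := 0) hSE)
  have hui := integrableOn_modalFeedback (B := B) hN hST huc
  have hwi := integrableOn_modalFeedback (B := B) hN hST hwc
  have hsub : Icc (0 : ℝ) S ⊆ Ici 0 := fun t ht => ht.1
  refine eq_of_inner_cosMode_profile B (Z.thickness_pos ht0) fun i k => ?_
  -- Differences of the pairings with backward modes, that is of the cosine coefficients up to an
  -- explicit positive factor.
  set Δ : ℕ → ℝ → ℝ := fun k t =>
    (∫ x, Z.mode (-(B.σ i)) (k * Real.pi) t x * inner ℝ (B.q i) (w t x) ∂Z.slice t) -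
    ∫ x, Z.mode (-(B.σ i)) (k * Real.pi) t x * inner ℝ (B.q i) (u t x) ∂Z.slice t with hΔ
  have hΔc : ∀ k, ContinuousOn (Δ k) (Icc 0 S) := fun k =>
    (hwc.continuousOn_integral_mode hsub _ _ _).sub (huc.continuousOn_integral_mode hsub _ _ _)
  set I : ℕ → ℝ → ℝ := fun k r => Z.mode (-(B.σ i)) (k * Real.pi) r (Z.thickness r) *
    (Z.fluxFactor (B.σ i) r * ∑ j ∈ Finset.range (N S), kernelCoef (N r) j *
      ((decay (-(B.σ i)) (j * Real.pi) (Z.scaledTime r))⁻¹ * Δ j r)) with hI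
  have hmc : ∀ k : ℕ, ContinuousOn (fun r => Z.mode (-(B.σ i)) (k * Real.pi) r (Z.thickness r))
      (Icc 0 S) := fun k r hr => by
    refine ContinuousAt.continuousWithinAt ?_
    exact ContinuousAt.comp (f := fun t => (t, Z.thickness t))
      (g := fun p : ℝ × ℝ => Z.mode (-(B.σ i)) (k * Real.pi) p.1 p.2)
      (Z.continuousAt_mode (neg_ne_zero.2 (B.σ_pos i).ne') _ (Z.thickness_pos hr.1)) (by fun_prop)
  have hform : ∀ k, ∀ t ∈ Icc 0 S, Δ k t = ∫ r in (0 : ℝ)..t, I k r := by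
    intro k t ht
    have hint : ∀ {v : ∀ t, Z.L2 t}, IntegrableOn
        (fun t => (Z.modalFeedback B N T).nonlocal t (v t)) (Ioo 0 S) → IntervalIntegrable
        (fun r => Z.mode (-(B.σ i)) (k * Real.pi) r (Z.thickness r) *
          inner ℝ (B.q i) ((Z.modalFeedback B N T).nonlocal r (v r))) volume 0 t := by
      intro v hv
      rw [intervalIntegrable_iff_integrableOn_Ioo_of_le ht.1]
      exact (integrableOn_continuous_mul (hmc k) (hv.const_inner (B.q i))).mono_set
        (Ioo_subset_Ioo_right ht.2)
    simp only [hΔ]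
    rw [hw.integral_mode_eq (fun _ => rfl) (B.σ_pos i).ne' (B.mulVec_q i) le_rfl h0S hSE hwi
      (Real.sin_nat_mul_pi k) ht, hu.integral_mode_eq (fun _ => rfl) (B.σ_pos i).ne'
      (B.mulVec_q i) le_rfl h0S hSE hui (Real.sin_nat_mul_pi k) ht, add_sub_add_left_eq_sub,
      ← intervalIntegral.integral_sub (hint hwi) (hint hui)]
    refine intervalIntegral.integral_congr fun r hr => ?_
    rw [uIcc_of_le ht.1] at hr
    have hrT : r < T := (hr.2.trans ht.2).trans_lt hST
    have hNr : N r ≤ N S := hN ⟨hr.1, hrT⟩ ⟨h0S.le, hST⟩ (hr.2.trans ht.2)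
    have hE := Z.thickness_pos hr.1
    simp only [hI]
    rw [inner_modalFeedback hr.1 hrT, inner_modalFeedback hr.1 hrT, ← mul_sub, ← mul_sub,
      inner_feedbackKernel_eq hNr, inner_feedbackKernel_eq hNr, ← Finset.sum_sub_distrib]
    congr 2
    refine Finset.sum_congr rfl fun j _ => ?_
    rw [← mul_sub]
    congr 1
    simp only [hΔ]
    rw [integral_mode_eq_profile B hE, integral_mode_eq_profile B hE, ← mul_sub, ← mul_assoc,
      inv_mul_cancel₀ (decay_pos _ _ _).ne', one_mul]
  -- This finite sum controls the feedback difference, so the inequality for it is closed.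
  set D : ℝ → ℝ := fun t => ∑ j ∈ Finset.range (N S), |Δ j t| with hDdef
  have hDc : ContinuousOn D (Icc 0 S) := continuousOn_finsetSum _ fun j _ => (hΔc j).abs
  have hD0 : ∀ t ∈ Icc 0 S, 0 ≤ D t := fun t _ => Finset.sum_nonneg fun _ _ => abs_nonneg _
  obtain ⟨C₁, hC₁, h₁⟩ := exists_fluxFactor_bound (Z := Z) B S
  obtain ⟨C₂, hC₂, h₂⟩ := exists_kernelCoef_bound (N S)
  have hb : ∀ j : ℕ, ∃ C, ∀ r ∈ Icc 0 S, |(decay (-(B.σ i)) (j * Real.pi) (Z.scaledTime r))⁻¹| ≤ C :=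
    fun j => isCompact_Icc.exists_bound_of_continuousOn fun r hr => (ContinuousAt.inv₀
        (Z.continuousAt_decay_scaledTime _ _ hr.1) (decay_pos _ _ _).ne').continuousWithinAt
  choose C₃ h₃ using hb
  have hm : ∀ j : ℕ, ∃ C, ∀ r ∈ Icc 0 S,
      |Z.mode (-(B.σ i)) (j * Real.pi) r (Z.thickness r)| ≤ C :=
    fun j => isCompact_Icc.exists_bound_of_continuousOn (hmc j)
  choose C₄ h₄ using hm
  set K₃ := ∑ j ∈ Finset.range (N S), |C₃ j| with hK₃
  have hsum : ∀ r ∈ Icc 0 S, |∑ j ∈ Finset.range (N S), kernelCoef (N r) j *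
      ((decay (-(B.σ i)) (j * Real.pi) (Z.scaledTime r))⁻¹ * Δ j r)| ≤ C₂ * K₃ * D r := by
    intro r hr
    have hNr : N r ≤ N S := hN ⟨hr.1, hr.2.trans_lt hST⟩ ⟨h0S.le, hST⟩ hr.2
    refine (Finset.abs_sum_le_sum_abs _ _).trans ?_
    rw [hDdef, Finset.mul_sum]
    refine Finset.sum_le_sum fun j hj => ?_
    rw [abs_mul, abs_mul, ← mul_assoc]
    gcongr
    · exact h₂ _ hNr _ (Finset.mem_range.1 hj)
    · exact ((h₃ j r hr).trans (le_abs_self _)).trans (Finset.single_le_sum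
        (f := fun j => |C₃ j|) (fun _ _ => abs_nonneg _) hj)
  have hIb : ∀ k, ∀ r ∈ Icc 0 S, |I k r| ≤ |C₄ k| * (C₁ * (C₂ * K₃ * D r)) := by
    intro k r hr
    simp only [hI]
    rw [abs_mul, abs_mul]
    exact mul_le_mul ((h₄ k r hr).trans (le_abs_self _)) (mul_le_mul (h₁ r hr i) (hsum r hr)
      (abs_nonneg _) hC₁) (by positivity) (abs_nonneg _)
  have hDi : ∀ t ∈ Icc 0 S, IntervalIntegrable D volume 0 t := fun t ht =>
    (hDc.mono (by rw [uIcc_of_le ht.1]; exact Icc_subset_Icc_right ht.2)).intervalIntegrable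
  have hΔb : ∀ k, ∀ t ∈ Icc 0 S, |Δ k t| ≤ |C₄ k| * (C₁ * (C₂ * K₃)) * ∫ r in (0 : ℝ)..t, D r := by
    intro k t ht
    rw [hform k t ht, ← intervalIntegral.integral_const_mul, ← Real.norm_eq_abs]
    refine intervalIntegral.norm_integral_le_of_norm_le ht.1 (ae_of_all _ fun r hr => ?_)
      ((hDi t ht).const_mul _)
    refine (hIb k r ⟨hr.1.le, hr.2.trans ht.2⟩).trans (le_of_eq (by ring))
  have hDz := eq_zero_of_le_integral (C := ∑ j ∈ Finset.range (N S), |C₄ j| * (C₁ * (C₂ * K₃)))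
    hDc hD0 fun t ht => by
      rw [Finset.sum_mul]
      exact Finset.sum_le_sum fun j _ => hΔb j t ht
  have hfin := hΔb k t ⟨ht0, htS.le⟩
  have hz : ∫ r in (0 : ℝ)..t, D r = 0 := by
    rw [intervalIntegral.integral_congr (g := fun _ => 0) fun r hr => ?_]
    · simp
    · rw [uIcc_of_le ht0] at hr
      exact hDz r ⟨hr.1, hr.2.trans htS.le⟩
  rw [hz, mul_zero] at hfin
  exact sub_eq_zero.1 (abs_eq_zero.1 (le_antisymm hfin (abs_nonneg _)))

/-- The nonlocal feedback is zero after `T`, so the pairings with backward modes keep their initial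
values, which determine the solution. -/
theorem unique_after (hT : 0 ≤ T) {uT : Z.L2 T} {u w : ∀ t, Z.L2 t}
    (hu : Z.IsWeakSolution A (Z.modalFeedback B N T) T ⊤ uT u)
    (hw : Z.IsWeakSolution A (Z.modalFeedback B N T) T ⊤ uT w) {t : ℝ} (ht : T ≤ t) :
    w t = u t := by
  refine eq_of_inner_cosMode_profile B (Z.thickness_pos (hT.trans ht)) fun i k => ?_
  have hz : ∀ (v : ∀ t, Z.L2 t), ∀ r ∈ Ici T, (Z.modalFeedback B N T).nonlocal r (v r) = 0 :=
    fun v r hr => by rw [modalFeedback_of_le hr]; rfl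
  have hi : ∀ (v : ∀ t, Z.L2 t), IntegrableOn
      (fun r => (Z.modalFeedback B N T).nonlocal r (v r)) (Ioo T (t + 1)) := fun v =>
    (integrableOn_congr_fun (fun r hr => hz v r (mem_Ici.2 hr.1.le)) measurableSet_Ioo).2
      (by exact integrableOn_zero)
  have hf : ∀ {v : ∀ t, Z.L2 t}, Z.IsWeakSolution A (Z.modalFeedback B N T) T ⊤ uT v →
      ∫ x, Z.mode (-(B.σ i)) (k * Real.pi) t x * inner ℝ (B.q i) (v t x) ∂Z.slice t =
      ∫ x, Z.mode (-(B.σ i)) (k * Real.pi) T x * inner ℝ (B.q i) (uT x) ∂Z.slice T := by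
    intro v hv
    rw [hv.integral_mode_eq (S := t + 1) (fun _ => rfl) (B.σ_pos i).ne' (B.mulVec_q i) hT
      (by linarith) (EReal.coe_lt_top _) (hi v) (Real.sin_nat_mul_pi k) ⟨ht, by linarith⟩]
    rw [intervalIntegral.integral_congr (g := fun _ => 0) fun r hr => ?_]
    · simp
    · rw [uIcc_of_le ht] at hr
      simp only [hz v r hr.1, inner_zero_right, mul_zero]
  rw [hf hu, hf hw]

end TargetState

end CrossDiffusion

namespace CrossDiffusion

/-! ### The schedule of the feedback -/

/-- The times at which the number of modified modes changes. -/
noncomputable def knot (T : ℝ) (m : ℕ) : ℝ := T * (m / (m + 1))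

/-- The index of the time interval that contains `t`. -/
noncomputable def knotIndex (T t : ℝ) : ℕ := ⌊t / (T - t)⌋₊

/-- The number of modified modes on the time interval of index `m`. -/
def modeCount (m : ℕ) : ℕ := (m + 1) ^ 4

lemma one_le_modeCount (m : ℕ) : 1 ≤ modeCount m := Nat.one_le_pow _ _ (by omega)

lemma modeCount_mono : Monotone modeCount := fun _ _ h => Nat.pow_le_pow_left (by omega) 4

lemma knot_zero (T : ℝ) : knot T 0 = 0 := by simp [knot]

lemma knot_succ_sub (T : ℝ) (m : ℕ) : knot T (m + 1) - knot T m = T / ((m + 1) * (m + 2)) := by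
  have : (0 : ℝ) ≤ m := m.cast_nonneg
  unfold knot
  push_cast
  field_simp
  ring

variable {T : ℝ}

lemma knot_lt_succ (hT : 0 < T) (m : ℕ) : knot T m < knot T (m + 1) := by
  have h := knot_succ_sub T m
  have : 0 < T / ((m + 1) * (m + 2)) := by positivity
  linarith

lemma knot_mono (hT : 0 < T) : StrictMono (knot T) := strictMono_nat_of_lt_succ (knot_lt_succ hT)

lemma knot_nonneg (hT : 0 < T) (m : ℕ) : 0 ≤ knot T m := by unfold knot; positivity

lemma knot_lt (hT : 0 < T) (m : ℕ) : knot T m < T := by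
  unfold knot
  refine mul_lt_of_lt_one_right hT ?_
  rw [div_lt_one (by positivity)]; linarith

/-- The function `t / (T - t)` maps the knot of index `m` to `m`, so its integer part is the index
of the interval. -/
lemma knot_le_iff {t : ℝ} (htT : t < T) (m : ℕ) : knot T m ≤ t ↔ (m : ℝ) ≤ t / (T - t) := by
  have : 0 < T - t := by linarith
  rw [le_div_iff₀ this, knot, ← mul_div_assoc, div_le_iff₀ (by positivity)]
  constructor <;> intro h <;> nlinarith

lemma knotIndex_eq {t : ℝ} {m : ℕ} (ht0 : 0 ≤ t) (htT : t < T) (h1 : knot T m ≤ t)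
    (h2 : t < knot T (m + 1)) : knotIndex T t = m := by
  rw [knotIndex, Nat.floor_eq_iff (div_nonneg ht0 (by linarith))]
  refine ⟨(knot_le_iff htT m).1 h1, ?_⟩
  have := mt (knot_le_iff htT (m + 1)).2 (not_le.2 h2)
  push_cast at this
  exact not_le.1 this

lemma knot_knotIndex_le {t : ℝ} (ht0 : 0 ≤ t) (htT : t < T) : knot T (knotIndex T t) ≤ t :=
  (knot_le_iff htT _).2 (Nat.floor_le (div_nonneg ht0 (by linarith)))

lemma lt_knot_knotIndex_succ {t : ℝ} (htT : t < T) : t < knot T (knotIndex T t + 1) := by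
  refine not_le.1 (mt (knot_le_iff htT _).1 ?_)
  push_cast
  exact not_le.2 (Nat.lt_floor_add_one _)

lemma knotIndex_monotoneOn : MonotoneOn (knotIndex T) (Ico 0 T) := by
  intro s hs t ht hst
  refine Nat.floor_mono ?_
  have h1 : 0 < T - t := by linarith [ht.2]
  have := ht.1
  gcongr

lemma tendsto_knotIndex (hT : 0 < T) : Tendsto (knotIndex T) (𝓝[<] T) atTop := by
  refine tendsto_atTop.2 fun m => ?_
  filter_upwards [Ioo_mem_nhdsLT (knot_lt hT m)] with t ht
  exact Nat.le_floor ((knot_le_iff ht.2 m).1 ht.1.le)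

namespace TargetState

variable {n : ℕ} (Z : TargetState n)

lemma scaledTime_sub {s t : ℝ} (hs : 0 ≤ s) (ht : 0 ≤ t) :
    Z.scaledTime t - Z.scaledTime s = (t - s) / (Z.thickness s * Z.thickness t) := by
  have h0 := Z.initialThickness_pos
  have h1 := Z.thickness_pos hs
  have h2 := Z.thickness_pos ht
  unfold scaledTime
  rw [div_sub_div _ _ (by positivity) (by positivity), div_eq_div_iff (by positivity) (by positivity)]
  simp only [thickness]
  ring

lemma scaledTime_sub_nonneg {s t : ℝ} (hs : 0 ≤ s) (hst : s ≤ t) :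
    0 ≤ Z.scaledTime t - Z.scaledTime s := by
  rw [Z.scaledTime_sub hs (hs.trans hst)]
  have h1 := Z.thickness_pos hs
  have h2 := Z.thickness_pos (hs.trans hst)
  exact div_nonneg (by linarith) (by positivity)

/-- Scaled duration of the time interval of index `m`. -/
noncomputable def scaledStep (T : ℝ) (m : ℕ) : ℝ :=
  Z.scaledTime (knot T (m + 1)) - Z.scaledTime (knot T m)

/-- The domain is never thicker than `ē(T)` before `T`, so scaled durations shrink no faster than a
multiple of `1 / m²`. -/
lemma le_scaledStep (hT : 0 < T) (m : ℕ) :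
    T / Z.thickness T ^ 2 / ((m + 1) * (m + 2)) ≤ Z.scaledStep T m := by
  have h1 := knot_nonneg hT m
  have h2 := knot_nonneg hT (m + 1)
  have hE := Z.thickness_pos hT.le
  have h3 := Z.thickness_pos h1
  have h4 := Z.thickness_pos h2
  rw [scaledStep, Z.scaledTime_sub h1 h2, knot_succ_sub, div_right_comm, sq]
  gcongr
  · exact Z.thickness_mono (knot_lt hT m).le
  · exact Z.thickness_mono (knot_lt hT _).le

end TargetState

/-! ### Decay of the closed-loop evolution -/

/-- Weight of the norms at the beginning of a time interval. -/
noncomputable def stepWeight (m : ℕ) : ℝ := modeCount m * evolConst (modeCount m)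

/-- The norm estimates need only `evolConst`; the additional factor `modeCount m` in the weight
serves the energy estimate of the time derivative in `abs_integral_pairing_evol_le`. -/
lemma evolConst_le_stepWeight (m : ℕ) : evolConst (modeCount m) ≤ stepWeight m := by
  have h1 := one_le_evolConst (modeCount m)
  have h2 : (1 : ℝ) ≤ modeCount m := by exact_mod_cast one_le_modeCount m
  exact le_mul_of_one_le_left (by linarith) h2

lemma one_le_stepWeight (m : ℕ) : 1 ≤ stepWeight m :=
  (one_le_evolConst _).trans (evolConst_le_stepWeight m)

/-- With `a = m + 2` there are `a^4` modes, and `(2 a^4)^(4 a^4)` is at most `exp (20 a^5)` because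
`log` is sublinear. The polynomial factors cost `exp (16 a)`, and `a ≤ 2 (m + 1)` gives `36 · 32 =
1152`. -/
lemma stepWeight_succ_le (m : ℕ) : stepWeight (m + 1) ≤ Real.exp (1152 * (m + 1) ^ 5) := by
  set a : ℝ := m + 2 with ha
  have h0 : (0 : ℝ) ≤ m := m.cast_nonneg
  have ha1 : 1 ≤ a := by linarith
  have hν : ((modeCount (m + 1) : ℕ) : ℝ) = a ^ 4 := by
    rw [modeCount, ha]; push_cast; ring
  have hexp : ∀ j : ℕ, a ^ j ≤ Real.exp (j * a) := fun j => by
    rw [Real.exp_nat_mul]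
    exact pow_le_pow_left₀ (by linarith) (by linarith [Real.add_one_le_exp a]) j
  have hone : ∀ j : ℕ, 1 ≤ a ^ j := fun j => one_le_pow₀ ha1
  have h2 : 2 * a ^ 4 ≤ Real.exp (5 * a) := by
    have h3 : 2 ≤ Real.exp a := by linarith [Real.add_one_le_exp a]
    calc 2 * a ^ 4 ≤ Real.exp a * Real.exp ((4 : ℕ) * a) := by gcongr; exact hexp 4
      _ = _ := by rw [← Real.exp_add]; congr 1; push_cast; ring
  have h4 : (2 * a ^ 4) ^ (4 * modeCount (m + 1)) ≤ Real.exp (20 * a ^ 5) := by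
    calc _ ≤ Real.exp (5 * a) ^ (4 * modeCount (m + 1)) := by gcongr
      _ = _ := by rw [← Real.exp_nat_mul]; push_cast; rw [hν]; congr 1; ring
  have h21 : (21 : ℝ) ≤ Real.exp (4 * a) := by
    have h5 : (3 : ℝ) ≤ Real.exp a := by linarith [Real.add_one_le_exp a]
    have : Real.exp (4 * a) = Real.exp a ^ 4 := by rw [← Real.exp_nat_mul]; norm_num
    rw [this]
    calc (21 : ℝ) ≤ 3 ^ 4 := by norm_num
      _ ≤ _ := by gcongr
  have hbig : 1 ≤ (2 * a ^ 4) ^ (4 * modeCount (m + 1)) :=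
    one_le_pow₀ (by linarith [hone 4])
  have key : stepWeight (m + 1) ≤ 21 * a ^ 12 * (2 * a ^ 4) ^ (4 * modeCount (m + 1)) := by
    rw [stepWeight, evolConst, lowConst, hν]
    set X := (2 * a ^ 4) ^ (4 * modeCount (m + 1))
    have h6 : a ^ 4 ≤ a ^ 12 * X := by
      calc a ^ 4 ≤ a ^ 12 := pow_le_pow_right₀ ha1 (by norm_num)
        _ ≤ _ := le_mul_of_one_le_right (by positivity) hbig
    nlinarith
  refine key.trans ?_
  calc _ ≤ Real.exp (4 * a) * Real.exp ((12 : ℕ) * a) * Real.exp (20 * a ^ 5) := by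
        gcongr
        exact hexp 12
    _ = Real.exp (16 * a + 20 * a ^ 5) := by
        rw [← Real.exp_add, ← Real.exp_add]; congr 1; push_cast; ring
    _ ≤ _ := by
        refine Real.exp_le_exp.2 ?_
        have h7 : a ≤ a ^ 5 := le_self_pow₀ ha1 (by norm_num)
        have h8 : a ^ 5 ≤ (2 * (m + 1)) ^ 5 := by gcongr; linarith
        have h9 : (2 * ((m : ℝ) + 1)) ^ 5 = 32 * (m + 1) ^ 5 := by ring
        linarith

namespace TargetState

variable {n : ℕ} (Z : TargetState n) (σ T : ℝ)

/-- Factor by which the weighted norms shrink during the time interval of index `m`. -/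
noncomputable def stepFactor (m : ℕ) : ℝ :=
  stepWeight (m + 1) * decay σ (modeCount m * Real.pi) (Z.scaledStep T m)

variable {σ T}

lemma stepFactor_pos (m : ℕ) : 0 < Z.stepFactor σ T m :=
  mul_pos (by linarith [one_le_stepWeight (m + 1)]) (decay_pos _ _ _)

/-- Here the schedule pays off: `N² = (m + 1)^8` times a duration of order `1 / m²` gives a decay
exponent of order `m^6`, while the weight of the next interval has exponent of order `m^5`. -/
lemma tendsto_stepFactor (hσ : 0 < σ) (hT : 0 < T) :
    Tendsto (Z.stepFactor σ T) atTop (𝓝 0) := by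
  set κ := σ * (T / Z.thickness T ^ 2) / 2 with hκ
  have hE := Z.thickness_pos hT.le
  have hκ0 : 0 < κ := by positivity
  have hle : ∀ m : ℕ, Z.stepFactor σ T m ≤
      Real.exp (1152 * ((m : ℝ) + 1) ^ 5 - κ * (m + 1) ^ 6) := by
    intro m
    have h0 : (0 : ℝ) ≤ m := m.cast_nonneg
    have h1 := Z.le_scaledStep hT m
    have hs : 0 ≤ Z.scaledStep T m := le_trans (by positivity) h1
    rw [sub_eq_add_neg, Real.exp_add]
    refine mul_le_mul (stepWeight_succ_le m) ?_ (decay_pos _ _ _).le (Real.exp_pos _).le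
    rw [decay, Real.exp_le_exp, neg_le_neg_iff]
    have h2 : κ * (m + 1) ^ 6 ≤ σ * (m + 1) ^ 8 * (T / Z.thickness T ^ 2 / ((m + 1) * (m + 2))) := by
      rw [← mul_div_assoc, le_div_iff₀ (by positivity), hκ]
      have h3 : ((m : ℝ) + 1) ^ 6 * ((m + 1) * (m + 2)) ≤ 2 * (m + 1) ^ 8 := by
        have : ((m : ℝ) + 2) ≤ 2 * (m + 1) := by linarith
        calc _ ≤ ((m : ℝ) + 1) ^ 6 * ((m + 1) * (2 * (m + 1))) := by gcongr
          _ = _ := by ring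
      calc _ = σ * (T / Z.thickness T ^ 2) / 2 * (((m : ℝ) + 1) ^ 6 * ((m + 1) * (m + 2))) := by ring
        _ ≤ σ * (T / Z.thickness T ^ 2) / 2 * (2 * (m + 1) ^ 8) := by gcongr
        _ = _ := by ring
    refine h2.trans ?_
    have h4 : ((modeCount m : ℕ) : ℝ) = (m + 1) ^ 4 := by rw [modeCount]; push_cast; ring
    rw [h4, mul_pow, ← pow_mul]
    have h5 := one_le_pi_sq
    calc _ ≤ σ * (m + 1) ^ 8 * Z.scaledStep T m := by gcongr
      _ ≤ σ * (((m : ℝ) + 1) ^ (4 * 2) * Real.pi ^ 2) * Z.scaledStep T m := by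
        gcongr
        exact le_mul_of_one_le_right (by positivity) h5
  have hlim : Tendsto (fun m : ℕ => Real.exp (-((m : ℝ)))) atTop (𝓝 0) :=
    Real.tendsto_exp_neg_atTop_nhds_zero.comp tendsto_natCast_atTop_atTop
  refine squeeze_zero' (Eventually.of_forall fun m => (Z.stepFactor_pos m).le) ?_ hlim
  -- From this index on, `1152 - κ (m + 1) ≤ -1`.
  filter_upwards [eventually_ge_atTop ⌈1153 / κ⌉₊] with m hm
  refine (hle m).trans (Real.exp_le_exp.2 ?_)
  have h0 : (0 : ℝ) ≤ m := m.cast_nonneg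
  have h1 : 1153 / κ ≤ m := (Nat.le_ceil _).trans (by exact_mod_cast hm)
  rw [div_le_iff₀ hκ0] at h1
  have h2 : (1152 : ℝ) - κ * (m + 1) ≤ -1 := by nlinarith
  have h3 : (m : ℝ) ≤ (m + 1) ^ 5 :=
    (by linarith : (m : ℝ) ≤ m + 1).trans (le_self_pow₀ (by linarith) (by norm_num))
  calc _ = (1152 - κ * ((m : ℝ) + 1)) * (m + 1) ^ 5 := by ring
    _ ≤ -1 * (m + 1) ^ 5 := by gcongr
    _ ≤ _ := by linarith

variable (σ T) in
/-- Factor by which the weighted norms have shrunk before the time interval of index `m`. -/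
noncomputable def totalFactor (m : ℕ) : ℝ := ∏ j ∈ Finset.range m, Z.stepFactor σ T j

lemma totalFactor_pos (m : ℕ) : 0 < Z.totalFactor σ T m :=
  Finset.prod_pos fun _ _ => Z.stepFactor_pos _

/-- Ratio test: the quotients are the step factors. Summability, and not only convergence to zero,
is used to add the energy bounds of all intervals. -/
lemma summable_totalFactor (hσ : 0 < σ) (hT : 0 < T) : Summable (Z.totalFactor σ T) := by
  refine summable_of_ratio_test_tendsto_lt_one (l := 0) zero_lt_one
    (Eventually.of_forall fun m => (Z.totalFactor_pos m).ne') ?_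
  refine (Z.tendsto_stepFactor hσ hT).congr fun m => ?_
  rw [Real.norm_of_nonneg (Z.totalFactor_pos _).le, Real.norm_of_nonneg (Z.totalFactor_pos _).le,
    totalFactor, totalFactor, Finset.prod_range_succ, mul_div_cancel_left₀]
  exact (Z.totalFactor_pos m).ne'

/-! ### The closed-loop components -/

variable (T) in
/-- The component at the beginning of the time interval of index `m`. -/
noncomputable def stepState (hσ : 0 < σ) (z : UnitL2) : ℕ → UnitL2
  | 0 => z
  | m + 1 => evol hσ (modeCount m) (Z.scaledStep T m) (stepState hσ z m)

variable (T) in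
/-- The component at time `t`. -/
noncomputable def state (hσ : 0 < σ) (z : UnitL2) (t : ℝ) : UnitL2 :=
  evol hσ (modeCount (knotIndex T t)) (Z.scaledTime t - Z.scaledTime (knot T (knotIndex T t)))
    (Z.stepState T hσ z (knotIndex T t))

/-- The formula includes the right end point: there the index has already increased, but the next
evolution starts as the identity from the same state. -/
lemma state_eq (hσ : 0 < σ) (hT : 0 < T) (z : UnitL2) {m : ℕ} {t : ℝ}
    (ht : t ∈ Icc (knot T m) (knot T (m + 1))) :
    Z.state T hσ z t =
      evol hσ (modeCount m) (Z.scaledTime t - Z.scaledTime (knot T m)) (Z.stepState T hσ z m) := by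
  have h0 := (knot_nonneg hT m).trans ht.1
  have hlt := ht.2.trans_lt (knot_lt hT _)
  rcases ht.2.eq_or_lt with h | h
  · have hi : knotIndex T t = m + 1 := knotIndex_eq h0 hlt h.ge
      (by rw [h]; exact knot_lt_succ hT _)
    rw [state, hi, h, sub_self, evol_zero]
    rfl
  · rw [state, knotIndex_eq h0 hlt ht.1 h]

lemma state_zero (hσ : 0 < σ) (hT : 0 < T) (z : UnitL2) : Z.state T hσ z 0 = z := by
  rw [Z.state_eq hσ hT z (m := 0) ⟨(knot_zero T).le, knot_nonneg hT _⟩, knot_zero, sub_self, evol_zero]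
  rfl

/-- Each step factor already contains the weight of the following interval, so the weighted norms
form a telescoping product. -/
lemma stepWeight_mul_norm_le (hσ : 0 < σ) (hT : 0 < T) (z : UnitL2) (m : ℕ) :
    stepWeight m * ‖Z.stepState T hσ z m‖ ≤ Z.totalFactor σ T m * (stepWeight 0 * ‖z‖) := by
  induction m with
  | zero => simp [totalFactor, stepState]
  | succ m ih =>
    have h1 := norm_evol_le hσ (one_le_modeCount m)
      (Z.scaledTime_sub_nonneg (knot_nonneg hT m) (knot_lt_succ hT m).le) (Z.stepState T hσ z m)
    have hw := one_le_stepWeight (m + 1)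
    rw [totalFactor, Finset.prod_range_succ]
    calc _ ≤ stepWeight (m + 1) * (evolConst (modeCount m) *
          decay σ (modeCount m * Real.pi) (Z.scaledStep T m) * ‖Z.stepState T hσ z m‖) := by
          gcongr; exact h1
      _ = Z.stepFactor σ T m * (evolConst (modeCount m) * ‖Z.stepState T hσ z m‖) := by
          rw [stepFactor]; ring
      _ ≤ Z.stepFactor σ T m * (stepWeight m * ‖Z.stepState T hσ z m‖) := by
          have := (Z.stepFactor_pos (σ := σ) (T := T) m).le
          gcongr
          exact evolConst_le_stepWeight m
      _ ≤ Z.stepFactor σ T m * (Z.totalFactor σ T m * (stepWeight 0 * ‖z‖)) :=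
          mul_le_mul_of_nonneg_left ih (Z.stepFactor_pos _).le
      _ = _ := by rw [totalFactor]; ring

lemma norm_state_le (hσ : 0 < σ) (hT : 0 < T) (z : UnitL2) {t : ℝ} (ht0 : 0 ≤ t) (htT : t < T) :
    ‖Z.state T hσ z t‖ ≤ Z.totalFactor σ T (knotIndex T t) * (stepWeight 0 * ‖z‖) := by
  refine le_trans ?_ (Z.stepWeight_mul_norm_le hσ hT z (knotIndex T t))
  have h1 := Z.scaledTime_sub_nonneg (knot_nonneg hT (knotIndex T t)) (knot_knotIndex_le ht0 htT)
  refine (norm_evol_le hσ (one_le_modeCount _) h1 _).trans ?_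
  refine mul_le_mul_of_nonneg_right ?_ (norm_nonneg _)
  refine le_trans (mul_le_of_le_one_right ?_ (decay_le_one hσ.le h1 _)) (evolConst_le_stepWeight _)
  linarith [one_le_evolConst (modeCount (knotIndex T t))]

/-- A uniform limit of finite sums of continuous terms, including the time `r = 0`. -/
lemma continuousOn_evol (hσ : 0 < σ) {N : ℕ} (hN : 1 ≤ N) (z : UnitL2) :
    ContinuousOn (fun r => evol hσ N r z) (Ici 0) := by
  obtain ⟨δ, hδ, hb⟩ := exists_modalSum_error hσ hN z
  have hu : TendstoUniformlyOn (fun L r => modalSum σ N (N + L) r z) (fun r => evol hσ N r z)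
      atTop (Ici 0) := by
    rw [Metric.tendstoUniformlyOn_iff]
    intro ε hε
    filter_upwards [hδ.eventually_lt_const hε] with L hL r hr
    rw [dist_eq_norm]
    exact (hb L r hr).trans_lt hL
  refine hu.continuousOn (Frequently.of_forall fun L => ?_)
  unfold modalSum decay
  fun_prop

lemma continuousOn_state_Icc (hσ : 0 < σ) (hT : 0 < T) (z : UnitL2) (m : ℕ) :
    ContinuousOn (Z.state T hσ z) (Icc 0 (knot T m)) := by
  induction m with
  | zero => rw [knot_zero, Icc_self]; exact continuousOn_singleton _ _
  | succ m ih =>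
    rw [← Icc_union_Icc_eq_Icc (knot_nonneg hT m) (knot_lt_succ hT m).le]
    refine ih.union_of_isClosed ?_ isClosed_Icc isClosed_Icc
    refine ContinuousOn.congr ?_ fun t ht => Z.state_eq hσ hT z ht
    refine (continuousOn_evol hσ (one_le_modeCount m) (Z.stepState T hσ z m)).comp
      (f := fun t => Z.scaledTime t - Z.scaledTime (knot T m)) ?_ ?_
    · exact fun t ht => ((Z.hasDerivAt_scaledTime (Z.thickness_pos
        ((knot_nonneg hT m).trans ht.1))).continuousAt.sub continuousAt_const).continuousWithinAt
    · exact fun t ht => Z.scaledTime_sub_nonneg (knot_nonneg hT m) ht.1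

lemma continuousOn_state (hσ : 0 < σ) (hT : 0 < T) (z : UnitL2) :
    ContinuousOn (Z.state T hσ z) (Ico 0 T) := by
  intro t ht
  have h1 := lt_knot_knotIndex_succ ht.2
  refine (Z.continuousOn_state_Icc hσ hT z (knotIndex T t + 1) t ⟨ht.1, h1.le⟩).mono_of_mem_nhdsWithin ?_
  rw [mem_nhdsWithin]
  exact ⟨Iio _, isOpen_Iio, h1, fun s hs => ⟨hs.2.1, (mem_Iio.1 hs.1).le⟩⟩

end TargetState

end CrossDiffusion

namespace CrossDiffusion

namespace TargetState

/-! ### Existence: the weak formulation -/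

variable {n : ℕ} (Z : TargetState n)

/-- The pairing of `f` with the function of component `z` in the direction `p`. -/
noncomputable def pairing (σ : ℝ) (p : Vec n) (t : ℝ) (z : UnitL2) (f : ℝ → Vec n) : ℝ :=
  Z.thickness t * inner ℝ z (proj (Z.gauge σ t) p
    (toL2 unitMeasure fun y => f (y * Z.thickness t)))

variable {Z} {σ a S : ℝ} {p : Vec n}

lemma integral_inner_assemble {M : Mat n} (B : Eigenbasis M) {t : ℝ} (ht : 0 < Z.thickness t)
    (z : Fin n → UnitL2) {f : ℝ → Vec n} (hf : MemLp f 2 (Z.slice t)) :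
    ∫ x, inner ℝ (Z.assemble B t z x) (f x) ∂Z.slice t =
      ∑ i, Z.pairing (B.σ i) (B.p i) t (z i) f := by
  simp only [pairing]
  rw [← Finset.mul_sum]
  simp only [inner_proj]
  rw [← sum_inner, ← Z.contract_toL2 ht hf]
  rw [← Z.contract_dilate ht (∑ i, mulLift (Z.gauge (B.σ i) t) (B.p i) (z i)),
    ← Z.inner_eq_contract ht, L2.inner_def]
  refine integral_congr_ae ?_
  filter_upwards [coeFn_toL2 hf] with x hx
  rw [hx]
  rfl

lemma norm_toL2_slice {t : ℝ} {f : ℝ → Vec n} (hf : MemLp f 2 (Z.slice t)) :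
    ‖toL2 (Z.slice t) f‖ = √(∫ x, ‖f x‖ ^ 2 ∂Z.slice t) := by
  rw [eq_comm, Real.sqrt_eq_iff_mul_self_eq (integral_nonneg fun x => by positivity)
    (norm_nonneg _), ← real_inner_self_eq_norm_mul_norm, L2.inner_def]
  refine integral_congr_ae ?_
  filter_upwards [coeFn_toL2 hf] with x hx
  rw [hx, real_inner_self_eq_norm_sq]

/-- The powers of `ē` cancel: the gauge is at most `ē^(-1/2)`, rescaling `f` gives another
`ē^(-1/2)`, and the pairing carries the factor `ē`. -/
lemma abs_pairing_le (hσ : 0 < σ) {t : ℝ} (ht : 0 < Z.thickness t) (z : UnitL2) {f : ℝ → Vec n}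
    (hf : MemLp f 2 (Z.slice t)) :
    |Z.pairing σ p t z f| ≤ ‖p‖ * ‖z‖ * √(∫ x, ‖f x‖ ^ 2 ∂Z.slice t) := by
  have hs := Real.sqrt_pos.2 ht
  rw [pairing, inner_proj, ← Z.contract_toL2 ht hf, ← norm_toL2_slice hf, Z.norm_eq_contract ht,
    abs_mul, abs_of_pos ht]
  have h1 : ‖mulLift (Z.gauge σ t) p z‖ ≤ (√(Z.thickness t))⁻¹ * ‖p‖ * ‖z‖ :=
    (ContinuousLinearMap.le_opNorm _ _).trans (mul_le_mul_of_nonneg_right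
      (norm_mulLift_le (by positivity) (fun y _ => Z.gauge_abs_le hσ ht y) p) (norm_nonneg _))
  have h2 := (abs_real_inner_le_norm (mulLift (Z.gauge σ t) p z)
    (Z.contract t (toL2 (Z.slice t) f))).trans (mul_le_mul_of_nonneg_right h1 (norm_nonneg _))
  refine (mul_le_mul_of_nonneg_left h2 ht.le).trans (le_of_eq ?_)
  field_simp
  rw [Real.sq_sqrt ht.le]

lemma memLp_sqrt_integral_slice {E : Type*} [NormedAddCommGroup E] {z : ℝ × ℝ → E}
    (hz : MemLp z 2 (Z.regionMeasure a S)) :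
    MemLp (fun t => √(∫ x, ‖z (t, x)‖ ^ 2 ∂Z.slice t)) 2 (volume.restrict (Ioo a S)) := by
  have hi : Integrable (fun p => ‖z p‖ ^ 2) (Z.regionMeasure a S) := by
    simpa using hz.integrable_norm_rpow (by simp) (by simp)
  have hi2 := integrable_integral_slice hi
  rw [times_coe] at hi2
  rw [memLp_two_iff_integrable_sq hi2.1.aemeasurable.sqrt.aestronglyMeasurable]
  refine hi2.congr (ae_of_all _ fun t => ?_)
  exact (Real.sq_sqrt (integral_nonneg fun x => by positivity)).symm

lemma pairing_cosMode {t : ℝ} (ht : 0 < Z.thickness t) (w : ℝ) {f : ℝ → Vec n}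
    (hf : MemLp f 2 (Z.slice t)) :
    decay σ w (Z.scaledTime t) * Z.pairing σ p t (cosMode w) f =
      ∫ x, Z.mode σ w t x * inner ℝ p (f x) ∂Z.slice t := by
  rw [Z.integral_mode_mul ht σ w p hf, pairing]
  ring

/-- Pairings with a fixed cosine are slice integrals against a mode, hence measurable by Fubini; the
general pairing is their limit through the expansion in the cosine basis. -/
lemma aestronglyMeasurable_pairing (hσ : σ ≠ 0) (ha : 0 ≤ a) {z : ℝ → UnitL2}
    (hz : ContinuousOn z (Ioo a S)) {g : ℝ → ℝ → Vec n}
    (hg : MemLp (Function.uncurry g) 2 (Z.regionMeasure a S)) :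
    AEStronglyMeasurable (fun t => Z.pairing σ p t (z t) (g t)) (volume.restrict (Ioo a S)) := by
  have hgs := ae_memLp_slice hg
  rw [times_coe] at hgs
  have hk : ∀ w, AEStronglyMeasurable (fun t => Z.pairing σ p t (cosMode w) (g t))
      (volume.restrict (Ioo a S)) := by
    intro w
    have h1 := integrable_integral_slice (integrable_mul_of_continuousAt ha
      (fun p hp => Z.continuousAt_mode hσ w hp) (hg.const_inner p))
    rw [times_coe] at h1
    have h2 : AEStronglyMeasurable (fun t => (decay σ w (Z.scaledTime t))⁻¹)
        (volume.restrict (Ioo a S)) :=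
      ContinuousOn.aestronglyMeasurable (fun t ht => (ContinuousAt.inv₀
        (Z.continuousAt_decay_scaledTime _ _ (ha.trans ht.1.le))
          (decay_pos _ _ _).ne').continuousWithinAt) measurableSet_Ioo
    refine (h2.mul h1.1).congr ?_
    filter_upwards [hgs, ae_restrict_mem measurableSet_Ioo] with t ht htm
    have hE := Z.thickness_pos (ha.trans htm.1.le)
    rw [Pi.mul_apply, inv_mul_eq_iff_eq_mul₀ (decay_pos _ _ _).ne']
    exact (pairing_cosMode hE w ht).symm
  have hb : ∀ k, AEStronglyMeasurable (fun t => Z.thickness t * inner ℝ (cosBasis k)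
      (proj (Z.gauge σ t) p (toL2 unitMeasure fun y => g t (y * Z.thickness t))))
      (volume.restrict (Ioo a S)) := by
    intro k
    have h1 : ∃ c : ℝ, cosBasis k = c • cosMode (k * Real.pi) := by
      rw [cosBasis_apply, cosBasisVec]; exact ⟨_, rfl⟩
    obtain ⟨c, hc⟩ := h1
    refine ((hk (k * Real.pi)).const_mul c).congr (ae_of_all _ fun t => ?_)
    simp only [pairing]
    rw [hc, inner_smul_left, conj_trivial]
    ring
  refine aestronglyMeasurable_of_tendsto_ae atTop (f := fun K t => ∑ k ∈ Finset.range K,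
    inner ℝ (z t) (cosBasis k) * (Z.thickness t * inner ℝ (cosBasis k)
      (proj (Z.gauge σ t) p (toL2 unitMeasure fun y => g t (y * Z.thickness t)))))
    (fun K => Finset.aestronglyMeasurable_fun_sum _ fun k _ => AEStronglyMeasurable.mul
      ((hz.inner continuousOn_const).aestronglyMeasurable measurableSet_Ioo) (hb k))
    (ae_of_all _ fun t => ?_)
  have h := ((cosBasis.hasSum_inner_mul_inner (z t) (proj (Z.gauge σ t) p
    (toL2 unitMeasure fun y => g t (y * Z.thickness t)))).mul_left (Z.thickness t)).tendsto_sum_nat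
  refine h.congr fun K => Finset.sum_congr rfl fun k _ => ?_
  ring

lemma integrableOn_pairing (hσ : 0 < σ) (ha : 0 ≤ a) {z : ℝ → UnitL2}
    (hz : ContinuousOn z (Icc a S)) {g : ℝ → ℝ → Vec n}
    (hg : MemLp (Function.uncurry g) 2 (Z.regionMeasure a S)) :
    IntegrableOn (fun t => Z.pairing σ p t (z t) (g t)) (Ioo a S) := by
  obtain ⟨C, hC⟩ := isCompact_Icc.exists_bound_of_continuousOn hz
  have hgs := ae_memLp_slice hg
  rw [times_coe] at hgs
  refine Integrable.mono' (g := fun t => ‖p‖ * C * √(∫ x, ‖g t x‖ ^ 2 ∂Z.slice t))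
    (((memLp_sqrt_integral_slice hg).integrable (by norm_num)).const_mul _)
    (aestronglyMeasurable_pairing hσ.ne' ha (hz.mono Ioo_subset_Icc_self) hg) ?_
  filter_upwards [hgs, ae_restrict_mem measurableSet_Ioo] with t h1 h2
  refine (abs_pairing_le hσ (Z.thickness_pos (ha.trans h2.1.le)) (z t) h1).trans ?_
  exact mul_le_mul_of_nonneg_right (mul_le_mul_of_nonneg_left
    (hC t (Ioo_subset_Icc_self h2)) (norm_nonneg _)) (Real.sqrt_nonneg _)

lemma pairing_modalSum {N M : ℕ} {t t₀ : ℝ} (ht : 0 < Z.thickness t) (z : UnitL2) {f : ℝ → Vec n}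
    (hf : MemLp f 2 (Z.slice t)) :
    Z.pairing σ p t (modalSum σ N M (Z.scaledTime t - Z.scaledTime t₀) z) f =
      ∑ k ∈ Finset.range M, coef N k z * (decay σ (freq N k) (Z.scaledTime t₀))⁻¹ *
        ∫ x, Z.mode σ (freq N k) t x * inner ℝ p (f x) ∂Z.slice t := by
  rw [pairing, modalSum, sum_inner, Finset.mul_sum]
  refine Finset.sum_congr rfl fun k _ => ?_
  rw [← pairing_cosMode ht _ hf, pairing, inner_smul_left, conj_trivial]
  have h : decay σ (freq N k) (Z.scaledTime t - Z.scaledTime t₀) =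
      (decay σ (freq N k) (Z.scaledTime t₀))⁻¹ * decay σ (freq N k) (Z.scaledTime t) := by
    simp only [decay]
    rw [← Real.exp_neg, ← Real.exp_add]
    congr 1; ring
  rw [h]
  ring

/-- This closes the loop: the fluxes that the individual modes require at the moving end are
together the value of one functional of the state. -/
lemma sum_boundaryFlux {N M : ℕ} {t t₀ : ℝ} (z : UnitL2) :
    ∑ k ∈ Finset.range M, coef N k z * (decay σ (freq N k) (Z.scaledTime t₀))⁻¹ *
        Z.boundaryFlux σ (freq N k) t = Z.fluxFactor σ t *
      inner ℝ (feedbackKernel N) (modalSum σ N M (Z.scaledTime t - Z.scaledTime t₀) z) := by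
  rw [modalSum, inner_sum, Finset.mul_sum]
  refine Finset.sum_congr rfl fun k _ => ?_
  have h : decay σ (freq N k) (Z.scaledTime t - Z.scaledTime t₀) =
      (decay σ (freq N k) (Z.scaledTime t₀))⁻¹ * decay σ (freq N k) (Z.scaledTime t) := by
    simp only [decay]
    rw [← Real.exp_neg, ← Real.exp_add]
    congr 1; ring
  rw [inner_smul_right, inner_feedbackKernel, h, boundaryFlux, fluxFactor]
  ring

end TargetState

end CrossDiffusion

/-! ### Green's identity for the closed loop and its weak formulation -/

namespace CrossDiffusion

/-- Multiplication by a matrix as a continuous linear map. -/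
noncomputable def mulVecL {n : ℕ} (M : Mat n) : Vec n →L[ℝ] Vec n :=
  LinearMap.toContinuousLinearMap
    { toFun := mulVec M
      map_add' := fun x y => by simp [mulVec, Matrix.mulVec_add]
      map_smul' := fun c x => mulVec_smul M c x }

namespace TargetState

variable {n : ℕ} {Z : TargetState n} {σ a S T : ℝ} {p : Vec n} {A : Mat n} {K : ℝ → Mat n}
  {v vt vx vxx : ℝ → ℝ → Vec n}

lemma IsTestFunction.memLp_dual (hv : Z.IsTestFunction A K a S v vt vx vxx) :
    MemLp (Function.uncurry fun t x => vt t x + mulVec Aᵀ (vxx t x)) 2 (Z.regionMeasure a S) :=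
  hv.memLp_t.add ((mulVecL Aᵀ).comp_memLp' hv.memLp_xx)

lemma IsTestFunction.ae_memLp_dual (hv : Z.IsTestFunction A K a S v vt vx vxx) :
    ∀ᵐ t ∂volume.restrict (Ioo a S),
      MemLp (fun x => vt t x + mulVec Aᵀ (vxx t x)) 2 (Z.slice t) := by
  have h := ae_memLp_slice hv.memLp_dual
  rwa [times_coe] at h

lemma IsTestFunction.green_modalSum (hK : ∀ t, K t = (Z.speed / 2) • (1 : Mat n))
    (hv : Z.IsTestFunction A K a S v vt vx vxx) (hσ : 0 < σ) (hp : mulVec A p = σ • p)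
    (ha : 0 ≤ a) (N M : ℕ) (t₀ : ℝ) (z : UnitL2) {c d : ℝ} (hc : a ≤ c) (hcd : c ≤ d)
    (hd : d ≤ S) :
    IntegrableOn (fun t =>
      Z.pairing σ p t (modalSum σ N M (Z.scaledTime t - Z.scaledTime t₀) z)
        (fun x => vt t x + mulVec Aᵀ (vxx t x)) +
      Z.fluxFactor σ t * inner ℝ (feedbackKernel N)
        (modalSum σ N M (Z.scaledTime t - Z.scaledTime t₀) z) * inner ℝ p (v t (Z.thickness t)))
      (Ioo c d) ∧
    Z.pairing σ p d (modalSum σ N M (Z.scaledTime d - Z.scaledTime t₀) z) (v d) -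
      Z.pairing σ p c (modalSum σ N M (Z.scaledTime c - Z.scaledTime t₀) z) (v c) =
    ∫ t in Ioo c d,
      (Z.pairing σ p t (modalSum σ N M (Z.scaledTime t - Z.scaledTime t₀) z)
        (fun x => vt t x + mulVec Aᵀ (vxx t x)) +
      Z.fluxFactor σ t * inner ℝ (feedbackKernel N)
        (modalSum σ N M (Z.scaledTime t - Z.scaledTime t₀) z) *
          inner ℝ p (v t (Z.thickness t))) := by
  have hf := hv.isScalarTest hσ.ne' hp hK
  have hgr := fun w => hf.green hσ.ne' ha w
    (hv.continuousL2On.continuousOn_integral_mode (fun t ht => ha.trans ht.1) σ w p)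
  set D : ℕ → ℝ := fun k => coef N k z * (decay σ (freq N k) (Z.scaledTime t₀))⁻¹ with hD
  have hint : IntegrableOn (fun t => ∑ k ∈ Finset.range M, D k *
      ((∫ x, Z.mode σ (freq N k) t x * (inner ℝ p (vt t x) + σ * inner ℝ p (vxx t x)) ∂Z.slice t) +
        Z.boundaryFlux σ (freq N k) t * inner ℝ p (v t (Z.thickness t)))) (Ioo c d) :=
    integrable_finsetSum _ fun k _ => ((hgr (freq N k)).1.mono_set
      (Ioo_subset_Ioo hc hd)).const_mul (D k)
  have heq : ∀ᵐ t ∂volume.restrict (Ioo c d), ∑ k ∈ Finset.range M, D k *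
      ((∫ x, Z.mode σ (freq N k) t x * (inner ℝ p (vt t x) + σ * inner ℝ p (vxx t x)) ∂Z.slice t) +
        Z.boundaryFlux σ (freq N k) t * inner ℝ p (v t (Z.thickness t))) =
      Z.pairing σ p t (modalSum σ N M (Z.scaledTime t - Z.scaledTime t₀) z)
        (fun x => vt t x + mulVec Aᵀ (vxx t x)) +
      Z.fluxFactor σ t * inner ℝ (feedbackKernel N)
        (modalSum σ N M (Z.scaledTime t - Z.scaledTime t₀) z) *
          inner ℝ p (v t (Z.thickness t)) := by
    filter_upwards [ae_restrict_of_ae_restrict_of_subset (Ioo_subset_Ioo hc hd) hv.ae_memLp_dual,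
      ae_restrict_mem measurableSet_Ioo] with t ht htm
    rw [pairing_modalSum (Z.thickness_pos (ha.trans (hc.trans htm.1.le))) z ht,
      ← sum_boundaryFlux (t₀ := t₀), Finset.sum_mul, ← Finset.sum_add_distrib]
    refine Finset.sum_congr rfl fun k _ => ?_
    simp only [inner_add_right, inner_mulVec_transpose hp, hD]
    ring
  refine ⟨hint.congr heq, ?_⟩
  have hpos : ∀ {t}, t ∈ Icc a S → 0 < Z.thickness t := fun ht => Z.thickness_pos (ha.trans ht.1)
  have hdm : d ∈ Icc a S := ⟨hc.trans hcd, hd⟩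
  have hcm : c ∈ Icc a S := ⟨hc, hcd.trans hd⟩
  rw [← integral_congr_ae heq, integral_finsetSum _ fun k _ => ((hgr (freq N k)).1.mono_set
      (Ioo_subset_Ioo hc hd)).const_mul (D k),
    pairing_modalSum (hpos hdm) z (hv.continuousL2On.1 d hdm),
    pairing_modalSum (hpos hcm) z (hv.continuousL2On.1 c hcm), ← Finset.sum_sub_distrib]
  refine Finset.sum_congr rfl fun k _ => ?_
  rw [← mul_sub, integral_const_mul, ← integral_Ioc_eq_integral_Ioo,
    ← intervalIntegral.integral_of_le hcd, ← (hgr (freq N k)).2 c d hc hcd hd]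

lemma tendsto_pairing {t : ℝ} {ι : Type*} {l : Filter ι} {z : ι → UnitL2} {z₀ : UnitL2}
    (h : Tendsto z l (𝓝 z₀)) (f : ℝ → Vec n) :
    Tendsto (fun j => Z.pairing σ p t (z j) f) l (𝓝 (Z.pairing σ p t z₀ f)) :=
  (h.inner tendsto_const_nhds).const_mul _

/-- Dominated convergence from finite modal sums. It is possible because the modal sums converge
uniformly in time and both the pairing and the feedback functional are continuous in `L²`; no trace
of the state enters. -/
lemma IsTestFunction.green_evol (hK : ∀ t, K t = (Z.speed / 2) • (1 : Mat n))
    (hv : Z.IsTestFunction A K a S v vt vx vxx) (hσ : 0 < σ) (hp : mulVec A p = σ • p)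
    (ha : 0 ≤ a) {N : ℕ} (hN : 1 ≤ N) {t₀ : ℝ} (ht₀ : 0 ≤ t₀) (z : UnitL2) {c d : ℝ} (hc : a ≤ c)
    (htc : t₀ ≤ c) (hcd : c ≤ d) (hd : d ≤ S) :
    IntegrableOn (fun t =>
      Z.pairing σ p t (evol hσ N (Z.scaledTime t - Z.scaledTime t₀) z)
        (fun x => vt t x + mulVec Aᵀ (vxx t x)) +
      Z.fluxFactor σ t * inner ℝ (feedbackKernel N)
        (evol hσ N (Z.scaledTime t - Z.scaledTime t₀) z) * inner ℝ p (v t (Z.thickness t)))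
      (Ioo c d) ∧
    Z.pairing σ p d (evol hσ N (Z.scaledTime d - Z.scaledTime t₀) z) (v d) -
      Z.pairing σ p c (evol hσ N (Z.scaledTime c - Z.scaledTime t₀) z) (v c) =
    ∫ t in Ioo c d,
      (Z.pairing σ p t (evol hσ N (Z.scaledTime t - Z.scaledTime t₀) z)
        (fun x => vt t x + mulVec Aᵀ (vxx t x)) +
      Z.fluxFactor σ t * inner ℝ (feedbackKernel N)
        (evol hσ N (Z.scaledTime t - Z.scaledTime t₀) z) * inner ℝ p (v t (Z.thickness t))) := by
  obtain ⟨δ, hδ, hb⟩ := exists_modalSum_error hσ hN z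
  have hgr := fun L => hv.green_modalSum hK hσ hp ha N (N + L) t₀ z hc hcd hd
  have hr : ∀ {t}, c ≤ t → 0 ≤ Z.scaledTime t - Z.scaledTime t₀ := fun ht =>
    Z.scaledTime_sub_nonneg ht₀ (htc.trans ht)
  have hlim : ∀ {t}, c ≤ t → Tendsto (fun L =>
      modalSum σ N (N + L) (Z.scaledTime t - Z.scaledTime t₀) z) atTop
      (𝓝 (evol hσ N (Z.scaledTime t - Z.scaledTime t₀) z)) := fun ht => by
    rw [tendsto_iff_norm_sub_tendsto_zero]
    refine squeeze_zero (fun L => norm_nonneg _) (fun L => ?_) hδ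
    rw [norm_sub_rev]
    exact hb L _ (hr ht)
  obtain ⟨Δ, hΔ⟩ := hδ.bddAbove_range
  have hΔ' : ∀ L, δ L ≤ Δ := fun L => hΔ (mem_range_self L)
  set C := evolConst N * ‖z‖ + Δ with hC
  have hmb : ∀ L {t}, c ≤ t →
      ‖modalSum σ N (N + L) (Z.scaledTime t - Z.scaledTime t₀) z‖ ≤ C := fun L t ht => by
    have h1 := norm_evol_le hσ hN (hr ht) z
    have h2 := hb L _ (hr ht)
    have h3 : evolConst N * decay σ (N * Real.pi) (Z.scaledTime t - Z.scaledTime t₀) * ‖z‖ ≤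
        evolConst N * ‖z‖ := mul_le_mul_of_nonneg_right (mul_le_of_le_one_right
          (by linarith [one_le_evolConst N]) (decay_le_one hσ.le (hr ht) _)) (norm_nonneg _)
    have h4 := norm_sub_norm_le (modalSum σ N (N + L) (Z.scaledTime t - Z.scaledTime t₀) z)
      (evol hσ N (Z.scaledTime t - Z.scaledTime t₀) z)
    rw [norm_sub_rev] at h4
    linarith [hΔ' L]
  have hC0 : 0 ≤ C := (norm_nonneg _).trans (hmb 0 le_rfl)
  have hf := hv.isScalarTest hσ.ne' hp hK
  have htr := (hf.integrableOn_trace ha).mono_set (Ioo_subset_Ioo hc hd)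
  obtain ⟨C₁, hC₁⟩ := (isCompact_Icc (a := c) (b := d)).exists_bound_of_continuousOn
    (f := Z.fluxFactor σ) fun t ht => (continuousAt_fluxFactor hσ.ne'
      (ha.trans (hc.trans ht.1))).continuousWithinAt
  have hsq := ((memLp_sqrt_integral_slice hv.memLp_dual).integrable (by norm_num)).mono_measure
    (Measure.restrict_mono (Ioo_subset_Ioo hc hd) le_rfl)
  -- A dominating function independent of the truncation, with `C` a uniform bound of the modal
  -- sums; the second term is integrable by the trace estimate.
  set bound : ℝ → ℝ := fun t => ‖p‖ * C * √(∫ x, ‖vt t x + mulVec Aᵀ (vxx t x)‖ ^ 2 ∂Z.slice t) +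
    |C₁| * (‖feedbackKernel N‖ * C) * |inner ℝ p (v t (Z.thickness t))| with hbound
  have hbi : IntegrableOn bound (Ioo c d) := (hsq.const_mul _).add (htr.abs.const_mul _)
  have hae : ∀ᵐ t ∂volume.restrict (Ioo c d),
      MemLp (fun x => vt t x + mulVec Aᵀ (vxx t x)) 2 (Z.slice t) ∧ t ∈ Ioo c d :=
    (ae_restrict_of_ae_restrict_of_subset (Ioo_subset_Ioo hc hd) hv.ae_memLp_dual).and
      (ae_restrict_mem measurableSet_Ioo)
  have hbd : ∀ L, ∀ᵐ t ∂volume.restrict (Ioo c d), ‖Z.pairing σ p t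
        (modalSum σ N (N + L) (Z.scaledTime t - Z.scaledTime t₀) z)
        (fun x => vt t x + mulVec Aᵀ (vxx t x)) +
      Z.fluxFactor σ t * inner ℝ (feedbackKernel N)
        (modalSum σ N (N + L) (Z.scaledTime t - Z.scaledTime t₀) z) *
          inner ℝ p (v t (Z.thickness t))‖ ≤ bound t := by
    intro L
    filter_upwards [hae] with t ht
    refine (norm_add_le _ _).trans (add_le_add ?_ ?_)
    · refine (abs_pairing_le hσ (Z.thickness_pos (ha.trans (hc.trans ht.2.1.le))) _ ht.1).trans ?_
      exact mul_le_mul_of_nonneg_right (mul_le_mul_of_nonneg_left (hmb L ht.2.1.le)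
        (norm_nonneg _)) (Real.sqrt_nonneg _)
    · rw [norm_mul, norm_mul, Real.norm_eq_abs (inner ℝ p _)]
      refine mul_le_mul_of_nonneg_right (mul_le_mul ((hC₁ t (Ioo_subset_Icc_self ht.2)).trans
        (le_abs_self _)) ?_ (norm_nonneg _) (abs_nonneg _)) (abs_nonneg _)
      exact (norm_inner_le_norm _ _).trans (mul_le_mul_of_nonneg_left (hmb L ht.2.1.le)
        (norm_nonneg _))
  have hpt : ∀ᵐ t ∂volume.restrict (Ioo c d), Tendsto (fun L => Z.pairing σ p t
        (modalSum σ N (N + L) (Z.scaledTime t - Z.scaledTime t₀) z)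
        (fun x => vt t x + mulVec Aᵀ (vxx t x)) +
      Z.fluxFactor σ t * inner ℝ (feedbackKernel N)
        (modalSum σ N (N + L) (Z.scaledTime t - Z.scaledTime t₀) z) *
          inner ℝ p (v t (Z.thickness t))) atTop
      (𝓝 (Z.pairing σ p t (evol hσ N (Z.scaledTime t - Z.scaledTime t₀) z)
        (fun x => vt t x + mulVec Aᵀ (vxx t x)) +
      Z.fluxFactor σ t * inner ℝ (feedbackKernel N)
        (evol hσ N (Z.scaledTime t - Z.scaledTime t₀) z) * inner ℝ p (v t (Z.thickness t)))) := by
    filter_upwards [hae] with t ht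
    have h1 := hlim ht.2.1.le
    exact (tendsto_pairing h1 _).add (((tendsto_const_nhds.inner h1).const_mul _).mul_const _)
  refine ⟨?_, ?_⟩
  · refine Integrable.mono' hbi (aestronglyMeasurable_of_tendsto_ae atTop
      (fun L => (hgr L).1.aestronglyMeasurable) hpt) ?_
    filter_upwards [hpt, ae_all_iff.2 hbd] with t h1 h2
    exact le_of_tendsto h1.norm (Eventually.of_forall h2)
  · have hR := tendsto_integral_of_dominated_convergence bound
      (fun L => (hgr L).1.aestronglyMeasurable) hbi hbd hpt
    have hL := (tendsto_pairing (Z := Z) (σ := σ) (p := p) (t := d) (hlim hcd) (v d)).sub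
      (tendsto_pairing (Z := Z) (σ := σ) (p := p) (t := c) (hlim le_rfl) (v c))
    exact tendsto_nhds_unique (hL.congr fun L => (hgr L).2) hR

variable (T) in
/-- The number of modified modes at time `t`. -/
noncomputable def schedule (t : ℝ) : ℕ := modeCount (knotIndex T t)

lemma schedule_monotoneOn : MonotoneOn (schedule T) (Ico 0 T) := fun _ hs _ ht h =>
  modeCount_mono (knotIndex_monotoneOn hs ht h)

/-- The identities of the single intervals are added. The terms at the knots cancel because the
state is continuous there, although the number of moved modes jumps. -/
lemma IsTestFunction.green_state (hK : ∀ t, K t = (Z.speed / 2) • (1 : Mat n))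
    (hv : Z.IsTestFunction A K 0 S v vt vx vxx) (hσ : 0 < σ) (hp : mulVec A p = σ • p)
    (hT : 0 < T) (z : UnitL2) {d : ℝ} (hd0 : 0 ≤ d) (hdT : d < T) (hd : d ≤ S) :
    IntegrableOn (fun t =>
      Z.pairing σ p t (Z.state T hσ z t) (fun x => vt t x + mulVec Aᵀ (vxx t x)) +
      Z.fluxFactor σ t * inner ℝ (feedbackKernel (schedule T t)) (Z.state T hσ z t) *
        inner ℝ p (v t (Z.thickness t))) (Ioo 0 d) ∧
    Z.pairing σ p d (Z.state T hσ z d) (v d) - Z.pairing σ p 0 z (v 0) =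
    ∫ t in Ioo 0 d,
      (Z.pairing σ p t (Z.state T hσ z t) (fun x => vt t x + mulVec Aᵀ (vxx t x)) +
      Z.fluxFactor σ t * inner ℝ (feedbackKernel (schedule T t)) (Z.state T hσ z t) *
        inner ℝ p (v t (Z.thickness t))) := by
  set F : ℝ → ℝ := fun t =>
      Z.pairing σ p t (Z.state T hσ z t) (fun x => vt t x + mulVec Aᵀ (vxx t x)) +
      Z.fluxFactor σ t * inner ℝ (feedbackKernel (schedule T t)) (Z.state T hσ z t) *
        inner ℝ p (v t (Z.thickness t)) with hF
  have piece : ∀ (m : ℕ) (d : ℝ), d ∈ Icc (knot T m) (knot T (m + 1)) → d ≤ S →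
      IntegrableOn F (Ioo (knot T m) d) ∧
      Z.pairing σ p d (Z.state T hσ z d) (v d) -
        Z.pairing σ p (knot T m) (Z.state T hσ z (knot T m)) (v (knot T m)) =
        ∫ t in Ioo (knot T m) d, F t := by
    intro m d hd hdS
    obtain ⟨h1, h2⟩ := hv.green_evol hK hσ hp le_rfl (one_le_modeCount m) (knot_nonneg hT m)
      (Z.stepState T hσ z m) (knot_nonneg hT m) le_rfl hd.1 hdS
    rw [← Z.state_eq hσ hT z hd, ← Z.state_eq hσ hT z ⟨le_rfl, (knot_lt_succ hT m).le⟩] at h2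
    have he : EqOn (fun t => Z.pairing σ p t (evol hσ (modeCount m)
          (Z.scaledTime t - Z.scaledTime (knot T m)) (Z.stepState T hσ z m))
          (fun x => vt t x + mulVec Aᵀ (vxx t x)) +
        Z.fluxFactor σ t * inner ℝ (feedbackKernel (modeCount m)) (evol hσ (modeCount m)
          (Z.scaledTime t - Z.scaledTime (knot T m)) (Z.stepState T hσ z m)) *
            inner ℝ p (v t (Z.thickness t))) F (Ioo (knot T m) d) := by
      intro t ht
      have h3 : t < knot T (m + 1) := ht.2.trans_le hd.2
      have h4 : schedule T t = modeCount m := by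
        rw [schedule, knotIndex_eq ((knot_nonneg hT m).trans ht.1.le) (h3.trans (knot_lt hT _))
          ht.1.le h3]
      simp only [hF]
      rw [h4, Z.state_eq hσ hT z ⟨ht.1.le, h3.le⟩]
    exact ⟨h1.congr_fun he measurableSet_Ioo, h2.trans (setIntegral_congr_fun measurableSet_Ioo he)⟩
  have main : ∀ (m : ℕ) (d : ℝ), 0 ≤ d → d ≤ knot T m → d ≤ S →
      IntegrableOn F (Ioo 0 d) ∧
      Z.pairing σ p d (Z.state T hσ z d) (v d) - Z.pairing σ p 0 z (v 0) =
        ∫ t in Ioo 0 d, F t := by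
    intro m
    induction m with
    | zero =>
      intro d h0 h1 _
      rw [knot_zero] at h1
      obtain rfl := le_antisymm h1 h0
      rw [Z.state_zero hσ hT, sub_self]
      simp
    | succ m ih =>
      intro d h0 h1 h2
      rcases le_total d (knot T m) with h3 | h3
      · exact ih d h0 h3 h2
      · obtain ⟨i1, e1⟩ := ih _ (knot_nonneg hT m) le_rfl (h3.trans h2)
        obtain ⟨i2, e2⟩ := piece m d ⟨h3, h1⟩ h2
        have j1 : IntervalIntegrable F volume 0 (knot T m) := by
          rwa [intervalIntegrable_iff_integrableOn_Ioo_of_le (knot_nonneg hT m)]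
        have j2 : IntervalIntegrable F volume (knot T m) d := by
          rwa [intervalIntegrable_iff_integrableOn_Ioo_of_le h3]
        have j3 := j1.trans j2
        have e3 := intervalIntegral.integral_add_adjacent_intervals j1 j2
        rw [intervalIntegrable_iff_integrableOn_Ioo_of_le h0] at j3
        rw [intervalIntegral.integral_of_le (knot_nonneg hT m), intervalIntegral.integral_of_le h3,
          intervalIntegral.integral_of_le h0, integral_Ioc_eq_integral_Ioo,
          integral_Ioc_eq_integral_Ioo, integral_Ioc_eq_integral_Ioo] at e3
        exact ⟨j3, by linarith⟩
  exact main _ d hd0 (lt_knot_knotIndex_succ hdT).le hd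

variable (Z T) in
open Classical in
/-- The closed-loop solution. -/
noncomputable def closedLoop (B : Eigenbasis A) (u₀ : Z.L2 0) (t : ℝ) : Z.L2 t :=
  if t < T then Z.assemble B t fun i => Z.state T (B.σ_pos i) (Z.profile B i 0 u₀) t else 0

lemma closedLoop_of_lt (B : Eigenbasis A) (u₀ : Z.L2 0) {t : ℝ} (ht : t < T) :
    Z.closedLoop T B u₀ t =
      Z.assemble B t fun i => Z.state T (B.σ_pos i) (Z.profile B i 0 u₀) t := if_pos ht

lemma closedLoop_of_le (B : Eigenbasis A) (u₀ : Z.L2 0) {t : ℝ} (ht : T ≤ t) :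
    Z.closedLoop T B u₀ t = 0 := if_neg (not_lt.2 ht)

/-- Sum of the scalar Green identities over the eigenvectors; the pairing at time `S` drops out by
the final condition of the test function. -/
theorem closedLoop_weak (B : Eigenbasis A) (hT : 0 < T) (u₀ : Z.L2 0) (h0S : 0 < S) (hST : S < T)
    (hv : Z.IsTestFunction A (Z.modalFeedback B (schedule T) T).gain 0 S v vt vx vxx) :
    (∫ t in Ioo 0 S, ∫ x, inner ℝ (Z.closedLoop T B u₀ t x)
        (vt t x + mulVec Aᵀ (vxx t x)) ∂Z.slice t) +
      (∫ x, inner ℝ (u₀ x) (v 0 x) ∂Z.slice 0) +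
      (∫ t in Ioo 0 S, inner ℝ ((Z.modalFeedback B (schedule T) T).nonlocal t
        (Z.closedLoop T B u₀ t)) (v t (Z.thickness t))) = 0 := by
  set z : Fin n → UnitL2 := fun i => Z.profile B i 0 u₀ with hz
  have hgr := fun i => hv.green_state (fun _ => rfl) (B.σ_pos i) (B.mulVec_p i) hT (z i)
    h0S.le hST le_rfl
  have hS : ∀ i, Z.pairing (B.σ i) (B.p i) S (Z.state T (B.σ_pos i) (z i) S) (v S) = 0 := by
    intro i
    have h1 := abs_pairing_le (p := B.p i) (B.σ_pos i) (Z.thickness_pos h0S.le)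
      (Z.state T (B.σ_pos i) (z i) S) (hv.continuousL2On.1 S ⟨h0S.le, le_rfl⟩)
    have h2 : ∫ x, ‖v S x‖ ^ 2 ∂Z.slice S = 0 := by
      refine integral_eq_zero_of_ae ?_
      filter_upwards [hv.final] with x hx
      simp [hx]
    rw [h2, Real.sqrt_zero, mul_zero] at h1
    exact abs_eq_zero.1 (le_antisymm h1 (abs_nonneg _))
  have hp : ∀ i, IntegrableOn (fun t => Z.pairing (B.σ i) (B.p i) t
      (Z.state T (B.σ_pos i) (z i) t) (fun x => vt t x + mulVec Aᵀ (vxx t x))) (Ioo 0 S) :=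
    fun i => integrableOn_pairing (B.σ_pos i) le_rfl
      ((Z.continuousOn_state (B.σ_pos i) hT (z i)).mono fun t ht => ⟨ht.1, ht.2.trans_lt hST⟩)
      hv.memLp_dual
  have hq : ∀ i, IntegrableOn (fun t => Z.fluxFactor (B.σ i) t *
      inner ℝ (feedbackKernel (schedule T t)) (Z.state T (B.σ_pos i) (z i) t) *
        inner ℝ (B.p i) (v t (Z.thickness t))) (Ioo 0 S) := fun i => by
    refine ((hgr i).1.sub (hp i)).congr (ae_of_all _ fun t => ?_)
    simp only [Pi.sub_apply, add_sub_cancel_left]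
  have e1 : ∫ t in Ioo 0 S, ∫ x, inner ℝ (Z.closedLoop T B u₀ t x)
        (vt t x + mulVec Aᵀ (vxx t x)) ∂Z.slice t = ∑ i, ∫ t in Ioo 0 S,
        Z.pairing (B.σ i) (B.p i) t (Z.state T (B.σ_pos i) (z i) t)
          (fun x => vt t x + mulVec Aᵀ (vxx t x)) := by
    rw [← integral_finsetSum _ fun i _ => hp i]
    refine integral_congr_ae ?_
    filter_upwards [hv.ae_memLp_dual, ae_restrict_mem measurableSet_Ioo] with t ht htm
    rw [closedLoop_of_lt B u₀ (htm.2.trans hST), integral_inner_assemble B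
      (Z.thickness_pos htm.1.le) _ ht]
  have e2 : ∫ x, inner ℝ (u₀ x) (v 0 x) ∂Z.slice 0 =
      ∑ i, Z.pairing (B.σ i) (B.p i) 0 (z i) (v 0) := by
    rw [← integral_inner_assemble B (Z.thickness_pos le_rfl) z
      (hv.continuousL2On.1 0 ⟨le_rfl, h0S.le⟩), hz, assemble_profile B (Z.thickness_pos le_rfl)]
  have e3 : ∫ t in Ioo 0 S, inner ℝ ((Z.modalFeedback B (schedule T) T).nonlocal t
        (Z.closedLoop T B u₀ t)) (v t (Z.thickness t)) = ∑ i, ∫ t in Ioo 0 S,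
      Z.fluxFactor (B.σ i) t *
        inner ℝ (feedbackKernel (schedule T t)) (Z.state T (B.σ_pos i) (z i) t) *
          inner ℝ (B.p i) (v t (Z.thickness t)) := by
    rw [← integral_finsetSum _ fun i _ => hq i]
    refine setIntegral_congr_fun measurableSet_Ioo fun t ht => ?_
    have htT := ht.2.trans hST
    rw [modalFeedback_apply ht.1.le htT, sum_inner]
    refine Finset.sum_congr rfl fun i _ => ?_
    rw [closedLoop_of_lt B u₀ htT, profile_assemble B (Z.thickness_pos ht.1.le), inner_smul_left,
      conj_trivial]
  rw [e1, e2, e3, ← Finset.sum_add_distrib, ← Finset.sum_add_distrib]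
  refine Finset.sum_eq_zero fun i _ => ?_
  have h := (hgr i).2
  rw [hS i, integral_add (hp i) (hq i)] at h
  linarith

end TargetState

end CrossDiffusion

/-! ### Stability, continuity and extinction of the closed loop -/

namespace CrossDiffusion

namespace TargetState

variable {n : ℕ} {Z : TargetState n} {T : ℝ} {A : Mat n}

lemma norm_assemble_le (B : Eigenbasis A) {t : ℝ} (ht : 0 < Z.thickness t)
    (z : Fin n → UnitL2) : ‖Z.assemble B t z‖ ≤ ∑ i, ‖B.p i‖ * ‖z i‖ := by
  have hs := Real.sqrt_pos.2 ht
  rw [Z.norm_eq_contract ht, assemble, Z.contract_dilate ht]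
  refine (mul_le_mul_of_nonneg_left (norm_sum_le _ _) hs.le).trans ?_
  rw [Finset.mul_sum]
  refine Finset.sum_le_sum fun i _ => ?_
  have h1 : ‖mulLift (Z.gauge (B.σ i) t) (B.p i) (z i)‖ ≤
      (√(Z.thickness t))⁻¹ * ‖B.p i‖ * ‖z i‖ :=
    (ContinuousLinearMap.le_opNorm _ _).trans (mul_le_mul_of_nonneg_right
      (norm_mulLift_le (by positivity) (fun y _ => Z.gauge_abs_le (B.σ_pos i) ht y) _)
      (norm_nonneg _))
  refine (mul_le_mul_of_nonneg_left h1 hs.le).trans_eq ?_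
  field_simp

lemma norm_closedLoop_le (B : Eigenbasis A) (hT : 0 < T) (u₀ : Z.L2 0) {t : ℝ} (ht0 : 0 ≤ t)
    (htT : t < T) : ‖Z.closedLoop T B u₀ t‖ ≤ ∑ i, ‖B.p i‖ *
      (Z.totalFactor (B.σ i) T (knotIndex T t) * (stepWeight 0 * ‖Z.profile B i 0 u₀‖)) := by
  rw [closedLoop_of_lt B u₀ htT]
  refine (norm_assemble_le B (Z.thickness_pos ht0) _).trans (Finset.sum_le_sum fun i _ => ?_)
  exact mul_le_mul_of_nonneg_left (Z.norm_state_le (B.σ_pos i) hT _ ht0 htT) (norm_nonneg _)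

/-- Each total factor is at most the sum of all of them, which is a constant independent of time and
of the initial value. -/
lemma exists_norm_closedLoop_le (B : Eigenbasis A) (hT : 0 < T) :
    ∃ C, 0 ≤ C ∧ ∀ (u₀ : Z.L2 0) (t : ℝ), 0 ≤ t → t < T → ‖Z.closedLoop T B u₀ t‖ ≤ C * ‖u₀‖ := by
  set Q : Fin n → ℝ := fun i => √(Z.thickness 0) *
    Real.exp (Z.speed * Z.thickness 0 / (4 * B.σ i)) * ‖B.q i‖ * (√(Z.thickness 0))⁻¹ with hQ
  have hw : 0 ≤ stepWeight 0 := zero_le_one.trans (one_le_stepWeight 0)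
  have htf : ∀ i m, 0 ≤ Z.totalFactor (B.σ i) T m := fun i m => (Z.totalFactor_pos m).le
  refine ⟨∑ i, ‖B.p i‖ * ((∑' m, Z.totalFactor (B.σ i) T m) * (stepWeight 0 * Q i)),
    Finset.sum_nonneg fun i _ => mul_nonneg (norm_nonneg _)
      (mul_nonneg (tsum_nonneg (htf i)) (mul_nonneg hw (by positivity))), fun u₀ t h0 h1 => ?_⟩
  refine (norm_closedLoop_le B hT u₀ h0 h1).trans ?_
  rw [Finset.sum_mul]
  refine Finset.sum_le_sum fun i _ => ?_
  rw [mul_assoc, mul_assoc, mul_assoc (stepWeight 0)]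
  refine mul_le_mul_of_nonneg_left (mul_le_mul ?_ (mul_le_mul_of_nonneg_left
    (norm_profile_le B le_rfl le_rfl i u₀) hw) (mul_nonneg hw (norm_nonneg _))
    (tsum_nonneg (htf i))) (norm_nonneg _)
  exact (Z.summable_totalFactor (B.σ_pos i) hT).le_tsum _ fun m _ => htf i m

lemma tendsto_norm_closedLoop (B : Eigenbasis A) (hT : 0 < T) (u₀ : Z.L2 0) :
    Tendsto (fun t => ‖Z.closedLoop T B u₀ t‖) (𝓝[<] T) (𝓝 0) := by
  have h : Tendsto (fun t => ∑ i, ‖B.p i‖ * (Z.totalFactor (B.σ i) T (knotIndex T t) *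
      (stepWeight 0 * ‖Z.profile B i 0 u₀‖))) (𝓝[<] T) (𝓝 (∑ i : Fin n, ‖B.p i‖ * (0 *
      (stepWeight 0 * ‖Z.profile B i 0 u₀‖)))) :=
    tendsto_finsetSum _ fun i _ => ((((Z.summable_totalFactor (B.σ_pos i)
      hT).tendsto_atTop_zero.comp (tendsto_knotIndex hT)).mul_const _).const_mul _)
  simp only [zero_mul, mul_zero, Finset.sum_const_zero] at h
  refine squeeze_zero' (Eventually.of_forall fun _ => norm_nonneg _) ?_ h
  filter_upwards [Ioo_mem_nhdsLT hT] with t ht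
  exact norm_closedLoop_le B hT u₀ ht.1.le ht.2

/-- Only the time `T` needs care; there continuity from the left is the convergence of the norms to
zero. -/
lemma continuousL2On_closedLoop (B : Eigenbasis A) (hT : 0 < T) (u₀ : Z.L2 0) :
    Z.ContinuousL2On (fun t => Z.closedLoop T B u₀ t) (Ici 0) := by
  refine ⟨fun t _ => Lp.memLp _, ?_⟩
  change ContinuousOn (fun t => Z.contract t (Z.closedLoop T B u₀ t)) (Ici 0)
  have hbefore : ContinuousOn (fun t => Z.contract t (Z.closedLoop T B u₀ t)) (Ico 0 T) := by
    have h : ContinuousOn (fun t => ∑ i, mulLift (Z.gauge (B.σ i) t) (B.p i)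
        (Z.state T (B.σ_pos i) (Z.profile B i 0 u₀) t)) (Ico 0 T) := by
      refine continuousOn_finsetSum _ fun i _ => ContinuousOn.clm_apply ?_ (Z.continuousOn_state _ hT _)
      exact (continuousOn_mulLift (Z.continuousOn_gauge (B.σ i)) (B.p i)).mono Ico_subset_Ici_self
    refine h.congr fun t ht => ?_
    rw [closedLoop_of_lt B u₀ ht.2, assemble, Z.contract_dilate (Z.thickness_pos ht.1)]
  have hafter : ∀ t, T ≤ t → Z.contract t (Z.closedLoop T B u₀ t) = 0 := fun t ht => by
    rw [closedLoop_of_le B u₀ ht, Z.contract_zero (Z.thickness_pos (hT.le.trans ht))]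
  intro t ht
  rcases lt_trichotomy t T with h | rfl | h
  · refine (hbefore t ⟨ht, h⟩).mono_of_mem_nhdsWithin ?_
    rw [mem_nhdsWithin]
    exact ⟨Iio T, isOpen_Iio, h, fun s hs => ⟨hs.2, hs.1⟩⟩
  · refine ContinuousAt.continuousWithinAt ?_
    rw [continuousAt_iff_continuous_left'_right', ContinuousWithinAt, ContinuousWithinAt,
      hafter t le_rfl]
    constructor
    · rw [tendsto_zero_iff_norm_tendsto_zero]
      have hE := Real.sqrt_pos.2 (Z.thickness_pos le_rfl)
      have h1 := (tendsto_norm_closedLoop B hT u₀).const_mul (√(Z.thickness 0))⁻¹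
      rw [mul_zero] at h1
      refine squeeze_zero' (Eventually.of_forall fun _ => norm_nonneg _) ?_ h1
      filter_upwards [Ioo_mem_nhdsLT hT] with s hs
      rw [Z.norm_eq_contract (Z.thickness_pos hs.1.le), ← mul_assoc]
      refine le_mul_of_one_le_left (norm_nonneg _) ?_
      rw [← div_eq_inv_mul, one_le_div hE]
      exact Real.sqrt_le_sqrt (Z.thickness_mono hs.1.le)
    · refine tendsto_const_nhds.congr' ?_
      filter_upwards [self_mem_nhdsWithin] with s hs
      exact (hafter s (mem_Ioi.1 hs).le).symm
  · refine ContinuousAt.continuousWithinAt (ContinuousAt.congr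
      (continuousAt_const (y := (0 : UnitVecL2 n))) ?_)
    filter_upwards [Ioi_mem_nhds h] with s hs
    exact (hafter s (mem_Ioi.1 hs).le).symm

lemma integral_inner_zero {t : ℝ} {u : Z.L2 t} (hu : u = 0) (f : ℝ → Vec n) :
    ∫ x, inner ℝ (u x) (f x) ∂Z.slice t = 0 := by
  subst hu
  refine integral_eq_zero_of_ae ?_
  filter_upwards [Lp.coeFn_zero (Vec n) 2 (Z.slice t)] with x hx
  rw [hx, Pi.zero_apply, inner_zero_left, Pi.zero_apply]

lemma isWeakSolution_zero (H : Z.Feedback) {a : ℝ} {u : ∀ t, Z.L2 t} (hu : ∀ t, a ≤ t → u t = 0)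
    (hc : Z.ContinuousL2On (fun t => u t) (Ici a)) : Z.IsWeakSolution A H a ⊤ (u a) u where
  continuousL2On := hc.mono fun t ht => ht.1
  timeDeriv := by
    refine ⟨fun _ => 0, fun _ => 0, MemLp.zero', MemLp.zero', fun φ _ => ?_⟩
    simp only [inner_zero_left, add_zero, integral_zero, neg_zero]
    refine (setIntegral_congr_fun (measurableSet_times a ⊤) fun t ht =>
      integral_inner_zero (hu t ht.1.le) _).trans ?_
    simp
  weak S _ _ v vt vx vxx _ := by
    rw [setIntegral_congr_fun measurableSet_Ioo fun t ht => integral_inner_zero (hu t ht.1.le) _,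
      integral_inner_zero (hu a le_rfl)]
    have h : EqOn (fun t => inner ℝ (H.nonlocal t (u t)) (v t (Z.thickness t)))
        (fun _ => (0 : ℝ)) (Ioo a S) := fun t ht => by
      simp only [hu t ht.1.le, map_zero, inner_zero_left]
    rw [setIntegral_congr_fun measurableSet_Ioo h]
    simp

end TargetState

end CrossDiffusion

/-! ### Energy estimates for the modal sums -/

namespace CrossDiffusion

lemma abs_integral_mul_le_sqrt {α : Type*} [MeasurableSpace α] {μ : Measure α} {f g : α → ℝ}
    (hf : MemLp f 2 μ) (hg : MemLp g 2 μ) :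
    |∫ x, f x * g x ∂μ| ≤ √(∫ x, f x ^ 2 ∂μ) * √(∫ x, g x ^ 2 ∂μ) := by
  have hn : ∀ {f : α → ℝ} (hf : MemLp f 2 μ), ‖hf.toLp f‖ = √(∫ x, f x ^ 2 ∂μ) := by
    intro f hf
    rw [eq_comm, Real.sqrt_eq_iff_mul_self_eq (integral_nonneg fun x => by positivity)
      (norm_nonneg _), ← real_inner_self_eq_norm_mul_norm, L2.inner_def]
    refine integral_congr_ae ?_
    filter_upwards [hf.coeFn_toLp] with x hx
    rw [hx, real_inner_self_eq_norm_sq, Real.norm_eq_abs, sq_abs]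
  rw [← hn hf, ← hn hg]
  refine le_trans (le_of_eq ?_) (abs_real_inner_le_norm (hf.toLp f) (hg.toLp g))
  rw [L2.inner_def]
  congr 1
  refine integral_congr_ae ?_
  filter_upwards [hf.coeFn_toLp, hg.coeFn_toLp] with x h1 h2
  rw [h1, h2]
  simp [mul_comm]

namespace TargetState

variable {n : ℕ} {Z : TargetState n} {σ : ℝ} {p : Vec n}

lemma integral_mode_mul_deriv (hσ : σ ≠ 0) {t : ℝ} (ht : 0 < Z.thickness t) (w : ℝ)
    {g g' : ℝ → Vec n} (hg : ∀ x, HasDerivAt g (g' x) x) (hg' : Continuous g') (h0 : g 0 = 0)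
    (h1 : g (Z.thickness t) = 0) (p : Vec n) :
    ∫ x, Z.mode σ w t x * inner ℝ p (g' x) ∂Z.slice t =
      -∫ x, Z.modeX σ w t x * inner ℝ p (g x) ∂Z.slice t := by
  rw [integral_slice_eq_intervalIntegral ht, integral_slice_eq_intervalIntegral ht,
    intervalIntegral.integral_mul_deriv_eq_deriv_mul (fun x _ => Z.hasDerivAt_mode_x σ w t x)
      (v := fun x => inner ℝ p (g x))
      (fun x _ => by simpa using (hasDerivAt_const x p).inner ℝ (hg x))
      ((continuous_modeX_x hσ ht w).intervalIntegrable _ _)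
      ((continuous_const.inner hg').intervalIntegrable _ _)]
  simp [h0, h1]

/-- Bound for the square of the `L²` norm of the space derivative of a modal sum. -/
noncomputable def gradBound (σ : ℝ) (N L : ℕ) (r : ℝ) (z : UnitL2) : ℝ :=
  2 * N * ∑ k ∈ Finset.range N, (coef N k z * (freq N k * decay σ (freq N k) r)) ^ 2 +
    2 * ∑ l ∈ Finset.range L,
      (coef N (N + l) z * (freq N (N + l) * decay σ (freq N (N + l)) r)) ^ 2

lemma gradBound_nonneg (N L : ℕ) (r : ℝ) (z : UnitL2) : 0 ≤ gradBound σ N L r z := by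
  unfold gradBound; positivity

lemma abs_integral_sum_sin_le (hσ : 0 < σ) {t : ℝ} (ht : 0 < Z.thickness t) (N L : ℕ) (r : ℝ)
    (z : UnitL2) {g : ℝ → Vec n} (hg : Continuous g) :
    |∫ x, Z.amp σ t x * (∑ k ∈ Finset.range (N + L), coef N k z * (freq N k *
      decay σ (freq N k) r) * Real.sin (freq N k * (x / Z.thickness t))) *
        inner ℝ p (g x) ∂Z.slice t| ≤
      √(gradBound σ N L r z) * (‖p‖ * √(∫ x, ‖g x‖ ^ 2 ∂Z.slice t)) := by
  have ha : Continuous (Z.amp σ t) :=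
    continuous_iff_continuousAt.2 fun x => (Z.hasDerivAt_amp_x σ t x).continuousAt
  refine (abs_integral_mul_le_sqrt (memLp_slice_of_continuous (by fun_prop))
    (memLp_slice_of_continuous (continuous_const.inner hg))).trans ?_
  refine mul_le_mul (Real.sqrt_le_sqrt ?_) ?_ (Real.sqrt_nonneg _) (Real.sqrt_nonneg _)
  · refine le_trans ?_ (integral_sq_sum_sin_freq_le N L
      fun k => coef N k z * (freq N k * decay σ (freq N k) r))
    rw [Z.integral_slice ht, smul_eq_mul, ← integral_const_mul,
      intervalIntegral.integral_of_le zero_le_one, integral_Ioc_eq_integral_Ioo]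
    refine integral_mono (((memLp_unit_of_continuous (Continuous.pow (by fun_prop) 2) 1).integrable
      le_rfl).const_mul _) ((memLp_unit_of_continuous (by fun_prop) 1).integrable le_rfl)
      fun y => ?_
    simp only [mul_div_cancel_right₀ _ ht.ne', Z.amp_mul ht]
    rw [mul_pow, ← mul_assoc]
    refine mul_le_of_le_one_left (sq_nonneg _) ?_
    have h1 := pow_le_pow_left₀ (abs_nonneg _) (Z.gauge_abs_le hσ ht y) 2
    rw [sq_abs, inv_pow, Real.sq_sqrt ht.le] at h1
    calc _ ≤ Z.thickness t * (Z.thickness t)⁻¹ := mul_le_mul_of_nonneg_left h1 ht.le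
      _ = 1 := mul_inv_cancel₀ ht.ne'
  · rw [← Real.sqrt_sq (norm_nonneg p), ← Real.sqrt_mul (sq_nonneg _), ← integral_const_mul]
    refine Real.sqrt_le_sqrt (integral_mono
      (memLp_slice_of_continuous (continuous_const.inner hg)).integrable_sq
      ((memLp_slice_of_continuous hg).integrable_norm_pow (by simp) |>.const_mul _) fun x => ?_)
    rw [← mul_pow, ← sq_abs]
    exact pow_le_pow_left₀ (abs_nonneg _) (abs_real_inner_le_norm _ _) 2

/-- After integration by parts the derivative falls on the modes. Its Gaussian part is the mode
times `v̄ x / (2 σ ē)`, where `x ≤ ē`, and is controlled by the norm of the modal sum; its sine part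
is controlled by `gradBound`. -/
lemma abs_pairing_modalSum_deriv_le (hσ : 0 < σ) {t t₀ : ℝ} (ht : 0 < Z.thickness t) (N L : ℕ)
    (z : UnitL2) {g g' : ℝ → Vec n} (hg : ∀ x, HasDerivAt g (g' x) x) (hg' : Continuous g')
    (h0 : g 0 = 0) (h1 : g (Z.thickness t) = 0) :
    |Z.pairing σ p t (modalSum σ N (N + L) (Z.scaledTime t - Z.scaledTime t₀) z) g'| ≤
      ‖p‖ * (Z.speed / (2 * σ) *
        ‖modalSum σ N (N + L) (Z.scaledTime t - Z.scaledTime t₀) z‖ + (Z.thickness t)⁻¹ *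
          √(gradBound σ N L (Z.scaledTime t - Z.scaledTime t₀) z)) *
        √(∫ x, ‖g x‖ ^ 2 ∂Z.slice t) := by
  have hgc : Continuous g := continuous_iff_continuousAt.2 fun x => (hg x).continuousAt
  have hxg : Continuous fun x => x • g x := by fun_prop
  set r := Z.scaledTime t - Z.scaledTime t₀ with hr
  set E := Z.thickness t with hE
  set I : ℝ := ∫ x, Z.amp σ t x * (∑ k ∈ Finset.range (N + L), coef N k z * (freq N k *
      decay σ (freq N k) r) * Real.sin (freq N k * (x / E))) * inner ℝ p (g x) ∂Z.slice t with hI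
  have ha : Continuous (Z.amp σ t) :=
    continuous_iff_continuousAt.2 fun x => (Z.hasDerivAt_amp_x σ t x).continuousAt
  have hint : ∀ {F : ℝ → ℝ}, Continuous F → Integrable F (Z.slice t) := fun hF =>
    (memLp_slice_of_continuous hF).integrable (by norm_num)
  have key : Z.pairing σ p t (modalSum σ N (N + L) r z) g' =
      Z.speed / (2 * σ * E) * Z.pairing σ p t (modalSum σ N (N + L) r z) (fun x => x • g x) +
        E⁻¹ * I := by
    rw [pairing_modalSum ht z (memLp_slice_of_continuous hg'),
      pairing_modalSum ht z (memLp_slice_of_continuous hxg), hI]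
    simp only [Finset.mul_sum, Finset.sum_mul]
    rw [integral_finsetSum _ fun k _ => hint (by fun_prop), Finset.mul_sum,
      ← Finset.sum_add_distrib]
    refine Finset.sum_congr rfl fun k _ => ?_
    rw [integral_mode_mul_deriv hσ.ne' ht _ hg hg' h0 h1, ← integral_neg, ← integral_const_mul,
      ← integral_const_mul, ← integral_const_mul, ← integral_const_mul, ← integral_add
        (hint (by have := Z.continuous_mode_x σ (freq N k) t; fun_prop)) (hint (by fun_prop))]
    congr 1
    funext x
    have h : decay σ (freq N k) r =
        (decay σ (freq N k) (Z.scaledTime t₀))⁻¹ * decay σ (freq N k) (Z.scaledTime t) := by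
      simp only [decay, hr]
      rw [← Real.exp_neg, ← Real.exp_add]
      congr 1
      ring
    rw [h, inner_smul_right]
    simp only [modeX, mode, ← hE]
    field_simp
    ring
  have hp1 : |Z.pairing σ p t (modalSum σ N (N + L) r z) (fun x => x • g x)| ≤
      ‖p‖ * ‖modalSum σ N (N + L) r z‖ * (E * √(∫ x, ‖g x‖ ^ 2 ∂Z.slice t)) := by
    refine (abs_pairing_le hσ ht _ (memLp_slice_of_continuous hxg)).trans
      (mul_le_mul_of_nonneg_left ?_ (by positivity))
    rw [← Real.sqrt_sq ht.le, ← Real.sqrt_mul (sq_nonneg _), ← integral_const_mul]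
    refine Real.sqrt_le_sqrt (setIntegral_mono_on
      ((memLp_slice_of_continuous hxg).integrable_norm_pow (by simp))
      ((memLp_slice_of_continuous hgc).integrable_norm_pow (by simp) |>.const_mul _)
      measurableSet_Ioo fun x hx => ?_)
    rw [norm_smul, mul_pow, Real.norm_of_nonneg hx.1.le]
    exact mul_le_mul_of_nonneg_right (pow_le_pow_left₀ hx.1.le hx.2.le 2) (sq_nonneg _)
  have hp2 := abs_integral_sum_sin_le (p := p) hσ ht N L r z hgc
  rw [key]
  refine (abs_add_le _ _).trans ?_
  rw [abs_mul, abs_mul, abs_of_pos (inv_pos.2 ht)]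
  have hs : 0 < Z.speed / (2 * σ * E) := div_pos Z.speed_pos (by positivity)
  rw [abs_of_pos hs]
  calc _ ≤ Z.speed / (2 * σ * E) * (‖p‖ * ‖modalSum σ N (N + L) r z‖ *
          (E * √(∫ x, ‖g x‖ ^ 2 ∂Z.slice t))) + E⁻¹ * (√(gradBound σ N L r z) *
            (‖p‖ * √(∫ x, ‖g x‖ ^ 2 ∂Z.slice t))) :=
        add_le_add (mul_le_mul_of_nonneg_left hp1 hs.le)
          (mul_le_mul_of_nonneg_left hp2 (inv_pos.2 ht).le)
    _ = _ := by field_simp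

/-- Parabolic smoothing with a bound independent of the frequency: up to the factor `ē(d)² / ē(t)² ≥
1`, the integrand is the derivative of a multiple of the squared decay factor. -/
lemma integral_freq_decay_le (hσ : 0 < σ) (w : ℝ) {t₀ c d : ℝ} (ht₀ : 0 ≤ t₀) (htc : t₀ ≤ c)
    (hcd : c ≤ d) :
    ∫ t in c..d, (w * decay σ w (Z.scaledTime t - Z.scaledTime t₀)) ^ 2 ≤
      Z.thickness d ^ 2 / (2 * σ) := by
  set D : ℝ → ℝ := fun t => decay σ w (Z.scaledTime t - Z.scaledTime t₀) with hD
  have hpos : ∀ {t}, t ∈ uIcc c d → 0 < Z.thickness t := fun ht => by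
    rw [uIcc_of_le hcd] at ht
    exact Z.thickness_pos (ht₀.trans (htc.trans ht.1))
  have hder : ∀ t ∈ uIcc c d, HasDerivAt (fun t => -(Z.thickness d ^ 2 / (2 * σ)) * D t ^ 2)
      (Z.thickness d ^ 2 * (1 / Z.thickness t ^ 2) * (w * D t) ^ 2) t := by
    intro t ht
    have h1 : HasDerivAt D (D t * -(σ * w ^ 2 * (1 / Z.thickness t ^ 2))) t :=
      ((((Z.hasDerivAt_scaledTime (hpos ht)).sub_const _).const_mul (σ * w ^ 2)).neg).exp
    refine ((h1.pow 2).const_mul (-(Z.thickness d ^ 2 / (2 * σ)))).congr_deriv ?_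
    push_cast
    field_simp
  have hDc : ContinuousOn D (uIcc c d) := fun t ht => by
    have := (Z.hasDerivAt_scaledTime (hpos ht)).continuousAt
    refine ContinuousAt.continuousWithinAt ?_
    simp only [hD, decay]
    fun_prop
  have hEc : ContinuousOn (fun t => 1 / Z.thickness t ^ 2) (uIcc c d) := fun t ht =>
    ContinuousAt.continuousWithinAt (continuousAt_const.div
      ((Z.continuousAt_thickness t).pow 2) (pow_pos (hpos ht) 2).ne')
  have i1 : IntervalIntegrable (fun t => (w * D t) ^ 2) volume c d :=
    ContinuousOn.intervalIntegrable (by fun_prop)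
  have i2 : IntervalIntegrable (fun t => Z.thickness d ^ 2 * (1 / Z.thickness t ^ 2) *
      (w * D t) ^ 2) volume c d := ContinuousOn.intervalIntegrable (by fun_prop)
  refine (intervalIntegral.integral_mono_on hcd i1 i2 fun t ht => ?_).trans ?_
  · refine le_mul_of_one_le_left (sq_nonneg _) ?_
    have hE := hpos (by rwa [uIcc_of_le hcd])
    rw [mul_one_div, one_le_div (by positivity)]
    exact pow_le_pow_left₀ hE.le (Z.thickness_mono ht.2) 2
  · rw [intervalIntegral.integral_eq_sub_of_hasDerivAt hder i2]
    have h1 : D c ^ 2 ≤ 1 := pow_le_one₀ (decay_pos _ _ _).le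
      (decay_le_one hσ.le (Z.scaledTime_sub_nonneg ht₀ htc) w)
    have h2 : 0 ≤ Z.thickness d ^ 2 / (2 * σ) := by positivity
    nlinarith [mul_nonneg h2 (sq_nonneg (D d))]

lemma continuousOn_gradBound (N L : ℕ) (z : UnitL2) {t₀ c d : ℝ} (hc : 0 ≤ c) :
    ContinuousOn (fun t => gradBound σ N L (Z.scaledTime t - Z.scaledTime t₀) z) (Icc c d) := by
  intro t ht
  have := (Z.hasDerivAt_scaledTime (Z.thickness_pos (hc.trans ht.1))).continuousAt
  refine ContinuousAt.continuousWithinAt ?_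
  simp only [gradBound, decay]
  fun_prop

/-- Each mode contributes its squared coefficient times the same constant, so the sum is the
weighted sum of squares of `sum_coef_sq_le`, uniformly in the number of modes. -/
lemma integral_gradBound_le (hσ : 0 < σ) {N : ℕ} (hN : 1 ≤ N) (L : ℕ) (z : UnitL2) {t₀ c d : ℝ}
    (ht₀ : 0 ≤ t₀) (htc : t₀ ≤ c) (hcd : c ≤ d) :
    ∫ t in c..d, gradBound σ N L (Z.scaledTime t - Z.scaledTime t₀) z ≤
      Z.thickness d ^ 2 / (2 * σ) * (8 * (N * evolConst N * ‖z‖) ^ 2) := by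
  set q : ℕ → ℝ → ℝ := fun k t =>
    (freq N k * decay σ (freq N k) (Z.scaledTime t - Z.scaledTime t₀)) ^ 2 with hq
  have hqi : ∀ k, IntervalIntegrable (q k) volume c d := fun k => by
    refine ContinuousOn.intervalIntegrable fun t ht => ?_
    rw [uIcc_of_le hcd] at ht
    have := (Z.hasDerivAt_scaledTime (Z.thickness_pos (ht₀.trans (htc.trans ht.1)))).continuousAt
    refine ContinuousAt.continuousWithinAt ?_
    simp only [hq, decay]
    fun_prop
  have hqb : ∀ k, ∫ t in c..d, q k t ≤ Z.thickness d ^ 2 / (2 * σ) := fun k =>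
    integral_freq_decay_le hσ _ ht₀ htc hcd
  have hsum : ∀ (s : Finset ℕ) (f : ℕ → ℕ), IntervalIntegrable
      (fun t => ∑ k ∈ s, coef N (f k) z ^ 2 * q (f k) t) volume c d := fun s f => by
    have e : (fun t => ∑ k ∈ s, coef N (f k) z ^ 2 * q (f k) t) =
        ∑ k ∈ s, fun t => coef N (f k) z ^ 2 * q (f k) t := by
      ext t
      simp
    rw [e]
    exact IntervalIntegrable.sum _ fun k _ => (hqi _).const_mul _
  have he : ∫ t in c..d, gradBound σ N L (Z.scaledTime t - Z.scaledTime t₀) z =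
      2 * N * ∑ k ∈ Finset.range N, (coef N k z ^ 2 * ∫ t in c..d, q k t) +
      2 * ∑ l ∈ Finset.range L, (coef N (N + l) z ^ 2 * ∫ t in c..d, q (N + l) t) := by
    simp only [gradBound, mul_pow (coef _ _ _), ← intervalIntegral.integral_const_mul]
    rw [← intervalIntegral.integral_finsetSum fun k _ => (hqi _).const_mul _,
      ← intervalIntegral.integral_finsetSum fun k _ => (hqi _).const_mul _,
      ← intervalIntegral.integral_const_mul, ← intervalIntegral.integral_const_mul,
      ← intervalIntegral.integral_add]
    · exact (hsum (Finset.range N) id).const_mul _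
    · exact (hsum (Finset.range L) (N + ·)).const_mul _
  have hb : ∀ (s : Finset ℕ) (f : ℕ → ℕ), ∑ k ∈ s, coef N (f k) z ^ 2 * ∫ t in c..d, q (f k) t ≤
      Z.thickness d ^ 2 / (2 * σ) * ∑ k ∈ s, coef N (f k) z ^ 2 := fun s f => by
    rw [Finset.mul_sum]
    refine Finset.sum_le_sum fun k _ => ?_
    rw [mul_comm (_ / _)]
    exact mul_le_mul_of_nonneg_left (hqb _) (sq_nonneg _)
  have h1 := hb (Finset.range N) id
  have h2 := hb (Finset.range L) (N + ·)
  have h3 := sum_coef_sq_le hN L z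
  have hN1 : (1 : ℝ) ≤ N := by exact_mod_cast hN
  -- Replacing `N` by `N²` loses little and produces the quantity that `stepWeight` controls.
  have h4 : 4 * N * evolConst N ^ 2 * ‖z‖ ^ 2 ≤ 4 * (N * evolConst N * ‖z‖) ^ 2 := by
    have : 0 ≤ (evolConst N * ‖z‖) ^ 2 * (N * (N - 1)) := by
      have : 0 ≤ (N : ℝ) - 1 := by linarith
      positivity
    nlinarith
  have h5 : 0 ≤ Z.thickness d ^ 2 / (2 * σ) := by positivity
  rw [he]
  simp only [id] at h1
  set Q := Z.thickness d ^ 2 / (2 * σ) with hQ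
  set S1 := ∑ k ∈ Finset.range N, coef N k z ^ 2 with hS1
  set S2 := ∑ l ∈ Finset.range L, coef N (N + l) z ^ 2 with hS2
  have hS1' : 0 ≤ S1 := Finset.sum_nonneg fun _ _ => sq_nonneg _
  calc _ ≤ 2 * N * (Q * S1) + 2 * (Q * S2) := by
        have := mul_le_mul_of_nonneg_left h1 (by positivity : 0 ≤ 2 * (N : ℝ))
        linarith
    _ ≤ Q * (2 * (2 * N * S1 + S2)) := by
        have : 0 ≤ Q * (N * S1) := by positivity
        linarith
    _ ≤ _ := mul_le_mul_of_nonneg_left (by linarith) h5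

end TargetState

end CrossDiffusion

/-! ### Bound for the spatial derivative of the closed loop in the dual norm -/

namespace CrossDiffusion

namespace TargetState

variable {n : ℕ} {Z : TargetState n} {σ T : ℝ} {p : Vec n} {g g' : ℝ → ℝ → Vec n}

lemma integral_sq_sqrt_slice (g : ℝ → ℝ → Vec n) (s : Set ℝ) :
    ∫ t in s, √(∫ x, ‖g t x‖ ^ 2 ∂Z.slice t) ^ 2 = ∫ t in s, ∫ x, ‖g t x‖ ^ 2 ∂Z.slice t := by
  congr 1
  funext t
  exact Real.sq_sqrt (integral_nonneg fun x => by positivity)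

variable (Z σ p T) in
/-- Factor in the estimate of the dual norm of the second derivative of a component. -/
noncomputable def dualFactor : ℝ :=
  ‖p‖ * (Z.speed / (2 * σ) * √T + (Z.thickness 0)⁻¹ * √(Z.thickness T ^ 2 / (2 * σ) * 8))

lemma abs_integral_pairing_evol_le (hσ : 0 < σ) {N : ℕ} (hN : 1 ≤ N) (z : UnitL2) {t₀ c d : ℝ}
    (ht₀ : 0 ≤ t₀) (htc : t₀ ≤ c) (hcd : c ≤ d) (hdT : d ≤ T)
    (hgc : Continuous (Function.uncurry g)) (hgc' : Continuous (Function.uncurry g'))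
    (hg : ∀ t x, HasDerivAt (g t) (g' t x) x) (h0 : ∀ t, g t 0 = 0)
    (h1 : ∀ t, g t (Z.thickness t) = 0) :
    |∫ t in Ioo c d, Z.pairing σ p t (evol hσ N (Z.scaledTime t - Z.scaledTime t₀) z) (g' t)| ≤
      Z.dualFactor σ T p * (N * evolConst N * ‖z‖) *
        √(∫ t in Ioo c d, ∫ x, ‖g t x‖ ^ 2 ∂Z.slice t) := by
  obtain ⟨δ, hδ, hb⟩ := exists_modalSum_error hσ hN z
  have hδ0 : ∀ L, 0 ≤ δ L := fun L => (norm_nonneg _).trans (hb L 0 le_rfl)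
  have hc0 : 0 ≤ c := ht₀.trans htc
  have hr : ∀ {t}, c ≤ t → 0 ≤ Z.scaledTime t - Z.scaledTime t₀ := fun ht =>
    Z.scaledTime_sub_nonneg ht₀ (htc.trans ht)
  set G : ℝ → ℝ := fun t => √(∫ x, ‖g t x‖ ^ 2 ∂Z.slice t) with hG
  set G' : ℝ → ℝ := fun t => √(∫ x, ‖g' t x‖ ^ 2 ∂Z.slice t) with hG'
  have hGm : MemLp G 2 (volume.restrict (Ioo c d)) :=
    memLp_sqrt_integral_slice (z := Function.uncurry g) (memLp_of_continuousOn hgc.continuousOn)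
  have hGm' : MemLp G' 2 (volume.restrict (Ioo c d)) :=
    memLp_sqrt_integral_slice (z := Function.uncurry g') (memLp_of_continuousOn hgc'.continuousOn)
  set v := Z.speed / (2 * σ) with hv
  have hv0 : 0 ≤ v := (div_pos Z.speed_pos (by positivity)).le
  set W := N * evolConst N * ‖z‖ with hW
  set R := √(∫ t in Ioo c d, ∫ x, ‖g t x‖ ^ 2 ∂Z.slice t) with hR
  have hE0 := Z.thickness_pos le_rfl
  -- The evolution is split into a modal sum, estimated by energy, and an error of norm at most `δ
  -- L`, paired directly with `g'`. The second contribution disappears in the limit, so the norm of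
  -- `g'` does not enter the result.
  have hstep : ∀ L,
      |∫ t in Ioo c d, Z.pairing σ p t (evol hσ N (Z.scaledTime t - Z.scaledTime t₀) z) (g' t)| ≤
      ‖p‖ * (v * (evolConst N * ‖z‖ + δ L) * √T + (Z.thickness 0)⁻¹ *
        √(Z.thickness T ^ 2 / (2 * σ) * 8 * W ^ 2)) * R + ‖p‖ * δ L * ∫ t in Ioo c d, G' t := by
    intro L
    set J : ℝ → ℝ := fun t => √(gradBound σ N L (Z.scaledTime t - Z.scaledTime t₀) z) with hJ
    have hJc : ContinuousOn (fun t => gradBound σ N L (Z.scaledTime t - Z.scaledTime t₀) z)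
        (Icc c d) := continuousOn_gradBound N L z hc0
    have hJm : MemLp J 2 (volume.restrict (Ioo c d)) := by
      have : IntegrableOn (fun t => gradBound σ N L (Z.scaledTime t - Z.scaledTime t₀) z)
          (Ioo c d) := (hJc.integrableOn_compact isCompact_Icc).mono_set Ioo_subset_Icc_self
      rw [memLp_two_iff_integrable_sq this.1.aemeasurable.sqrt.aestronglyMeasurable]
      exact this.congr (ae_of_all _ fun t => (Real.sq_sqrt (gradBound_nonneg _ _ _ _)).symm)
    have hJi : √(∫ t in Ioo c d, J t ^ 2) ≤ √(Z.thickness T ^ 2 / (2 * σ) * 8 * W ^ 2) := by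
      refine Real.sqrt_le_sqrt ?_
      simp only [hJ, Real.sq_sqrt (gradBound_nonneg _ _ _ _)]
      rw [← integral_Ioc_eq_integral_Ioo, ← intervalIntegral.integral_of_le hcd, mul_assoc]
      refine (integral_gradBound_le hσ hN L z ht₀ htc hcd).trans ?_
      refine mul_le_mul_of_nonneg_right ?_ (by positivity)
      have := pow_le_pow_left₀ (Z.thickness_pos (hc0.trans hcd)).le (Z.thickness_mono hdT) 2
      gcongr
    have hJG : ∫ t in Ioo c d, J t * G t ≤ √(Z.thickness T ^ 2 / (2 * σ) * 8 * W ^ 2) * R := by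
      refine (le_abs_self _).trans ((abs_integral_mul_le_sqrt hJm hGm).trans ?_)
      rw [integral_sq_sqrt_slice]
      exact mul_le_mul_of_nonneg_right hJi (Real.sqrt_nonneg _)
    have hG1 : ∫ t in Ioo c d, G t ≤ √T * R := by
      have h := abs_integral_mul_le_sqrt (memLp_const (1 : ℝ)) hGm
      simp only [one_mul, one_pow, integral_const, MeasurableSet.univ, measureReal_restrict_apply,
        univ_inter, Real.volume_real_Ioo_of_le hcd, smul_eq_mul, mul_one] at h
      rw [integral_sq_sqrt_slice] at h
      refine (le_abs_self _).trans (h.trans (mul_le_mul_of_nonneg_right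
        (Real.sqrt_le_sqrt (by linarith)) (Real.sqrt_nonneg _)))
    have iG : Integrable G (volume.restrict (Ioo c d)) := hGm.integrable (by norm_num)
    have iG' : Integrable G' (volume.restrict (Ioo c d)) := hGm'.integrable (by norm_num)
    have iJG : Integrable (fun t => J t * G t) (volume.restrict (Ioo c d)) := hJm.integrable_mul hGm
    have hle := norm_integral_le_of_norm_le (μ := volume.restrict (Ioo c d))
      (f := fun t => Z.pairing σ p t (evol hσ N (Z.scaledTime t - Z.scaledTime t₀) z) (g' t))
      (g := fun t => ‖p‖ * v * (evolConst N * ‖z‖ + δ L) * G t +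
        ‖p‖ * (Z.thickness 0)⁻¹ * (J t * G t) + ‖p‖ * δ L * G' t)
      (((iG.const_mul _).add (iJG.const_mul _)).add (iG'.const_mul _)) ?_
    · rw [integral_add (integrable_fun_add (iG.const_mul _) (iJG.const_mul _)) (iG'.const_mul _),
        integral_add (iG.const_mul _) (iJG.const_mul _), integral_const_mul, integral_const_mul,
        integral_const_mul] at hle
      refine hle.trans ?_
      have e1 : 0 ≤ ‖p‖ * v * (evolConst N * ‖z‖ + δ L) := by
        have := one_le_evolConst N
        have := hδ0 L
        positivity
      have e2 := mul_le_mul_of_nonneg_left hG1 e1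
      have e3 := mul_le_mul_of_nonneg_left hJG
        (by positivity : 0 ≤ ‖p‖ * (Z.thickness 0)⁻¹)
      linarith
    · filter_upwards [ae_restrict_mem measurableSet_Ioo] with t ht
      have hE := Z.thickness_pos (hc0.trans ht.1.le)
      have hgt' : Continuous (g' t) := hgc'.comp (by fun_prop : Continuous fun x : ℝ => (t, x))
      set M := modalSum σ N (N + L) (Z.scaledTime t - Z.scaledTime t₀) z with hM
      set Y := evol hσ N (Z.scaledTime t - Z.scaledTime t₀) z with hY
      have b1 := abs_pairing_modalSum_deriv_le (p := p) (t₀ := t₀) hσ hE N L z (hg t) hgt' (h0 t)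
        (h1 t)
      have b2 := abs_pairing_le (p := p) hσ hE (Y - M) (memLp_slice_of_continuous hgt')
      have b3 : Z.pairing σ p t Y (g' t) =
          Z.pairing σ p t M (g' t) + Z.pairing σ p t (Y - M) (g' t) := by
        simp only [pairing, inner_sub_left]
        ring
      have b4 : ‖Y - M‖ ≤ δ L := hb L _ (hr ht.1.le)
      have b5 : ‖Y‖ ≤ evolConst N * ‖z‖ := by
        refine (norm_evol_le hσ hN (hr ht.1.le) z).trans ?_
        exact mul_le_mul_of_nonneg_right (mul_le_of_le_one_right
          (by linarith [one_le_evolConst N]) (decay_le_one hσ.le (hr ht.1.le) _)) (norm_nonneg _)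
      have b6 : ‖M‖ ≤ evolConst N * ‖z‖ + δ L := by
        have := norm_sub_norm_le M Y
        rw [norm_sub_rev] at this
        linarith
      have b7 : (Z.thickness t)⁻¹ ≤ (Z.thickness 0)⁻¹ :=
        inv_anti₀ hE0 (Z.thickness_mono (hc0.trans ht.1.le))
      rw [b3, Real.norm_eq_abs]
      refine (abs_add_le _ _).trans (add_le_add (b1.trans ?_) (b2.trans ?_))
      · calc _ ≤ ‖p‖ * (v * (evolConst N * ‖z‖ + δ L) + (Z.thickness 0)⁻¹ * J t) * G t :=
              mul_le_mul_of_nonneg_right (mul_le_mul_of_nonneg_left (add_le_add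
                (mul_le_mul_of_nonneg_left b6 hv0)
                (mul_le_mul_of_nonneg_right b7 (Real.sqrt_nonneg _))) (norm_nonneg _))
                (Real.sqrt_nonneg _)
          _ = _ := by ring
      · exact mul_le_mul_of_nonneg_right (mul_le_mul_of_nonneg_left b4 (norm_nonneg _))
          (Real.sqrt_nonneg _)
  have hlim : Tendsto (fun L => ‖p‖ * (v * (evolConst N * ‖z‖ + δ L) * √T + (Z.thickness 0)⁻¹ *
        √(Z.thickness T ^ 2 / (2 * σ) * 8 * W ^ 2)) * R + ‖p‖ * δ L * ∫ t in Ioo c d, G' t) atTop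
      (𝓝 (‖p‖ * (v * (evolConst N * ‖z‖ + 0) * √T + (Z.thickness 0)⁻¹ *
        √(Z.thickness T ^ 2 / (2 * σ) * 8 * W ^ 2)) * R + ‖p‖ * 0 * ∫ t in Ioo c d, G' t)) :=
    ((((((hδ.const_add _).const_mul _).mul_const _).add_const _).const_mul _).mul_const _).add
      ((hδ.const_mul _).mul_const _)
  refine (ge_of_tendsto hlim (Eventually.of_forall hstep)).trans ?_
  have hN1 : (1 : ℝ) ≤ N := by exact_mod_cast hN
  have hc1 := one_le_evolConst N
  have hW0 : 0 ≤ W := by positivity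
  have hW1 : evolConst N * ‖z‖ ≤ W := by
    rw [hW, mul_assoc]
    exact le_mul_of_one_le_left (by positivity) hN1
  rw [Real.sqrt_mul (by positivity), Real.sqrt_sq hW0, add_zero, mul_zero, zero_mul, add_zero]
  refine mul_le_mul_of_nonneg_right ?_ (Real.sqrt_nonneg _)
  rw [dualFactor, mul_assoc ‖p‖]
  refine mul_le_mul_of_nonneg_left ?_ (norm_nonneg _)
  have := mul_le_mul_of_nonneg_right (mul_le_mul_of_nonneg_left hW1 hv0) (Real.sqrt_nonneg T)
  linarith

/-- The interval of index `j` costs `stepWeight j` times the norm of its initial state, hence a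
multiple of `totalFactor j`. Summability makes the bound independent of `m`, although the feedback
becomes singular at `T`. -/
lemma abs_integral_pairing_state_le (hσ : 0 < σ) (hT : 0 < T) (z : UnitL2) (m : ℕ)
    (hgc : Continuous (Function.uncurry g)) (hgc' : Continuous (Function.uncurry g'))
    (hg : ∀ t x, HasDerivAt (g t) (g' t x) x) (h0 : ∀ t, g t 0 = 0)
    (h1 : ∀ t, g t (Z.thickness t) = 0) :
    |∫ t in Ioo 0 (knot T m), Z.pairing σ p t (Z.state T hσ z t) (g' t)| ≤
      Z.dualFactor σ T p * ((∑' j, Z.totalFactor σ T j) * (stepWeight 0 * ‖z‖)) *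
        √(∫ t in Ioo 0 (knot T m), ∫ x, ‖g t x‖ ^ 2 ∂Z.slice t) := by
  have hk0 := knot_nonneg hT m
  set R := √(∫ t in Ioo 0 (knot T m), ∫ x, ‖g t x‖ ^ 2 ∂Z.slice t) with hR
  have hK : 0 ≤ Z.dualFactor σ T p := by
    have := Z.speed_pos
    have := Z.thickness_pos le_rfl
    unfold dualFactor
    positivity
  have hint : IntervalIntegrable (fun t => Z.pairing σ p t (Z.state T hσ z t) (g' t)) volume 0
      (knot T m) := by
    rw [intervalIntegrable_iff_integrableOn_Ioo_of_le hk0]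
    exact integrableOn_pairing hσ le_rfl ((Z.continuousOn_state hσ hT z).mono
      (Icc_subset_Ico_right (knot_lt hT m))) (memLp_of_continuousOn hgc'.continuousOn)
  have hsub : ∀ j < m, knot T j ∈ Icc 0 (knot T m) ∧ knot T (j + 1) ∈ Icc 0 (knot T m) :=
    fun j hj => ⟨⟨knot_nonneg hT _, (knot_mono hT).monotone hj.le⟩,
      ⟨knot_nonneg hT _, (knot_mono hT).monotone hj⟩⟩
  have hsum := intervalIntegral.sum_integral_adjacent_intervals (μ := volume) (a := knot T) (n := m)
    (f := fun t => Z.pairing σ p t (Z.state T hσ z t) (g' t)) fun j hj =>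
      hint.mono_set (by
        rw [uIcc_of_le hk0, uIcc_of_le (knot_lt_succ hT j).le]
        exact Icc_subset_Icc (hsub j hj).1.1 (hsub j hj).2.2)
  rw [knot_zero] at hsum
  rw [← integral_Ioc_eq_integral_Ioo, ← intervalIntegral.integral_of_le hk0, ← hsum]
  have hsq : IntegrableOn (fun t => ∫ x, ‖g t x‖ ^ 2 ∂Z.slice t) (Ioo 0 (knot T m)) := by
    have h := integrable_integral_slice (Z := Z) (a := 0) (b := (knot T m : EReal))
      (F := fun p => ‖g p.1 p.2‖ ^ 2)
      ((memLp_of_continuousOn (F := Function.uncurry g) hgc.continuousOn).integrable_norm_pow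
        (by simp))
    rwa [times_coe] at h
  refine (Finset.abs_sum_le_sum_abs _ _).trans ?_
  calc _ ≤ ∑ j ∈ Finset.range m,
        Z.dualFactor σ T p * (Z.totalFactor σ T j * (stepWeight 0 * ‖z‖)) * R := by
        refine Finset.sum_le_sum fun j hj => ?_
        have hj := Finset.mem_range.1 hj
        rw [intervalIntegral.integral_of_le (knot_lt_succ hT j).le, integral_Ioc_eq_integral_Ioo,
          setIntegral_congr_fun (g := fun t => Z.pairing σ p t (evol hσ (modeCount j)
            (Z.scaledTime t - Z.scaledTime (knot T j)) (Z.stepState T hσ z j)) (g' t))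
            measurableSet_Ioo fun t ht => by
              simp only [Z.state_eq hσ hT z ⟨ht.1.le, ht.2.le⟩]]
        refine (abs_integral_pairing_evol_le hσ (one_le_modeCount j) _ (knot_nonneg hT j) le_rfl
          (knot_lt_succ hT j).le (knot_lt hT _).le hgc hgc' hg h0 h1).trans ?_
        refine mul_le_mul (mul_le_mul_of_nonneg_left (Z.stepWeight_mul_norm_le hσ hT z j) hK)
          (Real.sqrt_le_sqrt (setIntegral_mono_set hsq
            (ae_of_all _ fun t => integral_nonneg fun x => by positivity)
            (Ioo_subset_Ioo (hsub j hj).1.1 (hsub j hj).2.2).eventuallyLE))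
          (Real.sqrt_nonneg _) ?_
        have := (Z.totalFactor_pos (σ := σ) (T := T) j).le
        have := one_le_stepWeight 0
        positivity
    _ ≤ _ := by
        rw [← Finset.sum_mul, ← Finset.mul_sum, ← Finset.sum_mul]
        refine mul_le_mul_of_nonneg_right (mul_le_mul_of_nonneg_left (mul_le_mul_of_nonneg_right
          ((Z.summable_totalFactor hσ hT).sum_le_tsum _ fun j _ => (Z.totalFactor_pos j).le) ?_) hK)
          (Real.sqrt_nonneg _)
        have := one_le_stepWeight 0
        positivity

end TargetState

end CrossDiffusion

/-! ### Smooth functions of compact support as test functions -/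

namespace CrossDiffusion

section Bump

variable {n : ℕ} {U : Set (ℝ × ℝ)} {φ ψ : ℝ × ℝ → Vec n}

lemma tsupport_fderiv_apply_subset (φ : ℝ × ℝ → Vec n) (e : ℝ × ℝ) :
    tsupport (fun p => fderiv ℝ φ p e) ⊆ tsupport φ := by
  refine closure_minimal (fun p hp => ?_) (isClosed_tsupport φ)
  by_contra h
  refine hp ?_
  simp only
  rw [image_eq_zero_of_notMem_tsupport fun h' => h (tsupport_fderiv_subset ℝ h'), zero_apply]

lemma IsBump.fderiv_apply (hφ : IsBump U φ) (e : ℝ × ℝ) : IsBump U fun p => fderiv ℝ φ p e where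
  smooth := (hφ.smooth.fderiv_right (m := ∞) (by simp)).clm_apply contDiff_const
  compactSupport := hφ.compactSupport.of_isClosed_subset (isClosed_tsupport _)
    (tsupport_fderiv_apply_subset φ e)
  support_subset := (tsupport_fderiv_apply_subset φ e).trans hφ.support_subset

lemma IsBump.partialX (hφ : IsBump U φ) : IsBump U (partialX φ) := hφ.fderiv_apply _

lemma IsBump.partialT (hφ : IsBump U φ) : IsBump U (partialT φ) := hφ.fderiv_apply _

lemma IsBump.eq_zero (hφ : IsBump U φ) {p : ℝ × ℝ} (hp : p ∉ U) : φ p = 0 :=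
  image_eq_zero_of_notMem_tsupport fun h => hp (hφ.support_subset h)

lemma IsBump.continuous (hφ : IsBump U φ) : Continuous φ := hφ.smooth.continuous

lemma IsBump.hasDerivAt_x (hφ : IsBump U φ) (t x : ℝ) :
    HasDerivAt (fun x => φ (t, x)) (CrossDiffusion.partialX φ (t, x)) x :=
  HasFDerivAt.comp_hasDerivAt (f := fun x : ℝ => (t, x)) x
    ((hφ.smooth.differentiable (by simp)) (t, x)).hasFDerivAt
    ((hasDerivAt_const x t).prodMk (hasDerivAt_id x))

lemma IsBump.hasDerivAt_t (hφ : IsBump U φ) (t x : ℝ) :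
    HasDerivAt (fun t => φ (t, x)) (CrossDiffusion.partialT φ (t, x)) t :=
  HasFDerivAt.comp_hasDerivAt (f := fun t : ℝ => (t, x)) t
    ((hφ.smooth.differentiable (by simp)) (t, x)).hasFDerivAt
    ((hasDerivAt_id t).prodMk (hasDerivAt_const t x))

lemma IsBump.memLp (hφ : IsBump U φ) (s : Set (ℝ × ℝ)) : MemLp φ 2 (volume.restrict s) :=
  (hφ.continuous.memLp_of_hasCompactSupport hφ.compactSupport).restrict s

variable (U n) in
/-- The space of bump functions. -/
def bumps : Submodule ℝ (ℝ × ℝ → Vec n) where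
  carrier := {φ | IsBump U φ}
  zero_mem' := ⟨contDiff_const, HasCompactSupport.zero, by simp⟩
  add_mem' {φ ψ} hφ hψ := ⟨hφ.smooth.add hψ.smooth, hφ.compactSupport.add hψ.compactSupport,
    (tsupport_add φ ψ).trans (union_subset hφ.support_subset hψ.support_subset)⟩
  smul_mem' c φ hφ := by
    have h : tsupport (c • φ) ⊆ tsupport φ := closure_minimal (fun p hp => subset_tsupport _ fun h =>
      hp (by rw [Pi.smul_apply, h, smul_zero])) (isClosed_tsupport φ)
    exact ⟨hφ.smooth.const_smul c,
      hφ.compactSupport.of_isClosed_subset (isClosed_tsupport _) h, h.trans hφ.support_subset⟩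

end Bump

namespace TargetState

variable {n : ℕ} {Z : TargetState n} {T a S : ℝ} {φ : ℝ × ℝ → Vec n}

/-- A compact support reaches a maximal time, which is smaller than `T`, and the knots accumulate
only at `T`. -/
lemma exists_isBump_knot (hφ : IsBump (Z.region 0 T) φ) :
    ∃ m, IsBump (Z.region 0 (knot T (m + 1))) φ := by
  suffices h : ∃ m, ∀ p ∈ tsupport φ, p.1 < knot T (m + 1) by
    obtain ⟨m, hm⟩ := h
    refine ⟨m, hφ.smooth, hφ.compactSupport, fun p hp => ?_⟩
    obtain ⟨h1, -, h2⟩ := hφ.support_subset hp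
    exact ⟨h1, by exact_mod_cast hm p hp, h2⟩
  rcases (tsupport φ).eq_empty_or_nonempty with he | hne
  · exact ⟨0, by simp [he]⟩
  · obtain ⟨q, hq, hmax⟩ := (show IsCompact (tsupport φ) from hφ.compactSupport).exists_isMaxOn hne
      continuous_fst.continuousOn
    have hqT : q.1 < T := by exact_mod_cast (hφ.support_subset hq).2.1
    exact ⟨_, fun p hp => (hmax hp).trans_lt (lt_knot_knotIndex_succ hqT)⟩

lemma continuousL2On_of_continuous (hφ : Continuous φ) (J : Set ℝ) :
    Z.ContinuousL2On (fun t x => φ (t, x)) J := by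
  refine ⟨fun t _ => memLp_slice_of_continuous (hφ.comp (by fun_prop)), ?_⟩
  have hE := Z.continuous_thickness
  set γ : Fin n → ℝ → C(ℝ, ℝ) := fun j t =>
    ⟨fun y => φ (t, y * Z.thickness t) j, by fun_prop⟩ with hγ
  have h : ContinuousOn (fun t => ∑ j, mulLift (γ j t) (EuclideanSpace.single j 1) (cosMode 0)) J :=
    continuousOn_finsetSum _ fun j _ => (continuousOn_mulLift (Continuous.continuousOn (by
      simp only [hγ, ContinuousMap.coe_mk]
      fun_prop)) _).clm_apply continuousOn_const
  refine h.congr fun t _ => ?_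
  have hm : MemLp (fun y => φ (t, y * Z.thickness t)) 2 unitMeasure :=
    memLp_unit_of_continuous (by fun_prop) 2
  refine Lp.ext ?_
  filter_upwards [coeFn_toL2 hm, coeFn_finset_sum Finset.univ fun j =>
    mulLift (γ j t) (EuclideanSpace.single j 1) (cosMode 0), coeFn_cosMode 0,
    ae_all_iff.2 fun j => coeFn_mulLift (γ j t) (EuclideanSpace.single j 1) (cosMode 0)]
    with y h1 h2 h3 h4
  rw [h1, h2]
  simp only [h4, h3, zero_mul, Real.cos_zero, mul_one]
  ext i
  simp [hγ, Pi.single_apply]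

lemma isTestFunction_bump (hφ : IsBump (Z.region a S) φ) (A : Mat n) (K : ℝ → Mat n) :
    Z.IsTestFunction A K a S (fun t x => φ (t, x)) (fun t x => partialT φ (t, x))
      (fun t x => partialX φ (t, x)) (fun t x => partialX (partialX φ) (t, x)) := by
  have hleft : ∀ t : ℝ, (t, (0 : ℝ)) ∉ Z.region a S := fun t h => lt_irrefl _ h.2.2.1
  have hright : ∀ t : ℝ, (t, Z.thickness t) ∉ Z.region a S := fun t h => lt_irrefl _ h.2.2.2
  have hint : ∀ {ψ : ℝ × ℝ → Vec n}, IsBump (Z.region a S) ψ → ∀ t x : ℝ,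
      ψ (t, x) = ψ (t, 0) + ∫ y in (0 : ℝ)..x, partialX ψ (t, y) := fun hψ t x => by
    rw [intervalIntegral.integral_eq_sub_of_hasDerivAt (fun y _ => hψ.hasDerivAt_x t y)
      (Continuous.intervalIntegrable (hψ.partialX.continuous.comp (by fun_prop)) _ _)]
    abel
  refine ⟨hφ.memLp _, hφ.partialT.memLp _, hφ.partialX.memLp _, hφ.partialX.partialX.memLp _,
    ae_of_all _ fun t x _ => hint hφ t x, ae_of_all _ fun t x _ => hint hφ.partialX t x,
    fun ψ hψ => ?_, continuousL2On_of_continuous hφ.continuous _, ae_of_all _ fun x =>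
      hφ.eq_zero fun h => lt_irrefl (S : EReal) h.2.1, ae_of_all _ fun t => ?_,
    ae_of_all _ fun t => ?_⟩
  · have h0 : ∫ p, (inner ℝ (φ p) (partialT ψ p) + inner ℝ (partialT φ p) (ψ p)) = 0 :=
      integral_eq_zero_of_hasDerivAt_fst (F := fun p => inner ℝ (φ p) (ψ p))
        (fun t x => (hφ.hasDerivAt_t t x).inner ℝ (hψ.hasDerivAt_t t x))
        (hφ.continuous.inner hψ.continuous)
        ((hφ.continuous.inner hψ.partialT.continuous).add
          (hφ.partialT.continuous.inner hψ.continuous))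
        (HasCompactSupport.of_support_subset_isCompact hψ.compactSupport fun p hp =>
          by_contra fun h => hp (by simp [image_eq_zero_of_notMem_tsupport h]))
        (HasCompactSupport.of_support_subset_isCompact hφ.compactSupport fun p hp =>
          by_contra fun h => hp (by
            simp only
            rw [image_eq_zero_of_notMem_tsupport h, partialT, partialT,
              image_eq_zero_of_notMem_tsupport fun h' => h (tsupport_fderiv_subset ℝ h')]
            simp))
    have hreg : ∫ p, (inner ℝ (φ p) (partialT ψ p) + inner ℝ (partialT φ p) (ψ p))
        ∂Z.regionMeasure a S = 0 := by
      rw [← h0, regionMeasure]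
      exact setIntegral_eq_integral_of_forall_compl_eq_zero fun p hp => by
        rw [hφ.eq_zero hp, hψ.eq_zero hp, inner_zero_left, inner_zero_right, add_zero]
    have hi : ∀ {f g : ℝ × ℝ → Vec n}, IsBump (Z.region a S) f → IsBump (Z.region a S) g →
        Integrable (fun p => inner ℝ (f p) (g p)) (Z.regionMeasure a S) := fun hf hg =>
      ((hf.continuous.inner hg.continuous).integrable_of_hasCompactSupport
        (HasCompactSupport.of_support_subset_isCompact hg.compactSupport fun p hp =>
          by_contra fun h => hp (by simp [image_eq_zero_of_notMem_tsupport h]))).restrict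
    rw [integral_add (hi hφ hψ.partialT) (hi hφ.partialT hψ)] at hreg
    exact eq_neg_of_add_eq_zero_left hreg
  · rw [hφ.partialX.eq_zero (hleft t)]
    simp [mulVec]
  · rw [hφ.partialX.eq_zero (hright t), hφ.eq_zero (hright t)]
    simp [mulVec]

variable {A : Mat n}

lemma integral_inner_closedLoop (B : Eigenbasis A) (hT : 0 < T) (u₀ : Z.L2 0) (hST : S < T)
    {g : ℝ → ℝ → Vec n} (hg : Continuous (Function.uncurry g)) :
    IntegrableOn (fun t => ∫ x, inner ℝ (Z.closedLoop T B u₀ t x) (g t x) ∂Z.slice t) (Ioo 0 S) ∧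
    ∫ t in Ioo 0 S, ∫ x, inner ℝ (Z.closedLoop T B u₀ t x) (g t x) ∂Z.slice t =
      ∑ i, ∫ t in Ioo 0 S, Z.pairing (B.σ i) (B.p i) t
        (Z.state T (B.σ_pos i) (Z.profile B i 0 u₀) t) (g t) := by
  have he : EqOn (fun t => ∫ x, inner ℝ (Z.closedLoop T B u₀ t x) (g t x) ∂Z.slice t)
      (fun t => ∑ i, Z.pairing (B.σ i) (B.p i) t
        (Z.state T (B.σ_pos i) (Z.profile B i 0 u₀) t) (g t)) (Ioo 0 S) := fun t ht => by
    simp only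
    rw [closedLoop_of_lt B u₀ (ht.2.trans hST)]
    exact integral_inner_assemble B (Z.thickness_pos ht.1.le) _
      (memLp_slice_of_continuous (hg.comp (by fun_prop : Continuous fun x : ℝ => (t, x))))
  have hi : ∀ i, IntegrableOn (fun t => Z.pairing (B.σ i) (B.p i) t
      (Z.state T (B.σ_pos i) (Z.profile B i 0 u₀) t) (g t)) (Ioo 0 S) := fun i =>
    integrableOn_pairing (B.σ_pos i) le_rfl ((Z.continuousOn_state (B.σ_pos i) hT _).mono
      (Icc_subset_Ico_right hST)) (memLp_of_continuousOn hg.continuousOn)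
  exact ⟨IntegrableOn.congr_fun (integrable_finsetSum _ fun i _ => hi i) he.symm measurableSet_Ioo,
    (setIntegral_congr_fun measurableSet_Ioo he).trans (integral_finsetSum _ fun i _ => hi i)⟩

/-- The weak formulation with a bump function has neither initial nor boundary terms, so it
expresses the distributional time derivative through second space derivatives alone. -/
lemma integral_inner_closedLoop_partialT (B : Eigenbasis A) (hT : 0 < T) (u₀ : Z.L2 0)
    (h0S : 0 < S) (hST : S < T) (hφ : IsBump (Z.region 0 S) φ) :
    ∫ t in Ioo 0 S, ∫ x, inner ℝ (Z.closedLoop T B u₀ t x) (partialT φ (t, x)) ∂Z.slice t =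
      -∑ i, ∫ t in Ioo 0 S, Z.pairing (B.σ i) (B.p i) t
        (Z.state T (B.σ_pos i) (Z.profile B i 0 u₀) t)
          (fun x => mulVec Aᵀ (partialX (partialX φ) (t, x))) := by
  have hc1 : Continuous (Function.uncurry fun t x => partialT φ (t, x)) := hφ.partialT.continuous
  have hc2 : Continuous (Function.uncurry fun t x => mulVec Aᵀ (partialX (partialX φ) (t, x))) :=
    (mulVecL Aᵀ).continuous.comp hφ.partialX.partialX.continuous
  obtain ⟨i1, e1⟩ := integral_inner_closedLoop B hT u₀ hST hc1
  obtain ⟨i2, e2⟩ := integral_inner_closedLoop B hT u₀ hST hc2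
  have hw := closedLoop_weak B hT u₀ h0S hST
    (isTestFunction_bump hφ A (Z.modalFeedback B (schedule T) T).gain)
  have hz1 : ∀ x : ℝ, φ (0, x) = 0 := fun x => hφ.eq_zero fun h => lt_irrefl _ h.1
  have hz2 : ∀ t : ℝ, φ (t, Z.thickness t) = 0 := fun t => hφ.eq_zero fun h => lt_irrefl _ h.2.2.2
  simp only [hz1, hz2, inner_zero_right, integral_zero, add_zero] at hw
  rw [← e2, ← add_eq_zero_iff_eq_neg, ← integral_add i1 i2]
  refine Eq.trans ?_ hw
  refine setIntegral_congr_fun measurableSet_Ioo fun t ht => ?_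
  have hm : ∀ {g : ℝ → ℝ → Vec n}, Continuous (Function.uncurry g) →
      Integrable (fun x => inner ℝ (Z.closedLoop T B u₀ t x) (g t x)) (Z.slice t) := fun {g} hg => by
    have h : MemLp (g t) 2 (Z.slice t) :=
      memLp_slice_of_continuous (hg.comp (by fun_prop : Continuous fun x : ℝ => (t, x)))
    refine (L2.integrable_inner (𝕜 := ℝ) (Z.closedLoop T B u₀ t) (h.toLp _)).congr ?_
    filter_upwards [h.coeFn_toLp] with x hx
    rw [hx]
  simp only [inner_add_right]
  exact (integral_add (hm hc1) (hm hc2)).symm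

end TargetState

end CrossDiffusion

/-! ### The time derivative in the dual space, and the conclusion -/

namespace CrossDiffusion

/-- The estimate lets `l` factor through the range of `D` as a bounded functional; it is extended to
`H` by Hahn-Banach and represented by Riesz. -/
lemma exists_inner_eq_of_abs_le {V H : Type*} [AddCommGroup V] [Module ℝ V] [NormedAddCommGroup H]
    [InnerProductSpace ℝ H] [CompleteSpace H] (D : V →ₗ[ℝ] H) (l : V →ₗ[ℝ] ℝ) {K : ℝ}
    (h : ∀ v, |l v| ≤ K * ‖D v‖) : ∃ f : H, ∀ v, l v = inner ℝ f (D v) := by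
  have hker : LinearMap.ker D ≤ LinearMap.ker l := fun v hv => by
    have := h v
    rw [LinearMap.mem_ker.1 hv, norm_zero, mul_zero] at this
    exact abs_nonpos_iff.1 this
  set m : LinearMap.range D →ₗ[ℝ] ℝ :=
    ((LinearMap.ker D).liftQ l hker).comp D.quotKerEquivRange.symm.toLinearMap with hm
  have hmv : ∀ v, m ⟨D v, v, rfl⟩ = l v := fun v => by
    have : D.quotKerEquivRange.symm ⟨D v, v, rfl⟩ = (LinearMap.ker D).mkQ v := by
      rw [LinearEquiv.symm_apply_eq]
      rfl
    simp [hm, this]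
  obtain ⟨g, hg, -⟩ := _root_.exists_extension_norm_eq (LinearMap.range D)
    (m.mkContinuous K (by
      rintro ⟨-, v, rfl⟩
      rw [hmv]
      exact h v))
  refine ⟨(InnerProductSpace.toDual ℝ H).symm g, fun v => ?_⟩
  rw [InnerProductSpace.toDual_symm_apply, ← hmv v]
  exact (hg ⟨D v, v, rfl⟩).symm

namespace TargetState

variable {n : ℕ} {Z : TargetState n} {T : ℝ} {A : Mat n}

lemma norm_toLp_eq_sqrt {α : Type*} [MeasurableSpace α] {μ : Measure α} {f : α → Vec n}
    (hf : MemLp f 2 μ) : ‖hf.toLp f‖ = √(∫ x, ‖f x‖ ^ 2 ∂μ) := by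
  rw [eq_comm, Real.sqrt_eq_iff_mul_self_eq (integral_nonneg fun x => by positivity)
    (norm_nonneg _), ← real_inner_self_eq_norm_mul_norm, L2.inner_def]
  refine integral_congr_ae ?_
  filter_upwards [hf.coeFn_toLp] with x hx
  rw [hx, real_inner_self_eq_norm_sq]

lemma integral_times_partialT {S : ℝ} {φ : ℝ × ℝ → Vec n}
    (hφ : IsBump (Z.region 0 S) φ) (u : ∀ t, Z.L2 t) {t : ℝ} (ht : t ∈ times 0 T \ Ioo 0 S) :
    ∫ x, inner ℝ (u t x) (partialT φ (t, x)) ∂Z.slice t = 0 := by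
  have hz : ∀ x : ℝ, partialT φ (t, x) = 0 := fun x => hφ.partialT.eq_zero fun h =>
    ht.2 ⟨ht.1.1, by exact_mod_cast h.2.1⟩
  simp [hz]

lemma Ioo_subset_times {S : ℝ} (hST : S < T) : Ioo 0 S ⊆ times 0 T := fun _ ht =>
  ⟨ht.1, by exact_mod_cast ht.2.trans hST⟩

lemma integrableOn_times_partialT (B : Eigenbasis A) (hT : 0 < T) (u₀ : Z.L2 0)
    {φ : ℝ × ℝ → Vec n} (hφ : IsBump (Z.region 0 T) φ) :
    IntegrableOn (fun t => ∫ x, inner ℝ (Z.closedLoop T B u₀ t x) (partialT φ (t, x)) ∂Z.slice t)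
      (times 0 T) := by
  obtain ⟨m, hm⟩ := exists_isBump_knot hφ
  have hlt := knot_lt hT (m + 1)
  exact ((integral_inner_closedLoop B hT u₀ hlt (g := fun t x => partialT φ (t, x))
    hφ.partialT.continuous).1).of_forall_sdiff_eq_zero (measurableSet_times 0 T)
      fun t ht => integral_times_partialT hm _ ht

/-- The dual estimate is applied with `g = Aᵀ ∂ₓ φ`, which vanishes at both ends of each slice. The
constant does not depend on how close the support of `φ` comes to `T`. -/
lemma exists_abs_integral_partialT_le (B : Eigenbasis A) (hT : 0 < T) (u₀ : Z.L2 0) :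
    ∃ K : ℝ, ∀ φ : ℝ × ℝ → Vec n, IsBump (Z.region 0 T) φ →
      |∫ t in times 0 T, ∫ x, inner ℝ (Z.closedLoop T B u₀ t x) (partialT φ (t, x)) ∂Z.slice t| ≤
        K * √(∫ q, ‖partialX φ q‖ ^ 2 ∂Z.regionMeasure 0 T) := by
  set c : Fin n → ℝ := fun i => Z.dualFactor (B.σ i) T (B.p i) *
    ((∑' j, Z.totalFactor (B.σ i) T j) * (stepWeight 0 * ‖Z.profile B i 0 u₀‖)) with hc
  have hc0 : ∀ i, 0 ≤ c i := fun i => by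
    have := Z.speed_pos
    have := Z.thickness_pos le_rfl
    have h1 : 0 ≤ ∑' j, Z.totalFactor (B.σ i) T j := tsum_nonneg fun j => (Z.totalFactor_pos j).le
    have h2 := one_le_stepWeight 0
    have h3 := B.σ_pos i
    simp only [hc]
    unfold dualFactor
    positivity
  refine ⟨(∑ i, c i) * ‖mulVecL Aᵀ‖, fun φ hφ => ?_⟩
  obtain ⟨m, hm⟩ := exists_isBump_knot hφ
  have hlt := knot_lt hT (m + 1)
  have h0S : 0 < knot T (m + 1) := (knot_nonneg hT m).trans_lt (knot_lt_succ hT m)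
  set S := knot T (m + 1) with hS
  rw [setIntegral_eq_of_subset_of_forall_sdiff_eq_zero (measurableSet_times 0 T)
    (Ioo_subset_times hlt) fun t ht => integral_times_partialT hm _ ht,
    integral_inner_closedLoop_partialT B hT u₀ h0S hlt hm, abs_neg]
  have hx := hm.partialX
  have hz : ∀ {q : ℝ × ℝ}, q ∉ Z.region 0 S → mulVec Aᵀ (partialX φ q) = 0 := fun hq => by
    rw [hx.eq_zero hq]
    simp [mulVec]
  have hb : √(∫ t in Ioo 0 S, ∫ x, ‖mulVec Aᵀ (partialX φ (t, x))‖ ^ 2 ∂Z.slice t) ≤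
      ‖mulVecL Aᵀ‖ * √(∫ q, ‖partialX φ q‖ ^ 2 ∂Z.regionMeasure 0 T) := by
    have i1 : MemLp (fun q => mulVec Aᵀ (partialX φ q)) 2 (Z.regionMeasure 0 S) :=
      (mulVecL Aᵀ).comp_memLp' (hx.memLp _)
    have h1 := integral_region (i1.integrable_norm_pow (by simp))
    rw [times_coe] at h1
    rw [← h1, ← Real.sqrt_sq (norm_nonneg (mulVecL Aᵀ)), ← Real.sqrt_mul (sq_nonneg _),
      ← integral_const_mul]
    have i2 : ∀ s : Set (ℝ × ℝ), Integrable (fun q => ‖mulVecL Aᵀ‖ ^ 2 * ‖partialX φ q‖ ^ 2)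
        (volume.restrict s) := fun s => ((hx.memLp s).integrable_norm_pow (by simp)).const_mul _
    refine Real.sqrt_le_sqrt ((integral_mono (i1.integrable_norm_pow (by simp)) (i2 _)
      fun q => ?_).trans (setIntegral_mono_set (i2 _) (ae_of_all _ fun q => by positivity)
        (LE.le.eventuallyLE fun q hq => ?_)))
    · rw [← mul_pow]
      exact pow_le_pow_left₀ (norm_nonneg _) ((mulVecL Aᵀ).le_opNorm _) 2
    · exact ⟨hq.1, hq.2.1.trans (by exact_mod_cast hlt), hq.2.2⟩
  refine (Finset.abs_sum_le_sum_abs _ _).trans ?_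
  calc _ ≤ ∑ i, c i * √(∫ t in Ioo 0 S, ∫ x, ‖mulVec Aᵀ (partialX φ (t, x))‖ ^ 2 ∂Z.slice t) := by
        refine Finset.sum_le_sum fun i _ => ?_
        exact abs_integral_pairing_state_le (g := fun t x => mulVec Aᵀ (partialX φ (t, x)))
          (B.σ_pos i) hT _ (m + 1) ((mulVecL Aᵀ).continuous.comp hx.continuous)
          ((mulVecL Aᵀ).continuous.comp hx.partialX.continuous)
          (fun t x => (mulVecL Aᵀ).hasFDerivAt.comp_hasDerivAt x (hx.hasDerivAt_x t x))
          (fun t => hz fun h => lt_irrefl _ h.2.2.1) (fun t => hz fun h => lt_irrefl _ h.2.2.2)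
    _ ≤ _ := by
        rw [← Finset.sum_mul, mul_assoc]
        exact mul_le_mul_of_nonneg_left hb (Finset.sum_nonneg fun i _ => hc0 i)

lemma timeDerivInDual_closedLoop (B : Eigenbasis A) (hT : 0 < T) (u₀ : Z.L2 0) :
    Z.TimeDerivInDual 0 T (Z.closedLoop T B u₀) := by
  obtain ⟨K, hK⟩ := exists_abs_integral_partialT_le B hT u₀
  have hd : ∀ {φ : ℝ × ℝ → Vec n}, IsBump (Z.region 0 T) φ → Differentiable ℝ φ := fun hφ =>
    hφ.smooth.differentiable (by simp)
  have hmem : ∀ {φ : ℝ × ℝ → Vec n}, IsBump (Z.region 0 T) φ →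
      MemLp (partialX φ) 2 (Z.regionMeasure 0 T) := fun hφ => hφ.partialX.memLp _
  have hslice : ∀ {φ : ℝ × ℝ → Vec n}, IsBump (Z.region 0 T) φ → ∀ t,
      Integrable (fun x => inner ℝ (Z.closedLoop T B u₀ t x) (partialT φ (t, x))) (Z.slice t) := by
    intro φ hφ t
    have h : MemLp (fun x => partialT φ (t, x)) 2 (Z.slice t) := memLp_slice_of_continuous
      (hφ.partialT.continuous.comp (by fun_prop : Continuous fun x : ℝ => (t, x)))
    refine (L2.integrable_inner (𝕜 := ℝ) (Z.closedLoop T B u₀ t) (h.toLp _)).congr ?_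
    filter_upwards [h.coeFn_toLp] with x hx
    rw [hx]
  let D : bumps n (Z.region 0 T) →ₗ[ℝ] Lp (Vec n) 2 (Z.regionMeasure 0 T) :=
    { toFun := fun φ => (hmem φ.2).toLp _
      map_add' := fun φ ψ => by
        rw [← MemLp.toLp_add]
        refine MemLp.toLp_congr _ _ (ae_of_all _ fun q => ?_)
        simp [partialX, fderiv_add (hd φ.2 q) (hd ψ.2 q)]
      map_smul' := fun c φ => by
        rw [RingHom.id_apply, ← MemLp.toLp_const_smul]
        refine MemLp.toLp_congr _ _ (ae_of_all _ fun q => ?_)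
        simp [partialX, fderiv_const_smul (hd φ.2 q)] }
  let l : bumps n (Z.region 0 T) →ₗ[ℝ] ℝ :=
    { toFun := fun φ => ∫ t in times 0 T, ∫ x,
        inner ℝ (Z.closedLoop T B u₀ t x) (partialT φ.1 (t, x)) ∂Z.slice t
      map_add' := fun φ ψ => by
        rw [← integral_add (integrableOn_times_partialT B hT u₀ φ.2)
          (integrableOn_times_partialT B hT u₀ ψ.2)]
        refine integral_congr_ae (ae_of_all _ fun t => ?_)
        simp only
        rw [← integral_add (hslice φ.2 t) (hslice ψ.2 t)]
        refine integral_congr_ae (ae_of_all _ fun x => ?_)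
        simp [partialT, fderiv_add (hd φ.2 _) (hd ψ.2 _), inner_add_right]
      map_smul' := fun c φ => by
        rw [RingHom.id_apply, smul_eq_mul, ← integral_const_mul]
        refine integral_congr_ae (ae_of_all _ fun t => ?_)
        simp only
        rw [← integral_const_mul]
        refine integral_congr_ae (ae_of_all _ fun x => ?_)
        simp [partialT, fderiv_const_smul (hd φ.2 _), inner_smul_right] }
  obtain ⟨f, hf⟩ := exists_inner_eq_of_abs_le D l (K := K) fun φ => by
    change _ ≤ K * ‖(hmem φ.2).toLp _‖
    rw [norm_toLp_eq_sqrt]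
    exact hK φ.1 φ.2
  -- Only `∂ₓ φ` is needed to represent the functional; the sign compensates the minus in the
  -- definition of the distributional derivative.
  refine ⟨fun _ => 0, fun q => -(f q), MemLp.zero', (Lp.memLp f).neg, fun φ hφ => ?_⟩
  refine (hf ⟨φ, hφ⟩).trans ?_
  rw [L2.inner_def, ← integral_neg]
  refine integral_congr_ae ?_
  filter_upwards [(hmem hφ).coeFn_toLp] with q hq
  change inner ℝ (f q) ((hmem hφ).toLp _ q) = _
  rw [hq, inner_zero_left, inner_neg_left, zero_add, neg_neg]

lemma isWeakSolution_closedLoop (B : Eigenbasis A) (hT : 0 < T) (u₀ : Z.L2 0) :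
    Z.IsWeakSolution A (Z.modalFeedback B (schedule T) T) 0 T u₀ (Z.closedLoop T B u₀) where
  continuousL2On := (continuousL2On_closedLoop B hT u₀).mono fun t ht => ht.1
  timeDeriv := timeDerivInDual_closedLoop B hT u₀
  weak S h0 hS v vt vx vxx hv := closedLoop_weak B hT u₀ h0 (by exact_mod_cast hS) hv

lemma isClosedLoop_closedLoop (B : Eigenbasis A) (hT : 0 < T) (u₀ : Z.L2 0) :
    Z.IsClosedLoop A (Z.modalFeedback B (schedule T) T) T u₀ (Z.closedLoop T B u₀) where
  continuousL2On := continuousL2On_closedLoop B hT u₀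
  before := isWeakSolution_closedLoop B hT u₀
  after := isWeakSolution_zero _ (fun _ ht => closedLoop_of_le B u₀ ht)
    ((continuousL2On_closedLoop B hT u₀).mono (Ici_subset_Ici.2 hT.le))

/-- Uniqueness before `T`, then continuity to identify the value at `T`, then uniqueness from that
value on. Stability of all closed-loop evolutions thus reduces to that of the explicit one. -/
lemma IsClosedLoop.eq_closedLoop (B : Eigenbasis A) (hT : 0 < T) {u₀ : Z.L2 0} {u : ∀ t, Z.L2 t}
    (hu : Z.IsClosedLoop A (Z.modalFeedback B (schedule T) T) T u₀ u) {t : ℝ} (ht : 0 ≤ t) :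
    u t = Z.closedLoop T B u₀ t := by
  have hc := isClosedLoop_closedLoop B hT u₀
  have hb : ∀ s, 0 ≤ s → s < T → u s = Z.closedLoop T B u₀ s := fun s h0 h1 =>
    unique_before schedule_monotoneOn hc.before hu.before h0 h1
  have hET := Z.thickness_pos hT.le
  have huT : u T = Z.closedLoop T B u₀ T := by
    refine Z.contract_injective hET ?_
    have hlim : ∀ {w : ∀ t, Z.L2 t}, Z.ContinuousL2On (fun t => w t) (Ici 0) →
        Tendsto (fun t => Z.contract t (w t)) (𝓝[Ico 0 T] T) (𝓝 (Z.contract T (w T))) := fun hw =>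
      (hw.2 T hT.le).mono_left (nhdsWithin_mono _ Ico_subset_Ici_self)
    have : (𝓝[Ico 0 T] T).NeBot := by
      rw [← mem_closure_iff_nhdsWithin_neBot, closure_Ico hT.ne]
      exact right_mem_Icc.2 hT.le
    refine tendsto_nhds_unique ((hlim hu.continuousL2On).congr' ?_) (hlim hc.continuousL2On)
    filter_upwards [self_mem_nhdsWithin] with s hs
    rw [hb s hs.1 hs.2]
  rcases lt_or_ge t T with h | h
  · exact hb t ht h
  · have ha := hu.after
    rw [huT] at ha
    exact unique_after hT.le hc.after ha h

theorem fractionsStabilizable (B : Eigenbasis A) (hT : 0 < T) : Z.FractionsStabilizable A T := by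
  refine ⟨Z.modalFeedback B (schedule T) T, isRegular_modalFeedback_before schedule_monotoneOn,
    isRegular_modalFeedback_after, fun u₀ => ⟨Z.closedLoop T B u₀, isClosedLoop_closedLoop B hT u₀,
      fun w hw t h0 h1 => ?_, fun w hw t ht => ?_, tendsto_norm_closedLoop B hT u₀⟩,
    fun ε hε => ?_⟩
  · exact unique_before schedule_monotoneOn (isWeakSolution_closedLoop B hT u₀) hw h0 h1
  · exact unique_after hT.le (isClosedLoop_closedLoop B hT u₀).after hw ht
  · obtain ⟨C, hC0, hC⟩ := exists_norm_closedLoop_le (Z := Z) B hT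
    -- The constant `C` is only known to be nonnegative, hence the added one.
    refine ⟨ε / (C + 1), by positivity, fun u₀ u hu hν t ht => ?_⟩
    rw [hu.eq_closedLoop B hT ht]
    rcases lt_or_ge t T with h | h
    · refine (hC u₀ t ht h).trans ((mul_le_mul_of_nonneg_left hν hC0).trans ?_)
      rw [mul_div_assoc', div_le_iff₀ (by positivity)]
      nlinarith
    · rw [closedLoop_of_le B u₀ h, norm_zero]
      exact hε.le

end TargetState

end CrossDiffusion

theorem theorem3 {n : ℕ} (hn : 1 ≤ n)
    (A : CrossDiffusion.Vec n → CrossDiffusion.Mat n) (h : CrossDiffusion.Vec n → ℝ)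
    (Z : CrossDiffusion.TargetState n)
    (hA1 : Z.fraction ∈ CrossDiffusion.admissible n)
    (hA : ContinuousOn A (closure (CrossDiffusion.admissible n)))
    (hh : CrossDiffusion.IsEntropyDensity A h)
    (hM : (CrossDiffusion.mobility A h Z.fraction).IsSymm)
    (T : ℝ) (hT : 0 < T) :
    Z.StabilizableInFiniteTime A T := by
  obtain ⟨σ, p, q, hσ, hp, hq, hqp, hsum⟩ := hh.exists_eigenbasis hA1 hM
  exact ⟨CrossDiffusion.TargetState.fractionsStabilizable ⟨σ, p, q, hσ, hp, hq, hqp, hsum⟩ hT,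
    CrossDiffusion.thicknessStabilizable hT⟩
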